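/- **Model.** Tier 1 (macro, sub-6 GHz) and tier 2 (pico, mmWave) base stations (BSs) form independent homogeneous Poisson point processes $\Phi_1,\Phi_2$ in $\mathbb R^2$ with densities $\lambda_1,\lambda_2>0$; the typical user is at the origin. BSs of tier $i$ have transmit power $P_i$, $N_i\ge 1$ antennas and bandwidth $B_i$, and path loss $L_1(r)=C_1r^{-\alpha_1}$, $L_2(r)=\mathbf U(R_L-r)\,C_2r^{-\alpha_2}$ with $\alpha_1>2$, $\alpha_2\ge 2$; here $\mathbf U(x)=1$ for $x\ge 0$ and $0$ otherwise. Each BS $x$ carries independent marks: a fading power $|h_x|^2$ that is Gamma distributed with shape $N_i^p$ and mean $1$ ($N_1^p=1$, $N_2^p\ge1$ an integer); an angle $\omega_x$ uniform on $[-d/\lambda,d/\lambda]$ ($d$ the antenna spacing, $\lambda$ the wavelength), giving the interferer gain $G_1=1$, $G_2(\omega)=\frac{\sin^2(\pi N_2\omega)}{N_2^2\sin^2(\pi\omega)}$; and a random cache of exactly $M_i$ of the files $1,\dots,H_c$ which contains file $f$ with probability $p_{i,f}$, where $\max(M_1,M_2)\le H_c\le N_c$. File $f\in\{1,\dots,N_c\}$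 is requested with probability $P_f=f^{-\delta}/\sum_{n=1}^{N_c}n^{-\delta}$, $\delta\ge 0$. A user served by the BS $x$ of tier $i$ has SINR $$\frac{P_iL_i(\|x\|)N_i|h_x|^2}{\sigma_i^2+\sum_{y\in\Phi_i\setminus\{x\}}P_iL_i(\|y\|)N_i|h_y|^2G_i(\omega_y)},\qquad \sigma_i^2\ge0 .$$ Let $\Upsilon_{i,f}$ be the SINR from the nearest tier-$i$ BS caching $f$ (and $0$ if there is none), $P_{\Upsilon_{i,f}}(\tau)=\mathbb P[\Upsilon_{i,f}>\tau]$, and $p_{\Upsilon_{i,f}}=-\frac{d}{d\tau}P_{\Upsilon_{i,f}}$. *Max-RP*: a user requesting $f\le H_c$ is served by the BS with the largest biased average received power $b_i^PP_iL_i(\|x\|)N_i$ among all BSs of both tiers caching $f$; $P_a^P(\tau)=\Theta_{i,f}(\tau)$ is the probability that this BS is in tier $i$ and the SINR exceeds $\tau$. *Max-Rate*: the user is served by the tier with the larger biased rate $b_i^BB_i\log_2(1+\Upsilon_{i,f})$; $P_a^R(\tau)$ is the probability that this is tier $i$ and $\Upsilon_{i,f}>\tau$. *Server mode* ($f>H_c$):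 the nearest macro BS serves, with SINR $\Upsilon_1$, and the delivery succeeds if $R_{th}\le C_{bh}$ and $B_1\log_2(1+\Upsilon_1)>R_{th}$, where $C_{bh}\ge 0$ is the backhaul capacity. For a rate threshold $R_{th}>0$ put $\tau_i=2^{R_{th}/B_i}-1$. The area spectral efficiency (ASE) is the sum over $f$, weighted by $P_f$, of (density of active BSs)$\,\times\log_2(1+\text{threshold})\times$(coverage probability): for $f\le H_c$ of $\sum_i p_{i,f}\lambda_i\log_2(1+\tau_i)P_a^\kappa(\tau_i)$, and for $f>H_c$ of $\lambda_1\log_2(1+\tau_1)$ times the success probability of the server mode. **Proposition.** For both schemes $\kappa\in\{P,R\}$, $$ASE=\sum_{f=1}^{H_c}\sum_{i=1}^2\frac{P_f\,p_{i,f}\,\lambda_i R_{th}}{B_i}\,P_a^\kappa\big(2^{R_{th}/B_i}-1\big)+\frac{\lambda_1R_{th}}{B_1}P_S(R_{th}),$$ $$P_S(R_{th})=\mathbf U(C_{bh}-R_{th})\,\mathbf U(N_c-H_c-1)\sum_{f=H_c+1}^{N_c}P_f\,P_{\Upsilon_1}\big(2^{R_{th}/B_1}-1\big),$$ where $P_{\Upsilon_1}$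 is the expression (c) below with $p=1$. Moreover, for $1\le f\le H_c$ and $\tau>0$, with $S_i(z)={}_2F_1(-\tfrac2{\alpha_i},N_i^p;1-\tfrac2{\alpha_i};-z)$ and $\Delta_i(z)=\frac{\Gamma(1-2/\alpha_i)\Gamma(N_i^p+2/\alpha_i)}{\Gamma(N_i^p)}z^{2/\alpha_i}$: (a) *Max-RP.* $\Theta_{1,f}(\tau)=\int_0^\infty \exp\!\big(-\tfrac{\tau\sigma_1^2r^{\alpha_1}}{P_1C_1N_1}-\pi\lambda_1r^2(p_{1,f}(S_1(\tau)-1)+(1-p_{1,f})\Delta_1(\tau))\big)f^P_{1,f}(r)\,dr$, and $\Theta_{2,f}(\tau)\approx Q_{u_1,u_2}[f^P_{2,f}](\tau)$, where, with $P^r_{j,i}=\frac{b^P_jP_jC_jN_j}{b^P_iP_iC_iN_i}$ and $R_r=(P^r_{1,2}R_L^{\alpha_2})^{1/\alpha_1}$, $$f^P_{1,f}(r)=2\pi p_{1,f}\lambda_1r\Big[e^{-\pi\sum_jp_{j,f}\lambda_j(P^r_{j,1})^{2/\alpha_2}r^{2\alpha_1/\alpha_j}}\mathbf U(R_r-r)+e^{-\pi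 p_{2,f}\lambda_2R_L^2-\pi p_{1,f}\lambda_1r^2}\mathbf U(r-R_r)\Big],$$ $$f^P_{2,f}(r)=2\pi p_{2,f}\lambda_2r\,e^{-\pi\sum_jp_{j,f}\lambda_j(P^r_{j,2})^{2/\alpha_1}r^{2\alpha_2/\alpha_j}}\mathbf U(R_L-r),$$ $$Q_{u_1,u_2}[g](\tau)=\frac{\pi R_L}{2u_2}\sum_{n=1}^{N_2^p}(-1)^{n+1}\binom{N_2^p}{n}\sum_{k=1}^{u_2}F_n\Big(\frac{(x_k+1)R_L}{2}\Big)\sqrt{1-x_k^2},\quad x_k=\cos\frac{(2k-1)\pi}{2u_2},$$ $$F_n(r)=\exp\!\Big(-\frac{n\eta r^{\alpha_2}\tau\sigma_2^2}{P_2C_2N_2}-\pi\lambda_2(R_L^2-p_{2,f}r^2)-\frac{\pi^2\lambda_2}{2u_1}\sum_{k=1}^{u_1}W\big(\tfrac{x'_kd}{\lambda}\big)\sqrt{1-x_k'^2}\Big)g(r),\quad x_k'=\cos\frac{(2k-1)\pi}{2u_1},$$ $\eta=N_2^p(N_2^p!)^{-1/N_2^p}$ and, with $X=n\eta r^{\alpha_2}G_2(\omega)\tau/N_2^p$,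 $W(\omega)=p_{2,f}S_2(Xr^{-\alpha_2})r^2+(1-p_{2,f})\Delta_2(X)-S_2(XR_L^{-\alpha_2})R_L^2$ if $\alpha_2>2$, while if $\alpha_2=2$, $W(\omega)=X\big(F_y(X/R_L^2)-p_{2,f}F_y(X/r^2)\big)$ (by its limit $p_{2,f}r^2-R_L^2$ at $X=0$), where $F_y(y)=N_2^p\ln(1+\tfrac1y)-\frac{1}{y(1+y)^{N_2^p-1}}-\sum_{m=1}^{N_2^p-1}\frac{N_2^p}{(1+y)^{N_2^p-m}(N_2^p-m)}$. Here $c\approx Q_{u_1,u_2}$ means that $Q_{u_1,u_2}$ converges as $u_1,u_2\to\infty$ and that its limit differs from $c$ by at most $\sup_{y\ge0}\big|\mathbb P[|h_2|^2<y]-(1-e^{-\eta y})^{N_2^p}\big|$, where $|h_2|^2$ is the fading power of a pico BS (this supremum is $0$ if $N_2^p=1$). (b) *Max-Rate.* $P_{\Upsilon_{i,f}}$ is differentiable at $\tau$, and with $j\ne i$ the other tier and $$f^R_{i,f}(t)=p_{\Upsilon_{i,f}}(t)\Big(1-P_{\Upsilon_{j,f}}\big((1+t)^{b_i^BB_i/(b_j^BB_j)}-1\big)\Big),$$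 $f^R_{i,f}$ is integrable on $(\tau,\infty)$ and $P_a^R(\tau)=\int_\tau^\infty f^R_{i,f}(t)\,dt$ whenever $i=1$ or $\sigma_2^2>0$. If $i=2$ and $\sigma_2^2=0$, the probability $p_{2,f}\,\pi\lambda_2R_L^2\,e^{-\pi\lambda_2R_L^2}$ of the event $\Upsilon_{2,f}=\infty$ has to be added to the integral. (c) $P_{\Upsilon_{1,f}}(\tau)$ is the value at $p=p_{1,f}$ of $\int_0^\infty\exp\!\big(-\tfrac{\tau\sigma_1^2r^{\alpha_1}}{P_1C_1N_1}-\pi\lambda_1r^2(p(S_1(\tau)-1)+(1-p)\Delta_1(\tau))\big)2\pi p\lambda_1r\,e^{-\pi p\lambda_1r^2}dr$, which equals $\frac{p}{pS_1(\tau)+(1-p)\Delta_1(\tau)}$ for all $0\le p\le1$ if $\sigma_1^2=0$; and $P_{\Upsilon_{2,f}}(\tau)\approx Q_{u_1,u_2}[g]$ with $g(r)=2\pi p_{2,f}\lambda_2r\,e^{-\pi p_{2,f}\lambda_2r^2}$. -/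

import Mathlib

open MeasureTheory ProbabilityTheory Filter Topology

noncomputable section

namespace HetNetASE

/-! ### Special functions and quadrature nodes -/

/-- The unit step function. -/
def unitStep (x : ℝ) : ℝ := if 0 ≤ x then 1 else 0

/-- The real Gauss hypergeometric function on `x < 1`: the power series for `|x| < 1`, and for
`x ≤ -1` its analytic continuation, given by the transformation
`F(a,b;c;x) = (1-x)^(-a) F(a,c-b;c;x/(x-1))` (whose argument lies in `[1/2,1)`). -/
def gaussHyp (a b c x : ℝ) : ℝ :=
  if |x| < 1 then ordinaryHypergeometric a b c x
  else (1 - x) ^ (-a) * ordinaryHypergeometric a (c - b) c (x / (x - 1))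

/-- `S(z) = ₂F₁(-2/α, n; 1-2/α; -z)` for path loss exponent `α` and fading parameter `n`. -/
def hypS (α : ℝ) (n : ℕ) (z : ℝ) : ℝ := gaussHyp (-(2 / α)) n (1 - 2 / α) (-z)

/-- `Δ(z) = Γ(1-2/α) Γ(n+2/α) Γ(n)⁻¹ z^(2/α)`. -/
def gammaDelta (α : ℝ) (n : ℕ) (z : ℝ) : ℝ :=
  Real.Gamma (1 - 2 / α) * Real.Gamma (n + 2 / α) * (Real.Gamma n)⁻¹ * z ^ (2 / α)

/-- The elementary function replacing the hypergeometric one when the exponent is `2`. -/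
def elemF (n : ℕ) (y : ℝ) : ℝ :=
  n * Real.log (1 + 1 / y) - 1 / (y * (1 + y) ^ (n - 1))
    - ∑ m ∈ Finset.Icc 1 (n - 1), (n : ℝ) / ((1 + y) ^ (n - m) * ((n : ℝ) - m))

/-- The `k`-th Gauss-Chebyshev node `cos((2k-1)π/(2u))`, `1 ≤ k ≤ u`, on `[-1,1]`. -/
def chebNode (u k : ℕ) : ℝ := Real.cos ((2 * k - 1) / (2 * u) * Real.pi)

/-- `(π/u) ∑ₖ g(xₖ) √(1-xₖ²)`: Gauss-Chebyshev quadrature for the integral of `g` over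
`[-1,1]`. -/
def chebQuad (u : ℕ) (g : ℝ → ℝ) : ℝ :=
  Real.pi / u * ∑ k ∈ Finset.Icc 1 u, g (chebNode u k) * Real.sqrt (1 - chebNode u k ^ 2)

/-! ### Poisson point processes -/

/-- The σ-algebra generated by the counts of a random set of points. -/
@[reducible] def countAlgebra {Ω E : Type*} [MeasurableSpace E] (Φ : Ω → Set E) : MeasurableSpace Ω :=
  ⨆ B : {B : Set E // MeasurableSet B},
    MeasurableSpace.comap (fun ω => (Φ ω ∩ B.1).encard) inferInstance

/-- `Φ` is a Poisson point process with intensity measure `μ`: the counts of points in measurable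
sets are random variables, they are Poisson with mean `μ B` whenever `μ B < ∞`, and the counts in
disjoint sets are independent. -/
structure IsPoissonProcess {Ω E : Type*} [MeasurableSpace Ω] [MeasurableSpace E]
    (Φ : Ω → Set E) (μ : Measure E) (P : Measure Ω) : Prop where
  measurable_count : ∀ B : Set E, MeasurableSet B → Measurable fun ω => (Φ ω ∩ B).encard
  count_law : ∀ B : Set E, MeasurableSet B → μ B ≠ ⊤ → ∀ n : ℕ,
    P {ω | (Φ ω ∩ B).encard = n} = poissonMeasure (μ B).toNNReal {n}
  count_indep : ∀ (k : ℕ) (B : Fin k → Set E), (∀ j, MeasurableSet (B j)) →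
    Pairwise (fun i j => Disjoint (B i) (B j)) →
    iIndepFun (fun j ω => (Φ ω ∩ B j).encard) P

/-! ### The network -/

/-- A base station as seen by the typical user at the origin: its location, the set of (indices
of) files in its cache, its fading power `|h|²`, and the spatial angle `ω` of its beam relative to
the typical user. -/
abbrev BS : Type := EuclideanSpace ℝ (Fin 2) × (Set ℕ × (ℝ × ℝ))

/-- Distance of a base station to the typical user. -/
def BS.dist (x : BS) : ℝ := ‖x.1‖
/-- Files stored at a base station. -/
def BS.cache (x : BS) : Set ℕ := x.2.1
/-- Small-scale fading power `|h|²` of the link from a base station. -/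
def BS.fade (x : BS) : ℝ := x.2.2.1
/-- Spatial angle entering the array gain of an interfering base station. -/
def BS.angle (x : BS) : ℝ := x.2.2.2

/-- The parameters of the two-tier network. Tier index `0` is the first tier (macro, sub-6 GHz),
tier index `1` is the second tier (pico, mmWave). -/
structure HetNet where
  /-- densities of the base stations -/
  dens : Fin 2 → ℝ
  dens_pos : ∀ i, 0 < dens i
  /-- transmit powers -/
  power : Fin 2 → ℝ
  power_pos : ∀ i, 0 < power i
  /-- numbers of antennas -/
  ant : Fin 2 → ℕ
  ant_pos : ∀ i, 0 < ant i
  /-- path loss intercepts -/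
  icpt : Fin 2 → ℝ
  icpt_pos : ∀ i, 0 < icpt i
  /-- path loss exponents -/
  expo : Fin 2 → ℝ
  expo_macro : 2 < expo 0
  expo_pico : 2 ≤ expo 1
  /-- noise powers `σᵢ²` (zero in the interference-limited case) -/
  noise : Fin 2 → ℝ
  noise_nonneg : ∀ i, 0 ≤ noise i
  /-- radius of the line-of-sight ball of the pico tier -/
  losR : ℝ
  losR_pos : 0 < losR
  /-- Nakagami parameter of the pico tier -/
  nak : ℕ
  nak_pos : 0 < nak
  /-- antenna spacing -/
  spacing : ℝ
  spacing_pos : 0 < spacing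
  /-- wavelength of the pico tier -/
  wavelen : ℝ
  wavelen_pos : 0 < wavelen
  /-- bandwidths -/
  band : Fin 2 → ℝ
  band_pos : ∀ i, 0 < band i
  /-- bias factors of the maximum received power scheme -/
  biasP : Fin 2 → ℝ
  biasP_pos : ∀ i, 0 < biasP i
  /-- bias factors of the maximum rate scheme -/
  biasB : Fin 2 → ℝ
  biasB_pos : ∀ i, 0 < biasB i
  /-- number of files in the catalog -/
  Nc : ℕ
  Nc_pos : 0 < Nc
  /-- number of files cached in the network -/
  Hc : ℕ
  Hc_le : Hc ≤ Nc
  /-- number of files one base station can store -/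
  cap : Fin 2 → ℕ
  cap_le : ∀ i, cap i ≤ Hc
  /-- skew of the popularity distribution -/
  skew : ℝ
  skew_nonneg : 0 ≤ skew
  /-- backhaul capacity -/
  Cbh : ℝ
  Cbh_nonneg : 0 ≤ Cbh
  /-- law of the set of files stored at a base station -/
  place : Fin 2 → Measure (Set ℕ)
  place_prob : ∀ i, IsProbabilityMeasure (place i)
  /-- every base station fills its storage with files among the first `Hc` -/
  place_full : ∀ i, ∀ᵐ c ∂(place i), c ⊆ Set.Icc 1 Hc ∧ c.ncard = cap i

namespace HetNet

variable (N : HetNet)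

/-- Zipf requesting probability `P_f` of file `f`. -/
def req (f : ℕ) : ℝ :=
  (f : ℝ) ^ (-N.skew) / ∑ n ∈ Finset.Icc 1 N.Nc, (n : ℝ) ^ (-N.skew)

/-- Probability `p_{i,f}` that file `f` is cached at a base station of tier `i`. -/
def cacheProb (i : Fin 2) (f : ℕ) : ℝ := (N.place i).real {c | f ∈ c}

/-- Path loss laws: a power law for the macro tier, and a power law restricted to the
line-of-sight ball for the pico tier. -/
def pathLoss (i : Fin 2) (r : ℝ) : ℝ :=
  if i = 0 then N.icpt 0 * r ^ (-N.expo 0)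
  else unitStep (N.losR - r) * (N.icpt 1 * r ^ (-N.expo 1))

/-- Array gains: omnidirectional macro base stations, uniform linear array at the pico ones
(with the removable singularities at integer angles filled in). -/
def gain (i : Fin 2) (w : ℝ) : ℝ :=
  if i = 0 then 1
  else if Real.sin (Real.pi * w) = 0 then 1
  else Real.sin (Real.pi * N.ant 1 * w) ^ 2 / ((N.ant 1 : ℝ) ^ 2 * Real.sin (Real.pi * w) ^ 2)

/-- Fading parameters: `1` (Rayleigh) for the macro tier, Nakagami for the pico tier. -/
def fadeParam (i : Fin 2) : ℕ := if i = 0 then 1 else N.nak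

/-- Law of the fading power: normalized Gamma. -/
def fadeLaw (i : Fin 2) : Measure ℝ := gammaMeasure (N.fadeParam i) (N.fadeParam i)

/-- Law of the angle: uniform on `[-d/wavelength, d/wavelength]`. -/
def angleLaw : Measure ℝ :=
  ProbabilityTheory.cond volume
    (Set.Icc (-(N.spacing / N.wavelen)) (N.spacing / N.wavelen))

/-- Intensity of the base stations of tier `i` with their independent marks. -/
def intensity (i : Fin 2) : Measure BS :=
  (ENNReal.ofReal (N.dens i) • (volume : Measure (EuclideanSpace ℝ (Fin 2)))).prod
    ((N.place i).prod ((N.fadeLaw i).prod N.angleLaw))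

/-- `Φ 0` and `Φ 1` are the two tiers of base stations: independent, locally finite,
independently marked homogeneous Poisson point processes. -/
structure IsModel {Ω : Type*} [MeasurableSpace Ω] (P : Measure Ω)
    (Φ : Fin 2 → Ω → Set BS) : Prop where
  poisson : ∀ i, IsPoissonProcess (Φ i) (N.intensity i) P
  locFinite : ∀ i ω (R : ℝ), {x ∈ Φ i ω | x.dist ≤ R}.Finite
  indep : Indep (countAlgebra (Φ 0)) (countAlgebra (Φ 1)) P

/-! ### Signal, interference, association -/

/-- Received power at the typical user if `x`, of tier `i`, is the serving base station
(its beam is aligned, with gain `G₀ = 1`). -/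
def signal (i : Fin 2) (x : BS) : ℝ := N.power i * N.pathLoss i x.dist * N.ant i * x.fade

/-- Received power at the typical user from an interfering base station `x` of tier `i`. -/
def interfPower (i : Fin 2) (x : BS) : ℝ :=
  N.power i * N.pathLoss i x.dist * (N.ant i * x.fade * N.gain i x.angle)

/-- SINR at the typical user when it is served by the base station `x` of tier `i` and all other
base stations `S` of that tier interfere. It is `∞` when the signal is positive and there is
neither noise nor interference. -/
def sinr (i : Fin 2) (S : Set BS) (x : BS) : ENNReal :=
  ENNReal.ofReal (N.signal i x) /
    (ENNReal.ofReal (N.noise i) + ∑' y : {y // y ∈ S ∧ y ≠ x}, ENNReal.ofReal (N.interfPower i y))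

/-- Biased average received power from the base station `x` of tier `i`. -/
def avgPower (i : Fin 2) (x : BS) : ℝ :=
  N.biasP i * N.power i * N.pathLoss i x.dist * N.ant i

/-- `x` is the nearest among the base stations of `S` whose cache satisfies `K`. -/
def IsNearest (K : Set ℕ → Prop) (S : Set BS) (x : BS) : Prop :=
  x ∈ S ∧ K x.cache ∧ ∀ y ∈ S, K y.cache → y ≠ x → x.dist < y.dist

open Classical in
/-- SINR of the link from the nearest base station of `S` (all of tier `i`) whose cache satisfies
`K`; it is `0` if there is none. -/
def tierSinr (i : Fin 2) (K : Set ℕ → Prop) (S : Set BS) : ENNReal :=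
  if h : ∃ x, IsNearest K S x then N.sinr i S h.choose else 0

/-- The data rate `B log₂(1+υ)` of a link with bandwidth `B` and SINR `υ`. -/
def rate (B : ℝ) (v : ENNReal) : EReal := ((B / Real.log 2 : ℝ) : EReal) * ENNReal.log (1 + v)

/-- The SINR threshold `2^(R/Bᵢ) - 1` for the rate threshold `R`. -/
def thr (i : Fin 2) (R : ℝ) : ℝ := (2 : ℝ) ^ (R / N.band i) - 1

section Probabilities

variable {Ω : Type*} [MeasurableSpace Ω] (P : Measure Ω) (Φ : Fin 2 → Ω → Set BS)

/-- `Υ_{i,f}`: SINR of the typical user requesting file `f` from tier `i`, which is served by the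
nearest base station of that tier that caches `f`. -/
def fileSinr (i : Fin 2) (f : ℕ) (ω : Ω) : ENNReal := N.tierSinr i (fun c => f ∈ c) (Φ i ω)

/-- Cache-related coverage probability `P_{Υ_{i,f}}(τ) = ℙ[Υ_{i,f} > τ]`. -/
def tierCov (i : Fin 2) (f : ℕ) (τ : ℝ) : ℝ :=
  P.real {ω | ENNReal.ofReal τ < N.fileSinr Φ i f ω}

/-- Its density `p_{Υ_{i,f}} = - d/dτ P_{Υ_{i,f}}`. -/
def tierDens (i : Fin 2) (f : ℕ) (τ : ℝ) : ℝ := -deriv (N.tierCov P Φ i f) τ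

/-- The user requesting file `f` is associated under Max-RP with `x`, of tier `i`: this base
station caches `f`, and its biased average received power is larger than that of all other base
stations of both tiers caching `f`. -/
def AssocRP (f : ℕ) (ω : Ω) (i : Fin 2) (x : BS) : Prop :=
  x ∈ Φ i ω ∧ f ∈ x.cache ∧
    ∀ j, ∀ y ∈ Φ j ω, f ∈ y.cache → (j, y) ≠ (i, x) → N.avgPower j y < N.avgPower i x

/-- Max-RP coverage probability `Θ_{i,f}(τ)`: the user requesting file `f` is associated with a
base station of tier `i`, and the SINR of that link exceeds `τ`. -/
def maxRPCov (i : Fin 2) (f : ℕ) (τ : ℝ) : ℝ :=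
  P.real {ω | ∃ x, N.AssocRP Φ f ω i x ∧ ENNReal.ofReal τ < N.sinr i (Φ i ω) x}

/-- Biased data rate `R_{i,f}` offered by tier `i`. -/
def biasedRate (i : Fin 2) (f : ℕ) (ω : Ω) : EReal :=
  rate (N.biasB i * N.band i) (N.fileSinr Φ i f ω)

/-- Max-Rate coverage probability: the biased rate offered by tier `i` is larger than that of the
other tier, and the SINR of the link of tier `i` exceeds `τ`. -/
def maxRateCov (i : Fin 2) (f : ℕ) (τ : ℝ) : ℝ :=
  P.real {ω | (∀ j, j ≠ i → N.biasedRate Φ j f ω < N.biasedRate Φ i f ω) ∧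
    ENNReal.ofReal τ < N.fileSinr Φ i f ω}

/-- `f^R_{i,f}(τ) = p_{Υ_{i,f}}(τ) (1 - P_{Υ_{j,f}}((1+τ)^(bᵢBᵢ/(bⱼBⱼ)) - 1))`, with `j = 1 - i` the
other tier. -/
def maxRateDens (i : Fin 2) (f : ℕ) (τ : ℝ) : ℝ :=
  N.tierDens P Φ i f τ *
    (1 - N.tierCov P Φ (1 - i) f
      ((1 + τ) ^ (N.biasB i * N.band i / (N.biasB (1 - i) * N.band (1 - i))) - 1))

/-- Server mode: the user is served by the nearest macro base station (whatever it caches), the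
backhaul supports the rate `R`, and the rate of the radio link exceeds `R`. -/
def serverProb (R : ℝ) : ℝ :=
  P.real {ω | R ≤ N.Cbh ∧ (R : EReal) < rate (N.band 0) (N.tierSinr 0 (fun _ => True) (Φ 0 ω))}

end Probabilities

/-- The two user association schemes. -/
inductive Scheme where
  | maxRP
  | maxRate

/-- Area spectral efficiency `(density) * log₂(1+τ) * (coverage probability at τ)` of a set of
active transmitters. -/
def aseTerm (density τ cov : ℝ) : ℝ := density * Real.logb 2 (1 + τ) * cov

section ASE

variable {Ω : Type*} [MeasurableSpace Ω] (P : Measure Ω) (Φ : Fin 2 → Ω → Set BS)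

/-- Coverage probability, in the model, of a user requesting `f` from tier `i`. -/
def coverage (s : Scheme) (i : Fin 2) (f : ℕ) (τ : ℝ) : ℝ :=
  match s with
  | .maxRP => N.maxRPCov P Φ i f τ
  | .maxRate => N.maxRateCov P Φ i f τ

/-- Area spectral efficiency of the network for rate threshold `R`, averaged over the requested
file: files `f ≤ Hc` are delivered by the base stations of both tiers that cache `f` (density
`p_{i,f} λᵢ`), the other files by the server through the macro tier. -/
def ASE (s : Scheme) (R : ℝ) : ℝ :=
  ∑ f ∈ Finset.Icc 1 N.Nc, N.req f *
    (if f ≤ N.Hc then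
      ∑ i : Fin 2, aseTerm (N.cacheProb i f * N.dens i) (N.thr i R)
        (N.coverage P Φ s i f (N.thr i R))
    else aseTerm (N.dens 0) (N.thr 0 R) (N.serverProb P Φ R))

end ASE

/-! ### Explicit expressions -/

/-- Density `P_{i,f}(r)` of the distance to the nearest base station of tier `i` caching `f`, in
terms of `p = p_{i,f}`. -/
def nearestDens (i : Fin 2) (p r : ℝ) : ℝ :=
  2 * Real.pi * p * N.dens i * r * Real.exp (-(Real.pi * p * N.dens i * r ^ 2))

/-- `P^r_{j,i}`, the ratio of biased received powers at unit distance. -/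
def powRatio (j i : Fin 2) : ℝ :=
  (N.biasP j * N.power j * N.icpt j * N.ant j) / (N.biasP i * N.power i * N.icpt i * N.ant i)

/-- `R_r = (P^r_{1,2} R_L^{α₂})^{1/α₁}`. -/
def radR : ℝ := (N.powRatio 0 1 * N.losR ^ N.expo 1) ^ (1 / N.expo 0)

/-- Density of the distance to the serving base station under Max-RP (joint with the event that
the serving tier is `i`). -/
def distDensRP (i : Fin 2) (f : ℕ) (r : ℝ) : ℝ :=
  if i = 0 then
    2 * Real.pi * N.cacheProb 0 f * N.dens 0 * r *
        Real.exp (-(Real.pi * ∑ j : Fin 2, N.cacheProb j f * N.dens j *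
          N.powRatio j 0 ^ (2 / N.expo 1) * r ^ (2 / (N.expo j / N.expo 0)))) *
        unitStep (N.radR - r) +
      2 * Real.pi * N.cacheProb 0 f * N.dens 0 * r *
        Real.exp (-(Real.pi * N.cacheProb 1 f * N.dens 1 * N.losR ^ 2)
          - Real.pi * N.cacheProb 0 f * N.dens 0 * r ^ 2) *
        unitStep (r - N.radR)
  else
    2 * Real.pi * N.cacheProb 1 f * N.dens 1 * r *
      Real.exp (-(Real.pi * ∑ j : Fin 2, N.cacheProb j f * N.dens j *
        N.powRatio j 1 ^ (2 / N.expo 0) * r ^ (2 / (N.expo j / N.expo 1)))) *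
      unitStep (N.losR - r)

/-- Coverage integral of the macro tier with caching probability `p` and density `g` of the
serving distance:
`∫ exp(-τσ₁²r^{α₁}/(P₁C₁N₁) - πλ₁r²(p(S(τ)-1) + (1-p)Δ(τ))) g(r) dr` over `r > 0`. -/
def macroInt (p : ℝ) (g : ℝ → ℝ) (τ : ℝ) : ℝ :=
  ∫ r in Set.Ioi (0 : ℝ),
    Real.exp (-(τ * N.noise 0 * r ^ N.expo 0 / (N.power 0 * N.icpt 0 * N.ant 0))
      - Real.pi * N.dens 0 * r ^ 2 *
        (p * (hypS (N.expo 0) 1 τ - 1) + (1 - p) * gammaDelta (N.expo 0) 1 τ)) * g r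

/-- Coverage probability of the macro tier whose base stations cache the requested file with
probability `p`. -/
def macroCov (p τ : ℝ) : ℝ := N.macroInt p (N.nearestDens 0 p) τ

/-- Success probability `P_S(R)` of the server mode. -/
def PS (R : ℝ) : ℝ :=
  unitStep (N.Cbh - R) * unitStep ((N.Nc : ℝ) - N.Hc - 1) *
    ∑ f ∈ Finset.Icc (N.Hc + 1) N.Nc, N.req f * N.macroCov 1 (N.thr 0 R)

/-- The right-hand side of the area spectral efficiency formula, for the coverage probabilities
`Pa i f τ`. -/
def aseFormula (Pa : Fin 2 → ℕ → ℝ → ℝ) (R : ℝ) : ℝ :=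
  (∑ f ∈ Finset.Icc 1 N.Hc, ∑ i : Fin 2,
      N.req f * N.cacheProb i f * N.dens i * R / N.band i * Pa i f (N.thr i R))
    + N.dens 0 * R / N.band 0 * N.PS R

/-- `η = n (n!)^(-1/n)` for the Nakagami parameter `n` of the pico tier. -/
def eta : ℝ := N.nak * (N.nak.factorial : ℝ) ^ (-(1 / (N.nak : ℝ)))

/-- `W_f(ω,s,τ)`, at distance `r` from the serving base station and with `p = p_{2,f}`. In the case
of exponent `2` the value at `X = 0` is the limit `X → 0`. -/
def lapW (p r w s τ : ℝ) : ℝ :=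
  let X := s * N.gain 1 w * τ / N.nak
  if N.expo 1 = 2 then
    if X = 0 then p * r ^ 2 - N.losR ^ 2
    else X * (elemF N.nak (X / N.losR ^ 2) - p * elemF N.nak (X / r ^ 2))
  else
    p * hypS (N.expo 1) N.nak (X / r ^ N.expo 1) * r ^ 2
      + (1 - p) * gammaDelta (N.expo 1) N.nak X
      - hypS (N.expo 1) N.nak (X / N.losR ^ N.expo 1) * N.losR ^ 2

/-- Laplace transform `L₂(s,τ)` of the interference in the pico tier, with `u` nodes in the
quadrature over the angle:
`exp(-πλ₂(R_L² - p r²) - (π²λ₂/(2u)) ∑ₖ W(xₖ d/wavelength, s, τ) √(1-xₖ²))`. -/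
def lapL (u : ℕ) (p r s τ : ℝ) : ℝ :=
  Real.exp (-(Real.pi * N.dens 1 * (N.losR ^ 2 - p * r ^ 2))
    - Real.pi * N.dens 1 / 2 *
      chebQuad u fun x => N.lapW p r (x * N.spacing / N.wavelen) s τ)

/-- The approximation of the coverage probability of the pico tier with caching probability `p`
and density `g` of the serving distance, with `u₁` and `u₂` quadrature nodes:
`(πR_L/(2u₂)) ∑ₙ (-1)^(n+1) C(N,n) ∑ₖ F((xₖ+1)R_L/2) √(1-xₖ²)` with
`F(r) = L₂(nηr^{α₂}, τ) exp(-nητσ₂²r^{α₂}/(P₂C₂N₂)) g(r)`. -/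
def picoQuad (u₁ u₂ : ℕ) (p : ℝ) (g : ℝ → ℝ) (τ : ℝ) : ℝ :=
  N.losR / 2 * ∑ n ∈ Finset.Icc 1 N.nak, (-1) ^ (n + 1) * (N.nak.choose n : ℝ) *
    chebQuad u₂ fun x =>
      (fun r : ℝ =>
        N.lapL u₁ p r (n * N.eta * r ^ N.expo 1) τ *
          Real.exp (-(n * N.eta * r ^ N.expo 1 * τ * N.noise 1 /
            (N.power 1 * N.icpt 1 * N.ant 1))) * g r)
        ((x + 1) * N.losR / 2)

/-- `ε` bounds uniformly the error made when the distribution function of the fading power of the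
pico tier is replaced by `y ↦ (1 - exp(-η y))^N`. -/
def FadeApprox (ε : ℝ) : Prop :=
  ∀ y : ℝ, 0 ≤ y →
    |(N.fadeLaw 1).real (Set.Iio y) - (1 - Real.exp (-(N.eta * y))) ^ N.nak| ≤ ε

/-- The meaning of `c ≈ a(u₁,u₂)`: as the numbers of quadrature nodes tend to infinity the
expression `a` converges, and the limit differs from `c` by no more than the error made in the
distribution function of the fading power (which is zero for Rayleigh fading). -/
def Approximates (c : ℝ) (a : ℕ → ℕ → ℝ) : Prop :=
  ∃ l : ℝ, Tendsto (fun u : ℕ × ℕ => a u.1 u.2) atTop (𝓝 l) ∧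
    ∀ ε : ℝ, N.FadeApprox ε → |c - l| ≤ ε

end HetNet

end HetNetASE

end

noncomputable section

namespace HetNetASE

open Set
open scoped ENNReal

/-! ### The function `exp (-x)` on `[0, ∞]` -/

/-! The coverage event says that some point x of the Poisson process has the best score among the
stations caching the file, beats an independent level M, and has SINR above τ. Ranking is strict, so
at most one x qualifies and the probability is the expectation of a sum over the points. The Mecke
formula (`IsPoissonProcess.mecke`) turns it into an integral over the location of x of a probability
for the unchanged process. Both association rules fit this scheme (`ServingRule`): for the nearest
station the level is 0, for received power it is the top score of the other tier, which is
independent of the serving tier.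

The event SINR > τ says that the fading power of x exceeds τY, where Y is noise plus interference
divided by the link gain of x. The fading mark of x is independent of Y, so the coverage is the
integral of the fading tail at τy against a sub-probability law, `interfLaw`
(`measure_served_sinr`). The Laplace transform of this law is explicit
(`lintegral_expNeg_interfLaw`): the event that no better station exists and the interference depend
on the same points, but a weight ∞ on the better stations turns the pair into a single Laplace
functional. In polar coordinates its exponent consists of integrals of 1 - (1 + X u^(-α))^(-n) over
a disc, the exterior of a disc, or the whole plane. They are evaluated by a first-order differential
equation for the hypergeometric function (`integral_Ioi_sub_hypS`), by Gamma integrals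
(`lintegral_Ioi_zero_eq_gammaDelta`), and by their difference (`discAvg_eq_hypS_sub`); exponent 2
has an elementary antiderivative (`discAvg_two`).

For the macro tier the fading tail is exp(-y), so the coverage is the Laplace transform at τ. For
the pico tier the tail is replaced by 1 - (1 - exp(-ηy))^N. Since the law has mass at most 1, the
error is at most the uniform error of the distribution function, and the binomial expansion leaves
Laplace transforms at nητ (`ServingRule.abs_coverage_sub_le`). Gauss-Chebyshev quadrature becomes,
under x = cos θ, a midpoint sum on [0, π], and dominated convergence gives the limit
(`tendsto_chebQuad`, `tendsto_picoQuad`).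

For the rate association, the two SINRs are functions of independent tiers. Their survival functions
are differentiable by differentiation under the integral sign, so the finite part of each law has a
density and the comparison is a product integral (`measureReal_one_add_lt_rpow`). What remains is
the mass at SINR = ∞, the limit of the coverage for large thresholds: zero for the macro tier or
with positive noise, and otherwise the probability that the ball holds exactly one pico station,
which caches the file. -/

/-- `exp (-x)` for `x ∈ [0, ∞]`. -/
def expNeg (x : ℝ≥0∞) : ℝ≥0∞ := EReal.exp (-(x : EReal))

@[simp] lemma expNeg_zero : expNeg 0 = 1 := by simp [expNeg]

@[simp] lemma expNeg_top : expNeg ⊤ = 0 := by simp [expNeg]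

lemma expNeg_add (x y : ℝ≥0∞) : expNeg (x + y) = expNeg x * expNeg y := by
  unfold expNeg
  rw [EReal.coe_ennreal_add, EReal.neg_add (by simp) (by simp), sub_eq_add_neg, EReal.exp_add]

lemma expNeg_antitone : Antitone expNeg := fun x y h => by
  unfold expNeg
  rw [EReal.exp_le_exp_iff, EReal.neg_le_neg_iff]
  exact_mod_cast h

lemma expNeg_le_one (x : ℝ≥0∞) : expNeg x ≤ 1 := by
  simpa using expNeg_antitone (zero_le (a := x))

lemma expNeg_ne_top (x : ℝ≥0∞) : expNeg x ≠ ⊤ := ne_top_of_le_ne_top (by simp) (expNeg_le_one x)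

lemma continuous_expNeg : Continuous expNeg :=
  ENNReal.continuous_exp.comp (continuous_neg.comp continuous_coe_ennreal_ereal)

lemma measurable_expNeg : Measurable expNeg := continuous_expNeg.measurable

lemma expNeg_ofReal {x : ℝ} (hx : 0 ≤ x) : expNeg (ENNReal.ofReal x) = ENNReal.ofReal (Real.exp (-x)) := by
  unfold expNeg
  rw [EReal.coe_ennreal_ofReal, max_eq_left hx, ← EReal.coe_neg, EReal.exp_coe]

lemma expNeg_eq_toReal {x : ℝ≥0∞} (hx : x ≠ ⊤) :
    expNeg x = ENNReal.ofReal (Real.exp (-x.toReal)) := by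
  conv_lhs => rw [← ENNReal.ofReal_toReal hx]
  exact expNeg_ofReal ENNReal.toReal_nonneg

lemma expNeg_sum {ι : Type*} (s : Finset ι) (f : ι → ℝ≥0∞) :
    expNeg (∑ i ∈ s, f i) = ∏ i ∈ s, expNeg (f i) := by
  classical
  induction s using Finset.induction_on with
  | empty => simp
  | insert a s ha ih => rw [Finset.sum_insert ha, Finset.prod_insert ha, expNeg_add, ih]

/-! ### Poisson moments -/

lemma lintegral_poissonMeasure (r : NNReal) (g : ℕ → ℝ≥0∞) :
    ∫⁻ n, g n ∂(poissonMeasure r) =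
      ∑' n : ℕ, ENNReal.ofReal (Real.exp (-r) * r ^ n / n.factorial) * g n := by
  rw [poissonMeasure, lintegral_sum_measure]
  simp

lemma lintegral_cast_poissonMeasure (r : NNReal) : ∫⁻ n, (n : ℝ≥0∞) ∂(poissonMeasure r) = r := by
  rw [lintegral_poissonMeasure, tsum_eq_zero_add' ENNReal.summable]
  have h : ∀ n : ℕ, ENNReal.ofReal (Real.exp (-r) * r ^ (n + 1) / (n + 1).factorial) * ((n + 1 : ℕ) : ℝ≥0∞)
      = r * ENNReal.ofReal (Real.exp (-r) * r ^ n / n.factorial) := by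
    intro n
    rw [← ENNReal.ofReal_natCast, ← ENNReal.ofReal_mul (by positivity), ← ENNReal.ofReal_coe_nnreal,
      ← ENNReal.ofReal_mul (by positivity)]
    congr 1
    rw [Nat.factorial_succ]
    push_cast
    field_simp
    ring
  simp_rw [h]
  rw [ENNReal.tsum_mul_left, ← ENNReal.ofReal_tsum_of_nonneg (fun n => by positivity)
    (hasSum_one_poissonMeasure r).summable, (hasSum_one_poissonMeasure r).tsum_eq]
  simp

/-- The weight exp(-an) is absorbed into the power, (r exp(-a))^n, and the Poisson sum becomes an
exponential series. -/
lemma lintegral_expNeg_poissonMeasure (r : NNReal) {a : ℝ≥0∞} (ha : a ≠ ⊤) :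
    ∫⁻ n, expNeg (a * (n : ℕ)) ∂(poissonMeasure r) = expNeg (r * (1 - expNeg a)) := by
  lift a to NNReal using ha
  have h1 : expNeg (a : ℝ≥0∞) = ENNReal.ofReal (Real.exp (-a)) := by
    rw [← ENNReal.ofReal_coe_nnreal, expNeg_ofReal a.coe_nonneg]
  have h2 : ∀ n : ℕ, ENNReal.ofReal (Real.exp (-r) * r ^ n / n.factorial) * expNeg (a * (n : ℕ)) =
      ENNReal.ofReal (Real.exp (-r) * ((r * Real.exp (-a)) ^ n / n.factorial)) := by
    intro n
    rw [← ENNReal.ofReal_coe_nnreal, ← ENNReal.ofReal_natCast, ← ENNReal.ofReal_mul a.coe_nonneg,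
      expNeg_ofReal (by positivity), ← ENNReal.ofReal_mul (by positivity)]
    congr 1
    rw [mul_pow, ← Real.exp_nat_mul]
    ring_nf
  have hs := (NormedSpace.expSeries_div_hasSum_exp (r * Real.exp (-a) : ℝ)).mul_left (Real.exp (-r))
  rw [lintegral_poissonMeasure]
  simp_rw [h2]
  rw [← ENNReal.ofReal_tsum_of_nonneg (fun n => by positivity) hs.summable, hs.tsum_eq, h1,
    ← ENNReal.ofReal_one, ← ENNReal.ofReal_sub _ (by positivity), ← ENNReal.ofReal_coe_nnreal,
    ← ENNReal.ofReal_mul r.coe_nonneg, expNeg_ofReal, ← Real.exp_eq_exp_ℝ, ← Real.exp_add]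
  · ring_nf
  · have : Real.exp (-(a : ℝ)) ≤ 1 := by simp
    exact mul_nonneg r.coe_nonneg (by linarith)

/-! ### Point configurations -/

/-- Sets of points, with the σ-algebra generated by the void events `c ∩ B = ∅`. -/
@[ext] structure Config (E : Type*) where
  /-- the points -/
  pts : Set E

section Config

lemma tsum_indicator_eq_encard {E : Type*} (c B : Set E) :
    ∑' x : c, B.indicator (1 : E → ℝ≥0∞) x = ((c ∩ B).encard : ℝ≥0∞) := by
  rw [tsum_subtype c (B.indicator (1 : E → ℝ≥0∞)), indicator_indicator,
    ← tsum_subtype (c ∩ B) (1 : E → ℝ≥0∞)]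
  exact ENNReal.tsum_set_one _

variable {E : Type*} [MeasurableSpace E]

/-- The configurations without points in `B`. -/
def voidSet (B : Set E) : Set (Config E) := {c | c.pts ∩ B = ∅}

/-- Void events are closed under intersection (take the union of the two sets), unlike events
prescribing counts, so measures can be compared on them. The wrapper type keeps this σ-algebra apart
from the product one carried by `Set E`. -/
instance : MeasurableSpace (Config E) :=
  MeasurableSpace.generateFrom {s | ∃ B : Set E, MeasurableSet B ∧ voidSet B = s}

lemma measurableSet_voidSet {B : Set E} (hB : MeasurableSet B) : MeasurableSet (voidSet B) :=
  MeasurableSpace.measurableSet_generateFrom ⟨B, hB, rfl⟩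

lemma isPiSystem_voidSet :
    IsPiSystem {s : Set (Config E) | ∃ B : Set E, MeasurableSet B ∧ voidSet B = s} := by
  rintro _ ⟨B, hB, rfl⟩ _ ⟨B', hB', rfl⟩ -
  refine ⟨B ∪ B', hB.union hB', ?_⟩
  ext c
  simp only [voidSet, mem_ofPred_eq, mem_inter_iff, inter_union_distrib_left, union_empty_iff]

/-- The counting measure of a configuration. -/
def countMeas (c : Set E) : Measure E := Measure.sum fun x : c => Measure.dirac x.1

lemma lintegral_countMeas (c : Set E) {f : E → ℝ≥0∞} (hf : Measurable f) :
    ∫⁻ x, f x ∂(countMeas c) = ∑' x : c, f x := by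
  rw [countMeas, lintegral_sum_measure]
  simp [lintegral_dirac' _ hf]

lemma countMeas_apply (c : Set E) {B : Set E} (hB : MeasurableSet B) :
    countMeas c B = ((c ∩ B).encard : ℝ≥0∞) := by
  rw [← lintegral_indicator_one hB, lintegral_countMeas c (measurable_one.indicator hB),
    tsum_indicator_eq_encard]

/-- Suprema over the points of a configuration are measurable. -/
lemma measurable_iSup_config {f : E → ℝ≥0∞} (hf : Measurable f) :
    Measurable fun c : Config E => ⨆ x ∈ c.pts, f x := by
  refine measurable_of_Ioi fun a => ?_
  -- The supremum exceeds a exactly when some point lies where f > a, which is the complement of a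
  -- void event.
  have : (fun c : Config E => ⨆ x ∈ c.pts, f x) ⁻¹' Ioi a =
      (voidSet (f ⁻¹' Ioi a))ᶜ := by
    ext c
    simp only [mem_preimage, mem_Ioi, lt_iSup_iff, voidSet, mem_compl_iff, mem_ofPred_eq,
      ← ne_eq, ← nonempty_iff_ne_empty, Set.Nonempty, mem_inter_iff, exists_prop]
  rw [this]
  exact (measurableSet_voidSet (hf measurableSet_Ioi)).compl

variable [MeasurableSpace.CountablyGenerated E]

/-- The cells of a refining sequence of finite measurable partitions that separates points. -/
def cell (n : ℕ) (s : Fin n → Bool) : Set E :=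
  {x | ∀ i : Fin n, MeasurableSpace.mapNatBool E x i = s i}

lemma measurableSet_cell (n : ℕ) (s : Fin n → Bool) : MeasurableSet (cell n s : Set E) := by
  have h := MeasurableSpace.measurable_mapNatBool E
  have : (cell n s : Set E) = ⋂ i : Fin n, (fun x => MeasurableSpace.mapNatBool E x i) ⁻¹' {s i} := by
    ext x; simp [cell]
  rw [this]
  exact MeasurableSet.iInter fun i => (measurable_pi_iff.1 h i) (measurableSet_singleton _)

lemma mem_cell_iff (n : ℕ) (s : Fin n → Bool) (x : E) :
    x ∈ (cell n s : Set E) ↔ s = fun i : Fin n => MeasurableSpace.mapNatBool E x i := by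
  simp only [cell, mem_ofPred_eq, funext_iff, eq_comm]

variable [MeasurableSpace.SeparatesPoints E]

lemma exists_injOn_cell (F : Finset E) :
    ∃ n : ℕ, Set.InjOn (fun (x : E) (i : Fin n) => MeasurableSpace.mapNatBool E x i) (F : Set E) := by
  classical
  have h : ∀ p : E × E, ∃ k : ℕ, p.1 ≠ p.2 →
      MeasurableSpace.mapNatBool E p.1 k ≠ MeasurableSpace.mapNatBool E p.2 k := by
    rintro ⟨x, y⟩
    by_cases hxy : x = y
    · exact ⟨0, fun h => (h hxy).elim⟩
    · have := (MeasurableSpace.injective_mapNatBool E).ne hxy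
      obtain ⟨k, hk⟩ := Function.ne_iff.1 this
      exact ⟨k, fun _ => hk⟩
  choose k hk using h
  -- One more than the largest separating index, since `Fin n` only sees the bits below n.
  refine ⟨(F ×ˢ F).sup k + 1, fun x hx y hy hxy => ?_⟩
  by_contra hne
  refine hk (x, y) hne ?_
  have hle : k (x, y) < (F ×ˢ F).sup k + 1 :=
    Nat.lt_succ_of_le (Finset.le_sup (f := k) (Finset.mk_mem_product hx hy))
  exact congrFun hxy ⟨k (x, y), hle⟩

-- Counts are recovered from void events by counting the occupied cells of finer and finer
-- partitions. Disjoint cells never outnumber the points, and any finite set of points is separated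
-- at some level, so the supremum is the count even when it is infinite.
open Classical in
lemma encard_inter_eq_iSup (c B : Set E) :
    ((c ∩ B).encard : ℝ≥0∞) =
      ⨆ n : ℕ, ∑ s : Fin n → Bool, if c ∩ (B ∩ cell n s) = ∅ then 0 else 1 := by
  rw [← tsum_indicator_eq_encard]
  apply le_antisymm
  · rw [ENNReal.tsum_eq_iSup_sum]
    refine iSup_le fun F => ?_
    set G : Finset E := (F.filter fun x => x.1 ∈ B).image Subtype.val with hG
    obtain ⟨n, hn⟩ := exists_injOn_cell G
    refine le_trans ?_ (le_iSup _ n)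
    have h1 : ∑ a ∈ F, B.indicator (1 : E → ℝ≥0∞) a = (G.card : ℝ≥0∞) := by
      rw [hG, Finset.card_image_of_injective _ Subtype.val_injective, Finset.card_filter]
      push_cast
      exact Finset.sum_congr rfl fun x _ => by simp [indicator_apply]
    rw [h1, ← Finset.card_image_of_injOn hn]
    have h2 : ∀ s ∈ G.image (fun (x : E) (i : Fin n) => MeasurableSpace.mapNatBool E x i),
        (1 : ℝ≥0∞) ≤ if c ∩ (B ∩ cell n s) = ∅ then 0 else 1 := by
      intro s hs
      obtain ⟨x, hx, rfl⟩ := Finset.mem_image.1 hs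
      rw [if_neg]
      rw [hG] at hx
      obtain ⟨y, hy, rfl⟩ := Finset.mem_image.1 hx
      have : y.1 ∈ c ∩ (B ∩ cell n fun i : Fin n => MeasurableSpace.mapNatBool E y.1 i) :=
        ⟨y.2, (Finset.mem_filter.1 hy).2, (mem_cell_iff _ _ _).2 rfl⟩
      exact (nonempty_of_mem this).ne_empty
    calc _ = ∑ s ∈ G.image (fun (x : E) (i : Fin n) => MeasurableSpace.mapNatBool E x i),
              (1 : ℝ≥0∞) := by simp
      _ ≤ _ := Finset.sum_le_sum h2
      _ ≤ _ := Finset.sum_le_sum_of_subset (Finset.subset_univ _)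
  · refine iSup_le fun n => ?_
    have h1 : ∀ s : Fin n → Bool, (if c ∩ (B ∩ cell n s) = ∅ then 0 else 1) ≤
        ∑' x : c, (B ∩ cell n s).indicator (1 : E → ℝ≥0∞) x := by
      intro s
      split_ifs with h
      · simp
      · obtain ⟨x, hx⟩ := nonempty_iff_ne_empty.2 h
        refine le_trans ?_ (ENNReal.le_tsum ⟨x, hx.1⟩)
        simp [hx.2]
    refine (Finset.sum_le_sum fun s _ => h1 s).trans ?_
    rw [← Summable.tsum_finsetSum fun _ _ => ENNReal.summable]
    refine ENNReal.tsum_le_tsum fun x => ?_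
    rw [Finset.sum_eq_single (fun i : Fin n => MeasurableSpace.mapNatBool E x.1 i)]
    · exact indicator_le_indicator_of_subset inter_subset_left (fun _ => zero_le) _
    · intro s _ hs
      rw [indicator_of_notMem]
      exact fun h => hs ((mem_cell_iff _ _ _).1 h.2)
    · simp

lemma measurable_encard {B : Set E} (hB : MeasurableSet B) :
    Measurable fun c : Config E => ((c.pts ∩ B).encard : ℝ≥0∞) := by
  classical
  simp_rw [encard_inter_eq_iSup]
  refine Measurable.iSup fun n => Finset.measurable_sum _ fun s _ => ?_
  exact Measurable.ite (measurableSet_voidSet (hB.inter (measurableSet_cell n s)))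
    measurable_const measurable_const

lemma measurable_countMeas : Measurable fun c : Config E => countMeas c.pts := by
  refine Measure.measurable_of_measurable_coe _ fun B hB => ?_
  simp_rw [countMeas_apply _ hB]
  exact measurable_encard hB

/-- Sums over the points of a configuration are measurable. -/
lemma measurable_tsum_config {f : E → ℝ≥0∞} (hf : Measurable f) :
    Measurable fun c : Config E => ∑' x : c.pts, f x := by
  have := (Measure.measurable_lintegral hf).comp measurable_countMeas
  simpa only [Function.comp_def, lintegral_countMeas _ hf] using this

end Config

end HetNetASE

/-! ### Counts, void probabilities and the Mecke formula of a Poisson process -/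

namespace HetNetASE

open Set
open scoped ENNReal

section Poisson

variable {Ω E : Type*} {mΩ : MeasurableSpace Ω} [MeasurableSpace E] {Φ : Ω → Set E} {μ : Measure E}
  {P : Measure Ω}

lemma measurable_countAlgebra_encard (Φ : Ω → Set E) {B : Set E} (hB : MeasurableSet B) :
    Measurable[countAlgebra Φ] fun ω => (Φ ω ∩ B).encard :=
  Measurable.mono (comap_measurable _)
    (le_iSup (fun B : {B : Set E // MeasurableSet B} =>
      MeasurableSpace.comap (fun ω => (Φ ω ∩ B.1).encard) inferInstance) ⟨B, hB⟩) le_rfl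

lemma measurable_config (Φ : Ω → Set E) :
    Measurable[countAlgebra Φ] fun ω => (⟨Φ ω⟩ : Config E) := by
  refine @measurable_generateFrom _ _ (countAlgebra Φ) _ _ ?_
  rintro _ ⟨B, hB, rfl⟩
  have : (fun ω => (⟨Φ ω⟩ : Config E)) ⁻¹' voidSet B = (fun ω => (Φ ω ∩ B).encard) ⁻¹' {0} := by
    ext ω; simp [voidSet]
  rw [this]
  exact measurable_countAlgebra_encard Φ hB (measurableSet_singleton 0)

lemma IsPoissonProcess.countAlgebra_le (h : IsPoissonProcess Φ μ P) : countAlgebra Φ ≤ mΩ :=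
  iSup_le fun B => (h.measurable_count B.1 B.2).comap_le

lemma IsPoissonProcess.measure_void_of_ne_top (h : IsPoissonProcess Φ μ P) {B : Set E}
    (hB : MeasurableSet B) (hμ : μ B ≠ ⊤) : P {ω | Φ ω ∩ B = ∅} = expNeg (μ B) := by
  have := h.count_law B hB hμ 0
  simp only [Nat.cast_zero, encard_eq_zero] at this
  rw [this, poissonMeasure_singleton, expNeg_eq_toReal hμ]
  simp [ENNReal.coe_toNNReal_eq_toReal]

lemma IsPoissonProcess.measure_one (h : IsPoissonProcess Φ μ P) {B : Set E}
    (hB : MeasurableSet B) (hμ : μ B ≠ ⊤) :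
    P {ω | (Φ ω ∩ B).encard = 1} = μ B * expNeg (μ B) := by
  have := h.count_law B hB hμ 1
  rw [Nat.cast_one] at this
  rw [this, poissonMeasure_singleton, expNeg_eq_toReal hμ]
  simp only [ENNReal.coe_toNNReal_eq_toReal, pow_one, Nat.factorial_one, Nat.cast_one, div_one]
  rw [mul_comm, ENNReal.ofReal_mul ENNReal.toReal_nonneg, ENNReal.ofReal_toReal hμ]

lemma IsPoissonProcess.indep_pair (h : IsPoissonProcess Φ μ P) {B C : Set E}
    (hB : MeasurableSet B) (hC : MeasurableSet C) (hd : Disjoint B C) :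
    IndepFun (fun ω => (Φ ω ∩ B).encard) (fun ω => (Φ ω ∩ C).encard) P := by
  have := h.count_indep 2 ![B, C] (by simp [Fin.forall_fin_two, hB, hC]) (by
    intro i j hij
    fin_cases i <;> fin_cases j <;> simp_all [disjoint_comm])
  exact this.indepFun (i := 0) (j := 1) (by simp)

variable [IsProbabilityMeasure P]

/-- `count_law` speaks of finite counts only. These already carry the same mass on both sides, and
both measures are probabilities, so the atoms at ∞ agree as complements. -/
lemma IsPoissonProcess.map_count (h : IsPoissonProcess Φ μ P) {B : Set E} (hB : MeasurableSet B)
    (hμ : μ B ≠ ⊤) : P.map (fun ω => (Φ ω ∩ B).encard) =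
      (poissonMeasure (μ B).toNNReal).map (Nat.cast : ℕ → ℕ∞) := by
  have hm := h.measurable_count B hB
  have : IsProbabilityMeasure (P.map fun ω => (Φ ω ∩ B).encard) :=
    Measure.isProbabilityMeasure_map hm.aemeasurable
  have : IsProbabilityMeasure ((poissonMeasure (μ B).toNNReal).map (Nat.cast : ℕ → ℕ∞)) :=
    Measure.isProbabilityMeasure_map (measurable_of_countable _).aemeasurable
  have hnat : ∀ n : ℕ, P.map (fun ω => (Φ ω ∩ B).encard) {(n : ℕ∞)} =
      (poissonMeasure (μ B).toNNReal).map (Nat.cast : ℕ → ℕ∞) {(n : ℕ∞)} := by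
    intro n
    rw [Measure.map_apply hm (measurableSet_singleton _),
      Measure.map_apply (measurable_of_countable _) (measurableSet_singleton _)]
    refine (h.count_law B hB hμ n).trans ?_
    congr 1
    ext k; simp
  have hrange : P.map (fun ω => (Φ ω ∩ B).encard) (range (Nat.cast : ℕ → ℕ∞)) =
      (poissonMeasure (μ B).toNNReal).map (Nat.cast : ℕ → ℕ∞) (range (Nat.cast : ℕ → ℕ∞)) := by
    rw [← iUnion_singleton_eq_range,
      measure_iUnion (fun i j hij => by simpa using hij) fun i => measurableSet_singleton _,
      measure_iUnion (fun i j hij => by simpa using hij) fun i => measurableSet_singleton _]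
    exact tsum_congr hnat
  have htop : ({⊤} : Set ℕ∞) = (range (Nat.cast : ℕ → ℕ∞))ᶜ := by
    ext n
    induction n using ENat.recTopCoe <;> simp
  refine Measure.ext_of_singleton fun n => ?_
  induction n using ENat.recTopCoe with
  | coe n => exact hnat n
  | top =>
    have hr : MeasurableSet (range (Nat.cast : ℕ → ℕ∞)) := (countable_range _).measurableSet
    rw [htop, measure_compl hr (measure_ne_top _ _), measure_compl hr (measure_ne_top _ _), hrange]
    simp

lemma IsPoissonProcess.lintegral_count (h : IsPoissonProcess Φ μ P) {B : Set E}
    (hB : MeasurableSet B) (hμ : μ B ≠ ⊤) (g : ℕ∞ → ℝ≥0∞) :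
    ∫⁻ ω, g (Φ ω ∩ B).encard ∂P = ∫⁻ n : ℕ, g n ∂(poissonMeasure (μ B).toNNReal) := by
  rw [← lintegral_map (measurable_of_countable g) (h.measurable_count B hB), h.map_count hB hμ,
    lintegral_map (measurable_of_countable g) (measurable_of_countable _)]

lemma IsPoissonProcess.lintegral_encard (h : IsPoissonProcess Φ μ P) {B : Set E}
    (hB : MeasurableSet B) (hμ : μ B ≠ ⊤) :
    ∫⁻ ω, ((Φ ω ∩ B).encard : ℝ≥0∞) ∂P = μ B := by
  rw [h.lintegral_count hB hμ (fun n => (n : ℝ≥0∞))]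
  simp only [ENat.toENNReal_coe]
  rw [lintegral_cast_poissonMeasure, ENNReal.coe_toNNReal hμ]

/-- An increasing sequence of sets of finite measure that exhausts the space, each containing
finitely many points of `Φ`. -/
structure Exhausts (A : ℕ → Set E) (Φ : Ω → Set E) (μ : Measure E) : Prop where
  measurable : ∀ n, MeasurableSet (A n)
  mono : Monotone A
  union : ⋃ n, A n = univ
  ne_top : ∀ n, μ (A n) ≠ ⊤
  finite : ∀ ω n, (Φ ω ∩ A n).Finite

variable {A : ℕ → Set E}

/-- Removes the finiteness of μ B: the void events of `B ∩ A n` decrease to that of B, and `expNeg`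
is continuous up to ∞. -/
lemma IsPoissonProcess.measure_void (h : IsPoissonProcess Φ μ P) (hA : Exhausts A Φ μ) {B : Set E}
    (hB : MeasurableSet B) : P {ω | Φ ω ∩ B = ∅} = expNeg (μ B) := by
  have hU : B = ⋃ n, B ∩ A n := by rw [← inter_iUnion, hA.union, inter_univ]
  have hmono : Monotone fun n => B ∩ A n := fun m n hmn => inter_subset_inter_right _ (hA.mono hmn)
  have hfin : ∀ n, μ (B ∩ A n) ≠ ⊤ := fun n =>
    ne_top_of_le_ne_top (hA.ne_top n) (measure_mono inter_subset_right)
  have hmB : ∀ n, MeasurableSet (B ∩ A n) := fun n => hB.inter (hA.measurable n)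
  have h1 : Tendsto (fun n => expNeg (μ (B ∩ A n))) atTop (𝓝 (expNeg (μ B))) := by
    have := tendsto_measure_iUnion_atTop (μ := μ) hmono
    rw [← hU] at this
    exact (continuous_expNeg.tendsto _).comp this
  have h2 : {ω | Φ ω ∩ B = ∅} = ⋂ n, {ω | Φ ω ∩ (B ∩ A n) = ∅} := by
    ext ω
    simp only [mem_ofPred_eq, mem_iInter]
    conv_lhs => rw [hU, inter_iUnion, iUnion_eq_empty]
  have h3 : Tendsto (fun n => P {ω | Φ ω ∩ (B ∩ A n) = ∅}) atTop (𝓝 (P {ω | Φ ω ∩ B = ∅})) := by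
    rw [h2]
    refine tendsto_measure_iInter_atTop (fun n => ?_) ?_ ⟨0, measure_ne_top _ _⟩
    · have := h.measurable_count _ (hmB n) (measurableSet_singleton 0)
      refine MeasurableSet.nullMeasurableSet ?_
      convert this using 1
      ext ω; simp
    · intro m n hmn ω hω
      exact subset_eq_empty (inter_subset_inter_right _ (hmono hmn)) hω
  simp_rw [h.measure_void_of_ne_top (hmB _) (hfin _)] at h3
  exact tendsto_nhds_unique h3 h1

/-! ### The Mecke formula -/

-- Deleting x leaves B empty exactly when B was empty already or x was its only point. In the first
-- case the sum counts the points of A \ B; in the second it is 1 or 0 according to whether the only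
-- point of B lies in A. Each product on the right involves counts in disjoint sets, so independence
-- of counts applies to it.
open Classical in
lemma tsum_palm_void {E : Type*} (c A B : Set E) :
    ∑' x : c, (A.indicator 1 x.1 * if (c \ {x.1}) ∩ B = ∅ then 1 else 0 : ℝ≥0∞) =
      (c ∩ (A \ B)).encard * (if (c ∩ B).encard = 0 then 1 else 0) +
      (if (c ∩ (A ∩ B)).encard = 1 then 1 else 0) *
        (if (c ∩ (B \ A)).encard = 0 then 1 else 0) := by
  by_cases h0 : c ∩ B = ∅
  · have h1 : c ∩ (A ∩ B) = ∅ := by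
      rw [inter_left_comm, h0, inter_empty]
    have h2 : c ∩ (A \ B) = c ∩ A := by
      ext x
      have : x ∈ c → x ∉ B := fun hc hB => (h0 ▸ ⟨hc, hB⟩ : x ∈ (∅ : Set E))
      simp only [mem_inter_iff, Set.mem_sdiff]; tauto
    have h3 : ∀ x : c, (c \ {x.1}) ∩ B = ∅ := fun x =>
      subset_eq_empty (inter_subset_inter_left _ sdiff_subset) h0
    simp only [h3, if_true, mul_one, h1, h2, h0, encard_empty]
    simp [tsum_indicator_eq_encard]
  · have h1 : (c ∩ B).encard ≠ 0 := by simpa using h0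
    simp only [h1, if_false, mul_zero, zero_add]
    by_cases hs : (c ∩ B).encard = 1
    · obtain ⟨a, ha⟩ := encard_eq_one.1 hs
      have hac : a ∈ c ∧ a ∈ B := by
        have : a ∈ c ∩ B := ha ▸ mem_singleton a
        exact this
      have huniq : ∀ y, y ∈ c → y ∈ B → y = a := fun y hy hyB => by
        have : y ∈ c ∩ B := ⟨hy, hyB⟩
        rwa [ha] at this
      rw [tsum_eq_single (⟨a, hac.1⟩ : c)]
      · have h4 : (c \ {a}) ∩ B = ∅ := by
          ext y; simp only [mem_inter_iff, Set.mem_sdiff, mem_singleton_iff, mem_empty_iff_false,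
            iff_false]
          rintro ⟨⟨hy, hne⟩, hyB⟩
          exact hne (huniq y hy hyB)
        by_cases haA : a ∈ A
        · have h5 : c ∩ (A ∩ B) = {a} := by
            ext y; simp only [mem_inter_iff, mem_singleton_iff]
            exact ⟨fun hy => huniq y hy.1 hy.2.2, fun hy => hy ▸ ⟨hac.1, haA, hac.2⟩⟩
          have h6 : c ∩ (B \ A) = ∅ := by
            ext y; simp only [mem_inter_iff, Set.mem_sdiff, mem_empty_iff_false, iff_false]
            rintro ⟨hy, hyB, hyA⟩
            exact hyA (huniq y hy hyB ▸ haA)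
          simp [h4, h5, h6, haA]
        · have h5 : c ∩ (A ∩ B) = ∅ := by
            ext y; simp only [mem_inter_iff, mem_empty_iff_false, iff_false]
            rintro ⟨hy, hyA, hyB⟩
            exact haA (huniq y hy hyB ▸ hyA)
          simp [h5, haA]
      · rintro ⟨x, hx⟩ hne
        have : (c \ {x}) ∩ B ≠ ∅ := by
          have hax : a ∈ c \ {x} := (Set.mem_sdiff a).2
            (And.intro hac.1 fun h => hne (Subtype.ext (mem_singleton_iff.1 h).symm))
          exact (nonempty_of_mem (mem_inter hax hac.2)).ne_empty
        simp [this]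
    · have h4 : ∀ x : c, (c \ {x.1}) ∩ B ≠ ∅ := by
        intro x hx
        have hsub : c ∩ B ⊆ {x.1} := by
          intro y hy
          by_contra hne
          have hmem : y ∈ (c \ {x.1}) ∩ B :=
            Set.mem_inter ((Set.mem_sdiff y).2 (And.intro hy.1 hne)) hy.2
          rw [hx] at hmem
          exact hmem
        rcases subset_singleton_iff_eq.1 hsub with h | h
        · exact h0 h
        · exact hs (by rw [h]; simp)
      have h5 : ¬((c ∩ (A ∩ B)).encard = 1 ∧ (c ∩ (B \ A)).encard = 0) := by
        rintro ⟨h6, h7⟩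
        refine hs ?_
        have : c ∩ B = c ∩ (A ∩ B) := by
          have h7 := encard_eq_zero.1 h7
          ext y
          have : y ∈ c → y ∈ B → y ∈ A := fun hy hB => by
            by_contra hA
            have : y ∈ c ∩ (B \ A) := ⟨hy, hB, hA⟩
            rw [h7] at this
            exact this
          simp only [mem_inter_iff]; tauto
        rw [this, h6]
      simp only [h4, if_false, mul_zero, tsum_zero]
      rw [eq_comm]
      by_cases h6 : (c ∩ (A ∩ B)).encard = 1
      · simp only [h6, if_true, one_mul]
        rw [if_neg fun h7 => h5 ⟨h6, h7⟩]
      · simp [h6]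

variable {Y : Type*} [MeasurableSpace Y] {η : Ω → Y}

/-- The point measure, on `A`, of the pairs of a point and the remaining configuration, with a
further random element. -/
def palmMeas (Φ : Ω → Set E) (η : Ω → Y) (A : Set E) (ω : Ω) : Measure (E × (Config E × Y)) :=
  Measure.sum fun x : Φ ω => A.indicator (1 : E → ℝ≥0∞) x.1 •
    Measure.dirac (x.1, ((⟨Φ ω \ {x.1}⟩ : Config E), η ω))

lemma lintegral_palmMeas (Φ : Ω → Set E) (η : Ω → Y) (A : Set E) (ω : Ω)
    {F : E × (Config E × Y) → ℝ≥0∞} (hF : Measurable F) :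
    ∫⁻ z, F z ∂(palmMeas Φ η A ω) =
      ∑' x : Φ ω, A.indicator 1 x.1 * F (x.1, ((⟨Φ ω \ {x.1}⟩ : Config E), η ω)) := by
  rw [palmMeas, lintegral_sum_measure]
  refine tsum_congr fun x => ?_
  rw [lintegral_smul_measure, lintegral_dirac' _ hF, smul_eq_mul]

lemma palmMeas_univ (Φ : Ω → Set E) (η : Ω → Y) (A : Set E) (ω : Ω) :
    palmMeas Φ η A ω univ = (Φ ω ∩ A).encard := by
  rw [← lintegral_one, lintegral_palmMeas _ _ _ _ measurable_const, ← tsum_indicator_eq_encard]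
  simp

open Classical in
lemma palmMeas_rect (Φ : Ω → Set E) (η : Ω → Y) (A : Set E) (ω : Ω) {A' B : Set E} {D : Set Y}
    (hA' : MeasurableSet A') (hB : MeasurableSet B) (hD : MeasurableSet D) :
    palmMeas Φ η A ω (A' ×ˢ (voidSet B ×ˢ D)) =
      ((Φ ω ∩ ((A ∩ A') \ B)).encard * (if (Φ ω ∩ B).encard = 0 then 1 else 0) +
      (if (Φ ω ∩ ((A ∩ A') ∩ B)).encard = 1 then 1 else 0) *
        (if (Φ ω ∩ (B \ (A ∩ A'))).encard = 0 then 1 else 0)) * D.indicator 1 (η ω) := by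
  have hm : MeasurableSet (A' ×ˢ (voidSet B ×ˢ D)) := hA'.prod ((measurableSet_voidSet hB).prod hD)
  rw [← tsum_palm_void, ← lintegral_indicator_one hm,
    lintegral_palmMeas _ _ _ _ (measurable_one.indicator hm), ← ENNReal.tsum_mul_right]
  refine tsum_congr fun x => ?_
  by_cases h1 : x.1 ∈ A <;> by_cases h2 : x.1 ∈ A' <;> by_cases h3 : (Φ ω \ {x.1}) ∩ B = ∅ <;>
    by_cases h4 : η ω ∈ D <;> simp [voidSet, h1, h2, h3, h4]

/-- The π-system of rectangles built on void events. -/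
def palmRect (E Y : Type*) [MeasurableSpace E] [MeasurableSpace Y] :
    Set (Set (E × (Config E × Y))) :=
  image2 (· ×ˢ ·) {s : Set E | MeasurableSet s}
    (image2 (· ×ˢ ·) {s : Set (Config E) | ∃ B : Set E, MeasurableSet B ∧ voidSet B = s}
      {s : Set Y | MeasurableSet s})

lemma isPiSystem_palmRect : IsPiSystem (palmRect E Y) :=
  MeasurableSpace.isPiSystem_measurableSet.prod
    (isPiSystem_voidSet.prod MeasurableSpace.isPiSystem_measurableSet)

/-- A product σ-algebra is generated by rectangles when the generators of the factors are countably
spanning; for void events the single set `voidSet ∅` suffices. -/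
lemma generateFrom_palmRect :
    (inferInstance : MeasurableSpace (E × (Config E × Y))) =
      MeasurableSpace.generateFrom (palmRect E Y) := by
  have hE : IsCountablySpanning {s : Set E | MeasurableSet s} := isCountablySpanning_measurableSet
  have hY : IsCountablySpanning {s : Set Y | MeasurableSet s} := isCountablySpanning_measurableSet
  have hC : IsCountablySpanning {s : Set (Config E) | ∃ B : Set E, MeasurableSet B ∧ voidSet B = s} :=
    ⟨fun _ => voidSet ∅, fun _ => ⟨∅, MeasurableSet.empty, rfl⟩, by
      rw [iUnion_const]; ext c; simp [voidSet]⟩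
  exact (generateFrom_eq_prod MeasurableSpace.generateFrom_measurableSet
    (generateFrom_eq_prod rfl MeasurableSpace.generateFrom_measurableSet hC hY) hE (hC.prod hY)).symm

lemma Exhausts.isFiniteMeasure_palmMeas (hA : Exhausts A Φ μ) (n : ℕ) (ω : Ω) :
    IsFiniteMeasure (palmMeas Φ η (A n) ω) :=
  ⟨by
    rw [palmMeas_univ, lt_top_iff_ne_top, ne_eq, ENat.toENNReal_eq_top, encard_eq_top_iff]
    exact not_infinite.2 (hA.finite ω n)⟩

/-- Measurability of a measure-valued map can be tested on a π-system, and on rectangles the value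
is a formula in counts. The σ-algebra used is the one generated by counts and η, not the ambient
one, so that the resulting events keep track of the tier they depend on. -/
lemma Exhausts.measurable_palmMeas (hA : Exhausts A Φ μ) (n : ℕ) :
    Measurable[countAlgebra Φ ⊔ MeasurableSpace.comap η inferInstance] (palmMeas Φ η (A n)) := by
  classical
  have := hA.isFiniteMeasure_palmMeas (η := η) n
  let m := countAlgebra Φ ⊔ MeasurableSpace.comap η inferInstance
  have hc : ∀ {B : Set E}, MeasurableSet B → Measurable[m] fun ω => (Φ ω ∩ B).encard := fun hB =>
    (measurable_countAlgebra_encard Φ hB).mono le_sup_left le_rfl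
  have hη : Measurable[m] η := (comap_measurable η).mono le_sup_right le_rfl
  refine @Measurable.measure_of_isPiSystem _ _ m _ _ this _ generateFrom_palmRect
    isPiSystem_palmRect ?_ ?_
  · rintro _ ⟨A', hA', _, ⟨_, ⟨B, hB, rfl⟩, D, hD, rfl⟩, rfl⟩
    simp_rw [palmMeas_rect Φ η (A n) _ hA' hB hD]
    have hAA := (hA.measurable n).inter hA'
    have e : ∀ (k : ℕ∞) {B : Set E}, MeasurableSet B →
        Measurable[m] fun ω => if (Φ ω ∩ B).encard = k then (1 : ℝ≥0∞) else 0 := fun k B hB =>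
      (measurable_of_countable fun k' : ℕ∞ => if k' = k then (1 : ℝ≥0∞) else 0).comp (hc hB)
    have e1 : Measurable[m] fun ω => ((Φ ω ∩ ((A n ∩ A') \ B)).encard : ℝ≥0∞) :=
      (measurable_of_countable (fun k : ℕ∞ => (k : ℝ≥0∞))).comp (hc (hAA.diff hB))
    have e2 : Measurable[m] fun ω => D.indicator (1 : Y → ℝ≥0∞) (η ω) :=
      (measurable_one.indicator hD).comp hη
    exact ((e1.mul (e 0 hB)).add ((e 1 (hAA.inter hB)).mul (e 0 (hB.diff hAA)))).mul e2
  · simp_rw [palmMeas_univ]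
    exact (measurable_of_countable (fun k : ℕ∞ => (k : ℝ≥0∞))).comp (hc (hA.measurable n))

/-- Write A₁ for `A n ∩ A'`. The two terms of `tsum_palm_void` have means μ(A₁ \ B) exp(-μ B) and
μ(A₁ ∩ B) exp(-μ(A₁ ∩ B)) exp(-μ(B \ A₁)). The exponentials of the second recombine to exp(-μ B),
and the sum is μ(A₁) exp(-μ B); the independent element η contributes its own factor. -/
lemma IsPoissonProcess.lintegral_palmMeas_rect (h : IsPoissonProcess Φ μ P) (hA : Exhausts A Φ μ)
    (hη : Measurable η) (hind : Indep (countAlgebra Φ) (MeasurableSpace.comap η inferInstance) P)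
    (n : ℕ) {A' B : Set E} {D : Set Y}
    (hA' : MeasurableSet A') (hB : MeasurableSet B) (hD : MeasurableSet D) :
    ∫⁻ ω, palmMeas Φ η (A n) ω (A' ×ˢ (voidSet B ×ˢ D)) ∂P =
      μ (A n ∩ A') * (expNeg (μ B) * P (η ⁻¹' D)) := by
  classical
  simp_rw [palmMeas_rect Φ η (A n) _ hA' hB hD]
  set A₁ := A n ∩ A' with hA₁
  have hm1 : MeasurableSet A₁ := (hA.measurable n).inter hA'
  have hf1 : ∀ C, μ (A₁ ∩ C) ≠ ⊤ := fun C =>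
    ne_top_of_le_ne_top (hA.ne_top n) (measure_mono (inter_subset_left.trans inter_subset_left))
  have e : ∀ (k : ℕ∞) {B : Set E}, MeasurableSet B →
      Measurable[countAlgebra Φ] fun ω => if (Φ ω ∩ B).encard = k then (1 : ℝ≥0∞) else 0 :=
    fun k B hB => (measurable_of_countable fun k' : ℕ∞ => if k' = k then (1 : ℝ≥0∞) else 0).comp
      (measurable_countAlgebra_encard Φ hB)
  have e1 : Measurable[countAlgebra Φ] fun ω => ((Φ ω ∩ (A₁ \ B)).encard : ℝ≥0∞) :=
    (measurable_of_countable (fun k : ℕ∞ => (k : ℝ≥0∞))).comp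
      (measurable_countAlgebra_encard Φ (hm1.diff hB))
  have e2 : Measurable[MeasurableSpace.comap η inferInstance]
      fun ω => D.indicator (1 : Y → ℝ≥0∞) (η ω) :=
    (measurable_one.indicator hD).comp (comap_measurable η)
  have i1 : ∀ (k : ℕ∞) {B : Set E}, MeasurableSet B →
      ∫⁻ ω, (if (Φ ω ∩ B).encard = k then (1 : ℝ≥0∞) else 0) ∂P = P {ω | (Φ ω ∩ B).encard = k} := by
    intro k B hB
    have : MeasurableSet {ω | (Φ ω ∩ B).encard = k} :=
      h.measurable_count B hB (measurableSet_singleton k)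
    rw [← lintegral_indicator_one this]
    refine lintegral_congr fun ω => ?_
    by_cases hk : (Φ ω ∩ B).encard = k <;> simp [hk]
  have i2 : ∫⁻ ω, D.indicator (1 : Y → ℝ≥0∞) (η ω) ∂P = P (η ⁻¹' D) := by
    rw [← lintegral_indicator_one (hη hD)]
    rfl
  have hv : ∀ {B : Set E}, MeasurableSet B → P {ω | (Φ ω ∩ B).encard = 0} = expNeg (μ B) := by
    intro B hB
    simp_rw [encard_eq_zero]
    exact h.measure_void hA hB
  have ne : Measurable fun k : ℕ∞ => (k : ℝ≥0∞) := measurable_of_countable _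
  have nk : ∀ j : ℕ∞, Measurable fun k : ℕ∞ => if k = j then (1 : ℝ≥0∞) else 0 :=
    fun j => measurable_of_countable _
  have t1 : Measurable[countAlgebra Φ] fun ω => ((Φ ω ∩ (A₁ \ B)).encard : ℝ≥0∞) *
      (if (Φ ω ∩ B).encard = 0 then 1 else 0) := e1.mul (e 0 hB)
  have t2 : Measurable[countAlgebra Φ] fun ω =>
      ((Φ ω ∩ ((A₁ \ B))).encard : ℝ≥0∞) * (if (Φ ω ∩ B).encard = 0 then 1 else 0) +
      (if (Φ ω ∩ (A₁ ∩ B)).encard = 1 then 1 else 0) *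
      (if (Φ ω ∩ (B \ A₁)).encard = 0 then 1 else 0) :=
    t1.add ((e 1 (hm1.inter hB)).mul (e 0 (hB.diff hm1)))
  rw [lintegral_mul_eq_lintegral_mul_lintegral_of_independent_measurableSpace h.countAlgebra_le
    hη.comap_le hind t2 e2, i2, lintegral_add_left (t1.mono h.countAlgebra_le le_rfl)]
  have j1 : ∫⁻ ω, ((Φ ω ∩ (A₁ \ B)).encard : ℝ≥0∞) * (if (Φ ω ∩ B).encard = 0 then 1 else 0) ∂P =
      μ (A₁ \ B) * expNeg (μ B) := by
    have := lintegral_mul_eq_lintegral_mul_lintegral_of_indepFun''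
      (ne.comp (h.measurable_count _ (hm1.diff hB))).aemeasurable
      ((nk 0).comp (h.measurable_count _ hB)).aemeasurable
      ((h.indep_pair (hm1.diff hB) hB disjoint_sdiff_left).comp ne (nk 0))
    simp only [Function.comp_def] at this
    rw [this, i1 0 hB, hv hB, h.lintegral_encard (hm1.diff hB) (by
      rw [sdiff_eq]; exact hf1 _)]
  have j2 : ∫⁻ ω, (if (Φ ω ∩ (A₁ ∩ B)).encard = 1 then (1 : ℝ≥0∞) else 0) *
      (if (Φ ω ∩ (B \ A₁)).encard = 0 then 1 else 0) ∂P = μ (A₁ ∩ B) * expNeg (μ B) := by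
    have := lintegral_mul_eq_lintegral_mul_lintegral_of_indepFun''
      ((nk 1).comp (h.measurable_count _ (hm1.inter hB))).aemeasurable
      ((nk 0).comp (h.measurable_count _ (hB.diff hm1))).aemeasurable
      ((h.indep_pair (hm1.inter hB) (hB.diff hm1)
        (disjoint_sdiff_right.mono_left inter_subset_left)).comp (nk 1) (nk 0))
    simp only [Function.comp_def] at this
    rw [this, i1 0 (hB.diff hm1), i1 1 (hm1.inter hB), hv (hB.diff hm1),
      h.measure_one (hm1.inter hB) (hf1 _), mul_assoc, ← expNeg_add, inter_comm,
      measure_inter_add_sdiff _ hm1]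
  rw [j1, j2, ← add_mul, measure_sdiff_add_inter _ hB, mul_assoc]

/-- The Mecke formula as an equality of measures, localized to `A n` so that both sides are finite.
Finite measures agreeing on the π-system of rectangles and on the whole space coincide, so void
probabilities suffice. -/
theorem IsPoissonProcess.bind_palmMeas (h : IsPoissonProcess Φ μ P) (hA : Exhausts A Φ μ)
    (hη : Measurable η) (hind : Indep (countAlgebra Φ) (MeasurableSpace.comap η inferInstance) P)
    (n : ℕ) :
    P.bind (palmMeas Φ η (A n)) =
      (μ.restrict (A n)).prod (P.map fun ω => ((⟨Φ ω⟩ : Config E), η ω)) := by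
  have hmη : Measurable fun ω => ((⟨Φ ω⟩ : Config E), η ω) :=
    ((measurable_config Φ).mono h.countAlgebra_le le_rfl).prodMk hη
  have hpm : Measurable (palmMeas Φ η (A n)) :=
    (hA.measurable_palmMeas n).mono (sup_le h.countAlgebra_le hη.comap_le) le_rfl
  have hfin : IsFiniteMeasure (μ.restrict (A n)) :=
    ⟨by simpa using (hA.ne_top n).lt_top⟩
  have : IsProbabilityMeasure (P.map fun ω => ((⟨Φ ω⟩ : Config E), η ω)) :=
    Measure.isProbabilityMeasure_map hmη.aemeasurable
  have hrect : ∀ s ∈ palmRect E Y, P.bind (palmMeas Φ η (A n)) s =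
      (μ.restrict (A n)).prod (P.map fun ω => ((⟨Φ ω⟩ : Config E), η ω)) s := by
    rintro _ ⟨A', hA', _, ⟨_, ⟨B, hB, rfl⟩, D, hD, rfl⟩, rfl⟩
    have hBD := (measurableSet_voidSet hB).prod hD
    have hi := (Indep_iff _ _ _).1 hind ((fun ω => (⟨Φ ω⟩ : Config E)) ⁻¹' voidSet B) (η ⁻¹' D)
      (measurable_config Φ (measurableSet_voidSet hB)) ⟨D, hD, rfl⟩
    rw [Measure.bind_apply (hA'.prod hBD) hpm.aemeasurable,
      h.lintegral_palmMeas_rect hA hη hind n hA' hB hD, Measure.prod_prod,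
      Measure.restrict_apply hA', Measure.map_apply hmη hBD, inter_comm, ← h.measure_void hA hB]
    congr 1
    exact hi.symm
  have huniv : P.bind (palmMeas Φ η (A n)) univ =
      (μ.restrict (A n)).prod (P.map fun ω => ((⟨Φ ω⟩ : Config E), η ω)) univ := by
    have h0 : (voidSet ∅ : Set (Config E)) = univ := by ext c; simp [voidSet]
    refine hrect _ ⟨univ, MeasurableSet.univ, _, ⟨_, ⟨∅, MeasurableSet.empty, rfl⟩, univ,
      MeasurableSet.univ, rfl⟩, ?_⟩
    simp [h0]
  have : IsFiniteMeasure (P.bind (palmMeas Φ η (A n))) := ⟨by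
    rw [huniv]; exact measure_lt_top _ _⟩
  exact ext_of_generate_finite _ generateFrom_palmRect isPiSystem_palmRect hrect huniv

/-- Monotone convergence along the exhausting sets removes the localization. -/
lemma Exhausts.tsum_eq_iSup (hA : Exhausts A Φ μ) (ω : Ω) {F : E × (Config E × Y) → ℝ≥0∞}
    (hF : Measurable F) :
    ∑' x : Φ ω, F (x.1, ((⟨Φ ω \ {x.1}⟩ : Config E), η ω)) =
      ⨆ n, ∫⁻ z, F z ∂(palmMeas Φ η (A n) ω) := by
  have h1 : ∑' x : Φ ω, F (x.1, ((⟨Φ ω \ {x.1}⟩ : Config E), η ω)) =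
      ∫⁻ z, F z ∂(palmMeas Φ η univ ω) := by
    rw [lintegral_palmMeas _ _ _ _ hF]; simp
  have hFn : ∀ n, Measurable fun z : E × (Config E × Y) => (A n).indicator 1 z.1 * F z := fun n =>
    ((measurable_one.indicator (hA.measurable n)).comp measurable_fst).mul hF
  have h2 : ∀ n, ∫⁻ z, F z ∂(palmMeas Φ η (A n) ω) =
      ∫⁻ z, (A n).indicator 1 z.1 * F z ∂(palmMeas Φ η univ ω) := by
    intro n
    rw [lintegral_palmMeas _ _ _ _ hF, lintegral_palmMeas _ _ _ _ (hFn n)]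
    simp
  simp_rw [h1, h2]
  rw [← lintegral_iSup hFn]
  · refine lintegral_congr fun z => ?_
    rw [← ENNReal.iSup_mul]
    obtain ⟨n, hn⟩ := mem_iUnion.1 (hA.union ▸ mem_univ z.1 : z.1 ∈ ⋃ n, A n)
    have : ⨆ n, (A n).indicator (1 : E → ℝ≥0∞) z.1 = 1 := by
      refine le_antisymm (iSup_le fun k => indicator_le_self' (by simp) _) ?_
      exact le_iSup_of_le n (by simp [hn])
    rw [this, one_mul]
  · intro m n hmn z
    exact mul_le_mul_left (indicator_le_indicator_of_subset (hA.mono hmn) (by simp) _) _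

lemma Exhausts.measurable_tsum (hA : Exhausts A Φ μ) {F : E × (Config E × Y) → ℝ≥0∞}
    (hF : Measurable F) :
    Measurable[countAlgebra Φ ⊔ MeasurableSpace.comap η inferInstance]
      fun ω => ∑' x : Φ ω, F (x.1, ((⟨Φ ω \ {x.1}⟩ : Config E), η ω)) := by
  simp_rw [hA.tsum_eq_iSup _ hF]
  let m := countAlgebra Φ ⊔ MeasurableSpace.comap η inferInstance
  have hn : ∀ n, Measurable[m] fun ω => ∫⁻ z, F z ∂(palmMeas Φ η (A n) ω) :=
    fun n => (Measure.measurable_lintegral hF).comp (hA.measurable_palmMeas n)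
  exact Measurable.iSup hn

/-- The Mecke formula for a Poisson process and a further independent random element. -/
theorem IsPoissonProcess.mecke [SFinite μ] (h : IsPoissonProcess Φ μ P) (hA : Exhausts A Φ μ)
    (hη : Measurable η) (hind : Indep (countAlgebra Φ) (MeasurableSpace.comap η inferInstance) P)
    {F : E × (Config E × Y) → ℝ≥0∞} (hF : Measurable F) :
    ∫⁻ ω, ∑' x : Φ ω, F (x.1, ((⟨Φ ω \ {x.1}⟩ : Config E), η ω)) ∂P =
      ∫⁻ x, ∫⁻ ω, F (x, ((⟨Φ ω⟩ : Config E), η ω)) ∂P ∂μ := by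
  have hmη : Measurable fun ω => ((⟨Φ ω⟩ : Config E), η ω) :=
    ((measurable_config Φ).mono h.countAlgebra_le le_rfl).prodMk hη
  have hpm : ∀ n, Measurable (palmMeas Φ η (A n)) := fun n =>
    (hA.measurable_palmMeas n).mono (sup_le h.countAlgebra_le hη.comap_le) le_rfl
  have : IsProbabilityMeasure (P.map fun ω => ((⟨Φ ω⟩ : Config E), η ω)) :=
    Measure.isProbabilityMeasure_map hmη.aemeasurable
  simp_rw [hA.tsum_eq_iSup _ hF]
  have hFn : ∀ n, Measurable fun ω => ∫⁻ z, F z ∂(palmMeas Φ η (A n) ω) := fun n =>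
    (Measure.measurable_lintegral hF).comp (hpm n)
  rw [lintegral_iSup hFn]
  · have h1 : ∀ n, ∫⁻ ω, ∫⁻ z, F z ∂(palmMeas Φ η (A n) ω) ∂P =
        ∫⁻ x in A n, ∫⁻ ω, F (x, ((⟨Φ ω⟩ : Config E), η ω)) ∂P ∂μ := by
      intro n
      rw [← Measure.lintegral_bind (hpm n).aemeasurable hF.aemeasurable,
        h.bind_palmMeas hA hη hind n, lintegral_prod _ hF.aemeasurable]
      refine lintegral_congr fun x => ?_
      exact lintegral_map (hF.comp measurable_prodMk_left) hmη
    simp_rw [h1]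
    rw [← setLIntegral_iUnion_of_directed _ (directed_of_isDirected_le hA.mono), hA.union,
      Measure.restrict_univ]
  · intro m n hmn ω
    simp only [lintegral_palmMeas _ _ _ _ hF]
    exact ENNReal.tsum_le_tsum fun x => mul_le_mul_left
      (indicator_le_indicator_of_subset (hA.mono hmn) (by simp) _) _

end Poisson

end HetNetASE

/-! ### The Laplace functional of a Poisson process -/

namespace HetNetASE

open Set
open scoped ENNReal

section Laplace

variable {Ω E : Type*} {mΩ : MeasurableSpace Ω} [MeasurableSpace E] {Φ : Ω → Set E} {μ : Measure E}
  {P : Measure Ω} [IsProbabilityMeasure P] {A : ℕ → Set E}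

lemma IsPoissonProcess.lintegral_expNeg_finset (h : IsPoissonProcess Φ μ P) {ι : Type*}
    (s : Finset ι) (B : ι → Set E) (a : ι → ℝ≥0∞) (hB : ∀ j, MeasurableSet (B j))
    (hμ : ∀ j, μ (B j) ≠ ⊤) (hd : Pairwise fun i j => Disjoint (B i) (B j)) (ha : ∀ j ∈ s, a j ≠ ⊤) :
    ∫⁻ ω, expNeg (∑ j ∈ s, a j * ((Φ ω ∩ B j).encard : ℝ≥0∞)) ∂P =
      expNeg (∑ j ∈ s, μ (B j) * (1 - expNeg (a j))) := by
  -- `count_indep` is stated for families indexed by `Fin k`, hence the enumeration of the finset.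
  let e := s.equivFin
  have hcast : Measurable fun k : ℕ∞ => (k : ℝ≥0∞) := measurable_of_countable _
  have hind := h.count_indep s.card (fun k => B (e.symm k).1) (fun k => hB _) fun i j hij =>
    hd fun hne => hij (e.symm.injective (Subtype.ext hne))
  have hmg : ∀ k : Fin s.card, Measurable fun n : ℕ∞ => expNeg (a (e.symm k).1 * (n : ℝ≥0∞)) :=
    fun k => measurable_of_countable _
  have hind2 := hind.comp (fun k n => expNeg (a (e.symm k).1 * (n : ℝ≥0∞))) hmg
  have hmX : ∀ k : Fin s.card, Measurable ((fun n : ℕ∞ => expNeg (a (e.symm k).1 * (n : ℝ≥0∞))) ∘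
      fun ω => (Φ ω ∩ B (e.symm k).1).encard) := fun k =>
    (hmg k).comp (h.measurable_count _ (hB _))
  have hs : ∀ g : ι → ℝ≥0∞, ∑ j ∈ s, g j = ∑ k : Fin s.card, g (e.symm k).1 := by
    intro g
    rw [← Finset.sum_coe_sort, ← e.symm.sum_comp]
  have key := lintegral_prod_eq_prod_lintegral_of_indepFun Finset.univ _ hind2 hmX
  simp_rw [hs, expNeg_sum]
  refine Eq.trans ?_ (key.trans ?_)
  · rfl
  · refine Finset.prod_congr rfl fun k _ => ?_
    have h1 := h.lintegral_count (hB (e.symm k).1) (hμ _)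
      (fun n => expNeg (a (e.symm k).1 * (n : ℝ≥0∞)))
    refine h1.trans ?_
    simp only [ENat.toENNReal_coe]
    rw [lintegral_expNeg_poissonMeasure _ (ha _ (e.symm k).2), ENNReal.coe_toNNReal (hμ _)]

lemma lintegral_indicator_simpleFunc (ν : Measure E) {A : Set E} (hA : MeasurableSet A)
    (g : SimpleFunc E ℝ≥0∞) {φ : ℝ≥0∞ → ℝ≥0∞} (h0 : φ 0 = 0) :
    ∫⁻ x, φ (A.indicator g x) ∂ν = ∑ v ∈ g.range, φ v * ν (A ∩ g ⁻¹' {v}) := by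
  have h1 : ∀ x, φ (A.indicator g x) = A.indicator (g.map φ) x := by
    intro x
    by_cases hx : x ∈ A <;> simp [hx, h0]
  simp_rw [h1]
  rw [lintegral_indicator hA, SimpleFunc.lintegral_eq_lintegral, SimpleFunc.map_lintegral]
  refine Finset.sum_congr rfl fun v _ => ?_
  rw [Measure.restrict_apply (g.measurableSet_fiber v), inter_comm]

/-- The level sets of a simple function inside A are disjoint and of finite measure, so the sum over
points is a finite combination of independent Poisson counts. -/
lemma IsPoissonProcess.lintegral_expNeg_simpleFunc (h : IsPoissonProcess Φ μ P) {A : Set E}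
    (hA : MeasurableSet A) (hμ : μ A ≠ ⊤) (g : SimpleFunc E ℝ≥0∞) (hg : ∀ x, g x ≠ ⊤) :
    ∫⁻ ω, expNeg (∑' x : Φ ω, A.indicator g x.1) ∂P =
      expNeg (∫⁻ x, (1 - expNeg (A.indicator g x)) ∂μ) := by
  have h1 : ∀ ω, ∑' x : Φ ω, A.indicator g x.1 =
      ∑ v ∈ g.range, v * ((Φ ω ∩ (A ∩ g ⁻¹' {v})).encard : ℝ≥0∞) := by
    intro ω
    rw [← lintegral_countMeas _ (g.measurable.indicator hA)]
    rw [lintegral_indicator_simpleFunc _ hA g (φ := fun v => v) rfl]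
    refine Finset.sum_congr rfl fun v _ => ?_
    rw [countMeas_apply _ (hA.inter (g.measurableSet_fiber v))]
  simp_rw [h1]
  rw [h.lintegral_expNeg_finset g.range (fun v => A ∩ g ⁻¹' {v}) (fun v => v)
    (fun v => hA.inter (g.measurableSet_fiber v))
    (fun v => ne_top_of_le_ne_top hμ (measure_mono inter_subset_left))
    (fun u v huv => ((disjoint_singleton.2 huv).preimage g).mono inter_subset_right
      inter_subset_right)
    (fun v hv => by obtain ⟨x, rfl⟩ := SimpleFunc.mem_range.1 hv; exact hg x),
    lintegral_indicator_simpleFunc μ hA g (φ := fun v => 1 - expNeg v) (by simp)]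
  simp_rw [mul_comm]

variable [MeasurableSpace.CountablyGenerated E] [MeasurableSpace.SeparatesPoints E]

/-- The Laplace functional of a Poisson process. -/
theorem IsPoissonProcess.laplace (h : IsPoissonProcess Φ μ P) (hA : Exhausts A Φ μ)
    {f : E → ℝ≥0∞} (hf : Measurable f) :
    ∫⁻ ω, expNeg (∑' x : Φ ω, f x.1) ∂P = expNeg (∫⁻ x, (1 - expNeg (f x)) ∂μ) := by
  -- Truncation in space, by `A n`, and in height, by finite-valued simple functions. The limit may
  -- take the value ∞, which is how void events will be encoded.
  set g : ℕ → E → ℝ≥0∞ := fun n => (A n).indicator (SimpleFunc.eapprox f n) with hg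
  have hgm : ∀ n, Measurable (g n) := fun n =>
    (SimpleFunc.measurable _).indicator (hA.measurable n)
  have hmono : ∀ x, Monotone fun n => g n x := by
    intro x m n hmn
    refine (indicator_le_indicator_of_subset (hA.mono hmn) (fun _ => zero_le) x).trans ?_
    exact indicator_le_indicator (SimpleFunc.monotone_eapprox f hmn x)
  have hsup : ∀ x, ⨆ n, g n x = f x := by
    intro x
    rw [← SimpleFunc.iSup_eapprox_apply hf x]
    refine le_antisymm (iSup_mono fun n => indicator_le_self' (fun _ _ => zero_le) x) ?_
    obtain ⟨m, hm⟩ := mem_iUnion.1 (hA.union ▸ mem_univ x : x ∈ ⋃ n, A n)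
    refine iSup_le fun n => ?_
    refine le_trans ?_ (le_iSup _ (max m n))
    rw [hg]
    simp only
    rw [indicator_of_mem (hA.mono (le_max_left m n) hm)]
    exact SimpleFunc.monotone_eapprox f (le_max_right m n) x
  have hlim : ∀ x, Tendsto (fun n => g n x) atTop (𝓝 (f x)) := fun x => by
    rw [← hsup x]; exact tendsto_atTop_iSup (hmono x)
  have hsumlim : ∀ ω, Tendsto (fun n => ∑' x : Φ ω, g n x.1) atTop (𝓝 (∑' x : Φ ω, f x.1)) := by
    intro ω
    simp_rw [← lintegral_countMeas _ (hgm _), ← lintegral_countMeas _ hf]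
    exact lintegral_tendsto_of_tendsto_of_monotone (fun n => (hgm n).aemeasurable)
      (ae_of_all _ hmono) (ae_of_all _ hlim)
  have hL : Tendsto (fun n => ∫⁻ ω, expNeg (∑' x : Φ ω, g n x.1) ∂P) atTop
      (𝓝 (∫⁻ ω, expNeg (∑' x : Φ ω, f x.1) ∂P)) := by
    refine tendsto_lintegral_of_dominated_convergence (fun _ => 1) (fun n => ?_)
      (fun n => ae_of_all _ fun ω => expNeg_le_one _) (by simp)
      (ae_of_all _ fun ω => (continuous_expNeg.tendsto _).comp (hsumlim ω))
    exact measurable_expNeg.comp ((measurable_tsum_config (hgm n)).comp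
      ((measurable_config Φ).mono h.countAlgebra_le le_rfl))
  have hR : Tendsto (fun n => expNeg (∫⁻ x, (1 - expNeg (g n x)) ∂μ)) atTop
      (𝓝 (expNeg (∫⁻ x, (1 - expNeg (f x)) ∂μ))) := by
    refine (continuous_expNeg.tendsto _).comp ?_
    refine lintegral_tendsto_of_tendsto_of_monotone
      (fun n => (measurable_const.sub (measurable_expNeg.comp (hgm n))).aemeasurable)
      (ae_of_all _ fun x m n hmn => tsub_le_tsub_left (expNeg_antitone (hmono x hmn)) 1)
      (ae_of_all _ fun x => ?_)
    exact ENNReal.Tendsto.sub tendsto_const_nhds ((continuous_expNeg.tendsto _).comp (hlim x))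
      (Or.inl (by simp))
  have heq : ∀ n, ∫⁻ ω, expNeg (∑' x : Φ ω, g n x.1) ∂P =
      expNeg (∫⁻ x, (1 - expNeg (g n x)) ∂μ) := fun n =>
    h.lintegral_expNeg_simpleFunc (hA.measurable n) (hA.ne_top n) _
      fun x => (SimpleFunc.eapprox_lt_top f n x).ne
  simp_rw [heq] at hL
  exact tendsto_nhds_unique hL hR

end Laplace

end HetNetASE

/-! ### Ranking of base stations by scores, and the serving event -/

namespace HetNetASE

open Set
open scoped ENNReal

instance : MeasurableSpace.CountablyGenerated (Set ℕ) :=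
  inferInstanceAs (MeasurableSpace.CountablyGenerated (ℕ → Prop))

lemma BS.measurable_dist : Measurable BS.dist := by unfold BS.dist; fun_prop
lemma BS.measurable_cache : Measurable BS.cache := by unfold BS.cache; fun_prop
lemma BS.measurable_fade : Measurable BS.fade := by unfold BS.fade; fun_prop
lemma BS.measurable_angle : Measurable BS.angle := by unfold BS.angle; fun_prop

/-- The score of a base station in the ranking by `s` of those whose cache satisfies `K`. -/
def score (K : Set ℕ → Prop) (s : ℝ → ℝ≥0∞) : BS → ℝ≥0∞ :=
  {x : BS | K x.cache}.indicator fun x => s x.dist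

/-- The largest score in a configuration. -/
def topScore (K : Set ℕ → Prop) (s : ℝ → ℝ≥0∞) (c : Set BS) : ℝ≥0∞ := ⨆ x ∈ c, score K s x

lemma measurable_score {K : Set ℕ → Prop} {s : ℝ → ℝ≥0∞} (hK : MeasurableSet {c | K c})
    (hs : Measurable s) : Measurable (score K s) :=
  (hs.comp BS.measurable_dist).indicator (BS.measurable_cache hK)

/-- A supremum of values below a could equal a. It does not: for 0 < b < a the decay of s and local
finiteness leave finitely many stations of score at least b, so the supremum is at most the maximum
of b and finitely many values. -/
lemma topScore_lt_iff {K : Set ℕ → Prop} {s : ℝ → ℝ≥0∞} {c : Set BS}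
    (hfin : ∀ R : ℝ, {x ∈ c | x.dist ≤ R}.Finite)
    (hdec : ∀ b : ℝ≥0∞, 0 < b → ∃ R : ℝ, ∀ r, b ≤ s r → r ≤ R) {a : ℝ≥0∞} (ha : 0 < a) :
    topScore K s c < a ↔ ∀ x ∈ c, K x.cache → s x.dist < a := by
  constructor
  · intro h x hx hK
    refine lt_of_le_of_lt ?_ h
    have : score K s x = s x.dist := indicator_of_mem (s := {x : BS | K x.cache}) hK _
    rw [← this]
    exact le_iSup₂ (f := fun x (_ : x ∈ c) => score K s x) x hx
  · intro h
    obtain ⟨b, hb0, hba⟩ := exists_between ha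
    obtain ⟨R, hR⟩ := hdec b hb0
    have hF := hfin R
    have hle : topScore K s c ≤ max b (hF.toFinset.sup (score K s)) := by
      refine iSup₂_le fun x hx => ?_
      by_cases hxb : b ≤ score K s x
      · refine le_max_of_le_right (Finset.le_sup (f := score K s) ?_)
        rw [Finite.mem_toFinset]
        refine ⟨hx, ?_⟩
        by_cases hK : K x.cache
        · have : score K s x = s x.dist := indicator_of_mem (s := {x : BS | K x.cache}) hK _
          exact hR _ (this ▸ hxb)
        · have : score K s x = 0 := indicator_of_notMem (s := {x : BS | K x.cache}) hK _
          rw [this] at hxb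
          exact absurd hxb (not_le.2 hb0)
      · exact le_max_of_le_left (not_le.1 hxb).le
    refine hle.trans_lt (max_lt hba ?_)
    rw [Finset.sup_lt_iff (bot_lt_iff_ne_bot.2 ha.ne')]
    intro x hx
    rw [Finite.mem_toFinset] at hx
    by_cases hK : K x.cache
    · have : score K s x = s x.dist := indicator_of_mem (s := {x : BS | K x.cache}) hK _
      rw [this]; exact h x hx.1 hK
    · have : score K s x = 0 := indicator_of_notMem (s := {x : BS | K x.cache}) hK _
      rw [this]; exact ha

namespace HetNet

variable (N : HetNet)

instance (i : Fin 2) : IsProbabilityMeasure (N.place i) := N.place_prob i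

lemma fadeParam_pos (i : Fin 2) : 0 < N.fadeParam i := by
  unfold fadeParam
  split_ifs
  · exact one_pos
  · exact N.nak_pos

instance (i : Fin 2) : IsProbabilityMeasure (N.fadeLaw i) :=
  isProbabilityMeasure_gammaMeasure (by exact_mod_cast N.fadeParam_pos i)
    (by exact_mod_cast N.fadeParam_pos i)

instance : IsProbabilityMeasure N.angleLaw := by
  refine ProbabilityTheory.cond_isProbabilityMeasure_of_finite ?_ ?_
  · have : 0 < N.spacing / N.wavelen := div_pos N.spacing_pos N.wavelen_pos
    rw [Real.volume_Icc]
    simp [this]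
  · rw [Real.volume_Icc]; exact ENNReal.ofReal_ne_top

instance (i : Fin 2) : SFinite (N.intensity i) := by unfold intensity; infer_instance

lemma exhausts (i : Fin 2) {Ω : Type*} {Φ : Ω → Set BS}
    (hfin : ∀ ω (R : ℝ), {x ∈ Φ ω | x.dist ≤ R}.Finite) :
    Exhausts (fun n : ℕ => {x : BS | x.dist ≤ n}) Φ (N.intensity i) where
  measurable n := measurableSet_le BS.measurable_dist measurable_const
  mono m n hmn x hx := le_trans (mem_ofPred_eq ▸ hx) (by exact_mod_cast hmn)
  union := by
    ext x
    simp only [mem_iUnion, mem_univ, iff_true]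
    exact exists_nat_ge x.dist
  ne_top n := by
    have : {x : BS | x.dist ≤ n} = Metric.closedBall (0 : EuclideanSpace ℝ (Fin 2)) n ×ˢ univ := by
      ext x; simp [BS.dist]
    rw [this, intensity, Measure.prod_prod]
    simp only [Measure.smul_apply, smul_eq_mul, measure_univ, mul_one]
    exact ENNReal.mul_ne_top ENNReal.ofReal_ne_top (measure_closedBall_lt_top).ne
  finite ω n := hfin ω n

/-- The mean received power per unit of fading power at distance `r`. -/
def linkGain (i : Fin 2) (r : ℝ) : ℝ := N.power i * N.pathLoss i r * N.ant i

/-- The sum of the interfering powers of a configuration. -/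
def totInterf (i : Fin 2) (c : Set BS) : ℝ≥0∞ := ∑' y : c, ENNReal.ofReal (N.interfPower i y)

lemma measurable_unitStep : Measurable unitStep :=
  Measurable.ite measurableSet_Ici measurable_const measurable_const

lemma measurable_pathLoss (i : Fin 2) : Measurable (N.pathLoss i) := by
  have : Measurable fun r => unitStep (N.losR - r) :=
    measurable_unitStep.comp (measurable_const.sub measurable_id)
  unfold pathLoss
  split_ifs <;> fun_prop

lemma measurable_linkGain (i : Fin 2) : Measurable (N.linkGain i) :=
  ((N.measurable_pathLoss i).const_mul _).mul_const _

lemma measurable_gain (i : Fin 2) : Measurable (N.gain i) := by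
  unfold gain
  split_ifs
  · exact measurable_const
  · refine Measurable.ite ?_ measurable_const (by fun_prop)
    exact (measurableSet_singleton 0).preimage (f := fun w => Real.sin (Real.pi * w)) (by fun_prop)

lemma measurable_signal (i : Fin 2) : Measurable (N.signal i) :=
  ((N.measurable_linkGain i).comp BS.measurable_dist).mul BS.measurable_fade

lemma measurable_interfPower (i : Fin 2) : Measurable (N.interfPower i) :=
  (((N.measurable_pathLoss i).comp BS.measurable_dist).const_mul _).mul
    ((BS.measurable_fade.const_mul _).mul ((N.measurable_gain i).comp BS.measurable_angle))

lemma measurable_totInterf (i : Fin 2) : Measurable fun c : Config BS => N.totInterf i c.pts :=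
  measurable_tsum_config (N.measurable_interfPower i).ennreal_ofReal

/-- The user is served by the base station with the highest score (above the level `M`) among those
whose cache satisfies `K`, and this link, with its interference, belongs to `G`. -/
def ServedBy (i : Fin 2) (K : Set ℕ → Prop) (s : ℝ → ℝ≥0∞) (M : ℝ≥0∞) (G : Set (BS × ℝ≥0∞))
    (c : Set BS) (x : BS) : Prop :=
  x ∈ c ∧ K x.cache ∧ (∀ y ∈ c, K y.cache → y ≠ x → s y.dist < s x.dist) ∧ M < s x.dist ∧
    (x, N.totInterf i (c \ {x})) ∈ G

section Tier

variable {N} {Ω : Type*} {mΩ : MeasurableSpace Ω} {P : Measure Ω} [IsProbabilityMeasure P]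
  {Φ : Ω → Set BS} {i : Fin 2} {K : Set ℕ → Prop} {s : ℝ → ℝ≥0∞} {M : Ω → ℝ≥0∞}
  {G : Set (BS × ℝ≥0∞)}

variable (N i K s G) in
/-- The set underlying the functional to which the Mecke formula is applied. -/
def palmSet : Set (BS × (Config BS × ℝ≥0∞)) :=
  {z | K z.1.cache ∧ topScore K s z.2.1.pts < s z.1.dist ∧ z.2.2 < s z.1.dist ∧
    (z.1, N.totInterf i z.2.1.pts) ∈ G}

lemma measurableSet_palmSet (hK : MeasurableSet {c | K c}) (hs : Measurable s)
    (hG : MeasurableSet G) : MeasurableSet (N.palmSet i K s G) := by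
  have h1 : Measurable fun z : BS × (Config BS × ℝ≥0∞) => s z.1.dist :=
    hs.comp (BS.measurable_dist.comp measurable_fst)
  have h2 : Measurable fun z : BS × (Config BS × ℝ≥0∞) => topScore K s z.2.1.pts :=
    (measurable_iSup_config (measurable_score hK hs)).comp (measurable_fst.comp measurable_snd)
  have h3 : Measurable fun z : BS × (Config BS × ℝ≥0∞) => (z.1, N.totInterf i z.2.1.pts) :=
    measurable_fst.prodMk ((N.measurable_totInterf i).comp (measurable_fst.comp measurable_snd))
  exact ((hK.preimage (BS.measurable_cache.comp measurable_fst))).inter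
    ((measurableSet_lt h2 h1).inter ((measurableSet_lt (measurable_snd.comp measurable_snd) h1).inter
      (h3 hG)))

/-- The ranking becomes a condition on x and on the configuration without x, the form required by
the Mecke formula. The positivity of the score of x needed by `topScore_lt_iff` comes from its
exceeding the level. -/
lemma servedBy_iff (hfin : ∀ ω (R : ℝ), {x ∈ Φ ω | x.dist ≤ R}.Finite)
    (hdec : ∀ b : ℝ≥0∞, 0 < b → ∃ R : ℝ, ∀ r, b ≤ s r → r ≤ R) (ω : Ω) (x : BS) :
    N.ServedBy i K s (M ω) G (Φ ω) x ↔
      x ∈ Φ ω ∧ (x, ((⟨Φ ω \ {x}⟩ : Config BS), M ω)) ∈ N.palmSet i K s G := by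
  have hfin' : ∀ R : ℝ, {y ∈ Φ ω \ {x} | y.dist ≤ R}.Finite := fun R =>
    (hfin ω R).subset fun y hy => ⟨hy.1.1, hy.2⟩
  unfold ServedBy palmSet
  simp only [mem_ofPred_eq]
  refine and_congr_right fun hx => and_congr_right fun hKx => ?_
  constructor
  · rintro ⟨h1, h2, h3⟩
    refine ⟨?_, h2, h3⟩
    rw [topScore_lt_iff hfin' hdec (zero_le.trans_lt h2)]
    exact fun y hy hKy => h1 y hy.1 hKy hy.2
  · rintro ⟨h1, h2, h3⟩
    refine ⟨?_, h2, h3⟩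
    rw [topScore_lt_iff hfin' hdec (zero_le.trans_lt h2)] at h1
    exact fun y hy hKy hne => h1 y ((Set.mem_sdiff y).2 (And.intro hy hne)) hKy

lemma ServedBy.unique {c : Set BS} {M : ℝ≥0∞} {x y : BS} (hx : N.ServedBy i K s M G c x)
    (hy : N.ServedBy i K s M G c y) : x = y := by
  by_contra hne
  exact lt_asymm (hx.2.2.1 y hy.1 hy.2.1 (Ne.symm hne)) (hy.2.2.1 x hx.1 hx.2.1 hne)

/-- Strict ranking makes the server unique, so the sum over points is 0 or 1 and the indicator of an
existence event becomes a sum to which the Mecke formula applies. -/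
lemma tsum_palmSet (hfin : ∀ ω (R : ℝ), {x ∈ Φ ω | x.dist ≤ R}.Finite)
    (hdec : ∀ b : ℝ≥0∞, 0 < b → ∃ R : ℝ, ∀ r, b ≤ s r → r ≤ R) (ω : Ω) :
    ∑' x : Φ ω, (N.palmSet i K s G).indicator (1 : BS × (Config BS × ℝ≥0∞) → ℝ≥0∞)
      (x.1, ((⟨Φ ω \ {x.1}⟩ : Config BS), M ω)) =
      {ω | ∃ x, N.ServedBy i K s (M ω) G (Φ ω) x}.indicator (1 : Ω → ℝ≥0∞) ω := by
  by_cases h : ∃ x, N.ServedBy i K s (M ω) G (Φ ω) x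
  · have hm : ω ∈ {ω | ∃ x, N.ServedBy i K s (M ω) G (Φ ω) x} := h
    obtain ⟨x, hx⟩ := h
    have hx' := (servedBy_iff hfin hdec ω x).1 hx
    rw [indicator_of_mem hm, tsum_eq_single (⟨x, hx'.1⟩ : Φ ω)]
    · rw [indicator_of_mem hx'.2]; rfl
    · intro y hy
      refine indicator_of_notMem (fun hy' => hy ?_) _
      exact Subtype.ext (((servedBy_iff hfin hdec ω y.1).2 ⟨y.2, hy'⟩).unique hx)
  · have hm : ω ∉ {ω | ∃ x, N.ServedBy i K s (M ω) G (Φ ω) x} := h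
    rw [indicator_of_notMem hm, ENNReal.tsum_eq_zero]
    exact fun x => indicator_of_notMem (fun hx =>
      h ⟨x.1, (servedBy_iff hfin hdec ω x.1).2 ⟨x.2, hx⟩⟩) _

lemma measurableSet_servedBy (hfin : ∀ ω (R : ℝ), {x ∈ Φ ω | x.dist ≤ R}.Finite)
    (hdec : ∀ b : ℝ≥0∞, 0 < b → ∃ R : ℝ, ∀ r, b ≤ s r → r ≤ R)
    (hK : MeasurableSet {c | K c}) (hs : Measurable s) (hG : MeasurableSet G) :
    MeasurableSet[countAlgebra Φ ⊔ MeasurableSpace.comap M inferInstance]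
      {ω | ∃ x, N.ServedBy i K s (M ω) G (Φ ω) x} := by
  have := (N.exhausts i hfin).measurable_tsum (η := M)
    (measurable_one.indicator (measurableSet_palmSet (N := N) (i := i) hK hs hG))
  simp_rw [tsum_palmSet hfin hdec] at this
  have h2 := this (measurableSet_singleton 0).compl
  convert h2 using 1
  ext ω
  simp

/-- The probability that the serving link belongs to `G`. -/
lemma measure_servedBy (h : IsPoissonProcess Φ (N.intensity i) P)
    (hfin : ∀ ω (R : ℝ), {x ∈ Φ ω | x.dist ≤ R}.Finite)
    (hdec : ∀ b : ℝ≥0∞, 0 < b → ∃ R : ℝ, ∀ r, b ≤ s r → r ≤ R)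
    (hK : MeasurableSet {c | K c}) (hs : Measurable s) (hM : Measurable M)
    (hind : Indep (countAlgebra Φ) (MeasurableSpace.comap M inferInstance) P)
    (hG : MeasurableSet G) :
    P {ω | ∃ x, N.ServedBy i K s (M ω) G (Φ ω) x} =
      ∫⁻ x, ∫⁻ ω, (N.palmSet i K s G).indicator 1 (x, ((⟨Φ ω⟩ : Config BS), M ω)) ∂P
        ∂(N.intensity i) := by
  have hH := measurableSet_palmSet (N := N) (i := i) hK hs hG
  have hm : MeasurableSet {ω | ∃ x, N.ServedBy i K s (M ω) G (Φ ω) x} :=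
    (sup_le h.countAlgebra_le hM.comap_le) _ (measurableSet_servedBy hfin hdec hK hs hG)
  rw [← lintegral_indicator_one hm,
    ← h.mecke (N.exhausts i hfin) hM hind (measurable_one.indicator hH)]
  simp_rw [tsum_palmSet hfin hdec]

end Tier

end HetNet

end HetNetASE

/-! ### The law of the normalized noise and interference of the serving link -/

namespace HetNetASE

open Set
open scoped ENNReal

namespace HetNet

variable (N : HetNet)

lemma lintegral_intensity (i : Fin 2) {f : BS → ℝ≥0∞} (hf : Measurable f) :
    ∫⁻ x, f x ∂(N.intensity i) = ENNReal.ofReal (N.dens i) *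
      ∫⁻ z, ∫⁻ c, ∫⁻ h, ∫⁻ w, f (z, (c, (h, w))) ∂N.angleLaw ∂(N.fadeLaw i) ∂(N.place i)
        ∂(volume : Measure (EuclideanSpace ℝ (Fin 2))) := by
  rw [intensity, lintegral_prod _ hf.aemeasurable, lintegral_smul_measure, smul_eq_mul]
  congr 1
  refine lintegral_congr fun z => ?_
  have hmz : Measurable fun q : Set ℕ × (ℝ × ℝ) => f (z, q) := hf.comp measurable_prodMk_left
  rw [lintegral_prod _ hmz.aemeasurable]
  refine lintegral_congr fun c => ?_
  have hm : Measurable fun q : ℝ × ℝ => f (z, (c, q)) :=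
    hf.comp (measurable_prodMk_left.comp measurable_prodMk_left)
  rw [lintegral_prod _ hm.aemeasurable]

lemma pathLoss_nonneg (i : Fin 2) {r : ℝ} (hr : 0 ≤ r) : 0 ≤ N.pathLoss i r := by
  have h0 := (N.icpt_pos 0).le
  have h1 := (N.icpt_pos 1).le
  unfold pathLoss unitStep
  split_ifs <;> positivity

lemma linkGain_nonneg (i : Fin 2) {r : ℝ} (hr : 0 ≤ r) : 0 ≤ N.linkGain i r :=
  mul_nonneg (mul_nonneg (N.power_pos i).le (N.pathLoss_nonneg i hr)) (Nat.cast_nonneg _)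

section Law

variable {Ω : Type*} [mΩ : MeasurableSpace Ω] (P : Measure Ω)
  (Φ : Ω → Set BS) (i : Fin 2) (K : Set ℕ → Prop) (s : ℝ → ℝ≥0∞) (M : Ω → ℝ≥0∞)

/-- The locations of a serving base station, with the state of the network, for which this base
station has the highest score and a positive link gain. -/
def servingSet : Set (EuclideanSpace ℝ (Fin 2) × Ω) :=
  {q | 0 < N.linkGain i ‖q.1‖ ∧ topScore K s (Φ q.2) < s ‖q.1‖ ∧ M q.2 < s ‖q.1‖}

/-- The noise and interference, normalized by the link gain of the serving base station. -/
def normInterf (q : EuclideanSpace ℝ (Fin 2) × Ω) : ℝ≥0∞ :=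
  (ENNReal.ofReal (N.noise i) + N.totInterf i (Φ q.2)) / ENNReal.ofReal (N.linkGain i ‖q.1‖)

/-- The intensity of the base stations caching the file, jointly with the law of the network. -/
def servingMeas : Measure (EuclideanSpace ℝ (Fin 2) × Ω) :=
  ((ENNReal.ofReal (N.dens i) * N.place i {c | K c}) •
    (volume : Measure (EuclideanSpace ℝ (Fin 2)))).prod P

/-- The law of the normalized noise and interference of the serving link. -/
def interfLaw : Measure ℝ≥0∞ :=
  (((N.servingMeas P i K).restrict (N.servingSet Φ i K s M)).map (N.normInterf Φ i)).restrict {⊤}ᶜ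

variable {P Φ i K s M} {N}

lemma measurable_toConfig (h : IsPoissonProcess Φ (N.intensity i) P) :
    Measurable fun ω => (⟨Φ ω⟩ : Config BS) :=
  (measurable_config Φ).mono h.countAlgebra_le le_rfl

lemma measurable_topScore_comp (h : IsPoissonProcess Φ (N.intensity i) P)
    (hK : MeasurableSet {c | K c}) (hs : Measurable s) : Measurable fun ω => topScore K s (Φ ω) :=
  (measurable_iSup_config (measurable_score hK hs)).comp (measurable_toConfig h)

lemma measurable_totInterf_comp (h : IsPoissonProcess Φ (N.intensity i) P) :
    Measurable fun ω => N.totInterf i (Φ ω) :=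
  (N.measurable_totInterf i).comp (measurable_toConfig h)

lemma measurableSet_servingSet (h : IsPoissonProcess Φ (N.intensity i) P)
    (hK : MeasurableSet {c | K c}) (hs : Measurable s) (hM : Measurable M) :
    MeasurableSet (N.servingSet Φ i K s M) := by
  have h1 : Measurable fun q : EuclideanSpace ℝ (Fin 2) × Ω => s ‖q.1‖ :=
    hs.comp measurable_fst.norm
  exact (measurableSet_lt measurable_const
    ((N.measurable_linkGain i).comp measurable_fst.norm)).inter
    ((measurableSet_lt ((measurable_topScore_comp h hK hs).comp measurable_snd) h1).inter
      (measurableSet_lt (hM.comp measurable_snd) h1))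

lemma measurable_normInterf (h : IsPoissonProcess Φ (N.intensity i) P) :
    Measurable (N.normInterf Φ i) :=
  (((measurable_totInterf_comp h).comp measurable_snd).const_add _).div
    ((N.measurable_linkGain i).comp measurable_fst.norm).ennreal_ofReal

/-- Test functions that vanish at ∞ do not see that `interfLaw` has been restricted to finite
values. -/
lemma lintegral_interfLaw (h : IsPoissonProcess Φ (N.intensity i) P)
    {f : ℝ≥0∞ → ℝ≥0∞} (hf : Measurable f) (hf0 : f ⊤ = 0) :
    ∫⁻ y, f y ∂(N.interfLaw P Φ i K s M) =
      ∫⁻ q in N.servingSet Φ i K s M, f (N.normInterf Φ i q) ∂(N.servingMeas P i K) := by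
  rw [interfLaw, ← lintegral_indicator (measurableSet_singleton _).compl]
  have : ({⊤}ᶜ : Set ℝ≥0∞).indicator f = f := by
    refine indicator_eq_self.2 fun y hy hy' => hy ?_
    rw [mem_singleton_iff.1 hy', hf0]
  simp_rw [this]
  rw [lintegral_map hf (measurable_normInterf h)]

variable (N i) in
/-- The links with positive gain for which distance, fading power and interference belong to `U`. -/
def linkSet (U : Set (ℝ × (ℝ × ℝ≥0∞))) : Set (BS × ℝ≥0∞) :=
  {q | 0 < N.linkGain i q.1.dist ∧ (q.1.dist, (q.1.fade, q.2)) ∈ U}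

variable [IsProbabilityMeasure P]

/-- After the Mecke formula the marks of the serving station are independent of the network. The
cache mark contributes the caching probability, the angle integrates to 1, and the fading mark
contributes the probability that the link belongs to U. -/
lemma measure_servedBy_eq (h : IsPoissonProcess Φ (N.intensity i) P)
    (hfin : ∀ ω (R : ℝ), {x ∈ Φ ω | x.dist ≤ R}.Finite)
    (hdec : ∀ b : ℝ≥0∞, 0 < b → ∃ R : ℝ, ∀ r, b ≤ s r → r ≤ R)
    (hK : MeasurableSet {c | K c}) (hs : Measurable s) (hM : Measurable M)
    (hind : Indep (countAlgebra Φ) (MeasurableSpace.comap M inferInstance) P)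
    {U : Set (ℝ × (ℝ × ℝ≥0∞))} (hU : MeasurableSet U) :
    P {ω | ∃ x, N.ServedBy i K s (M ω)
        (N.linkSet i U) (Φ ω) x} =
      ∫⁻ q in N.servingSet Φ i K s M,
        N.fadeLaw i {t | (‖q.1‖, (t, N.totInterf i (Φ q.2))) ∈ U} ∂(N.servingMeas P i K) := by
  have hC := measurable_toConfig h
  have hI := measurable_totInterf_comp h
  have hG : MeasurableSet (N.linkSet i U) := by
    have h1 : Measurable fun q : BS × ℝ≥0∞ => N.linkGain i q.1.dist :=
      (N.measurable_linkGain i).comp (BS.measurable_dist.comp measurable_fst)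
    have h2 : Measurable fun q : BS × ℝ≥0∞ => (q.1.dist, (q.1.fade, q.2)) :=
      (BS.measurable_dist.comp measurable_fst).prodMk
        ((BS.measurable_fade.comp measurable_fst).prodMk measurable_snd)
    exact (measurableSet_lt measurable_const h1).inter (h2 hU)
  have hS := measurableSet_servingSet h hK hs hM
  have hH := measurableSet_palmSet (N := N) (i := i) hK hs hG
  have hUm : Measurable fun q : (EuclideanSpace ℝ (Fin 2) × ℝ) × Ω =>
      U.indicator (1 : ℝ × (ℝ × ℝ≥0∞) → ℝ≥0∞) (‖q.1.1‖, (q.1.2, N.totInterf i (Φ q.2))) :=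
    (measurable_one.indicator hU).comp ((measurable_fst.comp measurable_fst).norm.prodMk
      ((measurable_snd.comp measurable_fst).prodMk (hI.comp measurable_snd)))
  have hSm : Measurable fun q : (EuclideanSpace ℝ (Fin 2) × ℝ) × Ω =>
      (N.servingSet Φ i K s M).indicator (1 : EuclideanSpace ℝ (Fin 2) × Ω → ℝ≥0∞) (q.1.1, q.2) :=
    (measurable_one.indicator hS).comp ((measurable_fst.comp measurable_fst).prodMk measurable_snd)
  have hfl : ∀ q : EuclideanSpace ℝ (Fin 2) × Ω,
      N.fadeLaw i {t | (‖q.1‖, (t, N.totInterf i (Φ q.2))) ∈ U} =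
        ∫⁻ t, U.indicator 1 (‖q.1‖, (t, N.totInterf i (Φ q.2))) ∂(N.fadeLaw i) := by
    intro q
    have hq : Measurable fun t : ℝ => (‖q.1‖, (t, N.totInterf i (Φ q.2))) := by fun_prop
    exact (lintegral_indicator_one (hq hU)).symm
  have hF : Measurable fun q : BS × Ω => (N.palmSet i K s (N.linkSet i U)).indicator
      (1 : BS × (Config BS × ℝ≥0∞) → ℝ≥0∞) (q.1, ((⟨Φ q.2⟩ : Config BS), M q.2)) :=
    (measurable_one.indicator hH).comp (measurable_fst.prodMk
      ((hC.comp measurable_snd).prodMk (hM.comp measurable_snd)))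
  rw [measure_servedBy h hfin hdec hK hs hM hind hG, N.lintegral_intensity i hF.lintegral_prod_right']
  -- The integrand factors into a function of the cache, a function of location and network, and a
  -- function of fading and interference; it does not depend on the angle.
  have hfac : ∀ (z : EuclideanSpace ℝ (Fin 2)) c t w ω, (N.palmSet i K s (N.linkSet i U)).indicator (1 : BS × (Config BS × ℝ≥0∞) → ℝ≥0∞)
        ((z, (c, (t, w))), ((⟨Φ ω⟩ : Config BS), M ω)) =
      {c | K c}.indicator 1 c * ((N.servingSet Φ i K s M).indicator 1 (z, ω) *
        U.indicator 1 (‖z‖, (t, N.totInterf i (Φ ω)))) := by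
    intro z c t w ω
    simp only [indicator_apply, palmSet, servingSet, linkSet, mem_ofPred_eq, BS.dist, BS.cache, BS.fade]
    by_cases h1 : K c <;> by_cases h2 : 0 < N.linkGain i ‖z‖ <;>
      by_cases h3 : topScore K s (Φ ω) < s ‖z‖ <;> by_cases h4 : M ω < s ‖z‖ <;>
      by_cases h5 : (‖z‖, t, N.totInterf i (Φ ω)) ∈ U <;> simp [h1, h2, h3, h4, h5]
  simp_rw [hfac]
  have hb : ∀ z : EuclideanSpace ℝ (Fin 2), Measurable fun q : ℝ × Ω =>
      (N.servingSet Φ i K s M).indicator (1 : EuclideanSpace ℝ (Fin 2) × Ω → ℝ≥0∞) (z, q.2) *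
        U.indicator (1 : ℝ × (ℝ × ℝ≥0∞) → ℝ≥0∞) (‖z‖, (q.1, N.totInterf i (Φ q.2))) := fun z => by
    have hg : Measurable fun q : ℝ × Ω => ((z, q.1), q.2) :=
      (measurable_const.prodMk measurable_fst).prodMk measurable_snd
    have h1 := hSm.comp hg
    have h2 := hUm.comp hg
    exact h1.mul h2
  have hb1 : ∀ (z : EuclideanSpace ℝ (Fin 2)) (t : ℝ), Measurable fun ω =>
      (N.servingSet Φ i K s M).indicator (1 : EuclideanSpace ℝ (Fin 2) × Ω → ℝ≥0∞) (z, ω) *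
        U.indicator (1 : ℝ × (ℝ × ℝ≥0∞) → ℝ≥0∞) (‖z‖, (t, N.totInterf i (Φ ω))) := fun z t => by
    have h1 := (hb z).comp (measurable_prodMk_left (x := t))
    exact h1
  have hz : ∀ z : EuclideanSpace ℝ (Fin 2), ∫⁻ c, ∫⁻ t, ∫⁻ _w, ∫⁻ ω, {c | K c}.indicator 1 c *
      ((N.servingSet Φ i K s M).indicator 1 (z, ω) *
        U.indicator 1 (‖z‖, (t, N.totInterf i (Φ ω)))) ∂P ∂N.angleLaw ∂(N.fadeLaw i) ∂(N.place i) =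
      N.place i {c | K c} * ∫⁻ ω, (N.servingSet Φ i K s M).indicator 1 (z, ω) *
        N.fadeLaw i {t | (‖z‖, (t, N.totInterf i (Φ ω))) ∈ U} ∂P := by
    intro z
    simp_rw [lintegral_const_mul _ (hb1 z _), lintegral_const, measure_univ, mul_one]
    simp_rw [lintegral_const_mul _ (hb z).lintegral_prod_right']
    rw [lintegral_mul_const _ (measurable_one.indicator hK), lintegral_indicator_one hK]
    congr 1
    rw [lintegral_lintegral_swap (f := fun t ω => (N.servingSet Φ i K s M).indicator
      (1 : EuclideanSpace ℝ (Fin 2) × Ω → ℝ≥0∞) (z, ω) *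
        U.indicator 1 (‖z‖, (t, N.totInterf i (Φ ω)))) (hb z).aemeasurable]
    have hin : ∀ ω, ∫⁻ t, (N.servingSet Φ i K s M).indicator
        (1 : EuclideanSpace ℝ (Fin 2) × Ω → ℝ≥0∞) (z, ω) *
        U.indicator 1 (‖z‖, (t, N.totInterf i (Φ ω))) ∂(N.fadeLaw i) =
        (N.servingSet Φ i K s M).indicator 1 (z, ω) *
        N.fadeLaw i {t | (‖z‖, (t, N.totInterf i (Φ ω))) ∈ U} := by
      intro ω
      have hq : Measurable fun t : ℝ => U.indicator (1 : ℝ × (ℝ × ℝ≥0∞) → ℝ≥0∞)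
        (‖z‖, (t, N.totInterf i (Φ ω))) := by
        have h1 : Measurable fun t : ℝ => (‖z‖, (t, N.totInterf i (Φ ω))) := by fun_prop
        have h2 : Measurable (U.indicator (1 : ℝ × (ℝ × ℝ≥0∞) → ℝ≥0∞)) := measurable_one.indicator hU
        exact h2.comp h1
      rw [lintegral_const_mul _ hq, ← hfl (z, ω)]
    simp_rw [hin]
  simp_rw [hz]
  have hfm : Measurable fun q : EuclideanSpace ℝ (Fin 2) × Ω =>
      N.fadeLaw i {t | (‖q.1‖, (t, N.totInterf i (Φ q.2))) ∈ U} := by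
    have hg : Measurable fun w : (EuclideanSpace ℝ (Fin 2) × Ω) × ℝ =>
        (‖w.1.1‖, (w.2, N.totInterf i (Φ w.1.2))) :=
      measurable_fst.fst.norm.prodMk (measurable_snd.prodMk (hI.comp measurable_fst.snd))
    have h1 := measurable_measure_prodMk_left (ν := N.fadeLaw i) (hg hU)
    exact h1
  have hfm2 : Measurable fun q : EuclideanSpace ℝ (Fin 2) × Ω =>
      (N.servingSet Φ i K s M).indicator 1 (q.1, q.2) *
      N.fadeLaw i {t | (‖q.1‖, (t, N.totInterf i (Φ q.2))) ∈ U} :=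
    (measurable_one.indicator hS).mul hfm
  rw [← lintegral_indicator hS, servingMeas]
  have : ∀ q : EuclideanSpace ℝ (Fin 2) × Ω, (N.servingSet Φ i K s M).indicator
      (fun q => N.fadeLaw i {t | (‖q.1‖, (t, N.totInterf i (Φ q.2))) ∈ U}) q =
      (N.servingSet Φ i K s M).indicator 1 (q.1, q.2) *
      N.fadeLaw i {t | (‖q.1‖, (t, N.totInterf i (Φ q.2))) ∈ U} := by
    intro q
    by_cases hq : q ∈ N.servingSet Φ i K s M <;> simp [hq]
  simp_rw [this]
  rw [lintegral_prod _ hfm2.aemeasurable, lintegral_smul_measure, smul_eq_mul, mul_assoc,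
    lintegral_const_mul _ hfm2.lintegral_prod_right']

variable (N i) in
/-- The complementary distribution function of the fading power. -/
def fadeTail (y : ℝ≥0∞) : ℝ≥0∞ := N.fadeLaw i {t | y < ENNReal.ofReal t}

lemma fadeTail_antitone : Antitone (N.fadeTail i) := fun _ _ hxy =>
  measure_mono fun _ ht => hxy.trans_lt ht

lemma measurable_fadeTail : Measurable (N.fadeTail i) := fadeTail_antitone.measurable

@[simp] lemma fadeTail_top : N.fadeTail i ⊤ = 0 := by simp [fadeTail]

/-- With U everything, `measure_servedBy_eq` identifies the mass of the serving set with the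
probability that some station serves over a link of positive gain. -/
lemma interfLaw_univ_le (h : IsPoissonProcess Φ (N.intensity i) P)
    (hfin : ∀ ω (R : ℝ), {x ∈ Φ ω | x.dist ≤ R}.Finite)
    (hdec : ∀ b : ℝ≥0∞, 0 < b → ∃ R : ℝ, ∀ r, b ≤ s r → r ≤ R)
    (hK : MeasurableSet {c | K c}) (hs : Measurable s) (hM : Measurable M)
    (hind : Indep (countAlgebra Φ) (MeasurableSpace.comap M inferInstance) P) :
    N.interfLaw P Φ i K s M univ ≤ 1 := by
  have h1 := measure_servedBy_eq h hfin hdec hK hs hM hind (U := univ) MeasurableSet.univ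
  have h2 : N.interfLaw P Φ i K s M univ ≤
      (N.servingMeas P i K).restrict (N.servingSet Φ i K s M) univ := by
    refine (Measure.restrict_apply_le _ _).trans ?_
    rw [Measure.map_apply (measurable_normInterf h) MeasurableSet.univ, preimage_univ]
  refine h2.trans ?_
  simp only [mem_univ, ofPred_true, measure_univ, lintegral_one] at h1
  rw [← h1]
  exact prob_le_one

/-- Multiplying out also covers a vanishing or infinite denominator. Positivity of τ matters for the
latter, since 0 · ∞ = 0 would make the right side true for a positive signal. -/
lemma ofReal_lt_sinr_iff {τ : ℝ} (hτ : 0 < τ) {S : Set BS} {x : BS} :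
    ENNReal.ofReal τ < N.sinr i S x ↔
      ENNReal.ofReal τ * (ENNReal.ofReal (N.noise i) + N.totInterf i (S \ {x})) <
        ENNReal.ofReal (N.signal i x) := by
  have : N.sinr i S x = ENNReal.ofReal (N.signal i x) /
      (ENNReal.ofReal (N.noise i) + N.totInterf i (S \ {x})) := rfl
  rw [this]
  rw [ENNReal.lt_div_iff_mul_lt (Or.inr ENNReal.ofReal_ne_top) (Or.inr (by simpa using hτ))]

/-- The coverage probability of the serving link. -/
lemma measure_served_sinr (h : IsPoissonProcess Φ (N.intensity i) P)
    (hfin : ∀ ω (R : ℝ), {x ∈ Φ ω | x.dist ≤ R}.Finite)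
    (hdec : ∀ b : ℝ≥0∞, 0 < b → ∃ R : ℝ, ∀ r, b ≤ s r → r ≤ R)
    (hK : MeasurableSet {c | K c}) (hs : Measurable s) (hM : Measurable M)
    (hind : Indep (countAlgebra Φ) (MeasurableSpace.comap M inferInstance) P) {τ : ℝ} (hτ : 0 < τ) :
    P {ω | ∃ x, N.ServedBy i K s (M ω) univ (Φ ω) x ∧ ENNReal.ofReal τ < N.sinr i (Φ ω) x} =
      ∫⁻ y, N.fadeTail i (ENNReal.ofReal τ * y) ∂(N.interfLaw P Φ i K s M) := by
  have hτ0 : ENNReal.ofReal τ ≠ 0 := by simpa using hτ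
  have hU : MeasurableSet {u : ℝ × (ℝ × ℝ≥0∞) |
      ENNReal.ofReal τ * (ENNReal.ofReal (N.noise i) + u.2.2) <
        ENNReal.ofReal (N.linkGain i u.1 * u.2.1)} := by
    have h1 : Measurable fun u : ℝ × (ℝ × ℝ≥0∞) => N.linkGain i u.1 :=
      (N.measurable_linkGain i).comp measurable_fst
    exact measurableSet_lt (by fun_prop) (by fun_prop)
  have h1 := measure_servedBy_eq h hfin hdec hK hs hM hind hU
  have hf : Measurable fun y => N.fadeTail i (ENNReal.ofReal τ * y) :=
    measurable_fadeTail.comp (measurable_const_mul _)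
  rw [lintegral_interfLaw h hf (by simp [ENNReal.mul_top hτ0])]
  refine Eq.trans ?_ (h1.trans ?_)
  · congr 1
    ext ω
    simp only [mem_ofPred_eq]
    refine exists_congr fun x => ?_
    have hsig : N.linkGain i x.dist * x.fade = N.signal i x := rfl
    simp only [ServedBy, linkSet, mem_univ, and_true, mem_ofPred_eq, hsig, ofReal_lt_sinr_iff hτ]
    constructor
    · rintro ⟨⟨a, b, c, d⟩, e⟩
      refine ⟨a, b, c, d, ?_, e⟩
      -- A station without link gain has no signal, so its SINR cannot exceed τ; the positive gain
      -- demanded by `linkSet` is automatic.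
      refine lt_of_le_of_ne (N.linkGain_nonneg i (norm_nonneg _)) fun h0 => ?_
      rw [← hsig, ← h0] at e
      simp at e
    · rintro ⟨a, b, c, d, _, e⟩
      exact ⟨⟨a, b, c, d⟩, e⟩
  · refine setLIntegral_congr_fun (measurableSet_servingSet h hK hs hM) fun q hq => ?_
    have hg : 0 < N.linkGain i ‖q.1‖ := hq.1
    simp only [fadeTail, normInterf]
    congr 1
    ext t
    simp only [mem_ofPred_eq]
    rw [ENNReal.ofReal_mul hg.le, ← mul_div_assoc, ENNReal.div_lt_iff (Or.inl (by simpa using hg))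
      (Or.inl ENNReal.ofReal_ne_top), mul_comm (ENNReal.ofReal t)]

end Law

end HetNet

end HetNetASE

/-! ### Polar coordinates and the Laplace transform of the interference law -/

namespace HetNetASE

open Set
open scoped ENNReal

/-- Integration of radial functions in the plane. -/
lemma lintegral_norm_plane {f : ℝ → ℝ≥0∞} (hf : Measurable f) :
    ∫⁻ z : EuclideanSpace ℝ (Fin 2), f ‖z‖ =
      ∫⁻ r in Ioi (0 : ℝ), ENNReal.ofReal (2 * Real.pi * r) * f r := by
  set μ : Measure (EuclideanSpace ℝ (Fin 2)) := volume with hμ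
  have hdim : Module.finrank ℝ (EuclideanSpace ℝ (Fin 2)) = 2 := by simp
  have h1 : ∫⁻ z, f ‖z‖ ∂μ = ∫⁻ z : ({(0)}ᶜ : Set (EuclideanSpace ℝ (Fin 2))), f ‖z.1‖
      ∂(μ.comap (↑)) := by
    rw [lintegral_subtype_comap (measurableSet_singleton _).compl (fun z => f ‖z‖),
      restrict_compl_singleton]
  have hg : Measurable fun p : Metric.sphere (0 : EuclideanSpace ℝ (Fin 2)) 1 × Ioi (0 : ℝ) =>
    f p.2.1 := hf.comp (measurable_subtype_coe.comp measurable_snd)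
  have h2 := μ.measurePreserving_homeomorphUnitSphereProd.lintegral_comp hg
  have hi : Measurable fun r : Ioi (0 : ℝ) => f r.1 := hf.comp measurable_subtype_coe
  have h3 : ∫⁻ p, f p.2.1 ∂(μ.toSphere.prod (Measure.volumeIoiPow (2 - 1))) =
      ENNReal.ofReal (2 * Real.pi) * ∫⁻ r : Ioi (0 : ℝ), f r.1 ∂(Measure.volumeIoiPow (2 - 1)) := by
    rw [lintegral_prod _ hg.aemeasurable]
    simp only [lintegral_const, Measure.toSphere_apply_univ, hdim]
    rw [mul_comm, hμ, EuclideanSpace.volume_ball_fin_two]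
    congr 1
    rw [ENNReal.ofReal_mul (by norm_num)]
    simp
  have h4 : ∫⁻ r : Ioi (0 : ℝ), f r.1 ∂(Measure.volumeIoiPow (2 - 1)) =
      ∫⁻ r in Ioi (0 : ℝ), ENNReal.ofReal r * f r := by
    rw [Measure.volumeIoiPow, lintegral_withDensity_eq_lintegral_mul _ (by fun_prop) hi,
      ← lintegral_subtype_comap measurableSet_Ioi (fun r => ENNReal.ofReal r * f r)]
    simp
  rw [h1]
  refine Eq.trans ?_ (h2.trans ?_)
  · simp
  · rw [hdim, h3, h4, ← lintegral_const_mul _ (by fun_prop)]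
    refine setLIntegral_congr_fun measurableSet_Ioi fun r _ => ?_
    rw [← mul_assoc, ← ENNReal.ofReal_mul (by positivity)]

/-- The Laplace transform of the Gamma distribution. -/
lemma lintegral_expNeg_gammaMeasure {n : ℕ} (hn : 0 < n) {t : ℝ} (ht : 0 ≤ t) :
    ∫⁻ h, expNeg (ENNReal.ofReal (t * h)) ∂(gammaMeasure n n) =
      ENNReal.ofReal (((1 + t / n) ^ n)⁻¹) := by
  have hn' : (0 : ℝ) < n := by exact_mod_cast hn
  have hnt : (0 : ℝ) < n + t := by positivity
  have hm : Measurable fun h : ℝ => expNeg (ENNReal.ofReal (t * h)) :=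
    measurable_expNeg.comp (by fun_prop)
  rw [gammaMeasure, lintegral_withDensity_eq_lintegral_mul _
    (show Measurable (gammaPDF n n) from (measurable_gammaPDFReal _ _).ennreal_ofReal) hm]
  -- Exponential tilting: multiplied by exp(-th), the Gamma density of rate n is a constant multiple
  -- of the one of rate n + t.
  have h1 : ∀ h, (gammaPDF n n * fun h : ℝ => expNeg (ENNReal.ofReal (t * h))) h =
      ENNReal.ofReal (((1 + t / n) ^ n)⁻¹) * gammaPDF n (n + t) h := by
    intro h
    simp only [Pi.mul_apply]
    rcases lt_or_ge h 0 with hh | hh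
    · simp [gammaPDF_of_neg hh]
    · rw [gammaPDF_of_nonneg hh, gammaPDF_of_nonneg hh, expNeg_ofReal (by positivity),
        ← ENNReal.ofReal_mul (by positivity), ← ENNReal.ofReal_mul (by positivity)]
      congr 1
      have h2 : Real.exp (-((n + t) * h)) = Real.exp (-(n * h)) * Real.exp (-(t * h)) := by
        rw [← Real.exp_add]; ring_nf
      have h3 : (1 + t / n) ^ n = ((n : ℝ) + t) ^ n / n ^ n := by
        rw [← div_pow]; congr 1; field_simp
      rw [h2, h3, Real.rpow_natCast, Real.rpow_natCast]
      have := (Real.Gamma_pos_of_pos hn').ne'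
      field_simp
  simp_rw [h1]
  rw [lintegral_const_mul' _ _ ENNReal.ofReal_ne_top, lintegral_gammaPDF_eq_one hn' hnt, mul_one]

namespace HetNet

section Transform

variable {N : HetNet} {Ω : Type*} {mΩ : MeasurableSpace Ω} {P : Measure Ω} [IsProbabilityMeasure P]
  {Φ : Ω → Set BS} {i : Fin 2} {K : Set ℕ → Prop} {s : ℝ → ℝ≥0∞} {M : Ω → ℝ≥0∞}

variable (N i K s) in
/-- The exponent of the Laplace functional: no base station has a score of `a` or more, and the
interference is weighted by `κ`. -/
def laplaceExponent (a κ : ℝ≥0∞) : ℝ≥0∞ :=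
  ∫⁻ x, (1 - expNeg ({x | a ≤ score K s x}.indicator (fun _ => ⊤) x +
    κ * ENNReal.ofReal (N.interfPower i x))) ∂(N.intensity i)

/-- Points of score at least a receive weight ∞, so that exp(-sum) vanishes as soon as one exists.
The void event and the interference, which depend on the same points, are thereby expressed by one
Laplace functional. -/
lemma lintegral_topScore_expNeg (h : IsPoissonProcess Φ (N.intensity i) P)
    (hfin : ∀ ω (R : ℝ), {x ∈ Φ ω | x.dist ≤ R}.Finite)
    (hdec : ∀ b : ℝ≥0∞, 0 < b → ∃ R : ℝ, ∀ r, b ≤ s r → r ≤ R)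
    (hK : MeasurableSet {c | K c}) (hs : Measurable s) {a : ℝ≥0∞} (ha : 0 < a) (κ : ℝ≥0∞) :
    ∫⁻ ω, {ω | topScore K s (Φ ω) < a}.indicator (fun ω => expNeg (κ * N.totInterf i (Φ ω))) ω ∂P =
      expNeg (N.laplaceExponent i K s a κ) := by
  have hS : MeasurableSet {x | a ≤ score K s x} :=
    measurableSet_le measurable_const (measurable_score hK hs)
  have hf : Measurable fun x => {x | a ≤ score K s x}.indicator (fun _ => (⊤ : ℝ≥0∞)) x +
      κ * ENNReal.ofReal (N.interfPower i x) :=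
    (measurable_const.indicator hS).add ((N.measurable_interfPower i).ennreal_ofReal.const_mul _)
  rw [laplaceExponent, ← h.laplace (N.exhausts i hfin) hf]
  refine lintegral_congr fun ω => ?_
  rw [ENNReal.tsum_add, ENNReal.tsum_mul_left, expNeg_add]
  change _ = _ * expNeg (κ * N.totInterf i (Φ ω))
  by_cases hω : topScore K s (Φ ω) < a
  · have h0 : ∑' x : Φ ω, {x | a ≤ score K s x}.indicator (fun _ => (⊤ : ℝ≥0∞)) x.1 = 0 := by
      rw [ENNReal.tsum_eq_zero]
      refine fun x => indicator_of_notMem (fun hx => ?_) _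
      exact not_lt.2 hx ((le_iSup₂ (f := fun x (_ : x ∈ Φ ω) => score K s x) x.1 x.2).trans_lt hω)
    rw [h0, expNeg_zero, one_mul]
    exact indicator_of_mem (s := {ω | topScore K s (Φ ω) < a}) hω _
  · have h0 : ∑' x : Φ ω, {x | a ≤ score K s x}.indicator (fun _ => (⊤ : ℝ≥0∞)) x.1 = ⊤ := by
      rw [topScore_lt_iff (hfin ω) hdec ha] at hω
      push Not at hω
      obtain ⟨x, hx, hKx, hax⟩ := hω
      have hsc : score K s x = s x.dist := indicator_of_mem (s := {x : BS | K x.cache}) hKx _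
      refine ENNReal.tsum_eq_top_of_eq_top ⟨⟨x, hx⟩, ?_⟩
      exact indicator_of_mem (s := {x | a ≤ score K s x}) (by rw [mem_ofPred_eq, hsc]; exact hax) _
    rw [h0, expNeg_top, zero_mul]
    exact indicator_of_notMem (s := {ω | topScore K s (Φ ω) < a}) hω _

/-- The probability that no base station has a score of `a` or more. -/
lemma measure_topScore_lt (h : IsPoissonProcess Φ (N.intensity i) P)
    (hfin : ∀ ω (R : ℝ), {x ∈ Φ ω | x.dist ≤ R}.Finite)
    (hdec : ∀ b : ℝ≥0∞, 0 < b → ∃ R : ℝ, ∀ r, b ≤ s r → r ≤ R)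
    (hK : MeasurableSet {c | K c}) (hs : Measurable s) {a : ℝ≥0∞} (ha : 0 < a) :
    P {ω | topScore K s (Φ ω) < a} = expNeg (N.intensity i {x | a ≤ score K s x}) := by
  have hS : MeasurableSet {x | a ≤ score K s x} :=
    measurableSet_le measurable_const (measurable_score hK hs)
  have hm : MeasurableSet {ω | topScore K s (Φ ω) < a} :=
    measurableSet_lt (measurable_topScore_comp h hK hs) measurable_const
  have h1 := lintegral_topScore_expNeg h hfin hdec hK hs ha 0
  simp only [zero_mul, expNeg_zero, lintegral_indicator_const hm, one_mul] at h1
  rw [h1, laplaceExponent, ← lintegral_indicator_one hS]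
  congr 1
  refine lintegral_congr fun x => ?_
  by_cases hx : a ≤ score K s x <;> simp [hx]

/-- The Laplace transform of the law of the normalized noise and interference. -/
lemma lintegral_expNeg_interfLaw (h : IsPoissonProcess Φ (N.intensity i) P)
    (hfin : ∀ ω (R : ℝ), {x ∈ Φ ω | x.dist ≤ R}.Finite)
    (hdec : ∀ b : ℝ≥0∞, 0 < b → ∃ R : ℝ, ∀ r, b ≤ s r → r ≤ R)
    (hK : MeasurableSet {c | K c}) (hs : Measurable s) (hM : Measurable M)
    (hind : Indep (countAlgebra Φ) (MeasurableSpace.comap M inferInstance) P)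
    {κ : ℝ≥0∞} (hκ : κ ≠ 0) :
    ∫⁻ y, expNeg (κ * y) ∂(N.interfLaw P Φ i K s M) =
      ∫⁻ r in Ioi (0 : ℝ), ENNReal.ofReal (2 * Real.pi * r) *
        (ENNReal.ofReal (N.dens i) * N.place i {c | K c} * {r | 0 < N.linkGain i r}.indicator
          (fun r => expNeg (κ / ENNReal.ofReal (N.linkGain i r) * ENNReal.ofReal (N.noise i)) *
            (P {ω | M ω < s r} * expNeg (N.laplaceExponent i K s (s r)
              (κ / ENNReal.ofReal (N.linkGain i r))))) r) := by
  have hI := measurable_totInterf_comp h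
  have hT := measurable_topScore_comp h hK hs
  have hS := measurableSet_servingSet h hK hs hM
  have hSr : MeasurableSet {q : ℝ × Ω | 0 < N.linkGain i q.1 ∧ topScore K s (Φ q.2) < s q.1 ∧
      M q.2 < s q.1} :=
    (measurableSet_lt measurable_const ((N.measurable_linkGain i).comp measurable_fst)).inter
      ((measurableSet_lt (hT.comp measurable_snd) (hs.comp measurable_fst)).inter
        (measurableSet_lt (hM.comp measurable_snd) (hs.comp measurable_fst)))
  set f : ℝ × Ω → ℝ≥0∞ := {q : ℝ × Ω | 0 < N.linkGain i q.1 ∧ topScore K s (Φ q.2) < s q.1 ∧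
      M q.2 < s q.1}.indicator fun q => expNeg (κ *
        ((ENNReal.ofReal (N.noise i) + N.totInterf i (Φ q.2)) / ENNReal.ofReal (N.linkGain i q.1)))
    with hf
  have hfm : Measurable f := by
    refine Measurable.indicator (measurable_expNeg.comp (Measurable.const_mul ?_ _)) hSr
    exact ((hI.comp measurable_snd).const_add _).div
      ((N.measurable_linkGain i).comp measurable_fst).ennreal_ofReal
  have hE : Measurable fun y => expNeg (κ * y) := measurable_expNeg.comp (measurable_const_mul _)
  rw [lintegral_interfLaw h hE (by simp [ENNReal.mul_top hκ]), ← lintegral_indicator hS,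
    servingMeas]
  have h1 : ∀ q : EuclideanSpace ℝ (Fin 2) × Ω, (N.servingSet Φ i K s M).indicator
      (fun q => expNeg (κ * N.normInterf Φ i q)) q = f (‖q.1‖, q.2) := fun q => rfl
  simp_rw [h1]
  have hfz : Measurable fun q : EuclideanSpace ℝ (Fin 2) × Ω => f (‖q.1‖, q.2) := by
    have hg : Measurable fun q : EuclideanSpace ℝ (Fin 2) × Ω => (‖q.1‖, q.2) :=
      measurable_fst.norm.prodMk measurable_snd
    have := hfm.comp hg
    exact this
  have hH : Measurable fun r => ∫⁻ ω, f (r, ω) ∂P := hfm.lintegral_prod_right'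
  rw [lintegral_prod _ hfz.aemeasurable, lintegral_smul_measure, smul_eq_mul,
    lintegral_norm_plane hH, ← lintegral_const_mul _ (by fun_prop)]
  refine setLIntegral_congr_fun measurableSet_Ioi fun r _ => ?_
  rw [mul_left_comm]
  congr 2
  by_cases hg : 0 < N.linkGain i r
  swap
  · have h2 : ∀ ω, f (r, ω) = 0 := fun ω => indicator_of_notMem (fun hq => hg hq.1) _
    simp [h2, hg]
  rw [indicator_of_mem (s := {r | 0 < N.linkGain i r}) hg]
  rcases eq_or_ne (s r) 0 with hs0 | hs0
  · have h2 : ∀ ω, f (r, ω) = 0 := fun ω => indicator_of_notMem (fun hq => by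
      have := hq.2.1; simp [hs0] at this) _
    simp [h2, hs0]
  have hsr : 0 < s r := pos_iff_ne_zero.2 hs0
  set k := κ / ENNReal.ofReal (N.linkGain i r) with hk
  -- Splits off the deterministic noise, a function of the serving tier and a function of the level;
  -- the last two are independent.
  have h2 : ∀ ω, f (r, ω) = expNeg (k * ENNReal.ofReal (N.noise i)) *
      ({ω | topScore K s (Φ ω) < s r}.indicator (fun ω => expNeg (k * N.totInterf i (Φ ω))) ω *
        {m : ℝ≥0∞ | m < s r}.indicator 1 (M ω)) := by
    intro ω
    have h3 : κ * ((ENNReal.ofReal (N.noise i) + N.totInterf i (Φ ω)) /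
        ENNReal.ofReal (N.linkGain i r)) =
        k * ENNReal.ofReal (N.noise i) + k * N.totInterf i (Φ ω) := by
      simp only [hk, div_eq_mul_inv]
      ring
    simp only [hf, indicator_apply, mem_ofPred_eq, hg, true_and, h3, expNeg_add]
    by_cases h4 : topScore K s (Φ ω) < s r <;> by_cases h5 : M ω < s r <;> simp [h4, h5]
  simp_rw [h2]
  have hkm : Measurable fun y : ℝ≥0∞ => expNeg (k * y) :=
    measurable_expNeg.comp (measurable_const_mul _)
  have e1 : Measurable[countAlgebra Φ] fun ω => {ω | topScore K s (Φ ω) < s r}.indicator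
      (fun ω => expNeg (k * N.totInterf i (Φ ω))) ω := by
    have g1 : Measurable fun c : Config BS => {c : Config BS | topScore K s c.pts < s r}.indicator
        (fun c => expNeg (k * N.totInterf i c.pts)) c :=
      (hkm.comp (N.measurable_totInterf i)).indicator
        (measurableSet_lt (measurable_iSup_config (measurable_score hK hs)) measurable_const)
    exact g1.comp (measurable_config Φ)
  have e2 : Measurable[MeasurableSpace.comap M inferInstance] fun ω =>
      {m : ℝ≥0∞ | m < s r}.indicator (1 : ℝ≥0∞ → ℝ≥0∞) (M ω) :=
    (measurable_one.indicator measurableSet_Iio).comp (comap_measurable M)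
  rw [lintegral_const_mul' _ _ (expNeg_ne_top _),
    lintegral_mul_eq_lintegral_mul_lintegral_of_independent_measurableSpace h.countAlgebra_le
      hM.comap_le hind e1 e2, lintegral_topScore_expNeg h hfin hdec hK hs hsr]
  have h3 : ∫⁻ ω, {m : ℝ≥0∞ | m < s r}.indicator (1 : ℝ≥0∞ → ℝ≥0∞) (M ω) ∂P =
      P {ω | M ω < s r} :=
    lintegral_indicator_one (hM measurableSet_Iio)
  rw [h3, mul_comm (P _)]

end Transform

end HetNet

end HetNetASE

namespace HetNetASE

open Set
open scoped ENNReal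

/-! ### The hypergeometric functions `₂F₁(-β, b; 1-β; x)` -/

/-- It says that (-β)ₖ / (1-β)ₖ = β / (β - k): the k-th coefficient of the hypergeometric series,
multiplied by k - β, is -β times a binomial coefficient. -/
lemma ascPochhammer_neg_eval (β : ℝ) (k : ℕ) :
    (ascPochhammer ℝ k).eval (-β) * (k - β) = -β * (ascPochhammer ℝ k).eval (1 - β) := by
  induction k with
  | zero => simp
  | succ k ih =>
    rw [ascPochhammer_succ_eval, ascPochhammer_succ_eval, ← mul_assoc (-β), ← ih]
    push_cast
    ring

/-- The function `₂F₁(-β, b; 1-β; x)` solves `x F' = β F - β (1-x)^(-b)`. -/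
lemma hasDerivAt_hypergeometric {β b : ℝ} (hβ : 0 < β) (hβ' : β < 1) (hb : ∀ k : ℕ, (k : ℝ) ≠ -b)
    {x : ℝ} (hx : |x| < 1) :
    ∃ D, HasDerivAt (ordinaryHypergeometric (-β) b (1 - β)) D x ∧
      x * D = β * ordinaryHypergeometric (-β) b (1 - β) x - β * (1 - x) ^ (-b) := by
  have hk : ∀ k : ℕ, (k : ℝ) ≠ β := by
    intro k hk
    rcases Nat.eq_zero_or_pos k with rfl | h
    · simp at hk; linarith
    · have : (1 : ℝ) ≤ k := by exact_mod_cast h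
      linarith
  have hrad := ordinaryHypergeometricSeries_radius_eq_one (𝕂 := ℝ) (𝔸 := ℝ) (-β) b (1 - β)
    (fun k => ⟨by simpa using hk k, hb k, fun h => by
      have := hk (k + 1); push_cast at this; apply this; linarith⟩)
  set p := ordinaryHypergeometricSeries ℝ (-β) b (1 - β) with hp
  have hF : HasFPowerSeriesOnBall (ordinaryHypergeometric (-β) b (1 - β)) p 0 1 := by
    rw [← hrad]
    exact p.hasFPowerSeriesOnBall (by rw [hrad]; exact one_pos)
  have hxm : x ∈ Metric.eball (0 : ℝ) 1 := by
    simp only [Metric.mem_eball, edist_zero_right]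
    rw [← ofReal_norm, Real.norm_eq_abs]
    exact ENNReal.ofReal_lt_one.2 hx
  have h1 := hF.hasSum hxm
  have h2 := (hF.fderiv.hasSum hxm).mapL (ContinuousLinearMap.apply ℝ ℝ x)
  have h3 := (Real.one_div_one_sub_rpow_hasFPowerSeriesOnBall_zero b).hasSum hxm
  have hd : DifferentiableAt ℝ (ordinaryHypergeometric (-β) b (1 - β)) x :=
    (hF.differentiableOn x hxm).differentiableAt (Metric.isOpen_eball.mem_nhds hxm)
  have h4 : HasSum (fun k : ℕ => (k : ℝ) * p k fun _ => x)
      (x * deriv (ordinaryHypergeometric (-β) b (1 - β)) x) := by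
    rw [← hasSum_nat_add_iff' 1]
    have e : ∀ k : ℕ, ((ContinuousLinearMap.apply ℝ ℝ) x) ((p.derivSeries k) fun _ => x) =
        ((k + 1 : ℕ) : ℝ) * p (k + 1) fun _ => x := by
      intro k
      rw [ContinuousLinearMap.apply_apply, p.derivSeries_apply_diag, nsmul_eq_mul]
    simp_rw [e] at h2
    convert h2 using 1
    rw [zero_add, ContinuousLinearMap.apply_apply, fderiv_eq_smul_deriv]
    simp
  refine ⟨_, hd.hasDerivAt, ?_⟩
  rw [zero_add] at h1 h3
  have h5 : HasSum (fun k : ℕ => (k : ℝ) * (p k fun _ => x) - β * p k fun _ => x)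
      (x * deriv (ordinaryHypergeometric (-β) b (1 - β)) x -
        β * ordinaryHypergeometric (-β) b (1 - β) x) := h4.sub (h1.mul_left β)
  -- Termwise, the operator x d/dx - β turns the hypergeometric series into -β times the binomial
  -- series of (1-x)^(-b).
  have h6 : ∀ k : ℕ, (k : ℝ) * (p k fun _ => x) - β * (p k fun _ => x) =
      -β * ((FormalMultilinearSeries.ofScalars ℝ (fun n : ℕ => Ring.choose (b + n - 1) n)) k
        fun _ => x) := by
    intro k
    rw [hp, ordinaryHypergeometricSeries_apply_eq, FormalMultilinearSeries.ofScalars_apply_eq,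
      ← Ring.multichoose_eq]
    have hm := Ring.factorial_nsmul_multichoose_eq_ascPochhammer b k
    rw [Polynomial.ascPochhammer_smeval_eq_eval, nsmul_eq_mul] at hm
    rw [← hm]
    have hc : (ascPochhammer ℝ k).eval (1 - β) ≠ 0 := by
      rw [Ne, ascPochhammer_eval_eq_zero_iff]
      rintro ⟨j, -, hj⟩
      have := hk (j + 1); push_cast at this; apply this; linarith
    have ha := ascPochhammer_neg_eval β k
    have hf : (k.factorial : ℝ) ≠ 0 := by positivity
    simp only [smul_eq_mul]
    field_simp
    linear_combination (Ring.multichoose b k * x ^ k) * ha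
  simp_rw [h6] at h5
  have h7 := h5.unique (h3.mul_left (-β))
  have h8 : 0 < 1 - x := by linarith [(abs_lt.1 hx).2]
  rw [Real.rpow_neg h8.le]
  rw [one_div] at h7
  linear_combination h7

/-- Two solutions of `z R' = β R + g` which agree to the order `o(z^β)` at `0` agree. -/
lemma eq_zero_of_mul_deriv_eq {β : ℝ} {D : ℝ → ℝ} {b : ℝ}
    (hD : ∀ z ∈ Ioo 0 b, ∃ d, HasDerivAt D d z ∧ z * d = β * D z)
    (h0 : Tendsto (fun z => D z * z ^ (-β)) (𝓝[>] 0) (𝓝 0)) : ∀ z ∈ Ioo 0 b, D z = 0 := by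
  have hder : ∀ z ∈ Ioo 0 b, HasDerivAt (fun z => D z * z ^ (-β)) 0 z := by
    intro z hz
    obtain ⟨d, hd, he⟩ := hD z hz
    have h1 := hd.mul (Real.hasDerivAt_rpow_const (p := -β) (Or.inl hz.1.ne'))
    refine HasDerivAt.congr_deriv h1 ?_
    have hz' : z ^ (-β) = z ^ (-β - 1) * z := by
      rw [← Real.rpow_add_one hz.1.ne']; ring_nf
    rw [hz']
    linear_combination z ^ (-β - 1) * he
  intro z hz
  have hb : 0 < b := hz.1.trans hz.2
  have hc : ∀ y ∈ Ioo 0 b, D y * y ^ (-β) = D z * z ^ (-β) := by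
    intro y hy
    exact isOpen_Ioo.is_const_of_deriv_eq_zero isPreconnected_Ioo
      (fun w hw => (hder w hw).differentiableAt.differentiableWithinAt)
      (fun w hw => (hder w hw).deriv) hy hz
  have h1 : Tendsto (fun z => D z * z ^ (-β)) (𝓝[>] 0) (𝓝 (D z * z ^ (-β))) := by
    refine tendsto_const_nhds.congr' ?_
    filter_upwards [Ioo_mem_nhdsGT hb] with y hy
    exact (hc y hy).symm
  have h2 := tendsto_nhds_unique h1 h0
  exact (mul_eq_zero.1 h2).resolve_right (Real.rpow_pos_of_pos hz.1 _).ne'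

/-- The difference is O(z) by differentiability, and z^(1-β) tends to 0. This supplies the initial
condition in `eq_zero_of_mul_deriv_eq`, and its counterpart at infinity after the substitution z = X
/ u^α. -/
lemma tendsto_sub_mul_rpow_zero {β D : ℝ} (hβ' : β < 1) {R : ℝ → ℝ} (h : HasDerivAt R D 0) :
    Tendsto (fun z => (R z - R 0) * z ^ (-β)) (𝓝[>] 0) (𝓝 0) := by
  have h1 := h.tendsto_slope_zero_right
  have h2 : Tendsto (fun z : ℝ => z ^ (1 - β)) (𝓝[>] 0) (𝓝 0) := by
    have := (Real.continuousAt_rpow_const 0 (1 - β) (Or.inr (by linarith))).tendsto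
    rw [Real.zero_rpow (by linarith)] at this
    exact this.mono_left nhdsWithin_le_nhds
  have h3 := h1.mul h2
  rw [mul_zero] at h3
  refine h3.congr' ?_
  filter_upwards [self_mem_nhdsWithin] with z hz
  have hz' : (0 : ℝ) < z := hz
  rw [zero_add, smul_eq_mul, Real.rpow_sub hz', Real.rpow_one, Real.rpow_neg hz'.le]
  field_simp

variable {α : ℝ} {n : ℕ}

/-- The analytic continuation of `hypS`, by Pfaff's transformation. -/
def pfaffS (α : ℝ) (n : ℕ) (z : ℝ) : ℝ :=
  (1 + z) ^ (2 / α) * ordinaryHypergeometric (-(2 / α)) (1 - 2 / α - n) (1 - 2 / α) (z / (1 + z))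

/-- For z ≥ 0 the argument z/(1+z) stays in [0,1), so the power series is available on the whole
half-line. The chain rule carries its differential equation over to the one that z ↦ ₂F₁(-β, n; 1-β;
-z) satisfies near 0. -/
lemma hasDerivAt_pfaffS (hα : 2 < α) {z : ℝ} (hz : 0 ≤ z) :
    ∃ D, HasDerivAt (pfaffS α n) D z ∧
      z * D = 2 / α * pfaffS α n z - 2 / α * ((1 + z) ^ n)⁻¹ := by
  have hβ : 0 < 2 / α := by positivity
  have hβ' : 2 / α < 1 := by rw [div_lt_one (by linarith)]; exact hα
  set β := 2 / α with hβd
  have hz1 : 0 < 1 + z := by linarith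
  -- The second parameter is no nonpositive integer: that would make k + 1 = β + n with 0 < β < 1.
  have hb : ∀ k : ℕ, (k : ℝ) ≠ -(1 - β - n) := by
    intro k hk
    have h1 : (k : ℝ) + 1 = β + n := by linarith
    have h2 : (n : ℝ) < k + 1 := by linarith
    have h3 : (k : ℝ) < n := by linarith
    have h2' : n < k + 1 := by exact_mod_cast h2
    have h3' : k < n := by exact_mod_cast h3
    omega
  have hy : |z / (1 + z)| < 1 := by
    rw [abs_of_nonneg (by positivity), div_lt_one hz1]; linarith
  obtain ⟨d, hd, he⟩ := hasDerivAt_hypergeometric hβ hβ' hb hy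
  have hq : HasDerivAt (fun z : ℝ => z / (1 + z)) (((1 + z) ^ 2)⁻¹) z := by
    have := (hasDerivAt_id z).div ((hasDerivAt_id z).const_add 1) hz1.ne'
    refine HasDerivAt.congr_deriv this ?_
    simp only [id]
    field_simp
    ring
  have hp : HasDerivAt (fun z : ℝ => (1 + z) ^ β) (β * (1 + z) ^ (β - 1)) z := by
    have := ((hasDerivAt_id z).const_add 1).rpow_const (p := β) (Or.inl hz1.ne')
    refine HasDerivAt.congr_deriv this ?_
    simp
  have hh := hp.mul (hd.comp z hq)
  refine ⟨_, hh, ?_⟩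
  have h1 : 1 - z / (1 + z) = (1 + z)⁻¹ := by field_simp; ring
  have h2 : (1 - z / (1 + z)) ^ (-(1 - β - n)) = (1 + z) * ((1 + z) ^ n)⁻¹ * ((1 + z) ^ β)⁻¹ := by
    rw [h1, Real.inv_rpow hz1.le, Real.rpow_neg hz1.le, inv_inv, Real.rpow_sub hz1,
      Real.rpow_sub hz1, Real.rpow_one, Real.rpow_natCast]
    field_simp
  rw [h2] at he
  have h3 : (1 + z) ^ (β - 1) = (1 + z) ^ β / (1 + z) := by
    rw [Real.rpow_sub hz1, Real.rpow_one]
  have hpos : 0 < (1 + z) ^ β := Real.rpow_pos_of_pos hz1 _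
  have h4 : z * d = (1 + z) * (β * ordinaryHypergeometric (-β) (1 - β - n) (1 - β) (z / (1 + z)) -
      β * ((1 + z) * ((1 + z) ^ n)⁻¹ * ((1 + z) ^ β)⁻¹)) := by
    rw [← he]; field_simp
  unfold pfaffS
  rw [← hβd]
  simp only [Function.comp_apply]
  rw [h3]
  generalize ordinaryHypergeometric (-β) (1 - β - n) (1 - β) (z / (1 + z)) = H at *
  have h5 : (1 + z) ^ β * (z * d * ((1 + z) ^ 2)⁻¹) =
      (1 + z) ^ β / (1 + z) * (β * H) - β * ((1 + z) ^ n)⁻¹ := by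
    rw [h4]
    generalize ((1 + z) ^ n)⁻¹ = A
    field_simp
  have h6 : (1 + z) ^ β = (1 + z) * ((1 + z) ^ β / (1 + z)) := by field_simp
  linear_combination h5 - β * H * h6

lemma pfaffS_zero : pfaffS α n 0 = 1 := by
  simp [pfaffS, ordinaryHypergeometric_zero]

/-- For z ≥ 1 `gaussHyp` is defined by Pfaff's transformation. For z < 1 both functions solve the
same equation, equal 1 at 0 and are differentiable there, so their difference is o(z^β) and
vanishes. -/
lemma hypS_eq_pfaffS (hα : 2 < α) (hn : 0 < n) {z : ℝ} (hz : 0 ≤ z) :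
    hypS α n z = pfaffS α n z := by
  have hβ : 0 < 2 / α := by positivity
  have hβ' : 2 / α < 1 := by rw [div_lt_one (by linarith)]; exact hα
  have hb : ∀ k : ℕ, (k : ℝ) ≠ -(n : ℝ) := by
    intro k hk
    have h1 : (0 : ℝ) < n := by exact_mod_cast hn
    have h2 : (0 : ℝ) ≤ k := k.cast_nonneg
    linarith
  unfold hypS gaussHyp
  split_ifs with h
  swap
  · have : -z / (-z - 1) = z / (1 + z) := by
      rw [show -z - 1 = -(1 + z) by ring, neg_div_neg_eq]
    rw [pfaffS, this, neg_neg, sub_neg_eq_add]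
  rw [abs_neg, abs_of_nonneg hz] at h
  rcases hz.eq_or_lt with rfl | hz0
  · rw [pfaffS_zero, neg_zero, ordinaryHypergeometric_zero]
  set F : ℝ → ℝ := ordinaryHypergeometric (-(2 / α)) (n : ℝ) (1 - 2 / α) with hF
  have hFd : ∀ z : ℝ, |z| < 1 → ∃ D, HasDerivAt (fun z => F (-z)) D z ∧
      z * D = 2 / α * F (-z) - 2 / α * ((1 + z) ^ n)⁻¹ := by
    intro z hz
    obtain ⟨d, hd, he⟩ := hasDerivAt_hypergeometric hβ hβ' hb (x := -z) (by rwa [abs_neg])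
    refine ⟨_, HasDerivAt.scomp (g₁ := F) z hd (hasDerivAt_neg z), ?_⟩
    rw [sub_neg_eq_add, Real.rpow_neg (by linarith [(abs_lt.1 hz).1]), Real.rpow_natCast] at he
    rw [← he]; simp
  have key := eq_zero_of_mul_deriv_eq (β := 2 / α) (b := 1)
    (D := fun z => F (-z) - pfaffS α n z) (fun z hz => ?_) ?_ z ⟨hz0, h⟩
  · exact sub_eq_zero.1 key
  · obtain ⟨d, hd, he⟩ := hFd z (by rw [abs_of_pos hz.1]; exact hz.2)
    obtain ⟨d', hd', he'⟩ := hasDerivAt_pfaffS (n := n) hα hz.1.le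
    exact ⟨_, hd.sub hd', by linear_combination he - he'⟩
  · obtain ⟨d, hd, -⟩ := hFd 0 (by simp)
    obtain ⟨d', hd', -⟩ := hasDerivAt_pfaffS (n := n) hα le_rfl
    have := tendsto_sub_mul_rpow_zero hβ' (hd.sub hd')
    simpa [pfaffS_zero, hF, ordinaryHypergeometric_zero] using this

/-- The integral representation of `hypS`. -/
lemma integral_Ioi_sub_hypS (hα : 2 < α) (hn : 0 < n) {r X : ℝ} (hr : 0 < r) (hX : 0 ≤ X) :
    IntegrableOn (fun u : ℝ => 2 * u * (1 - ((1 + X / u ^ α) ^ n)⁻¹)) (Ioi r) ∧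
    ∫ u in Ioi r, 2 * u * (1 - ((1 + X / u ^ α) ^ n)⁻¹) = r ^ 2 * (hypS α n (X / r ^ α) - 1) := by
  have hz0 : ∀ u : ℝ, r ≤ u → 0 ≤ X / u ^ α := fun u hu => by
    have : 0 ≤ u := hr.le.trans hu
    positivity
  -- By the differential equation, -u²(S(X/u^α) - 1) is an antiderivative; it tends to 0 at infinity
  -- because α > 2.
  have hder : ∀ u : ℝ, r ≤ u → HasDerivAt (fun u => -(u ^ 2 * (pfaffS α n (X / u ^ α) - 1)))
      (2 * u * (1 - ((1 + X / u ^ α) ^ n)⁻¹)) u := by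
    intro u hu
    have hu0 : 0 < u := hr.trans_le hu
    obtain ⟨D, hD, he⟩ := hasDerivAt_pfaffS (n := n) hα (hz0 u hu)
    have hq : HasDerivAt (fun u : ℝ => X / u ^ α) (-(α / u) * (X / u ^ α)) u := by
      have h1 := (Real.hasDerivAt_rpow_const (p := α) (Or.inl hu0.ne')).inv
        (Real.rpow_pos_of_pos hu0 α).ne'
      have h2 := h1.const_mul X
      simp only [div_eq_mul_inv]
      refine HasDerivAt.congr_deriv h2 ?_
      rw [Real.rpow_sub_one hu0.ne']
      have := (Real.rpow_pos_of_pos hu0 α).ne'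
      field_simp
    have h1 := ((hasDerivAt_pow 2 u).mul ((hD.comp u hq).sub_const 1)).neg
    refine HasDerivAt.congr_deriv h1 ?_
    have hα0 : α ≠ 0 := by linarith
    have he' : α * (X / u ^ α * D) = 2 * pfaffS α n (X / u ^ α) -
        2 * ((1 + X / u ^ α) ^ n)⁻¹ := by
      rw [he]; field_simp
    simp only [Function.comp_apply]
    have hu2 : u ^ 2 * (D * (-(α / u) * (X / u ^ α))) = -(u * (α * (X / u ^ α * D))) := by
      field_simp
    rw [hu2, he']
    push_cast
    ring
  have hnn : ∀ u ∈ Ioi r, 0 ≤ 2 * u * (1 - ((1 + X / u ^ α) ^ n)⁻¹) := by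
    intro u hu
    have hu0 : 0 < u := hr.trans hu
    have h1 : 1 ≤ (1 + X / u ^ α) ^ n := one_le_pow₀ (by linarith [hz0 u (le_of_lt hu)])
    have h2 : ((1 + X / u ^ α) ^ n)⁻¹ ≤ 1 := inv_le_one_of_one_le₀ h1
    have : 0 ≤ 1 - ((1 + X / u ^ α) ^ n)⁻¹ := by linarith
    positivity
  have hlim : Tendsto (fun u => -(u ^ 2 * (pfaffS α n (X / u ^ α) - 1))) atTop (𝓝 0) := by
    rcases hX.eq_or_lt with rfl | hX0
    · simp [pfaffS_zero]
    obtain ⟨D, hD, -⟩ := hasDerivAt_pfaffS (n := n) hα le_rfl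
    have hβ' : 2 / α < 1 := by rw [div_lt_one (by linarith)]; exact hα
    have h1 := tendsto_sub_mul_rpow_zero hβ' hD
    have h2 : Tendsto (fun u : ℝ => X / u ^ α) atTop (𝓝[>] 0) := by
      rw [tendsto_nhdsWithin_iff]
      refine ⟨tendsto_const_nhds.div_atTop (tendsto_rpow_atTop (by linarith)), ?_⟩
      filter_upwards [eventually_gt_atTop 0] with u hu
      exact div_pos hX0 (Real.rpow_pos_of_pos hu _)
    have h3 := ((h1.comp h2).const_mul (X ^ (2 / α))).neg
    rw [mul_zero, neg_zero] at h3
    refine h3.congr' ?_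
    filter_upwards [eventually_gt_atTop 0] with u hu
    simp only [Function.comp_apply, pfaffS_zero]
    have hu' := Real.rpow_pos_of_pos hu α
    have h4 : (X / u ^ α) ^ (-(2 / α)) = u ^ 2 / X ^ (2 / α) := by
      rw [Real.rpow_neg (by positivity), Real.div_rpow hX hu'.le, ← Real.rpow_mul hu.le,
        mul_div_cancel₀ _ (by linarith : α ≠ 0), inv_div]
      norm_cast
    have := (Real.rpow_pos_of_pos hX0 (2 / α)).ne'
    rw [h4]
    field_simp
  have hcont : ContinuousWithinAt (fun u => -(u ^ 2 * (pfaffS α n (X / u ^ α) - 1))) (Ici r) r :=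
    (hder r le_rfl).continuousAt.continuousWithinAt
  refine ⟨integrableOn_Ioi_deriv_of_nonneg hcont (fun u hu => hder u (le_of_lt hu)) hnn hlim, ?_⟩
  rw [integral_Ioi_of_hasDerivAt_of_nonneg hcont (fun u hu => hder u (le_of_lt hu)) hnn hlim,
    hypS_eq_pfaffS hα hn (hz0 r le_rfl)]
  ring

end HetNetASE

namespace HetNetASE

open Set
open scoped ENNReal

/-! ### Integrals over discs of the Laplace transform of a Gamma variable -/

lemma lintegral_rpow_mul_exp {a r : ℝ} (ha : 0 < a) (hr : 0 < r) :
    ∫⁻ t in Ioi (0 : ℝ), ENNReal.ofReal (t ^ (a - 1) * Real.exp (-(r * t))) =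
      ENNReal.ofReal ((1 / r) ^ a * Real.Gamma a) := by
  rw [← Real.integral_rpow_mul_exp_neg_mul_Ioi ha hr, ofReal_integral_eq_lintegral_ofReal]
  -- A non-integrable function would have integral 0 by convention, contradicting the positive
  -- value.
  · by_contra h
    have h1 := Real.integral_rpow_mul_exp_neg_mul_Ioi ha hr
    rw [integral_undef h] at h1
    have : 0 < (1 / r) ^ a * Real.Gamma a :=
      mul_pos (Real.rpow_pos_of_pos (by positivity) _) (Real.Gamma_pos_of_pos ha)
    linarith
  · filter_upwards [ae_restrict_mem measurableSet_Ioi] with t ht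
    have : (0 : ℝ) < t := ht
    positivity

lemma integral_Ioc_two_mul {r : ℝ} (hr : 0 ≤ r) : ∫ v in Ioc (0 : ℝ) r, 2 * v = r ^ 2 := by
  rw [← intervalIntegral.integral_of_le hr, intervalIntegral.integral_const_mul, integral_id]
  ring

lemma lintegral_Ioo_two_mul {r : ℝ} (hr : 0 ≤ r) :
    ∫⁻ u in Ioo 0 r, ENNReal.ofReal (2 * u) = ENNReal.ofReal (r ^ 2) := by
  rw [← ofReal_integral_eq_lintegral_ofReal, ← integral_Ioc_eq_integral_Ioo,
    integral_Ioc_two_mul hr]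
  · exact ((continuous_const.mul continuous_id).integrableOn_Icc (a := 0) (b := r)).mono_set
      Ioo_subset_Icc_self
  · filter_upwards [ae_restrict_mem measurableSet_Ioo] with t ht
    have : (0 : ℝ) < t := ht.1
    positivity

/-- Exhibits 1 - (1+w)^(-n) as an integral over v ≤ w, so that Tonelli's theorem can be used in the
plane. -/
lemma one_sub_inv_one_add_pow_eq {n : ℕ} {w : ℝ} (hw : 0 ≤ w) :
    ENNReal.ofReal (1 - ((1 + w) ^ n)⁻¹) =
      ∫⁻ v in Ioc 0 w, ENNReal.ofReal (n * ((1 + v) ^ (n + 1))⁻¹) := by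
  have hd : ∀ v ∈ uIcc 0 w, HasDerivAt (fun v : ℝ => -((1 + v) ^ n)⁻¹)
      (n * ((1 + v) ^ (n + 1))⁻¹) v := by
    intro v hv
    rw [uIcc_of_le hw] at hv
    have h1 : 0 < 1 + v := by linarith [hv.1]
    have h2 := ((((hasDerivAt_id v).const_add 1).pow n).inv (pow_pos h1 n).ne').neg
    refine HasDerivAt.congr_deriv h2 ?_
    rcases n with _ | n
    · simp
    · simp only [id, Nat.add_sub_cancel, Pi.pow_apply]
      field_simp
      ring
  have hc : ContinuousOn (fun v : ℝ => n * ((1 + v) ^ (n + 1))⁻¹) (Icc 0 w) := by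
    refine continuousOn_const.mul (ContinuousOn.inv₀ (by fun_prop) fun v hv => ?_)
    have h1 : 0 < 1 + v := by linarith [hv.1]
    positivity
  have h := intervalIntegral.integral_eq_sub_of_hasDerivAt hd
    (hc.intervalIntegrable_of_Icc hw)
  rw [← ofReal_integral_eq_lintegral_ofReal, ← intervalIntegral.integral_of_le hw, h]
  · congr 1; simp; ring
  · exact hc.integrableOn_Icc.mono_set Ioc_subset_Icc_self
  · filter_upwards [ae_restrict_mem measurableSet_Ioc] with v hv
    have : (0 : ℝ) < v := hv.1
    positivity

variable {α : ℝ} {n : ℕ}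

/-- The integral of `1 - (1 + X u^(-α))^(-n)` over the plane. -/
lemma lintegral_Ioi_zero_eq_gammaDelta (hα : 2 < α) (hn : 0 < n) {X : ℝ} (hX : 0 ≤ X) :
    ∫⁻ u in Ioi (0 : ℝ), ENNReal.ofReal (2 * u * (1 - ((1 + X / u ^ α) ^ n)⁻¹)) =
      ENNReal.ofReal (gammaDelta α n X) := by
  have hα0 : 0 < α := by linarith
  have hβ : 0 < 2 / α := by positivity
  have hβ' : 2 / α < 1 := by rw [div_lt_one hα0]; exact hα
  have hn' : (0 : ℝ) < n := by exact_mod_cast hn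
  rcases hX.eq_or_lt with rfl | hX0
  · simp [gammaDelta, Real.zero_rpow hβ.ne']
  set β := 2 / α with hβd
  set k : ℝ → ℝ≥0∞ := fun v => ENNReal.ofReal (n * ((1 + v) ^ (n + 1))⁻¹) with hk
  have hkm : Measurable k := by fun_prop
  -- as a double integral
  have hS : MeasurableSet {q : ℝ × ℝ | q.2 ≤ X / q.1 ^ α} :=
    measurableSet_le measurable_snd (measurable_const.div (measurable_fst.pow_const _))
  have e1 : ∀ u ∈ Ioi (0 : ℝ), ENNReal.ofReal (2 * u * (1 - ((1 + X / u ^ α) ^ n)⁻¹)) =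
      ∫⁻ v in Ioi (0 : ℝ), {q : ℝ × ℝ | q.2 ≤ X / q.1 ^ α}.indicator
        (fun q => ENNReal.ofReal (2 * q.1) * k q.2) (u, v) := by
    intro u hu
    have hu' : (0 : ℝ) < u := hu
    have hw : 0 ≤ X / u ^ α := by positivity
    rw [ENNReal.ofReal_mul (by positivity), one_sub_inv_one_add_pow_eq hw,
      ← lintegral_const_mul _ hkm, ← Ioi_inter_Iic, inter_comm,
      ← Measure.restrict_restrict measurableSet_Iic, ← lintegral_indicator measurableSet_Iic]
    rfl
  rw [setLIntegral_congr_fun measurableSet_Ioi e1, lintegral_lintegral_swap]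
  swap
  · have hf : Measurable fun q : ℝ × ℝ => ENNReal.ofReal (2 * q.1) * k q.2 := by fun_prop
    exact (hf.indicator hS).aemeasurable
  -- For fixed v the condition v ≤ X/u^α confines u to (0, (X/v)^(1/α)], whose weight is X^β v^(-β).
  -- The remaining factor (1+v)^(-(n+1)) is written as a Gamma integral in a new variable y, which
  -- separates the variables.
  have e2 : ∀ v ∈ Ioi (0 : ℝ), ∫⁻ u in Ioi (0 : ℝ), {q : ℝ × ℝ | q.2 ≤ X / q.1 ^ α}.indicator
        (fun q => ENNReal.ofReal (2 * q.1) * k q.2) (u, v) =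
      ∫⁻ y in Ioi (0 : ℝ), ENNReal.ofReal (X ^ β * n / Real.Gamma (n + 1)) *
        ENNReal.ofReal (v ^ ((1 - β) - 1) * Real.exp (-(y * v))) *
          ENNReal.ofReal (y ^ n * Real.exp (-(1 * y))) := by
    intro v hv
    have hv' : (0 : ℝ) < v := hv
    have hXv : 0 < X / v := by positivity
    have h1 : ∀ u ∈ Ioi (0 : ℝ), {q : ℝ × ℝ | q.2 ≤ X / q.1 ^ α}.indicator
        (fun q => ENNReal.ofReal (2 * q.1) * k q.2) (u, v) =
        (Iic ((X / v) ^ (1 / α))).indicator (fun u => ENNReal.ofReal (2 * u) * k v) u := by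
      intro u hu
      have hu' : (0 : ℝ) < u := hu
      have h2 : v ≤ X / u ^ α ↔ u ≤ (X / v) ^ (1 / α) := by
        rw [one_div, ← Real.rpow_le_rpow_iff hu'.le (by positivity) hα0,
          Real.rpow_inv_rpow hXv.le hα0.ne', le_div_iff₀ (by positivity), le_div_iff₀ hv', mul_comm]
      simp only [indicator_apply, mem_ofPred_eq, mem_Iic, h2]
    rw [setLIntegral_congr_fun measurableSet_Ioi h1, lintegral_indicator measurableSet_Iic,
      Measure.restrict_restrict measurableSet_Iic, inter_comm, Ioi_inter_Iic,
      lintegral_mul_const _ (by fun_prop), ← restrict_Ioo_eq_restrict_Ioc,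
      lintegral_Ioo_two_mul (by positivity)]
    have h3 : ((X / v) ^ (1 / α)) ^ 2 = X ^ β * v ^ ((1 - β) - 1) := by
      rw [← Real.rpow_natCast, ← Real.rpow_mul hXv.le, Real.div_rpow hX hv'.le, hβd,
        show 1 - 2 / α - 1 = -(2 / α) by ring, Real.rpow_neg hv'.le]
      norm_num
      rw [show α⁻¹ * 2 = 2 / α by ring]
      field_simp
    have hG : (1 / (1 + v)) ^ ((n : ℝ) + 1) = ((1 + v) ^ (n + 1))⁻¹ := by
      rw [one_div, Real.inv_rpow (by positivity)]
      norm_cast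
    have hGp : 0 < Real.Gamma (n + 1) := Real.Gamma_pos_of_pos (by positivity)
    have h4 : k v = ∫⁻ y in Ioi (0 : ℝ), ENNReal.ofReal (n / Real.Gamma (n + 1)) *
        ENNReal.ofReal (y ^ (((n : ℝ) + 1) - 1) * Real.exp (-((1 + v) * y))) := by
      rw [lintegral_const_mul _ (by fun_prop),
        lintegral_rpow_mul_exp (by positivity) (by positivity), hG,
        ← ENNReal.ofReal_mul (by positivity), hk]
      field_simp
    rw [h4, ← lintegral_const_mul _ (by fun_prop)]
    refine setLIntegral_congr_fun measurableSet_Ioi fun y hy => ?_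
    have hy' : (0 : ℝ) < y := hy
    rw [← ENNReal.ofReal_mul (by positivity), ← ENNReal.ofReal_mul (by positivity),
      ← ENNReal.ofReal_mul (by positivity), ← ENNReal.ofReal_mul (by positivity), h3,
      add_sub_cancel_right, Real.rpow_natCast, show -((1 + v) * y) = -(y * v) + -(1 * y) by ring,
      Real.exp_add]
    congr 1
    ring
  rw [setLIntegral_congr_fun measurableSet_Ioi e2, lintegral_lintegral_swap]
  swap
  · exact Measurable.aemeasurable (by fun_prop)
  -- Integrating over v first gives Γ(1-β) y^(β-1), and the integral over y that is left gives
  -- Γ(n+β).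
  have e3 : ∀ y ∈ Ioi (0 : ℝ), ∫⁻ v in Ioi (0 : ℝ), ENNReal.ofReal (X ^ β * n / Real.Gamma (n + 1)) *
        ENNReal.ofReal (v ^ ((1 - β) - 1) * Real.exp (-(y * v))) *
          ENNReal.ofReal (y ^ n * Real.exp (-(1 * y))) =
      ENNReal.ofReal (X ^ β * n / Real.Gamma (n + 1) * Real.Gamma (1 - β)) *
        ENNReal.ofReal (y ^ ((n + β) - 1) * Real.exp (-(1 * y))) := by
    intro y hy
    have hy' : (0 : ℝ) < y := hy
    have hGp : 0 < Real.Gamma (n + 1) := Real.Gamma_pos_of_pos (by positivity)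
    have hGb : 0 < Real.Gamma (1 - β) := Real.Gamma_pos_of_pos (by linarith)
    rw [lintegral_mul_const _ (by fun_prop), lintegral_const_mul _ (by fun_prop),
      lintegral_rpow_mul_exp (by linarith) hy', ← ENNReal.ofReal_mul (by positivity),
      ← ENNReal.ofReal_mul (by positivity), ← ENNReal.ofReal_mul (by positivity)]
    congr 1
    have h1 : (1 / y) ^ (1 - β) * y ^ n = y ^ ((n + β) - 1) := by
      rw [one_div, Real.inv_rpow hy'.le, ← Real.rpow_neg hy'.le, ← Real.rpow_natCast,
        ← Real.rpow_add hy']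
      ring_nf
    rw [← h1]
    ring
  rw [setLIntegral_congr_fun measurableSet_Ioi e3, lintegral_const_mul _ (by fun_prop),
    lintegral_rpow_mul_exp (by positivity) one_pos]
  have hGp : 0 < Real.Gamma n := Real.Gamma_pos_of_pos (by positivity)
  have hGb : 0 < Real.Gamma (1 - β) := Real.Gamma_pos_of_pos (by linarith)
  rw [← ENNReal.ofReal_mul (by rw [Real.Gamma_add_one hn'.ne']; positivity), gammaDelta,
    Real.Gamma_add_one hn'.ne', ← hβd]
  congr 1
  simp only [div_one, Real.one_rpow]
  field_simp

/-- The average of `(1 + z v^(-α))^(-n)` over the unit disc. -/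
def discAvg (α : ℝ) (n : ℕ) (z : ℝ) : ℝ := ∫ v in Ioc (0 : ℝ) 1, 2 * v * ((1 + z / v ^ α) ^ n)⁻¹

lemma inv_one_add_div_pow_mem {z v : ℝ} (hz : 0 ≤ z) (hv : 0 ≤ v) :
    ((1 + z / v ^ α) ^ n)⁻¹ ∈ Icc (0 : ℝ) 1 := by
  have h0 : 0 ≤ z / v ^ α := by positivity
  exact ⟨by positivity, inv_le_one_of_one_le₀ (one_le_pow₀ (by linarith))⟩

lemma measurable_discIntegrand (X : ℝ) :
    Measurable fun v : ℝ => 2 * v * ((1 + X / v ^ α) ^ n)⁻¹ := by fun_prop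

lemma integrableOn_discIntegrand {X : ℝ} (hX : 0 ≤ X) (r : ℝ) :
    IntegrableOn (fun v : ℝ => 2 * v * ((1 + X / v ^ α) ^ n)⁻¹) (Ioc 0 r) := by
  refine Measure.integrableOn_of_bounded (M := 2 * r) measure_Ioc_lt_top.ne
    (measurable_discIntegrand X).aestronglyMeasurable ?_
  filter_upwards [ae_restrict_mem measurableSet_Ioc] with v hv
  have h := inv_one_add_div_pow_mem (α := α) (n := n) hX hv.1.le
  have hv0 : 0 < v := hv.1
  rw [Real.norm_eq_abs, abs_of_nonneg (mul_nonneg (by positivity) h.1)]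
  nlinarith [h.1, h.2, hv.2]

/-- Scaling v ↦ rv reduces a disc of radius r to the unit disc. -/
lemma integral_discIntegrand {X r : ℝ} (hr : 0 < r) :
    ∫ v in Ioc (0 : ℝ) r, 2 * v * ((1 + X / v ^ α) ^ n)⁻¹ = r ^ 2 * discAvg α n (X / r ^ α) := by
  rw [discAvg, ← intervalIntegral.integral_of_le hr.le,
    ← intervalIntegral.integral_of_le zero_le_one]
  have h := intervalIntegral.mul_integral_comp_mul_left (a := (0 : ℝ)) (b := 1)
    (f := fun v : ℝ => 2 * v * ((1 + X / v ^ α) ^ n)⁻¹) (c := r)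
  rw [mul_zero, mul_one] at h
  rw [← h, pow_two, mul_assoc, ← intervalIntegral.integral_const_mul r (fun x : ℝ => 2 * x * _)]
  congr 1
  refine intervalIntegral.integral_congr fun v hv => ?_
  rw [uIcc_of_le zero_le_one] at hv
  rw [Real.mul_rpow hr.le hv.1, div_div]
  ring

lemma discAvg_mem {z : ℝ} (hz : 0 ≤ z) : discAvg α n z ∈ Icc (0 : ℝ) 1 := by
  constructor
  · refine setIntegral_nonneg measurableSet_Ioc fun v hv => ?_
    exact mul_nonneg (by linarith [hv.1]) (inv_one_add_div_pow_mem hz hv.1.le).1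
  · have h1 : ∫ v in Ioc (0 : ℝ) 1, 2 * v = 1 := by rw [integral_Ioc_two_mul zero_le_one]; simp
    refine le_of_le_of_eq ?_ h1
    refine setIntegral_mono_on (integrableOn_discIntegrand hz 1) ?_ measurableSet_Ioc fun v hv => ?_
    · exact ((continuous_const.mul continuous_id).integrableOn_Icc (a := 0) (b := 1)).mono_set
        Ioc_subset_Icc_self
    · have := (inv_one_add_div_pow_mem (α := α) (n := n) hz hv.1.le).2
      nlinarith [hv.1]

lemma discAvg_zero : discAvg α n 0 = 1 := by
  have h := integral_Ioc_two_mul zero_le_one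
  simpa [discAvg] using h

lemma continuousOn_discAvg : ContinuousOn (discAvg α n) (Ici 0) := by
  unfold discAvg
  refine continuousOn_of_dominated (bound := fun _ => 2) (fun z _ =>
    (measurable_discIntegrand z).aestronglyMeasurable) (fun z hz => ?_)
    (by simp) ?_
  · filter_upwards [ae_restrict_mem measurableSet_Ioc] with v hv
    have h := inv_one_add_div_pow_mem (α := α) (n := n) hz hv.1.le
    have hv0 : 0 < v := hv.1
    rw [Real.norm_eq_abs, abs_of_nonneg (mul_nonneg (by positivity) h.1)]
    nlinarith [h.1, h.2, hv.2]
  · filter_upwards [ae_restrict_mem measurableSet_Ioc] with v hv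
    refine continuousOn_const.mul (ContinuousOn.inv₀ (by fun_prop) fun z hz => ?_)
    have h0 : 0 ≤ z / v ^ α := div_nonneg hz (Real.rpow_nonneg hv.1.le _)
    positivity

/-- The integral of `1 - (1 + X u^(-α))^(-n)` over a disc. -/
lemma lintegral_Ioc_one_sub {X r : ℝ} (hX : 0 ≤ X) (hr : 0 < r) :
    ∫⁻ u in Ioc (0 : ℝ) r, ENNReal.ofReal (2 * u * (1 - ((1 + X / u ^ α) ^ n)⁻¹)) =
      ENNReal.ofReal (r ^ 2 * (1 - discAvg α n (X / r ^ α))) := by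
  have h2 : IntegrableOn (fun u : ℝ => 2 * u) (Ioc 0 r) :=
    ((continuous_const.mul continuous_id).integrableOn_Icc (a := 0) (b := r)).mono_set
      Ioc_subset_Icc_self
  have h1 := integral_Ioc_two_mul hr.le
  simp_rw [mul_sub, mul_one]
  rw [← ofReal_integral_eq_lintegral_ofReal, integral_sub h2 (integrableOn_discIntegrand hX r),
    h1, integral_discIntegrand hr]
  · exact h2.sub (integrableOn_discIntegrand hX r)
  · filter_upwards [ae_restrict_mem measurableSet_Ioc] with v hv
    have := (inv_one_add_div_pow_mem (α := α) (n := n) hX hv.1.le).2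
    simp only [Pi.zero_apply]
    nlinarith [hv.1]

/-- The integral of `1 - (1 + X u^(-α))^(-n)` over the complement of a disc. -/
lemma lintegral_Ioi_one_sub (hα : 2 < α) (hn : 0 < n) {X r : ℝ} (hX : 0 ≤ X) (hr : 0 < r) :
    ∫⁻ u in Ioi r, ENNReal.ofReal (2 * u * (1 - ((1 + X / u ^ α) ^ n)⁻¹)) =
      ENNReal.ofReal (r ^ 2 * (hypS α n (X / r ^ α) - 1)) := by
  obtain ⟨h1, h2⟩ := integral_Ioi_sub_hypS hα hn hr hX
  rw [← ofReal_integral_eq_lintegral_ofReal h1, h2]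
  filter_upwards [ae_restrict_mem measurableSet_Ioi] with v hv
  have hv0 : 0 < v := hr.trans hv
  have := (inv_one_add_div_pow_mem (α := α) (n := n) hX hv0.le).2
  simp only [Pi.zero_apply]
  nlinarith

lemma one_le_hypS (hα : 2 < α) (hn : 0 < n) {z : ℝ} (hz : 0 ≤ z) : 1 ≤ hypS α n z := by
  have h2 := (integral_Ioi_sub_hypS hα hn one_pos hz).2
  have h3 : 0 ≤ ∫ u in Ioi (1 : ℝ), 2 * u * (1 - ((1 + z / u ^ α) ^ n)⁻¹) := by
    refine setIntegral_nonneg measurableSet_Ioi fun u hu => ?_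
    have hu' : (1 : ℝ) < u := hu
    have := (inv_one_add_div_pow_mem (α := α) (n := n) hz (by linarith)).2
    exact mul_nonneg (by linarith) (by linarith)
  rw [h2, Real.one_rpow, div_one] at h3
  linarith

lemma gammaDelta_pos (hα : 2 < α) (hn : 0 < n) {z : ℝ} (hz : 0 < z) : 0 < gammaDelta α n z := by
  have hβ' : 2 / α < 1 := by rw [div_lt_one (by linarith)]; exact hα
  have hn' : (0 : ℝ) < n := by exact_mod_cast hn
  have h1 := Real.Gamma_pos_of_pos (s := 1 - 2 / α) (by linarith)
  have h2 := Real.Gamma_pos_of_pos (s := n + 2 / α) (by positivity)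
  have h3 := Real.Gamma_pos_of_pos hn'
  unfold gammaDelta
  positivity

lemma gammaDelta_nonneg (hα : 2 < α) (hn : 0 < n) {z : ℝ} (hz : 0 ≤ z) :
    0 ≤ gammaDelta α n z := by
  rcases hz.eq_or_lt with rfl | h
  · have : 2 / α ≠ 0 := by positivity
    simp [gammaDelta, Real.zero_rpow this]
  · exact (gammaDelta_pos hα hn h).le

/-- Split the integral over the plane at radius 1: the disc contributes 1 - `discAvg`, the exterior
S - 1, and the total is Δ. In this way the disc average is expressed by known functions when α > 2.
-/
lemma discAvg_eq_hypS_sub (hα : 2 < α) (hn : 0 < n) {z : ℝ} (hz : 0 ≤ z) :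
    discAvg α n z = hypS α n z - gammaDelta α n z := by
  have h := lintegral_Ioi_zero_eq_gammaDelta hα hn hz
  rw [← Ioc_union_Ioi_eq_Ioi (zero_le_one (α := ℝ)),
    lintegral_union measurableSet_Ioi (Ioc_disjoint_Ioi le_rfl), lintegral_Ioc_one_sub hz one_pos,
    lintegral_Ioi_one_sub hα hn hz one_pos, Real.one_rpow, div_one, one_pow, one_mul, one_mul,
    ← ENNReal.ofReal_add (by linarith [(discAvg_mem (α := α) (n := n) hz).2])
      (by linarith [one_le_hypS hα hn hz]),
    ENNReal.ofReal_eq_ofReal_iff (by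
      linarith [(discAvg_mem (α := α) (n := n) hz).2, one_le_hypS hα hn hz]) (gammaDelta_nonneg hα hn hz)] at h
  linarith

lemma elemF_succ (n : ℕ) (y : ℝ) : elemF (n + 1) y = (n + 1 : ℝ) * Real.log (1 + 1 / y) -
    1 / (y * (1 + y) ^ n) - ∑ k ∈ Finset.range n, (n + 1 : ℝ) * ((1 + y) ^ (k + 1) * (k + 1))⁻¹ := by
  unfold elemF
  rw [Nat.add_sub_cancel]
  push_cast
  congr 1
  refine Finset.sum_nbij' (fun m => n - m) (fun k => n - k) ?_ ?_ ?_ ?_ ?_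
  · intro m hm; rw [Finset.mem_Icc] at hm; rw [Finset.mem_range]; omega
  · intro m hm; rw [Finset.mem_range] at hm; rw [Finset.mem_Icc]; omega
  · intro m hm; rw [Finset.mem_Icc] at hm; omega
  · intro m hm; rw [Finset.mem_range] at hm; omega
  · intro m hm
    rw [Finset.mem_Icc] at hm
    rw [show n + 1 - m = n - m + 1 by omega, Nat.cast_sub hm.2, div_eq_mul_inv]
    ring_nf

/-- The derivative of the finite sum is geometric and cancels the derivative of the logarithm up to
a single power; together with the middle term only 1/(y²(1+y)^n) survives. -/
lemma hasDerivAt_elemF (hn : 0 < n) {y : ℝ} (hy : 0 < y) :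
    HasDerivAt (elemF n) ((y ^ 2 * (1 + y) ^ n)⁻¹) y := by
  obtain ⟨n, rfl⟩ : ∃ m, n = m + 1 := ⟨n - 1, by omega⟩
  rw [show elemF (n + 1) = _ from funext (elemF_succ n)]
  have hy1 : 0 < 1 + y := by linarith
  have h0 : HasDerivAt (fun y : ℝ => 1 + y) 1 y := (hasDerivAt_id y).const_add 1
  have h1 : HasDerivAt (fun y : ℝ => (n + 1 : ℝ) * Real.log (1 + 1 / y))
      (-((n + 1) * (y * (1 + y))⁻¹)) y := by
    have := (((hasDerivAt_inv hy.ne').const_add 1).log (by positivity)).const_mul (n + 1 : ℝ)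
    simp only [one_div]
    refine HasDerivAt.congr_deriv this ?_
    field_simp
    ring
  have h2 : HasDerivAt (fun y : ℝ => 1 / (y * (1 + y) ^ n))
      (-((1 + y) ^ n + y * (n * (1 + y) ^ (n - 1))) / (y * (1 + y) ^ n) ^ 2) y := by
    have := ((hasDerivAt_id y).mul (h0.pow n)).inv
      (mul_pos hy (pow_pos hy1 n)).ne'
    simp only [one_div]
    refine HasDerivAt.congr_deriv this ?_
    simp
  have h3 : HasDerivAt (fun y : ℝ => ∑ k ∈ Finset.range n,
      (n + 1 : ℝ) * ((1 + y) ^ (k + 1) * (k + 1))⁻¹)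
      (∑ k ∈ Finset.range n, -((n + 1) * ((1 + y) ^ (k + 2))⁻¹)) y := by
    refine HasDerivAt.fun_sum fun k _ => ?_
    have := (((h0.pow (k + 1)).mul_const ((k : ℝ) + 1)).inv
      (mul_pos (pow_pos hy1 _) (by positivity)).ne').const_mul (n + 1 : ℝ)
    refine HasDerivAt.congr_deriv this ?_
    simp only [Nat.add_sub_cancel, Pi.pow_apply]
    push_cast
    field_simp
    ring
  refine HasDerivAt.congr_deriv ((h1.sub h2).sub h3) ?_
  have h4 : ∀ m : ℕ, ∑ k ∈ Finset.range m, -((n + 1 : ℝ) * ((1 + y) ^ (k + 2))⁻¹) =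
      -((n + 1) * (y * (1 + y))⁻¹) + (n + 1) * (y * (1 + y) ^ (m + 1))⁻¹ := by
    intro m
    induction m with
    | zero => simp
    | succ m ih =>
      rw [Finset.sum_range_succ, ih]
      field_simp
      ring
  rw [h4]
  rcases n with _ | m
  · simp
    field_simp
    ring
  · rw [Nat.add_sub_cancel]
    push_cast
    field_simp
    ring

lemma tendsto_elemF (hn : 0 < n) : Tendsto (elemF n) atTop (𝓝 0) := by
  obtain ⟨n, rfl⟩ : ∃ m, n = m + 1 := ⟨n - 1, by omega⟩
  rw [show elemF (n + 1) = _ from funext (elemF_succ n)]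
  have h0 : Tendsto (fun y : ℝ => 1 + y) atTop atTop := tendsto_atTop_add_const_left _ _ tendsto_id
  have h1 : Tendsto (fun y : ℝ => (n + 1 : ℝ) * Real.log (1 + 1 / y)) atTop (𝓝 0) := by
    have h2 : Tendsto (fun y : ℝ => 1 + 1 / y) atTop (𝓝 (1 + 0)) := by
      simp only [one_div]
      exact tendsto_const_nhds.add tendsto_inv_atTop_zero
    rw [add_zero] at h2
    have := (h2.log one_ne_zero).const_mul (n + 1 : ℝ)
    simpa using this
  have h2 : Tendsto (fun y : ℝ => 1 / (y * (1 + y) ^ n)) atTop (𝓝 0) := by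
    refine tendsto_const_nhds.div_atTop (tendsto_atTop_mono' _ ?_ tendsto_id)
    filter_upwards [eventually_ge_atTop 0] with y hy
    exact le_mul_of_one_le_right hy (one_le_pow₀ (by linarith))
  have h3 : Tendsto (fun y : ℝ => ∑ k ∈ Finset.range n,
      (n + 1 : ℝ) * ((1 + y) ^ (k + 1) * (k + 1))⁻¹) atTop (𝓝 0) := by
    have : Tendsto (fun y : ℝ => ∑ k ∈ Finset.range n,
        (n + 1 : ℝ) * ((1 + y) ^ (k + 1) * (k + 1))⁻¹) atTop
        (𝓝 (∑ k ∈ Finset.range n, (n + 1 : ℝ) * 0)) := by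
      refine tendsto_finsetSum _ fun k _ => Tendsto.const_mul _ (Tendsto.inv_tendsto_atTop ?_)
      exact ((tendsto_pow_atTop (by omega)).comp h0).atTop_mul_const (by positivity)
    simpa using this
  simpa using (h1.sub h2).sub h3

/-- For exponent 2 the function v ↦ -z `elemF n (z/v²)` is an antiderivative of the integrand. As v
decreases to 0 the argument tends to infinity, where `elemF` vanishes, so only the value at v = 1
remains. -/
lemma discAvg_two (hn : 0 < n) {z : ℝ} (hz : 0 < z) : discAvg 2 n z = -(z * elemF n z) := by
  have h1 : Tendsto (fun v : ℝ => z / v ^ 2) (𝓝[>] 0) atTop := by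
    simp only [div_eq_mul_inv]
    refine Tendsto.const_mul_atTop hz ?_
    refine Tendsto.inv_tendsto_nhdsGT_zero ?_
    rw [tendsto_nhdsWithin_iff]
    constructor
    · have : Tendsto (fun v : ℝ => v ^ 2) (𝓝 0) (𝓝 (0 ^ 2)) := (continuous_pow 2).tendsto 0
      simpa using this.mono_left nhdsWithin_le_nhds
    · filter_upwards [self_mem_nhdsWithin] with v hv
      exact pow_pos (mem_Ioi.1 hv) 2
  have hder : ∀ v : ℝ, 0 < v → HasDerivAt (fun v => -(z * elemF n (z / v ^ 2)))
      (2 * v * ((1 + z / v ^ (2 : ℝ)) ^ n)⁻¹) v := by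
    intro v hv
    have h2 := ((hasDerivAt_pow 2 v).inv (by positivity)).const_mul z
    have h3 : HasDerivAt (fun v : ℝ => z / v ^ 2) (z * (-(↑2 * v ^ (2 - 1)) / (v ^ 2) ^ 2)) v := by
      simp only [div_eq_mul_inv z]
      exact h2
    have h4 := (((hasDerivAt_elemF hn (by positivity : 0 < z / v ^ 2)).comp v h3).const_mul z).neg
    refine HasDerivAt.congr_deriv h4 ?_
    rw [Real.rpow_two]
    have : (1 + z / v ^ 2) ^ n ≠ 0 := by positivity
    generalize (1 + z / v ^ 2) ^ n = A at *
    push_cast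
    field_simp
  rw [discAvg, ← intervalIntegral.integral_of_le zero_le_one,
    intervalIntegral.integral_eq_sub_of_hasDerivAt_of_tendsto zero_lt_one
      (fun v hv => hder v hv.1)
      (by
        rw [intervalIntegrable_iff_integrableOn_Ioc_of_le zero_le_one]
        exact integrableOn_discIntegrand hz.le 1)
      (fa := 0) (fb := -(z * elemF n (z / 1 ^ 2)))]
  · simp
  · simpa using (((tendsto_elemF hn).comp h1).const_mul z).neg
  · exact (hder 1 one_pos).continuousAt.tendsto.mono_left nhdsWithin_le_nhds

end HetNetASE

/-! ### The Laplace exponent in polar coordinates -/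

namespace HetNetASE

open Set
open scoped ENNReal

namespace HetNet

variable {N : HetNet} {i : Fin 2} {K : Set ℕ → Prop} {s : ℝ → ℝ≥0∞}

lemma measurable_discAvg {α : ℝ} {n : ℕ} : Measurable (discAvg α n) := by
  have h : StronglyMeasurable fun q : ℝ × ℝ => 2 * q.2 * ((1 + q.1 / q.2 ^ α) ^ n)⁻¹ :=
    Measurable.stronglyMeasurable (by fun_prop)
  exact h.integral_prod_right'.measurable

/-- The mean number of base stations caching a requested file at distance at most `r`. -/
lemma intensity_le_score (hK : MeasurableSet {c | K c}) (hs : Measurable s) {a : ℝ≥0∞} (ha : 0 < a)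
    {r : ℝ} (hr : 0 ≤ r) (har : ∀ ρ : ℝ, 0 < ρ → (a ≤ s ρ ↔ ρ ≤ r)) :
    N.intensity i {x | a ≤ score K s x} =
      ENNReal.ofReal (Real.pi * ((N.place i).real {c | K c} * N.dens i) * r ^ 2) := by
  have hS : MeasurableSet {x | a ≤ score K s x} :=
    measurableSet_le measurable_const (measurable_score hK hs)
  have := N.place_prob i
  have hd := N.dens_pos i
  rw [← lintegral_indicator_one hS, N.lintegral_intensity i (measurable_one.indicator hS)]
  have h1 : ∀ (z : EuclideanSpace ℝ (Fin 2)) (c : Set ℕ) (h w : ℝ),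
      {x | a ≤ score K s x}.indicator (1 : BS → ℝ≥0∞) (z, (c, (h, w))) =
      {c | K c}.indicator (fun _ => {r | a ≤ s r}.indicator (1 : ℝ → ℝ≥0∞) ‖z‖) c := by
    intro z c h w
    by_cases hc : K c <;> by_cases hz : a ≤ s ‖z‖ <;>
      simp [score, BS.cache, BS.dist, hc, hz, ha.ne']
  have hm : MeasurableSet {r | a ≤ s r} := measurableSet_le measurable_const hs
  simp_rw [h1, lintegral_const, measure_univ, mul_one, lintegral_indicator_const hK]
  have h2 : ∀ z : EuclideanSpace ℝ (Fin 2), {r | a ≤ s r}.indicator (1 : ℝ → ℝ≥0∞) ‖z‖ *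
      N.place i {c | K c} = (fun ρ => {r | a ≤ s r}.indicator (1 : ℝ → ℝ≥0∞) ρ *
      N.place i {c | K c}) ‖z‖ := fun _ => rfl
  rw [lintegral_congr h2, lintegral_norm_plane ((measurable_one.indicator hm).mul_const _)]
  have h3 : ∀ ρ ∈ Ioi (0 : ℝ), ENNReal.ofReal (2 * Real.pi * ρ) *
      ({r | a ≤ s r}.indicator (1 : ℝ → ℝ≥0∞) ρ * N.place i {c | K c}) =
      (Iic r).indicator (fun ρ => ENNReal.ofReal (2 * ρ) *
        (ENNReal.ofReal Real.pi * N.place i {c | K c})) ρ := by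
    intro ρ hρ
    have hρ' : (0 : ℝ) < ρ := hρ
    have := har ρ hρ
    by_cases h : ρ ≤ r
    · rw [indicator_of_mem (s := {r | a ≤ s r}) (this.2 h), indicator_of_mem (s := Iic r) h]
      rw [Pi.one_apply, one_mul, ← mul_assoc, ← ENNReal.ofReal_mul (by positivity)]
      ring_nf
    · rw [indicator_of_notMem (s := {r | a ≤ s r}) (fun h' => h (this.1 h')),
        indicator_of_notMem (s := Iic r) h]
      simp
  rw [setLIntegral_congr_fun measurableSet_Ioi h3, lintegral_indicator measurableSet_Iic,
    Measure.restrict_restrict measurableSet_Iic, inter_comm, Ioi_inter_Iic,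
    lintegral_mul_const _ (by fun_prop), ← restrict_Ioo_eq_restrict_Ioc, lintegral_Ioo_two_mul hr,
    ← ofReal_measureReal (measure_ne_top _ _), ← ENNReal.ofReal_mul (by positivity),
    ← ENNReal.ofReal_mul (by positivity), ← ENNReal.ofReal_mul (by positivity)]
  congr 1
  ring

variable (N i) in
/-- The Laplace transform of the interference from one base station at distance `ρ` with beam
angle `w`. -/
def linkLaplace (k ρ w : ℝ) : ℝ :=
  ((1 + k * (N.linkGain i ρ * N.gain i w) / N.fadeParam i) ^ N.fadeParam i)⁻¹

lemma gain_nonneg (w : ℝ) : 0 ≤ N.gain i w := by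
  unfold gain
  split_ifs <;> positivity

lemma measurable_linkLaplace {k : ℝ} :
    Measurable fun q : ℝ × ℝ => N.linkLaplace i k q.1 q.2 := by
  have h1 : Measurable fun q : ℝ × ℝ => N.linkGain i q.1 :=
    (N.measurable_linkGain i).comp measurable_fst
  have h2 : Measurable fun q : ℝ × ℝ => N.gain i q.2 := (N.measurable_gain i).comp measurable_snd
  exact (((((h1.mul h2).const_mul k).div_const _).const_add 1).pow_const _).inv

lemma lintegral_fade_one_sub_expNeg {t : ℝ} (ht : 0 ≤ t) :
    ∫⁻ h, (1 - expNeg (ENNReal.ofReal (t * h))) ∂(N.fadeLaw i) =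
      ENNReal.ofReal (1 - ((1 + t / N.fadeParam i) ^ N.fadeParam i)⁻¹) := by
  have hm : Measurable fun h : ℝ => expNeg (ENNReal.ofReal (t * h)) :=
    measurable_expNeg.comp (by fun_prop)
  have h1 : ∫⁻ h, expNeg (ENNReal.ofReal (t * h)) ∂(N.fadeLaw i) =
      ENNReal.ofReal (((1 + t / N.fadeParam i) ^ N.fadeParam i)⁻¹) :=
    lintegral_expNeg_gammaMeasure (N.fadeParam_pos i) ht
  rw [lintegral_sub hm (by rw [h1]; exact ENNReal.ofReal_ne_top)
    (Eventually.of_forall fun h => expNeg_le_one _), h1, lintegral_one, measure_univ,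
    ENNReal.ofReal_sub _ (by positivity), ENNReal.ofReal_one]

variable (N i) in
/-- The mean effect of one interferer at distance `ρ`. -/
def linkLoss (k ρ : ℝ) : ℝ≥0∞ := ∫⁻ w, ENNReal.ofReal (1 - N.linkLaplace i k ρ w) ∂N.angleLaw

lemma measurable_ofReal_one_sub_linkLaplace {k : ℝ} :
    Measurable fun q : ℝ × ℝ => ENNReal.ofReal (1 - N.linkLaplace i k q.1 q.2) :=
  (measurable_linkLaplace.const_sub 1).ennreal_ofReal

lemma measurable_linkLoss {k : ℝ} : Measurable (N.linkLoss i k) :=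
  measurable_ofReal_one_sub_linkLaplace.lintegral_prod_right'

/-- Tonelli: the radial integral is done for a fixed angle, where it has a closed form, and the
angle is averaged afterwards. -/
lemma lintegral_linkLoss {k : ℝ} {A : Set ℝ} (hA : MeasurableSet A) (hA0 : A ⊆ Ioi 0) :
    ∫⁻ ρ in A, ENNReal.ofReal (2 * ρ) * N.linkLoss i k ρ =
      ∫⁻ w, (∫⁻ ρ in A, ENNReal.ofReal (2 * ρ * (1 - N.linkLaplace i k ρ w))) ∂N.angleLaw := by
  have hm : Measurable fun q : ℝ × ℝ => ENNReal.ofReal (2 * q.2 * (1 - N.linkLaplace i k q.2 q.1)) :=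
    Measurable.ennreal_ofReal ((measurable_snd.const_mul 2).mul
      ((measurable_linkLaplace.comp measurable_swap).const_sub 1))
  rw [lintegral_lintegral_swap hm.aemeasurable]
  refine setLIntegral_congr_fun hA fun ρ hρ => ?_
  have hρ' : (0 : ℝ) < ρ := hA0 hρ
  have h1 : Measurable fun w => ENNReal.ofReal (1 - N.linkLaplace i k ρ w) := by
    have h := (measurable_ofReal_one_sub_linkLaplace (N := N) (i := i) (k := k)).comp
      (measurable_prodMk_left (x := ρ))
    exact h
  have h2 : ∀ w, ENNReal.ofReal (2 * ρ * (1 - N.linkLaplace i k ρ w)) =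
      ENNReal.ofReal (2 * ρ) * ENNReal.ofReal (1 - N.linkLaplace i k ρ w) := fun w =>
    ENNReal.ofReal_mul (by positivity)
  rw [linkLoss, ← lintegral_const_mul _ h1]
  exact (lintegral_congr h2).symm

/-- The exponent of the Laplace functional in polar coordinates. -/
lemma laplaceExponent_eq (hK : MeasurableSet {c | K c}) (hs : Measurable s) {a : ℝ≥0∞}
    (ha : 0 < a) {r : ℝ} (hr : 0 ≤ r) (har : ∀ ρ : ℝ, 0 < ρ → (a ≤ s ρ ↔ ρ ≤ r))
    {k : ℝ} (hk : 0 ≤ k) :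
    N.laplaceExponent i K s a (ENNReal.ofReal k) =
      ENNReal.ofReal (Real.pi * N.dens i) *
        (ENNReal.ofReal ((N.place i).real {c | K c} * r ^ 2) +
          ENNReal.ofReal (1 - (N.place i).real {c | K c}) * (∫⁻ w, (∫⁻ ρ in Ioc 0 r,
            ENNReal.ofReal (2 * ρ * (1 - N.linkLaplace i k ρ w))) ∂N.angleLaw) +
          ∫⁻ w, (∫⁻ ρ in Ioi r,
            ENNReal.ofReal (2 * ρ * (1 - N.linkLaplace i k ρ w))) ∂N.angleLaw) := by
  have := N.place_prob i
  have hd := N.dens_pos i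
  have hS : MeasurableSet {x | a ≤ score K s x} :=
    measurableSet_le measurable_const (measurable_score hK hs)
  set p := (N.place i).real {c | K c} with hp
  have hp0 : 0 ≤ p := measureReal_nonneg
  have hp1 : p ≤ 1 := measureReal_le_one
  set φ : ℝ → ℝ≥0∞ := N.linkLoss i k with hφ
  have hφm : Measurable φ := measurable_linkLoss
  have hf : Measurable fun x => 1 - expNeg ({x | a ≤ score K s x}.indicator
      (fun _ => (⊤ : ℝ≥0∞)) x + ENNReal.ofReal k * ENNReal.ofReal (N.interfPower i x)) :=
    measurable_const.sub (measurable_expNeg.comp ((measurable_const.indicator hS).add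
      ((N.measurable_interfPower i).ennreal_ofReal.const_mul _)))
  rw [laplaceExponent, N.lintegral_intensity i hf]
  -- the marks
  have e1 : ∀ (z : EuclideanSpace ℝ (Fin 2)) (c : Set ℕ), ∫⁻ h, ∫⁻ w,
      (1 - expNeg ({x : BS | a ≤ score K s x}.indicator (fun _ => (⊤ : ℝ≥0∞)) (z, (c, (h, w))) +
        ENNReal.ofReal k * ENNReal.ofReal (N.interfPower i (z, (c, (h, w))))))
        ∂N.angleLaw ∂(N.fadeLaw i) =
      {c | K c}.indicator (fun _ => {r | a ≤ s r}.indicator (1 : ℝ → ℝ≥0∞) ‖z‖ +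
        {r | a ≤ s r}ᶜ.indicator φ ‖z‖) c + {c | K c}ᶜ.indicator (fun _ => φ ‖z‖) c := by
    intro z c
    -- A station that would win the ranking has weight ∞ and contributes 1; every other one
    -- contributes its mean loss φ.
    by_cases hc : K c ∧ a ≤ s ‖z‖
    · have h1 : ∀ h w : ℝ, a ≤ score K s (z, (c, (h, w))) := by
        intro h w
        simpa [score, indicator_apply, BS.cache, BS.dist, hc.1] using hc.2
      have h2 : ∀ h w : ℝ, {x : BS | a ≤ score K s x}.indicator (fun _ => (⊤ : ℝ≥0∞))
          (z, (c, (h, w))) = ⊤ := fun h w => indicator_of_mem (s := {x | a ≤ score K s x}) (h1 h w) _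
      simp_rw [h2]
      simp [hc.1, hc.2]
    · have h1 : ∀ h w : ℝ, ¬ a ≤ score K s (z, (c, (h, w))) := by
        intro h w
        by_cases hKc : K c
        · have := fun h' => hc ⟨hKc, h'⟩
          simpa [score, indicator_apply, BS.cache, BS.dist, hKc] using this
        · simp [score, BS.cache, hKc, ha.ne']
      have h2 : ∀ h w : ℝ, {x : BS | a ≤ score K s x}.indicator (fun _ => (⊤ : ℝ≥0∞))
          (z, (c, (h, w))) = 0 := fun h w =>
        indicator_of_notMem (s := {x | a ≤ score K s x}) (h1 h w) _
      simp_rw [h2, zero_add]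
      have h3 : ∀ h w : ℝ, ENNReal.ofReal k * ENNReal.ofReal (N.interfPower i (z, (c, (h, w)))) =
          ENNReal.ofReal ((k * (N.linkGain i ‖z‖ * N.gain i w)) * h) := by
        intro h w
        rw [← ENNReal.ofReal_mul hk]
        simp only [interfPower, linkGain, BS.dist, BS.fade, BS.angle]
        ring_nf
      have hm : Measurable fun q : ℝ × ℝ => 1 - expNeg (ENNReal.ofReal
          ((k * (N.linkGain i ‖z‖ * N.gain i q.2)) * q.1)) := by
        refine measurable_const.sub (measurable_expNeg.comp (Measurable.ennreal_ofReal ?_))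
        exact (((N.measurable_gain i).comp measurable_snd).const_mul _ |>.const_mul _).mul
          measurable_fst
      simp_rw [h3]
      rw [lintegral_lintegral_swap hm.aemeasurable]
      have h4 : ∀ w, ∫⁻ h, (1 - expNeg (ENNReal.ofReal
          ((k * (N.linkGain i ‖z‖ * N.gain i w)) * h))) ∂(N.fadeLaw i) =
          ENNReal.ofReal (1 - N.linkLaplace i k ‖z‖ w) := fun w => by
        have h5 := N.linkGain_nonneg i (norm_nonneg z)
        have h6 := N.gain_nonneg (i := i) w
        exact lintegral_fade_one_sub_expNeg (by positivity)
      simp_rw [h4]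
      by_cases hKc : K c
      · have := fun h' => hc ⟨hKc, h'⟩
        have h5 : s ‖z‖ < a := not_le.1 this
        simp [hKc, not_le.2 h5, hφ, linkLoss]
      · simp [hKc, hφ, linkLoss]
  have hm : MeasurableSet {r | a ≤ s r} := measurableSet_le measurable_const hs
  simp_rw [e1]
  obtain ⟨g, hg⟩ : ∃ g : ℝ → ℝ≥0∞, g = fun ρ =>
    ({r | a ≤ s r}.indicator (1 : ℝ → ℝ≥0∞) ρ + {r | a ≤ s r}ᶜ.indicator φ ρ) *
        ENNReal.ofReal p + φ ρ * ENNReal.ofReal (1 - p) := ⟨_, rfl⟩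
  have hgm : Measurable g := by
    rw [hg]
    exact (((measurable_one.indicator hm).add (hφm.indicator hm.compl)).mul_const _).add
      (hφm.mul_const _)
  have e2 : ∀ z : EuclideanSpace ℝ (Fin 2), ∫⁻ c, ({c | K c}.indicator
      (fun _ => {r | a ≤ s r}.indicator (1 : ℝ → ℝ≥0∞) ‖z‖ +
        {r | a ≤ s r}ᶜ.indicator φ ‖z‖) c + {c | K c}ᶜ.indicator (fun _ => φ ‖z‖) c) ∂(N.place i) =
      g ‖z‖ := by
    intro z
    rw [hg, lintegral_add_left (measurable_const.indicator hK), lintegral_indicator_const hK,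
      lintegral_indicator_const hK.compl, ← ofReal_measureReal (measure_ne_top _ _),
      ← ofReal_measureReal (μ := N.place i) (s := {c | K c}ᶜ) (measure_ne_top _ _),
      probReal_compl_eq_one_sub hK]
  rw [lintegral_congr e2, lintegral_norm_plane hgm, hg]
  have e3 := fun A hA hA0 => lintegral_linkLoss (N := N) (i := i) (k := k) (A := A) hA hA0
  -- Within radius r the fraction p of caching stations is forbidden and the fraction 1 - p
  -- interferes. Beyond r all stations interfere, so there the fractions recombine to 1.
  have e4 : ∫⁻ ρ in Ioi (0 : ℝ), ENNReal.ofReal (2 * Real.pi * ρ) *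
      (({r | a ≤ s r}.indicator (1 : ℝ → ℝ≥0∞) ρ + {r | a ≤ s r}ᶜ.indicator φ ρ) *
        ENNReal.ofReal p + φ ρ * ENNReal.ofReal (1 - p)) =
      ENNReal.ofReal Real.pi * (ENNReal.ofReal (p * r ^ 2) +
        ENNReal.ofReal (1 - p) * (∫⁻ ρ in Ioc 0 r, ENNReal.ofReal (2 * ρ) * φ ρ) +
        ∫⁻ ρ in Ioi r, ENNReal.ofReal (2 * ρ) * φ ρ) := by
    rw [← Ioc_union_Ioi_eq_Ioi hr, lintegral_union measurableSet_Ioi (Ioc_disjoint_Ioi le_rfl)]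
    have h1 : ∀ ρ ∈ Ioc 0 r, ENNReal.ofReal (2 * Real.pi * ρ) *
        (({r | a ≤ s r}.indicator (1 : ℝ → ℝ≥0∞) ρ + {r | a ≤ s r}ᶜ.indicator φ ρ) *
        ENNReal.ofReal p + φ ρ * ENNReal.ofReal (1 - p)) =
        ENNReal.ofReal Real.pi * (ENNReal.ofReal p * ENNReal.ofReal (2 * ρ) +
          ENNReal.ofReal (1 - p) * (ENNReal.ofReal (2 * ρ) * φ ρ)) := by
      intro ρ hρ
      have h := (har ρ hρ.1).2 hρ.2
      rw [show 2 * Real.pi * ρ = Real.pi * (2 * ρ) by ring, ENNReal.ofReal_mul (by positivity)]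
      simp only [indicator_apply, mem_ofPred_eq, h, mem_compl_iff, not_true_eq_false, if_true,
        if_false, Pi.one_apply]
      ring
    have h2 : ∀ ρ ∈ Ioi r, ENNReal.ofReal (2 * Real.pi * ρ) *
        (({r | a ≤ s r}.indicator (1 : ℝ → ℝ≥0∞) ρ + {r | a ≤ s r}ᶜ.indicator φ ρ) *
        ENNReal.ofReal p + φ ρ * ENNReal.ofReal (1 - p)) =
        ENNReal.ofReal Real.pi * (ENNReal.ofReal (2 * ρ) * φ ρ) := by
      intro ρ hρ
      have h : ¬ a ≤ s ρ := fun h => not_lt.2 ((har ρ (hr.trans_lt hρ)).1 h) hρ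
      have h3 : ENNReal.ofReal p + ENNReal.ofReal (1 - p) = 1 := by
        rw [← ENNReal.ofReal_add hp0 (by linarith)]; simp
      rw [show 2 * Real.pi * ρ = Real.pi * (2 * ρ) by ring, ENNReal.ofReal_mul (by positivity)]
      simp only [indicator_apply, mem_ofPred_eq, h, mem_compl_iff, not_false_eq_true, if_true,
        if_false, zero_add]
      rw [← mul_add (φ ρ), h3, mul_one]
      ring
    have hm2 : Measurable fun ρ : ℝ => ENNReal.ofReal (2 * ρ) * φ ρ := by fun_prop
    rw [setLIntegral_congr_fun measurableSet_Ioc h1, setLIntegral_congr_fun measurableSet_Ioi h2,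
      lintegral_const_mul _ (by fun_prop), lintegral_const_mul _ hm2,
      lintegral_add_left (by fun_prop), lintegral_const_mul _ (by fun_prop),
      lintegral_const_mul _ hm2, ← restrict_Ioo_eq_restrict_Ioc, lintegral_Ioo_two_mul hr,
      ← ENNReal.ofReal_mul hp0, ← mul_add]
  rw [e4, e3 _ measurableSet_Ioc (fun ρ hρ => hρ.1),
    e3 _ measurableSet_Ioi (fun ρ hρ => hr.trans_lt hρ), ← mul_assoc,
    ← ENNReal.ofReal_mul hd.le, mul_comm (N.dens i)]

end HetNet

end HetNetASE

/-! ### The interference transforms of the macro and the pico tier -/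

namespace HetNetASE

open Set
open scoped ENNReal

namespace HetNet

variable {N : HetNet} {Ω : Type*} {mΩ : MeasurableSpace Ω} {P : Measure Ω} [IsProbabilityMeasure P]
  {Φ : Ω → Set BS} {K : Set ℕ → Prop} {s : ℝ → ℝ≥0∞} {M : Ω → ℝ≥0∞}

lemma two_lt_expo (N : HetNet) : 2 < N.expo 0 := expo_macro N

lemma linkGain_zero_eq (r : ℝ) :
    N.linkGain 0 r = N.power 0 * N.icpt 0 * N.ant 0 * r ^ (-N.expo 0) := by
  simp only [linkGain, pathLoss, if_true]
  ring

lemma linkGain_zero_pos {r : ℝ} (hr : 0 < r) : 0 < N.linkGain 0 r := by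
  have h1 := N.power_pos 0
  have h2 := N.icpt_pos 0
  have h3 : (0 : ℝ) < N.ant 0 := by exact_mod_cast N.ant_pos 0
  rw [linkGain_zero_eq]
  positivity

lemma linkGain_one_of_le {r : ℝ} (hr : r ≤ N.losR) :
    N.linkGain 1 r = N.power 1 * N.icpt 1 * N.ant 1 * r ^ (-N.expo 1) := by
  simp only [linkGain, pathLoss, unitStep, one_ne_zero, if_false, sub_nonneg, hr, if_true]
  ring

lemma linkGain_one_of_lt {r : ℝ} (hr : N.losR < r) : N.linkGain 1 r = 0 := by
  simp [linkGain, pathLoss, unitStep, not_le.2 hr]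

lemma linkGain_one_pos_iff {r : ℝ} (hr : 0 < r) : 0 < N.linkGain 1 r ↔ r ≤ N.losR := by
  refine ⟨fun h => ?_, fun h => ?_⟩
  · by_contra h'
    rw [linkGain_one_of_lt (not_le.1 h')] at h
    exact lt_irrefl _ h
  · have h1 := N.power_pos 1
    have h2 := N.icpt_pos 1
    have h3 : (0 : ℝ) < N.ant 1 := by exact_mod_cast N.ant_pos 1
    rw [linkGain_one_of_le h]
    positivity

/-- Collects the factors left by the Mecke formula into the nearest-distance density; Q is the
probability that the level is beaten, and the hypothesis is the comparison of exponents. -/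
lemma ofReal_density_mul {r d p T E A : ℝ} (hr : 0 ≤ r) (hd : 0 ≤ d) (hp : 0 ≤ p) (Q : ℝ≥0∞)
    (h : A + -(Real.pi * p * d * r ^ 2) = -T + -E) :
    ENNReal.ofReal (2 * Real.pi * r) * (ENNReal.ofReal d * ENNReal.ofReal p *
      (ENNReal.ofReal (Real.exp (-T)) * (Q * ENNReal.ofReal (Real.exp (-E))))) =
    ENNReal.ofReal (Real.exp A * (2 * Real.pi * p * d * r *
      Real.exp (-(Real.pi * p * d * r ^ 2)))) * Q := by
  have hc : Real.exp A * (2 * Real.pi * p * d * r * Real.exp (-(Real.pi * p * d * r ^ 2))) =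
      2 * Real.pi * r * (d * p * (Real.exp (-T) * Real.exp (-E))) := by
    rw [← Real.exp_add, ← h, Real.exp_add]
    ring
  rw [hc, ENNReal.ofReal_mul (p := 2 * Real.pi * r) (by positivity),
    ENNReal.ofReal_mul (p := d * p) (by positivity),
    ENNReal.ofReal_mul (p := Real.exp (-T)) (by positivity), ENNReal.ofReal_mul hd]
  ring

/-- The Laplace transform of the interference and noise in the macro tier. -/
lemma lintegral_expNeg_interfLaw_macro (h : IsPoissonProcess Φ (N.intensity 0) P)
    (hfin : ∀ ω (R : ℝ), {x ∈ Φ ω | x.dist ≤ R}.Finite)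
    (hdec : ∀ b : ℝ≥0∞, 0 < b → ∃ R : ℝ, ∀ r, b ≤ s r → r ≤ R)
    (hK : MeasurableSet {c | K c}) (hs : Measurable s) (hM : Measurable M)
    (hind : Indep (countAlgebra Φ) (MeasurableSpace.comap M inferInstance) P)
    (hmono : ∀ r : ℝ, 0 < r → 0 < N.linkGain 0 r → 0 < s r ∧ ∀ ρ : ℝ, 0 < ρ → (s r ≤ s ρ ↔ ρ ≤ r))
    {τ : ℝ} (hτ : 0 < τ) :
    ∫⁻ y, expNeg (ENNReal.ofReal τ * y) ∂(N.interfLaw P Φ 0 K s M) =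
      ∫⁻ r in Ioi (0 : ℝ), ENNReal.ofReal
        (Real.exp (-(τ * N.noise 0 * r ^ N.expo 0 / (N.power 0 * N.icpt 0 * N.ant 0))
          - Real.pi * N.dens 0 * r ^ 2 *
            ((N.place 0).real {c | K c} * (hypS (N.expo 0) 1 τ - 1) +
              (1 - (N.place 0).real {c | K c}) * gammaDelta (N.expo 0) 1 τ)) *
          N.nearestDens 0 ((N.place 0).real {c | K c}) r) * P {ω | M ω < s r} := by
  have := N.place_prob 0
  have hd := N.dens_pos 0
  have hα := N.two_lt_expo
  set p := (N.place 0).real {c | K c} with hp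
  have hp0 : 0 ≤ p := measureReal_nonneg
  have hp1 : p ≤ 1 := measureReal_le_one
  have hκ : ENNReal.ofReal τ ≠ 0 := by simpa using hτ
  rw [lintegral_expNeg_interfLaw h hfin hdec hK hs hM hind hκ]
  refine setLIntegral_congr_fun measurableSet_Ioi fun r hr => ?_
  have hr' : (0 : ℝ) < r := hr
  have hg := N.linkGain_zero_pos hr'
  obtain ⟨hs0, hsr⟩ := hmono r hr' hg
  rw [indicator_of_mem (s := {r | 0 < N.linkGain 0 r}) hg, ← ENNReal.ofReal_div_of_pos hg,
    laplaceExponent_eq hK hs hs0 hr'.le hsr (by positivity)]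
  have hN := N.noise_nonneg 0
  -- Relative to the serving link, power, intercept and number of antennas cancel; only the ratio of
  -- the distances remains.
  have hlink : ∀ ρ : ℝ, 0 < ρ → ∀ w, N.linkLaplace 0 (τ / N.linkGain 0 r) ρ w =
      ((1 + τ * r ^ N.expo 0 / ρ ^ N.expo 0) ^ 1)⁻¹ := by
    intro ρ hρ w
    have hA : 0 < N.power 0 * N.icpt 0 * N.ant 0 := by
      have h1 := N.power_pos 0
      have h2 := N.icpt_pos 0
      have h3 : (0 : ℝ) < N.ant 0 := by exact_mod_cast N.ant_pos 0
      positivity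
    simp only [linkLaplace, fadeParam, gain, if_true, linkGain_zero_eq, Real.rpow_neg hr'.le,
      Real.rpow_neg hρ.le, Nat.cast_one, div_one]
    have := (Real.rpow_pos_of_pos hr' (N.expo 0)).ne'
    have hA' := hA.ne'
    generalize N.power 0 * N.icpt 0 * N.ant 0 = A at hA' ⊢
    congr 3
    field_simp
  have hX : 0 ≤ τ * r ^ N.expo 0 := by positivity
  have hXr : τ * r ^ N.expo 0 / r ^ N.expo 0 = τ :=
    mul_div_cancel_right₀ _ (Real.rpow_pos_of_pos hr' _).ne'
  have e1 : ∀ w, ∫⁻ ρ in Ioc 0 r, ENNReal.ofReal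
      (2 * ρ * (1 - N.linkLaplace 0 (τ / N.linkGain 0 r) ρ w)) =
      ENNReal.ofReal (r ^ 2 * (1 - (hypS (N.expo 0) 1 τ - gammaDelta (N.expo 0) 1 τ))) := by
    intro w
    rw [← discAvg_eq_hypS_sub hα one_pos hτ.le]
    have := lintegral_Ioc_one_sub (α := N.expo 0) (n := 1) hX hr'
    rw [hXr] at this
    rw [← this]
    refine setLIntegral_congr_fun measurableSet_Ioc fun ρ hρ => ?_
    simp only [hlink ρ hρ.1]
  have e2 : ∀ w, ∫⁻ ρ in Ioi r, ENNReal.ofReal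
      (2 * ρ * (1 - N.linkLaplace 0 (τ / N.linkGain 0 r) ρ w)) =
      ENNReal.ofReal (r ^ 2 * (hypS (N.expo 0) 1 τ - 1)) := by
    intro w
    have := lintegral_Ioi_one_sub (α := N.expo 0) (n := 1) hα one_pos hX hr'
    rw [hXr] at this
    rw [← this]
    refine setLIntegral_congr_fun measurableSet_Ioi fun ρ hρ => ?_
    simp only [hlink ρ (hr'.trans hρ)]
  have hj := discAvg_mem (α := N.expo 0) (n := 1) hτ.le
  rw [discAvg_eq_hypS_sub hα one_pos hτ.le] at hj
  have hS := one_le_hypS (n := 1) hα one_pos hτ.le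
  simp_rw [e1, e2, lintegral_const, measure_univ, mul_one]
  have hj1 : 0 ≤ 1 - (hypS (N.expo 0) 1 τ - gammaDelta (N.expo 0) 1 τ) := by linarith [hj.2]
  have hS1 : 0 ≤ hypS (N.expo 0) 1 τ - 1 := by linarith
  have hp2 : 0 ≤ 1 - p := by linarith
  have hpl : N.place 0 {c | K c} = ENNReal.ofReal p := (ofReal_measureReal (measure_ne_top _ _)).symm
  have hk : τ / N.linkGain 0 r * N.noise 0 =
      τ * N.noise 0 * r ^ N.expo 0 / (N.power 0 * N.icpt 0 * N.ant 0) := by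
    rw [linkGain_zero_eq, Real.rpow_neg hr'.le]
    have := (Real.rpow_pos_of_pos hr' (N.expo 0)).ne'
    field_simp
  have hT : 0 ≤ τ / N.linkGain 0 r * N.noise 0 := by positivity
  have hcol : ENNReal.ofReal (p * r ^ 2) + ENNReal.ofReal (1 - p) *
        ENNReal.ofReal (r ^ 2 * (1 - (hypS (N.expo 0) 1 τ - gammaDelta (N.expo 0) 1 τ))) +
      ENNReal.ofReal (r ^ 2 * (hypS (N.expo 0) 1 τ - 1)) =
      ENNReal.ofReal (p * r ^ 2 +
        (1 - p) * (r ^ 2 * (1 - (hypS (N.expo 0) 1 τ - gammaDelta (N.expo 0) 1 τ))) +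
        r ^ 2 * (hypS (N.expo 0) 1 τ - 1)) := by
    rw [← ENNReal.ofReal_mul hp2, ← ENNReal.ofReal_add (by positivity) (by positivity),
      ← ENNReal.ofReal_add (by positivity) (by positivity)]
  rw [hpl, hcol, ← ENNReal.ofReal_mul (p := Real.pi * N.dens 0) (by positivity),
    ← ENNReal.ofReal_mul (p := τ / N.linkGain 0 r) (by positivity),
    expNeg_ofReal (x := Real.pi * N.dens 0 * _) (by positivity), expNeg_ofReal hT, hk, nearestDens]
  set T := τ * N.noise 0 * r ^ N.expo 0 / (N.power 0 * N.icpt 0 * N.ant 0)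
  -- The exponent is πλr²(pS + (1-p)Δ). The part πλpr² goes into the nearest-distance density, which
  -- leaves S - 1 in place of S.
  exact ofReal_density_mul hr'.le hd.le hp0 _ (by ring)

section Pico

variable (N) in
/-- The exact counterpart of `lapW`: an average over the interferers' discs. -/
def picoW (p t r w : ℝ) : ℝ :=
  p * r ^ 2 * discAvg (N.expo 1) N.nak (t * N.gain 1 w / N.nak) -
    N.losR ^ 2 * discAvg (N.expo 1) N.nak (t * N.gain 1 w / N.nak * (r ^ N.expo 1 / N.losR ^ N.expo 1))

variable (N) in
/-- The Laplace transform of the interference in the pico tier. -/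
def picoLap (p t r : ℝ) : ℝ :=
  Real.exp (-(Real.pi * N.dens 1 * (N.losR ^ 2 - p * r ^ 2))
    - Real.pi * N.dens 1 * ∫ w, N.picoW p t r w ∂N.angleLaw)

lemma measurable_picoW {p t : ℝ} : Measurable fun q : ℝ × ℝ => N.picoW p t q.1 q.2 := by
  have hG : Measurable fun q : ℝ × ℝ => N.gain 1 q.2 := (N.measurable_gain 1).comp measurable_snd
  have hZ : Measurable fun q : ℝ × ℝ => t * N.gain 1 q.2 / N.nak := (hG.const_mul _).div_const _
  have hr : Measurable fun q : ℝ × ℝ => q.1 ^ N.expo 1 / N.losR ^ N.expo 1 := by fun_prop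
  exact (Measurable.mul (by fun_prop) (measurable_discAvg.comp hZ)).sub
    ((measurable_discAvg.comp (hZ.mul hr)).const_mul _)

/-- Disc averages lie in [0,1] and p r² ≤ R_L², so this is a difference of two numbers in [0, R_L²].
The bound dominates both the angle integral and its quadratures. -/
lemma abs_picoW_le {p t r w : ℝ} (hp : p ∈ Icc (0 : ℝ) 1) (ht : 0 ≤ t) (hr : 0 ≤ r)
    (hrR : r ≤ N.losR) : |N.picoW p t r w| ≤ N.losR ^ 2 := by
  have hG := N.gain_nonneg (i := 1) w
  have hR := N.losR_pos
  have h1 := discAvg_mem (α := N.expo 1) (n := N.nak) (z := t * N.gain 1 w / N.nak) (by positivity)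
  have h2 := discAvg_mem (α := N.expo 1) (n := N.nak)
    (z := t * N.gain 1 w / N.nak * (r ^ N.expo 1 / N.losR ^ N.expo 1)) (by positivity)
  have h3 : r ^ 2 ≤ N.losR ^ 2 := pow_le_pow_left₀ hr hrR 2
  have h4 : p * r ^ 2 ≤ N.losR ^ 2 := by nlinarith [hp.1, hp.2, sq_nonneg r]
  have h5 : 0 ≤ p * r ^ 2 := mul_nonneg hp.1 (sq_nonneg r)
  unfold picoW
  rw [abs_le]
  constructor
  · nlinarith [mul_nonneg h5 h1.1, h2.2, sq_nonneg N.losR]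
  · nlinarith [mul_nonneg (sq_nonneg N.losR) h2.1, h1.2, h1.1]

lemma integrable_picoW {p t r : ℝ} (hp : p ∈ Icc (0 : ℝ) 1) (ht : 0 ≤ t) (hr : 0 ≤ r)
    (hrR : r ≤ N.losR) : Integrable (N.picoW p t r) N.angleLaw := by
  refine Integrable.of_bound (C := N.losR ^ 2) ?_ (Eventually.of_forall fun w => ?_)
  · have := (measurable_picoW (N := N) (p := p) (t := t)).comp (measurable_prodMk_left (x := r))
    exact this.aestronglyMeasurable
  · rw [Real.norm_eq_abs]
    exact abs_picoW_le hp ht hr hrR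

/-- The Laplace transform of the interference and noise in the pico tier. -/
lemma lintegral_expNeg_interfLaw_pico (h : IsPoissonProcess Φ (N.intensity 1) P)
    (hfin : ∀ ω (R : ℝ), {x ∈ Φ ω | x.dist ≤ R}.Finite)
    (hdec : ∀ b : ℝ≥0∞, 0 < b → ∃ R : ℝ, ∀ r, b ≤ s r → r ≤ R)
    (hK : MeasurableSet {c | K c}) (hs : Measurable s) (hM : Measurable M)
    (hind : Indep (countAlgebra Φ) (MeasurableSpace.comap M inferInstance) P)
    (hmono : ∀ r : ℝ, 0 < r → 0 < N.linkGain 1 r → 0 < s r ∧ ∀ ρ : ℝ, 0 < ρ → (s r ≤ s ρ ↔ ρ ≤ r))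
    {t : ℝ} (ht : 0 < t) :
    ∫⁻ y, expNeg (ENNReal.ofReal t * y) ∂(N.interfLaw P Φ 1 K s M) =
      ∫⁻ r in Ioc (0 : ℝ) N.losR, ENNReal.ofReal
        (N.picoLap ((N.place 1).real {c | K c}) t r *
          Real.exp (-(t * r ^ N.expo 1 * N.noise 1 / (N.power 1 * N.icpt 1 * N.ant 1))) *
          N.nearestDens 1 ((N.place 1).real {c | K c}) r) * P {ω | M ω < s r} := by
  have := N.place_prob 1
  have hd := N.dens_pos 1
  have hn : (0 : ℝ) < N.nak := by exact_mod_cast N.nak_pos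
  set p := (N.place 1).real {c | K c} with hp
  have hp0 : 0 ≤ p := measureReal_nonneg
  have hp1 : p ≤ 1 := measureReal_le_one
  have hκ : ENNReal.ofReal t ≠ 0 := by simpa using ht
  rw [lintegral_expNeg_interfLaw h hfin hdec hK hs hM hind hκ,
    ← Ioc_union_Ioi_eq_Ioi N.losR_pos.le,
    lintegral_union measurableSet_Ioi (Ioc_disjoint_Ioi le_rfl)]
  have hzero : ∫⁻ r in Ioi N.losR, ENNReal.ofReal (2 * Real.pi * r) *
        (ENNReal.ofReal (N.dens 1) * N.place 1 {c | K c} * {r | 0 < N.linkGain 1 r}.indicator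
          (fun r => expNeg (ENNReal.ofReal t / ENNReal.ofReal (N.linkGain 1 r) *
            ENNReal.ofReal (N.noise 1)) *
            (P {ω | M ω < s r} * expNeg (N.laplaceExponent 1 K s (s r)
              (ENNReal.ofReal t / ENNReal.ofReal (N.linkGain 1 r))))) r) = 0 := by
    refine (setLIntegral_congr_fun measurableSet_Ioi fun r hr => ?_).trans lintegral_zero
    have hr' : ¬ 0 < N.linkGain 1 r := by rw [linkGain_one_of_lt hr]; exact lt_irrefl _
    rw [indicator_of_notMem (s := {r | 0 < N.linkGain 1 r}) hr', mul_zero, mul_zero]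
  rw [hzero, add_zero]
  refine setLIntegral_congr_fun measurableSet_Ioc fun r hr => ?_
  obtain ⟨hr', hrR⟩ := hr
  have hg : 0 < N.linkGain 1 r := (N.linkGain_one_pos_iff hr').2 hrR
  obtain ⟨hs0, hsr⟩ := hmono r hr' hg
  rw [indicator_of_mem (s := {r | 0 < N.linkGain 1 r}) hg, ← ENNReal.ofReal_div_of_pos hg,
    laplaceExponent_eq hK hs hs0 hr'.le hsr (by positivity)]
  have hN := N.noise_nonneg 1
  have hra := Real.rpow_pos_of_pos hr' (N.expo 1)
  have hRa := Real.rpow_pos_of_pos N.losR_pos (N.expo 1)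
  set Z : ℝ → ℝ := fun w => t * N.gain 1 w / N.nak with hZ
  have hZ0 : ∀ w, 0 ≤ Z w := fun w => by
    have := N.gain_nonneg (i := 1) w
    simp only [hZ]; positivity
  have hlink : ∀ ρ ∈ Ioc 0 N.losR, ∀ w, N.linkLaplace 1 (t / N.linkGain 1 r) ρ w =
      ((1 + Z w * r ^ N.expo 1 / ρ ^ N.expo 1) ^ N.nak)⁻¹ := by
    intro ρ hρ w
    have hA : 0 < N.power 1 * N.icpt 1 * N.ant 1 := by
      have h1 := N.power_pos 1
      have h2 := N.icpt_pos 1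
      have h3 : (0 : ℝ) < N.ant 1 := by exact_mod_cast N.ant_pos 1
      positivity
    simp only [linkLaplace, fadeParam, one_ne_zero, if_false, linkGain_one_of_le hρ.2,
      linkGain_one_of_le hrR, Real.rpow_neg hr'.le, Real.rpow_neg hρ.1.le, hZ]
    have := Real.rpow_pos_of_pos hρ.1 (N.expo 1)
    have hA' := hA.ne'
    generalize N.power 1 * N.icpt 1 * N.ant 1 = A at hA' ⊢
    congr 3
    field_simp
  have hX : ∀ w, 0 ≤ Z w * r ^ N.expo 1 := fun w => mul_nonneg (hZ0 w) hra.le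
  set J : ℝ → ℝ := fun w => discAvg (N.expo 1) N.nak (Z w) with hJ
  set J' : ℝ → ℝ := fun w => discAvg (N.expo 1) N.nak (Z w * (r ^ N.expo 1 / N.losR ^ N.expo 1)) with hJ'
  have hJm : ∀ w, J w ∈ Icc (0 : ℝ) 1 := fun w => discAvg_mem (hZ0 w)
  have hJm' : ∀ w, J' w ∈ Icc (0 : ℝ) 1 := fun w => discAvg_mem (mul_nonneg (hZ0 w) (by positivity))
  have e1 : ∀ w, ∫⁻ ρ in Ioc 0 r, ENNReal.ofReal
      (2 * ρ * (1 - N.linkLaplace 1 (t / N.linkGain 1 r) ρ w)) =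
      ENNReal.ofReal (r ^ 2 * (1 - J w)) := by
    intro w
    have h1 := lintegral_Ioc_one_sub (α := N.expo 1) (n := N.nak) (hX w) hr'
    rw [mul_div_cancel_right₀ _ hra.ne'] at h1
    rw [← h1]
    refine setLIntegral_congr_fun measurableSet_Ioc fun ρ hρ => ?_
    simp only [hlink ρ ⟨hρ.1, hρ.2.trans hrR⟩]
  have e1' : ∀ w, ∫⁻ ρ in Ioc 0 N.losR, ENNReal.ofReal
      (2 * ρ * (1 - N.linkLaplace 1 (t / N.linkGain 1 r) ρ w)) =
      ENNReal.ofReal (N.losR ^ 2 * (1 - J' w)) := by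
    intro w
    have h1 := lintegral_Ioc_one_sub (α := N.expo 1) (n := N.nak) (hX w) N.losR_pos
    rw [mul_div_assoc] at h1
    rw [← h1]
    refine setLIntegral_congr_fun measurableSet_Ioc fun ρ hρ => ?_
    simp only [hlink ρ hρ]
  -- The interferers between r and R_L are obtained as a difference of two discs. This treats all
  -- exponents α ≥ 2 alike; for α = 2 the integral over the whole plane would diverge.
  have e3 : ∀ w, ENNReal.ofReal (N.losR ^ 2 * (1 - J' w)) = ENNReal.ofReal (r ^ 2 * (1 - J w)) +
      ∫⁻ ρ in Ioc r N.losR, ENNReal.ofReal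
        (2 * ρ * (1 - N.linkLaplace 1 (t / N.linkGain 1 r) ρ w)) := by
    intro w
    rw [← e1, ← e1', ← Ioc_union_Ioc_eq_Ioc hr'.le hrR, lintegral_union measurableSet_Ioc]
    exact Ioc_disjoint_Ioc_of_le le_rfl
  have hle : ∀ w, r ^ 2 * (1 - J w) ≤ N.losR ^ 2 * (1 - J' w) := by
    intro w
    rw [← ENNReal.ofReal_le_ofReal_iff (mul_nonneg (sq_nonneg _) (by linarith [(hJm' w).2])), e3]
    exact le_self_add
  have e2 : ∀ w, ∫⁻ ρ in Ioi r, ENNReal.ofReal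
      (2 * ρ * (1 - N.linkLaplace 1 (t / N.linkGain 1 r) ρ w)) =
      ENNReal.ofReal (N.losR ^ 2 * (1 - J' w) - r ^ 2 * (1 - J w)) := by
    intro w
    have h0 : ∫⁻ ρ in Ioi N.losR, ENNReal.ofReal
        (2 * ρ * (1 - N.linkLaplace 1 (t / N.linkGain 1 r) ρ w)) = 0 := by
      refine (setLIntegral_congr_fun measurableSet_Ioi fun ρ hρ => ?_).trans lintegral_zero
      simp [linkLaplace, linkGain_one_of_lt hρ]
    rw [← Ioc_union_Ioi_eq_Ioi hrR, lintegral_union measurableSet_Ioi (Ioc_disjoint_Ioi le_rfl), h0,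
      add_zero, ENNReal.ofReal_sub _ (mul_nonneg (sq_nonneg _) (by linarith [(hJm w).2])), e3,
      ENNReal.add_sub_cancel_left ENNReal.ofReal_ne_top]
  simp_rw [e1, e2]
  have hZm : Measurable Z := ((N.measurable_gain 1).const_mul _).div_const _
  have hJi : Integrable J N.angleLaw := by
    refine Integrable.of_bound (C := 1) (measurable_discAvg.comp hZm).aestronglyMeasurable
      (Eventually.of_forall fun w => ?_)
    rw [Real.norm_eq_abs, abs_of_nonneg (hJm w).1]; exact (hJm w).2
  have hJi' : Integrable J' N.angleLaw := by
    refine Integrable.of_bound (C := 1)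
      (measurable_discAvg.comp (hZm.mul_const _)).aestronglyMeasurable
      (Eventually.of_forall fun w => ?_)
    rw [Real.norm_eq_abs, abs_of_nonneg (hJm' w).1]; exact (hJm' w).2
  have hi1 : Integrable (fun w => r ^ 2 * (1 - J w)) N.angleLaw :=
    ((integrable_const 1).sub hJi).const_mul _
  have hi2 : Integrable (fun w => N.losR ^ 2 * (1 - J' w)) N.angleLaw :=
    ((integrable_const 1).sub hJi').const_mul _
  have hn1 : ∀ w, 0 ≤ r ^ 2 * (1 - J w) := fun w =>
    mul_nonneg (sq_nonneg _) (by linarith [(hJm w).2])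
  rw [← ofReal_integral_eq_lintegral_ofReal hi1 (Eventually.of_forall hn1),
    ← ofReal_integral_eq_lintegral_ofReal
      (f := fun w => N.losR ^ 2 * (1 - J' w) - r ^ 2 * (1 - J w)) (hi2.sub hi1)
      (Eventually.of_forall fun w => sub_nonneg.2 (hle w))]
  have hp2 : 0 ≤ 1 - p := by linarith
  have hI1 : 0 ≤ ∫ w, r ^ 2 * (1 - J w) ∂N.angleLaw := integral_nonneg hn1
  have hI2 : 0 ≤ ∫ w, (N.losR ^ 2 * (1 - J' w) - r ^ 2 * (1 - J w)) ∂N.angleLaw :=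
    integral_nonneg fun w => sub_nonneg.2 (hle w)
  have hpl : N.place 1 {c | K c} = ENNReal.ofReal p := (ofReal_measureReal (measure_ne_top _ _)).symm
  have hW : ∫ w, N.picoW p t r w ∂N.angleLaw =
      p * r ^ 2 * ∫ w, J w ∂N.angleLaw - N.losR ^ 2 * ∫ w, J' w ∂N.angleLaw := by
    rw [← integral_const_mul, ← integral_const_mul, ← integral_sub (hJi.const_mul _)
      (hJi'.const_mul _)]
    rfl
  have hE1 : ∫ w, r ^ 2 * (1 - J w) ∂N.angleLaw = r ^ 2 * (1 - ∫ w, J w ∂N.angleLaw) := by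
    rw [integral_const_mul, integral_sub (integrable_const _) hJi]; simp
  have hE2 : ∫ w, (N.losR ^ 2 * (1 - J' w) - r ^ 2 * (1 - J w)) ∂N.angleLaw =
      N.losR ^ 2 * (1 - ∫ w, J' w ∂N.angleLaw) - r ^ 2 * (1 - ∫ w, J w ∂N.angleLaw) := by
    rw [integral_sub hi2 hi1, hE1, integral_const_mul, integral_sub (integrable_const _) hJi']; simp
  have hk : t / N.linkGain 1 r * N.noise 1 =
      t * r ^ N.expo 1 * N.noise 1 / (N.power 1 * N.icpt 1 * N.ant 1) := by
    rw [linkGain_one_of_le hrR, Real.rpow_neg hr'.le]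
    field_simp
  have hT : 0 ≤ t / N.linkGain 1 r * N.noise 1 := by positivity
  set I1 := ∫ w, r ^ 2 * (1 - J w) ∂N.angleLaw
  set I2 := ∫ w, (N.losR ^ 2 * (1 - J' w) - r ^ 2 * (1 - J w)) ∂N.angleLaw
  have hcol : ENNReal.ofReal (p * r ^ 2) + ENNReal.ofReal (1 - p) * ENNReal.ofReal I1 +
      ENNReal.ofReal I2 = ENNReal.ofReal (p * r ^ 2 + (1 - p) * I1 + I2) := by
    rw [← ENNReal.ofReal_mul hp2, ← ENNReal.ofReal_add (by positivity) (by positivity),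
      ← ENNReal.ofReal_add (by positivity) (by positivity)]
  rw [hpl, hcol, ← ENNReal.ofReal_mul (p := Real.pi * N.dens 1) (by positivity),
    ← ENNReal.ofReal_mul (p := t / N.linkGain 1 r) (by positivity),
    expNeg_ofReal (x := Real.pi * N.dens 1 * _) (by positivity), expNeg_ofReal hT, hk, nearestDens, picoLap, hW, hE1, hE2,
    ← Real.exp_add]
  set T := t * r ^ N.expo 1 * N.noise 1 / (N.power 1 * N.icpt 1 * N.ant 1)
  exact ofReal_density_mul hr'.le hd.le hp0 _ (by ring)

end Pico

end HetNet

end HetNetASE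

/-! ### Serving rules: nearest station and received power -/

namespace HetNetASE

open Set
open scoped ENNReal

namespace HetNet

/-- The data of a serving rule of tier `i`: among the base stations with `K`, the one with the
highest score serves, provided that its score exceeds an independent level `M`. -/
structure ServingRule (N : HetNet) {Ω : Type*} {mΩ : MeasurableSpace Ω} (P : Measure Ω)
    (Φ : Ω → Set BS) (i : Fin 2) (K : Set ℕ → Prop) (s : ℝ → ℝ≥0∞) (M : Ω → ℝ≥0∞) : Prop where
  poisson : IsPoissonProcess Φ (N.intensity i) P
  finite : ∀ ω (R : ℝ), {x ∈ Φ ω | x.dist ≤ R}.Finite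
  decay : ∀ b : ℝ≥0∞, 0 < b → ∃ R : ℝ, ∀ r, b ≤ s r → r ≤ R
  measurable_place : MeasurableSet {c | K c}
  measurable_score : Measurable s
  measurable_level : Measurable M
  indep : Indep (countAlgebra Φ) (MeasurableSpace.comap M inferInstance) P
  mono : ∀ r : ℝ, 0 < r → 0 < N.linkGain i r → 0 < s r ∧ ∀ ρ : ℝ, 0 < ρ → (s r ≤ s ρ ↔ ρ ≤ r)

variable {N : HetNet} {Ω : Type*} {mΩ : MeasurableSpace Ω} {P : Measure Ω}

namespace ServingRule

variable [IsProbabilityMeasure P] {Φ : Ω → Set BS} {i : Fin 2} {K : Set ℕ → Prop} {s : ℝ → ℝ≥0∞} {M : Ω → ℝ≥0∞}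

lemma interfLaw_le (S : N.ServingRule P Φ i K s M) : N.interfLaw P Φ i K s M univ ≤ 1 :=
  interfLaw_univ_le S.poisson S.finite S.decay S.measurable_place S.measurable_score
    S.measurable_level S.indep

lemma measure_sinr (S : N.ServingRule P Φ i K s M) {τ : ℝ} (hτ : 0 < τ) :
    P {ω | ∃ x, N.ServedBy i K s (M ω) univ (Φ ω) x ∧ ENNReal.ofReal τ < N.sinr i (Φ ω) x} =
      ∫⁻ y, N.fadeTail i (ENNReal.ofReal τ * y) ∂(N.interfLaw P Φ i K s M) :=
  measure_served_sinr S.poisson S.finite S.decay S.measurable_place S.measurable_score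
    S.measurable_level S.indep hτ

end ServingRule

/-! ### Association with the nearest base station -/

/-- The score ranking base stations by distance. -/
def nearScore (r : ℝ) : ℝ≥0∞ := (ENNReal.ofReal r)⁻¹

lemma nearScore_pos (r : ℝ) : 0 < nearScore r := by
  simp [nearScore, pos_iff_ne_zero]

lemma nearScore_le_iff {r ρ : ℝ} (hr : 0 ≤ r) : nearScore r ≤ nearScore ρ ↔ ρ ≤ r := by
  rw [nearScore, nearScore, ENNReal.inv_le_inv, ENNReal.ofReal_le_ofReal_iff hr]

lemma nearScore_lt_iff {r ρ : ℝ} (hρ : 0 ≤ ρ) : nearScore r < nearScore ρ ↔ ρ < r := by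
  rw [← not_le, ← not_le, nearScore_le_iff hρ]

lemma measurable_nearScore : Measurable nearScore := by
  unfold nearScore; fun_prop

lemma nearScore_decay (b : ℝ≥0∞) (hb : 0 < b) : ∃ R : ℝ, ∀ r, b ≤ nearScore r → r ≤ R := by
  refine ⟨(b⁻¹).toReal, fun r h => ?_⟩
  rw [nearScore, ENNReal.le_inv_iff_le_inv] at h
  exact (ENNReal.ofReal_le_iff_le_toReal (by simpa using hb.ne')).1 h

/-- The level 0 lies below every score, because `nearScore` is positive everywhere, and a constant
is independent of anything. -/
lemma nearestRule [IsProbabilityMeasure P] {Φ : Fin 2 → Ω → Set BS} (hΦ : N.IsModel P Φ) (i : Fin 2) {K : Set ℕ → Prop}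
    (hK : MeasurableSet {c | K c}) : N.ServingRule P (Φ i) i K nearScore (fun _ => 0) where
  poisson := hΦ.poisson i
  finite := hΦ.locFinite i
  decay := nearScore_decay
  measurable_place := hK
  measurable_score := measurable_nearScore
  measurable_level := measurable_const
  indep := by
    rw [MeasurableSpace.comap_const]
    exact indep_bot_right _
  mono r hr _ := ⟨nearScore_pos r, fun ρ _ => nearScore_le_iff hr.le⟩

lemma isNearest_iff {i : Fin 2} {K : Set ℕ → Prop} {c : Set BS} {x : BS} :
    IsNearest K c x ↔ N.ServedBy i K nearScore 0 univ c x := by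
  simp only [IsNearest, ServedBy, nearScore_pos, mem_univ, and_true]
  refine and_congr_right fun _ => and_congr_right fun _ => ?_
  refine forall_congr' fun y => forall_congr' fun _ => forall_congr' fun _ => forall_congr' fun _ => ?_
  exact (nearScore_lt_iff (norm_nonneg _)).symm

/-- The nearest station is unique, so the choice made in `tierSinr` is immaterial. -/
lemma lt_tierSinr_iff {i : Fin 2} {K : Set ℕ → Prop} {c : Set BS} {v : ℝ≥0∞} :
    v < N.tierSinr i K c ↔ ∃ x, N.ServedBy i K nearScore 0 univ c x ∧ v < N.sinr i c x := by
  unfold tierSinr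
  split_ifs with h
  · constructor
    · intro hv
      exact ⟨_, isNearest_iff.1 h.choose_spec, hv⟩
    · rintro ⟨x, hx, hv⟩
      have : h.choose = x := ServedBy.unique (isNearest_iff.1 h.choose_spec) hx
      rwa [this]
  · simp only [not_lt_zero, false_iff]
    rintro ⟨x, hx, -⟩
    exact h ⟨x, (isNearest_iff (N := N) (i := i)).2 hx⟩

lemma measure_lt_tierSinr [IsProbabilityMeasure P] {Φ : Fin 2 → Ω → Set BS} (hΦ : N.IsModel P Φ) (i : Fin 2)
    {K : Set ℕ → Prop} (hK : MeasurableSet {c | K c}) {τ : ℝ} (hτ : 0 < τ) :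
    P {ω | ENNReal.ofReal τ < N.tierSinr i K (Φ i ω)} =
      ∫⁻ y, N.fadeTail i (ENNReal.ofReal τ * y) ∂(N.interfLaw P (Φ i) i K nearScore fun _ => 0) := by
  rw [← (nearestRule hΦ i hK).measure_sinr hτ]
  simp only [lt_tierSinr_iff]

/-! ### Association by received power -/

variable (N) in
/-- The score ranking base stations by biased average received power. -/
def powScore (i : Fin 2) (r : ℝ) : ℝ≥0∞ :=
  ENNReal.ofReal (N.biasP i * N.power i * N.pathLoss i r * N.ant i)

lemma measurable_powScore (i : Fin 2) : Measurable (N.powScore i) :=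
  (((N.measurable_pathLoss i).const_mul _).mul_const _).ennreal_ofReal

lemma powScore_eq (i : Fin 2) (r : ℝ) :
    N.powScore i r = ENNReal.ofReal (N.biasP i * N.linkGain i r) := by
  unfold powScore linkGain; congr 1; ring

lemma ofReal_avgPower (i : Fin 2) (x : BS) : ENNReal.ofReal (N.avgPower i x) = N.powScore i x.dist :=
  rfl

lemma tendsto_pathLoss (i : Fin 2) : Tendsto (N.pathLoss i) atTop (𝓝 0) := by
  have h0 := N.two_lt_expo
  fin_cases i
  · have h := (tendsto_rpow_neg_atTop (show 0 < N.expo 0 by linarith)).const_mul (N.icpt 0)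
    rw [mul_zero] at h
    exact h
  · refine tendsto_const_nhds.congr' ?_
    filter_upwards [eventually_gt_atTop N.losR] with r hr
    simp [pathLoss, unitStep, not_le.2 hr]

lemma powScore_decay (i : Fin 2) (b : ℝ≥0∞) (hb : 0 < b) : ∃ R : ℝ, ∀ r, b ≤ N.powScore i r → r ≤ R := by
  have h1 : Tendsto (N.powScore i) atTop (𝓝 0) := by
    have h2 := ENNReal.tendsto_ofReal
      (((tendsto_pathLoss (N := N) i).const_mul (N.biasP i * N.power i)).mul_const (N.ant i : ℝ))
    rw [mul_zero, zero_mul, ENNReal.ofReal_zero] at h2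
    exact h2
  obtain ⟨R, hR⟩ := eventually_atTop.1 (h1.eventually_lt_const hb)
  refine ⟨R, fun r hr => ?_⟩
  by_contra h
  exact not_le.2 (hR r (not_le.1 h).le) hr

lemma powScore_mono (i : Fin 2) {r : ℝ} (hr : 0 < r) (hg : 0 < N.linkGain i r) :
    0 < N.powScore i r ∧ ∀ ρ : ℝ, 0 < ρ → (N.powScore i r ≤ N.powScore i ρ ↔ ρ ≤ r) := by
  have hb := N.biasP_pos i
  rw [powScore_eq, ENNReal.ofReal_pos]
  refine ⟨mul_pos hb hg, fun ρ hρ => ?_⟩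
  rw [powScore_eq, ENNReal.ofReal_le_ofReal_iff (mul_nonneg hb.le (N.linkGain_nonneg i hρ.le)),
    mul_le_mul_iff_right₀ hb]
  have hA : 0 < N.power i * N.icpt i * N.ant i := by
    have h1 := N.power_pos i
    have h2 := N.icpt_pos i
    have h3 : (0 : ℝ) < N.ant i := by exact_mod_cast N.ant_pos i
    positivity
  have hp : ∀ α : ℝ, 0 < α → (r ^ (-α) ≤ ρ ^ (-α) ↔ ρ ≤ r) := fun α hα =>
    Real.rpow_le_rpow_iff_of_neg hr hρ (by linarith)
  have h0 := N.two_lt_expo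
  have h1 := N.expo_pico
  revert hg hA
  fin_cases i
  · intro hg hA
    simp only [Fin.zero_eta, linkGain_zero_eq] at hA ⊢
    rw [mul_le_mul_iff_right₀ hA, hp _ (by linarith)]
  · intro hg hA
    simp only [Fin.mk_one] at hA hg ⊢
    have hrR := (N.linkGain_one_pos_iff hr).1 hg
    by_cases hρR : ρ ≤ N.losR
    · rw [linkGain_one_of_le hrR, linkGain_one_of_le hρR, mul_le_mul_iff_right₀ hA,
        hp _ (by linarith)]
    -- Beyond the ball the score is zero and cannot reach the positive score at r; nor can such a ρ
    -- be at most r.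
    · rw [linkGain_one_of_lt (not_le.1 hρR)]
      constructor
      · intro h; linarith
      · intro h; exact absurd (h.trans hrR) hρR

/-- The other tier matters only through its top score, a function of its counts, so independence of
the tiers makes it an admissible level. -/
lemma powerRule {Φ : Fin 2 → Ω → Set BS} (hΦ : N.IsModel P Φ) {i j : Fin 2} (hij : i ≠ j)
    {K : Set ℕ → Prop} (hK : MeasurableSet {c | K c}) :
    N.ServingRule P (Φ i) i K (N.powScore i) (fun ω => topScore K (N.powScore j) (Φ j ω)) where
  poisson := hΦ.poisson i
  finite := hΦ.locFinite i
  decay := powScore_decay i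
  measurable_place := hK
  measurable_score := measurable_powScore i
  measurable_level := measurable_topScore_comp (hΦ.poisson j) hK (measurable_powScore j)
  indep := by
    have h1 : Indep (countAlgebra (Φ i)) (countAlgebra (Φ j)) P := by
      fin_cases i <;> fin_cases j
      · exact absurd rfl hij
      · exact hΦ.indep
      · exact hΦ.indep.symm
      · exact absurd rfl hij
    refine indep_of_indep_of_le_right h1 ?_
    have h2 : Measurable[countAlgebra (Φ j)] fun ω => topScore K (N.powScore j) (Φ j ω) :=
      (measurable_iSup_config (measurable_score hK (measurable_powScore j))).comp
        (measurable_config (Φ j))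
    exact h2.comap_le
  mono _ hr hg := powScore_mono i hr hg

lemma avgPower_nonneg (i : Fin 2) (x : BS) : 0 ≤ N.avgPower i x := by
  have h1 := N.biasP_pos i
  have h2 := N.power_pos i
  have h3 := N.pathLoss_nonneg i (norm_nonneg x.1)
  unfold avgPower BS.dist
  positivity

/-- Comparing the top score strictly with that of x requires the latter to be positive. A nonzero
SINR guarantees it: zero average power means zero signal. Hence the equivalence is stated jointly
with the SINR condition. -/
lemma assocRP_iff {Φ : Fin 2 → Ω → Set BS} (hΦ : N.IsModel P Φ) {i j : Fin 2} (hij : i ≠ j)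
    {f : ℕ} {ω : Ω} {x : BS} {v : ℝ≥0∞} :
    (N.AssocRP Φ f ω i x ∧ v < N.sinr i (Φ i ω) x) ↔
      (N.ServedBy i (fun c => f ∈ c) (N.powScore i)
        (topScore (fun c => f ∈ c) (N.powScore j) (Φ j ω)) univ (Φ i ω) x ∧
        v < N.sinr i (Φ i ω) x) := by
  refine and_congr_left fun hv => ?_
  have hpos : 0 < N.avgPower i x := by
    refine lt_of_le_of_ne (avgPower_nonneg i x) fun h0 => ?_
    have h1 : N.signal i x = 0 := by
      have h2 : N.avgPower i x = N.biasP i * (N.power i * N.pathLoss i x.dist * N.ant i) := by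
        unfold avgPower; ring
      rw [h2] at h0
      have h3 := (mul_eq_zero.1 h0.symm).resolve_left (N.biasP_pos i).ne'
      rw [signal, h3, zero_mul]
    simp [sinr, h1] at hv
  have hlt : ∀ (k : Fin 2) (y : BS), N.avgPower k y < N.avgPower i x ↔
      N.powScore k y.dist < N.powScore i x.dist := by
    intro k y
    rw [← ofReal_avgPower, ← ofReal_avgPower,
      ENNReal.ofReal_lt_ofReal_iff_of_nonneg (avgPower_nonneg k y)]
  have hs : 0 < N.powScore i x.dist := by
    rw [← ofReal_avgPower]; exact ENNReal.ofReal_pos.2 hpos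
  unfold AssocRP ServedBy
  rw [topScore_lt_iff (hΦ.locFinite j ω) (powScore_decay j) hs]
  simp only [mem_univ, and_true]
  refine and_congr_right fun _ => and_congr_right fun _ => ?_
  constructor
  · intro h
    exact ⟨fun y hy hf hne => (hlt i y).1 (h i y hy hf fun h => hne (Prod.ext_iff.1 h).2),
      fun y hy hf => (hlt j y).1 (h j y hy hf fun h => hij (Prod.ext_iff.1 h).1.symm)⟩
  · rintro ⟨h1, h2⟩ k y hy hf hne
    rw [hlt]
    by_cases hk : k = i
    · subst hk
      exact h1 y hy hf fun h => hne (by rw [h])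
    · have hkj : k = j := by omega
      subst hkj
      exact h2 y hy hf

lemma measurableSet_mem_place (f : ℕ) : MeasurableSet {c : Set ℕ | f ∈ c} :=
  measurableSet_setOfPred.2 (measurable_set_mem f)

lemma measure_maxRP [IsProbabilityMeasure P] {Φ : Fin 2 → Ω → Set BS} (hΦ : N.IsModel P Φ) {i j : Fin 2} (hij : i ≠ j)
    (f : ℕ) {τ : ℝ} (hτ : 0 < τ) :
    P {ω | ∃ x, N.AssocRP Φ f ω i x ∧ ENNReal.ofReal τ < N.sinr i (Φ i ω) x} =
      ∫⁻ y, N.fadeTail i (ENNReal.ofReal τ * y) ∂(N.interfLaw P (Φ i) i (fun c => f ∈ c)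
        (N.powScore i) fun ω => topScore (fun c => f ∈ c) (N.powScore j) (Φ j ω)) := by
  rw [← (powerRule hΦ hij (measurableSet_mem_place f)).measure_sinr hτ]
  simp only [assocRP_iff hΦ hij]

/-! ### The exclusion radii of the association by received power -/

variable (N) in
/-- The biased received power at unit distance. -/
def unitPower (i : Fin 2) : ℝ := N.biasP i * N.power i * N.icpt i * N.ant i

lemma unitPower_pos (i : Fin 2) : 0 < N.unitPower i := by
  have h0 := N.biasP_pos i
  have h1 := N.power_pos i
  have h2 := N.icpt_pos i
  have h3 : (0 : ℝ) < N.ant i := by exact_mod_cast N.ant_pos i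
  unfold unitPower
  positivity

lemma powRatio_eq (j i : Fin 2) : N.powRatio j i = N.unitPower j / N.unitPower i := rfl

lemma powRatio_pos (j i : Fin 2) : 0 < N.powRatio j i := div_pos (unitPower_pos j) (unitPower_pos i)

lemma powScore_zero (r : ℝ) : N.powScore 0 r = ENNReal.ofReal (N.unitPower 0 * r ^ (-N.expo 0)) := by
  rw [powScore_eq, linkGain_zero_eq]; unfold unitPower; congr 1; ring

lemma powScore_one_of_le {r : ℝ} (hr : r ≤ N.losR) :
    N.powScore 1 r = ENNReal.ofReal (N.unitPower 1 * r ^ (-N.expo 1)) := by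
  rw [powScore_eq, linkGain_one_of_le hr]; unfold unitPower; congr 1; ring

lemma rpow_neg_le_iff {a b α β r ρ : ℝ} (ha : 0 < a) (hb : 0 < b) (hβ : 0 < β)
    (hr : 0 < r) (hρ : 0 < ρ) :
    a * r ^ (-α) ≤ b * ρ ^ (-β) ↔ ρ ≤ (b / a) ^ (1 / β) * r ^ (α / β) := by
  have h1 := Real.rpow_pos_of_pos hr α
  have h2 := Real.rpow_pos_of_pos hρ β
  rw [Real.rpow_neg hr.le, Real.rpow_neg hρ.le,
    ← Real.rpow_le_rpow_iff hρ.le (by positivity) hβ,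
    Real.mul_rpow (by positivity) (by positivity), ← Real.rpow_mul (by positivity),
    ← Real.rpow_mul hr.le, one_div_mul_cancel hβ.ne', div_mul_cancel₀ _ hβ.ne', Real.rpow_one,
    ← div_eq_mul_inv, ← div_eq_mul_inv, div_le_div_iff₀ h1 h2, div_mul_eq_mul_div, le_div_iff₀ ha]
  ring_nf

variable (N) in
/-- The distance within which a pico base station beats a macro base station at distance `r`. -/
def exclPico (r : ℝ) : ℝ :=
  min N.losR (N.powRatio 1 0 ^ (1 / N.expo 1) * r ^ (N.expo 0 / N.expo 1))

variable (N) in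
/-- The distance within which a macro base station beats a pico base station at distance `r`. -/
def exclMacro (r : ℝ) : ℝ := N.powRatio 0 1 ^ (1 / N.expo 0) * r ^ (N.expo 1 / N.expo 0)

/-- The minimum with R_L appears because a pico station outside the ball has zero score and beats
nobody. -/
lemma powScore_le_exclPico {r : ℝ} (hr : 0 < r) {ρ : ℝ} (hρ : 0 < ρ) :
    N.powScore 0 r ≤ N.powScore 1 ρ ↔ ρ ≤ N.exclPico r := by
  have h1 := N.expo_pico
  have hs := (powScore_mono 0 hr (N.linkGain_zero_pos hr)).1
  rw [exclPico, le_min_iff]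
  by_cases hρR : ρ ≤ N.losR
  · have h0 := unitPower_pos (N := N) 1
    rw [powScore_zero, powScore_one_of_le hρR, ENNReal.ofReal_le_ofReal_iff (by positivity),
      rpow_neg_le_iff (unitPower_pos 0) (unitPower_pos 1) (by linarith) hr hρ, powRatio_eq]
    simp [hρR]
  · have h0 : N.powScore 1 ρ = 0 := by
      rw [powScore_eq, linkGain_one_of_lt (not_le.1 hρR)]; simp
    rw [h0]
    simp [hρR, hs.ne']

lemma powScore_le_exclMacro {r : ℝ} (hr : 0 < r) (hrR : r ≤ N.losR) {ρ : ℝ} (hρ : 0 < ρ) :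
    N.powScore 1 r ≤ N.powScore 0 ρ ↔ ρ ≤ N.exclMacro r := by
  have h1 := N.two_lt_expo
  have h0 := unitPower_pos (N := N) 0
  rw [powScore_zero, powScore_one_of_le hrR, ENNReal.ofReal_le_ofReal_iff (by positivity),
    rpow_neg_le_iff (unitPower_pos 1) (unitPower_pos 0) (by linarith) hr hρ, exclMacro, powRatio_eq]

lemma exclPico_nonneg {r : ℝ} (hr : 0 ≤ r) : 0 ≤ N.exclPico r := by
  have := powRatio_pos (N := N) 1 0
  exact le_min N.losR_pos.le (by positivity)

lemma exclMacro_nonneg {r : ℝ} (hr : 0 ≤ r) : 0 ≤ N.exclMacro r := by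
  have := powRatio_pos (N := N) 0 1
  unfold exclMacro
  positivity

/-- The probability that no base station of the other tier beats the serving one. -/
lemma measure_other_lt [IsProbabilityMeasure P] {Φ : Fin 2 → Ω → Set BS} (hΦ : N.IsModel P Φ) (j : Fin 2) (f : ℕ)
    {a : ℝ≥0∞} (ha : 0 < a) {R : ℝ} (hR : 0 ≤ R)
    (haR : ∀ ρ : ℝ, 0 < ρ → (a ≤ N.powScore j ρ ↔ ρ ≤ R)) :
    P {ω | topScore (fun c => f ∈ c) (N.powScore j) (Φ j ω) < a} =
      ENNReal.ofReal (Real.exp (-(Real.pi * (N.cacheProb j f * N.dens j) * R ^ 2))) := by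
  have hd := N.dens_pos j
  have hp : 0 ≤ N.cacheProb j f := measureReal_nonneg
  rw [measure_topScore_lt (hΦ.poisson j) (hΦ.locFinite j) (powScore_decay j)
    (measurableSet_mem_place f) (measurable_powScore j) ha,
    intensity_le_score (measurableSet_mem_place f) (measurable_powScore j) ha hR haR]
  exact expNeg_ofReal (by rw [cacheProb] at hp; positivity)

end HetNet

end HetNetASE

namespace HetNetASE

open Set
open scoped ENNReal

namespace HetNet

variable {N : HetNet} {Ω : Type*} {mΩ : MeasurableSpace Ω} {P : Measure Ω} [IsProbabilityMeasure P]
  {Φ : Fin 2 → Ω → Set BS}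

/-! ### The macro tier -/

/-- Rayleigh fading power is exponential, so the macro coverage is exactly the Laplace transform of
`interfLaw` at τ. -/
lemma fadeTail_zero (y : ℝ≥0∞) : N.fadeTail 0 y = expNeg y := by
  induction y with
  | top => simp
  | coe y =>
    have h1 : {t : ℝ | (y : ℝ≥0∞) < ENNReal.ofReal t} = (Iic (y : ℝ))ᶜ := by
      ext t
      rw [mem_ofPred_eq, ENNReal.lt_ofReal_iff_toReal_lt ENNReal.coe_ne_top]
      simp
    have h2 : N.fadeLaw 0 = expMeasure 1 := by simp [fadeLaw, fadeParam, expMeasure]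
    have h3 := cdf_expMeasure_eq one_pos (y : ℝ)
    have : IsProbabilityMeasure (expMeasure 1) := isProbabilityMeasure_expMeasure one_pos
    rw [if_pos y.coe_nonneg, cdf_eq_real] at h3
    rw [fadeTail, h1, h2, ← ofReal_measureReal (measure_ne_top _ _),
      probReal_compl_eq_one_sub measurableSet_Iic, h3, ← ENNReal.ofReal_coe_nnreal,
      expNeg_ofReal y.coe_nonneg]
    simp

lemma measurable_macroIntegrand (p τ : ℝ) : Measurable fun r : ℝ =>
    Real.exp (-(τ * N.noise 0 * r ^ N.expo 0 / (N.power 0 * N.icpt 0 * N.ant 0))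
      - Real.pi * N.dens 0 * r ^ 2 *
        (p * (hypS (N.expo 0) 1 τ - 1) + (1 - p) * gammaDelta (N.expo 0) 1 τ)) := by
  fun_prop

lemma measurable_nearestDens (i : Fin 2) (p : ℝ) : Measurable (N.nearestDens i p) := by
  unfold nearestDens; fun_prop

lemma nearestDens_nonneg (i : Fin 2) {p r : ℝ} (hp : 0 ≤ p) (hr : 0 ≤ r) :
    0 ≤ N.nearestDens i p r := by
  have := N.dens_pos i
  unfold nearestDens
  positivity

lemma toReal_lintegral_macro {p τ : ℝ} {g : ℝ → ℝ} (hg : Measurable g)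
    (hg0 : ∀ r ∈ Ioi (0 : ℝ), 0 ≤ g r) :
    (∫⁻ r in Ioi (0 : ℝ), ENNReal.ofReal
      (Real.exp (-(τ * N.noise 0 * r ^ N.expo 0 / (N.power 0 * N.icpt 0 * N.ant 0))
      - Real.pi * N.dens 0 * r ^ 2 *
        (p * (hypS (N.expo 0) 1 τ - 1) + (1 - p) * gammaDelta (N.expo 0) 1 τ)) * g r)).toReal =
      N.macroInt p g τ := by
  rw [macroInt, integral_eq_lintegral_of_nonneg_ae]
  · filter_upwards [ae_restrict_mem measurableSet_Ioi] with r hr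
    exact mul_nonneg (Real.exp_pos _).le (hg0 r hr)
  · exact ((measurable_macroIntegrand p τ).mul hg).aestronglyMeasurable

/-- Coverage probability of the nearest macro base station with `K`. -/
lemma measureReal_lt_tierSinr_zero (hΦ : N.IsModel P Φ) {K : Set ℕ → Prop}
    (hK : MeasurableSet {c | K c}) {τ : ℝ} (hτ : 0 < τ) :
    P.real {ω | ENNReal.ofReal τ < N.tierSinr 0 K (Φ 0 ω)} =
      N.macroCov ((N.place 0).real {c | K c}) τ := by
  have S := nearestRule hΦ 0 hK
  rw [measureReal_def, measure_lt_tierSinr hΦ 0 hK hτ]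
  simp only [fadeTail_zero]
  rw [lintegral_expNeg_interfLaw_macro S.poisson S.finite S.decay S.measurable_place
    S.measurable_score S.measurable_level S.indep S.mono hτ, macroCov,
    ← toReal_lintegral_macro (measurable_nearestDens 0 _)
      fun r hr => nearestDens_nonneg 0 measureReal_nonneg (le_of_lt hr)]
  congr 1
  refine lintegral_congr fun r => ?_
  simp [nearScore_pos]

lemma tierCov_zero (hΦ : N.IsModel P Φ) (f : ℕ) {τ : ℝ} (hτ : 0 < τ) :
    N.tierCov P Φ 0 f τ = N.macroCov (N.cacheProb 0 f) τ :=
  measureReal_lt_tierSinr_zero hΦ (measurableSet_mem_place f) hτ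

/-- Squares an exclusion radius into the form of the exponents in `distDensRP`. -/
lemma rpow_two_div_mul {c r a b : ℝ} (hc : 0 < c) (hr : 0 < r) :
    (c ^ (1 / b) * r ^ (a / b)) ^ 2 = c ^ (2 / b) * r ^ (2 / (b / a)) := by
  rw [mul_pow, ← Real.rpow_natCast, ← Real.rpow_natCast, ← Real.rpow_mul hc.le,
    ← Real.rpow_mul hr.le]
  congr 2
  · push_cast; ring
  · push_cast; rw [div_div_eq_mul_div]; ring

lemma rpow_two_div_self {r a : ℝ} (ha : a ≠ 0) : r ^ (2 / (a / a)) = r ^ 2 := by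
  rw [div_self ha, div_one]; norm_cast

lemma distDensRP_one_eq (f : ℕ) {r : ℝ} (hr : 0 < r) (hrR : r ≤ N.losR) :
    N.distDensRP 1 f r = N.nearestDens 1 (N.cacheProb 1 f) r *
      Real.exp (-(Real.pi * (N.cacheProb 0 f * N.dens 0) * N.exclMacro r ^ 2)) := by
  have h1 := N.expo_pico
  -- The own tier has ratio 1, so the exponent 2/α₁ given to it in the sum over tiers is harmless.
  have h11 : N.powRatio 1 1 = 1 := div_self (unitPower_pos 1).ne'
  simp only [distDensRP, one_ne_zero, if_false, unitStep, sub_nonneg, hrR, if_true, mul_one,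
    nearestDens, Fin.sum_univ_two, exclMacro, h11, Real.one_rpow,
    rpow_two_div_mul (powRatio_pos 0 1) hr, rpow_two_div_self (show N.expo 1 ≠ 0 by linarith)]
  rw [mul_assoc (2 * Real.pi * N.cacheProb 1 f * N.dens 1 * r), ← Real.exp_add]
  congr 2
  ring

/-- R_r is the macro distance at which the exclusion radius for pico stations reaches the edge of
the ball. -/
lemma le_radR_iff {r : ℝ} (hr : 0 < r) :
    r ≤ N.radR ↔ N.powRatio 1 0 ^ (1 / N.expo 1) * r ^ (N.expo 0 / N.expo 1) ≤ N.losR := by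
  have h0 := N.two_lt_expo
  have h1 := N.expo_pico
  have hR := N.losR_pos
  have hp := powRatio_pos (N := N) 0 1
  have hp' := powRatio_pos (N := N) 1 0
  have hα0 : 0 < N.expo 0 := by linarith
  have hα1 : 0 < N.expo 1 := by linarith
  rw [radR, ← Real.rpow_le_rpow_iff hr.le (by positivity) hα0, ← Real.rpow_mul (by positivity),
    one_div_mul_cancel hα0.ne', Real.rpow_one,
    ← Real.rpow_le_rpow_iff (by positivity : 0 ≤ N.powRatio 1 0 ^ (1 / N.expo 1) *
      r ^ (N.expo 0 / N.expo 1)) hR.le hα1,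
    Real.mul_rpow (by positivity) (by positivity), ← Real.rpow_mul (by positivity),
    ← Real.rpow_mul hr.le, one_div_mul_cancel hα1.ne', div_mul_cancel₀ _ hα1.ne', Real.rpow_one]
  have h01 : N.powRatio 1 0 = (N.powRatio 0 1)⁻¹ := by
    rw [powRatio_eq, powRatio_eq, inv_div]
  rw [h01, inv_mul_le_iff₀ hp]

/-- The serving density is the nearest-distance density times the void probability of the other tier
in the exclusion disc. At r = R_r both unit steps equal 1 and the two branches would add up, so this
point is excluded; it is a null set for the integral. -/
lemma distDensRP_zero_eq (f : ℕ) {r : ℝ} (hr : 0 < r) (hne : r ≠ N.radR) :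
    N.distDensRP 0 f r = N.nearestDens 0 (N.cacheProb 0 f) r *
      Real.exp (-(Real.pi * (N.cacheProb 1 f * N.dens 1) * N.exclPico r ^ 2)) := by
  have h0 := N.two_lt_expo
  have h00 : N.powRatio 0 0 = 1 := div_self (unitPower_pos 0).ne'
  have hp := powRatio_pos (N := N) 1 0
  rcases lt_or_gt_of_ne hne with h | h
  · have h1 := (le_radR_iff hr).1 h.le
    simp only [distDensRP, if_true, unitStep, sub_nonneg, h.le, not_le.2 h, if_false, mul_one,
      mul_zero, add_zero, nearestDens, Fin.sum_univ_two, exclPico, min_eq_right h1, h00,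
      Real.one_rpow, rpow_two_div_mul hp hr, rpow_two_div_self (show N.expo 0 ≠ 0 by linarith)]
    rw [mul_assoc (2 * Real.pi * N.cacheProb 0 f * N.dens 0 * r), ← Real.exp_add]
    congr 2
    ring
  · have h1 := fun h' => not_le.2 h ((le_radR_iff hr).2 h')
    simp only [distDensRP, if_true, unitStep, sub_nonneg, h.le, not_le.2 h, if_false, mul_one,
      mul_zero, zero_add, nearestDens, exclPico, min_eq_left (not_le.1 h1).le]
    rw [mul_assoc (2 * Real.pi * N.cacheProb 0 f * N.dens 0 * r), ← Real.exp_add]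
    congr 2
    ring

lemma measurable_distDensRP (i : Fin 2) (f : ℕ) : Measurable (N.distDensRP i f) := by
  have h1 := measurable_unitStep.comp (measurable_const.sub measurable_id : Measurable fun r : ℝ => N.radR - r)
  have h2 := measurable_unitStep.comp (measurable_id.sub measurable_const : Measurable fun r : ℝ => r - N.radR)
  have h3 := measurable_unitStep.comp (measurable_const.sub measurable_id : Measurable fun r : ℝ => N.losR - r)
  unfold distDensRP
  split_ifs
  · exact (Measurable.mul (by fun_prop) h1).add (Measurable.mul (by fun_prop) h2)
  · exact Measurable.mul (by fun_prop) h3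

lemma unitStep_nonneg (x : ℝ) : 0 ≤ unitStep x := by unfold unitStep; split_ifs <;> norm_num

lemma distDensRP_nonneg (i : Fin 2) (f : ℕ) {r : ℝ} (hr : 0 ≤ r) : 0 ≤ N.distDensRP i f r := by
  have h0 := N.dens_pos 0
  have h1 := N.dens_pos 1
  have h2 : 0 ≤ N.cacheProb 0 f := measureReal_nonneg
  have h3 : 0 ≤ N.cacheProb 1 f := measureReal_nonneg
  have h4 := unitStep_nonneg (N.radR - r)
  have h5 := unitStep_nonneg (r - N.radR)
  have h6 := unitStep_nonneg (N.losR - r)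
  unfold distDensRP
  split_ifs <;> positivity

lemma maxRPCov_zero (hΦ : N.IsModel P Φ) (f : ℕ) {τ : ℝ} (hτ : 0 < τ) :
    N.maxRPCov P Φ 0 f τ = N.macroInt (N.cacheProb 0 f) (N.distDensRP 0 f) τ := by
  have S := powerRule hΦ zero_ne_one (measurableSet_mem_place f)
  rw [maxRPCov, measureReal_def, measure_maxRP hΦ zero_ne_one f hτ]
  simp only [fadeTail_zero]
  rw [lintegral_expNeg_interfLaw_macro S.poisson S.finite S.decay S.measurable_place
    S.measurable_score S.measurable_level S.indep S.mono hτ,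
    ← toReal_lintegral_macro (measurable_distDensRP 0 f)
      fun r hr => distDensRP_nonneg 0 f (le_of_lt hr)]
  congr 1
  refine lintegral_congr_ae ?_
  have hne : ∀ᵐ r : ℝ ∂(volume.restrict (Ioi 0)), r ≠ N.radR :=
    ae_restrict_of_ae (compl_mem_ae_iff.2 (measure_singleton _))
  filter_upwards [ae_restrict_mem measurableSet_Ioi, hne] with r hr hrne
  have hr' : (0 : ℝ) < r := hr
  have hs := (powScore_mono 0 hr' (N.linkGain_zero_pos hr')).1
  rw [measure_other_lt hΦ 1 f hs (exclPico_nonneg hr'.le) fun ρ hρ => powScore_le_exclPico hr' hρ,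
    distDensRP_zero_eq f hr' hrne, ← mul_assoc (Real.exp _), ENNReal.ofReal_mul (q := Real.exp _)]
  · rfl
  · exact mul_nonneg (Real.exp_pos _).le (nearestDens_nonneg 0 measureReal_nonneg hr'.le)

lemma integral_Ioi_mul_exp_neg_sq {c : ℝ} (hc : 0 < c) :
    ∫ r in Ioi (0 : ℝ), r * Real.exp (-c * r ^ 2) = (2 * c)⁻¹ := by
  have h := integral_mul_cexp_neg_mul_sq (b := (c : ℂ)) (by simpa using hc)
  have h2 : ∀ r : ℝ, (r : ℂ) * Complex.exp (-(c : ℂ) * (r : ℂ) ^ 2) =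
      ((r * Real.exp (-c * r ^ 2) : ℝ) : ℂ) := by
    intro r; simp
  simp_rw [h2] at h
  rw [integral_complex_ofReal] at h
  exact_mod_cast h

/-- The closed form in the interference-limited case. -/
lemma macroCov_eq (hN : N.noise 0 = 0) {p τ : ℝ} (hp : 0 ≤ p) (hp1 : p ≤ 1) (hτ : 0 < τ) :
    N.macroCov p τ = p / (p * hypS (N.expo 0) 1 τ + (1 - p) * gammaDelta (N.expo 0) 1 τ) := by
  have hd := N.dens_pos 0
  have hS := one_le_hypS (n := 1) N.two_lt_expo one_pos hτ.le
  have hD := gammaDelta_pos (n := 1) N.two_lt_expo one_pos hτ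
  set S := hypS (N.expo 0) 1 τ
  set D := gammaDelta (N.expo 0) 1 τ
  have hq : 0 < p * S + (1 - p) * D := by
    rcases hp.eq_or_lt with rfl | hp0
    · simpa using hD
    · have := mul_pos hp0 (by linarith : 0 < S)
      have := mul_nonneg (sub_nonneg.2 hp1) hD.le
      linarith
  have hc : 0 < Real.pi * N.dens 0 * (p * S + (1 - p) * D) := by positivity
  have h1 : ∀ r : ℝ, Real.exp (-(τ * N.noise 0 * r ^ N.expo 0 / (N.power 0 * N.icpt 0 * N.ant 0))
      - Real.pi * N.dens 0 * r ^ 2 * (p * (S - 1) + (1 - p) * D)) * N.nearestDens 0 p r =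
      2 * Real.pi * p * N.dens 0 *
        (r * Real.exp (-(Real.pi * N.dens 0 * (p * S + (1 - p) * D)) * r ^ 2)) := by
    intro r
    rw [hN, nearestDens, mul_left_comm, ← Real.exp_add, mul_assoc (2 * Real.pi * p * N.dens 0)]
    congr 3
    ring
  refine (setIntegral_congr_fun measurableSet_Ioi fun r _ => h1 r).trans ?_
  rw [integral_const_mul, integral_Ioi_mul_exp_neg_sq hc]
  field_simp

/-! ### The server mode -/

lemma thr_pos (i : Fin 2) {R : ℝ} (hR : 0 < R) : 0 < N.thr i R := by
  have h := N.band_pos i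
  have := Real.one_lt_rpow (x := 2) one_lt_two (div_pos hR h)
  unfold thr
  linarith

lemma logb_one_add_thr (i : Fin 2) (R : ℝ) : Real.logb 2 (1 + N.thr i R) = R / N.band i := by
  rw [thr, add_sub_cancel, Real.logb_rpow two_pos (by norm_num)]

lemma rate_eq_log (B : ℝ) (v : ℝ≥0∞) : rate B v = ENNReal.log ((1 + v) ^ (B / Real.log 2)) := by
  rw [ENNReal.log_rpow, rate]

/-- Comparing logarithms becomes comparing powers, valid also for infinite SINR since everything
takes place in [0, ∞]. -/
lemma rate_lt_rate_iff {B B' : ℝ} (hB : 0 < B) (v v' : ℝ≥0∞) :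
    rate B v < rate B' v' ↔ 1 + v < (1 + v') ^ (B' / B) := by
  have hl : 0 < Real.log 2 := Real.log_pos one_lt_two
  rw [rate_eq_log, rate_eq_log, ENNReal.log_lt_log_iff,
    show B' / Real.log 2 = B' / B * (B / Real.log 2) by field_simp, ENNReal.rpow_mul,
    ENNReal.rpow_lt_rpow_iff (div_pos hB hl)]

lemma coe_eq_rate (i : Fin 2) {R : ℝ} (hR : 0 < R) :
    (R : EReal) = rate (N.band i) (ENNReal.ofReal (N.thr i R)) := by
  have hB := N.band_pos i
  have hl : 0 < Real.log 2 := Real.log_pos one_lt_two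
  have h1 : 1 + ENNReal.ofReal (N.thr i R) = ENNReal.ofReal ((2 : ℝ) ^ (R / N.band i)) := by
    rw [← ENNReal.ofReal_one, ← ENNReal.ofReal_add zero_le_one (thr_pos i hR).le, thr]
    congr 1; ring
  rw [rate, h1, ENNReal.log_ofReal_of_pos (by positivity), Real.log_rpow two_pos, ← EReal.coe_mul]
  congr 1
  field_simp

/-- The backhaul condition is deterministic and gives the unit step. Every macro station may serve,
so the caching probability is 1. -/
lemma serverProb_eq (hΦ : N.IsModel P Φ) {R : ℝ} (hR : 0 < R) :
    N.serverProb P Φ R = unitStep (N.Cbh - R) * N.macroCov 1 (N.thr 0 R) := by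
  have hB := N.band_pos 0
  have h1 : ∀ ω, (R : EReal) < rate (N.band 0) (N.tierSinr 0 (fun _ => True) (Φ 0 ω)) ↔
      ENNReal.ofReal (N.thr 0 R) < N.tierSinr 0 (fun _ => True) (Φ 0 ω) := by
    intro ω
    rw [coe_eq_rate (N := N) 0 hR, rate_lt_rate_iff hB, div_self hB.ne', ENNReal.rpow_one,
      ENNReal.add_lt_add_iff_left ENNReal.one_ne_top]
  have h2 := measureReal_lt_tierSinr_zero hΦ (K := fun _ => True) (by simp) (thr_pos (N := N) 0 hR)
  simp only [ofPred_true, probReal_univ] at h2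
  unfold serverProb unitStep
  simp only [h1, sub_nonneg]
  split_ifs with h
  · simp only [h, true_and, one_mul]
    exact h2
  · simp [h]

end HetNet

end HetNetASE

namespace HetNetASE

open Set
open scoped ENNReal

/-! ### Convergence of the Gauss-Chebyshev quadrature -/

/-- The midpoint of the cell containing `θ`, in the partition of `[0, π]` into `u` cells. -/
def cellMid (u : ℕ) (θ : ℝ) : ℝ := ((⌊u * θ / Real.pi⌋₊ : ℝ) + 1 / 2) * Real.pi / u

lemma abs_cellMid_sub_le {u : ℕ} (hu : 0 < u) {θ : ℝ} (hθ : 0 ≤ θ) :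
    |cellMid u θ - θ| ≤ Real.pi / u := by
  have hu' : (0 : ℝ) < u := by exact_mod_cast hu
  have hpi := Real.pi_pos
  have h0 : 0 ≤ u * θ / Real.pi := by positivity
  have h1 := Nat.floor_le h0
  have h2 := Nat.lt_floor_add_one (u * θ / Real.pi)
  have h3 : cellMid u θ - θ =
      ((⌊u * θ / Real.pi⌋₊ : ℝ) + 1 / 2 - u * θ / Real.pi) * (Real.pi / u) := by
    unfold cellMid; field_simp
  have h4 : |(⌊u * θ / Real.pi⌋₊ : ℝ) + 1 / 2 - u * θ / Real.pi| ≤ 1 := by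
    rw [abs_le]; constructor <;> linarith
  rw [h3, abs_mul, abs_of_pos (div_pos hpi hu')]
  exact mul_le_of_le_one_left (by positivity) h4

lemma cellMid_mem {u : ℕ} (hu : 0 < u) {θ : ℝ} (hθ : θ ∈ Ioo 0 Real.pi) :
    cellMid u θ ∈ Ioo 0 Real.pi := by
  have hu' : (0 : ℝ) < u := by exact_mod_cast hu
  have hpi := Real.pi_pos
  have h0 : 0 ≤ u * θ / Real.pi := by have := hθ.1; positivity
  have h2 : ⌊u * θ / Real.pi⌋₊ < u := by
    rw [Nat.floor_lt h0, div_lt_iff₀ hpi]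
    exact mul_lt_mul_of_pos_left hθ.2 hu'
  have h3 : (⌊u * θ / Real.pi⌋₊ : ℝ) + 1 ≤ u := by exact_mod_cast h2
  unfold cellMid
  constructor
  · positivity
  · rw [div_lt_iff₀ hu', mul_comm Real.pi]
    exact mul_lt_mul_of_pos_right (by linarith) hpi

/-- The nodes are cosines of the midpoints of u equal cells of [0, π], and π/u is the length of a
cell. The quadrature is therefore exactly the integral of a step function, a form suited to
dominated convergence. -/
lemma chebQuad_eq_integral {u : ℕ} (hu : 0 < u) (g : ℝ → ℝ) :
    chebQuad u g = ∫ θ in (0 : ℝ)..Real.pi,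
      g (Real.cos (cellMid u θ)) * Real.sqrt (1 - Real.cos (cellMid u θ) ^ 2) := by
  have hu' : (0 : ℝ) < u := by exact_mod_cast hu
  have hpi := Real.pi_pos
  set h : ℝ → ℝ := fun θ => g (Real.cos θ) * Real.sqrt (1 - Real.cos θ ^ 2) with hh
  set a : ℕ → ℝ := fun k => k * Real.pi / u with ha
  have hstep : ∀ k, a (k + 1) - a k = Real.pi / u := by
    intro k; simp only [ha]; push_cast; ring
  have hle : ∀ k, a k ≤ a (k + 1) := fun k => by
    have := hstep k
    have : 0 < Real.pi / u := by positivity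
    linarith
  have hcell : ∀ k : ℕ, ∀ᵐ θ ∂(volume.restrict (Ioc (a k) (a (k + 1)))),
      h (cellMid u θ) = h ((k + 1 / 2) * Real.pi / u) := by
    intro k
    rw [← restrict_Ioo_eq_restrict_Ioc]
    filter_upwards [ae_restrict_mem measurableSet_Ioo] with θ hθ
    have h1 : k * Real.pi < u * θ := by
      have := hθ.1; simp only [ha] at this; rw [div_lt_iff₀ hu'] at this; linarith
    have h2 : u * θ < (k + 1) * Real.pi := by
      have := hθ.2; simp only [ha] at this; rw [lt_div_iff₀ hu'] at this; push_cast at this; linarith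
    have h3 : ⌊u * θ / Real.pi⌋₊ = k := by
      rw [Nat.floor_eq_iff (div_nonneg (le_trans (by positivity) h1.le) hpi.le)]
      rw [le_div_iff₀ hpi, div_lt_iff₀ hpi]
      exact ⟨h1.le, h2⟩
    rw [cellMid, h3]
  have hint : ∀ k < u, IntervalIntegrable (fun θ => h (cellMid u θ)) volume (a k) (a (k + 1)) := by
    intro k _
    rw [intervalIntegrable_iff_integrableOn_Ioc_of_le (hle k)]
    exact (integrable_const (h ((k + 1 / 2) * Real.pi / u))).congr
      ((hcell k).mono fun _ hx => hx.symm)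
  have hsum := intervalIntegral.sum_integral_adjacent_intervals hint
  have h0 : a 0 = 0 := by simp [ha]
  have hn : a u = Real.pi := by simp only [ha]; field_simp
  rw [h0, hn] at hsum
  rw [← hsum, chebQuad, Finset.mul_sum]
  symm
  -- Cells are numbered from 0, nodes from 1.
  refine Finset.sum_bij (fun k _ => k + 1) ?_ ?_ ?_ ?_
  · intro k hk; rw [Finset.mem_range] at hk; rw [Finset.mem_Icc]; omega
  · intro k _ j _ h; omega
  · intro k hk
    rw [Finset.mem_Icc] at hk
    exact ⟨k - 1, by rw [Finset.mem_range]; omega, by omega⟩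
  · intro k _
    rw [intervalIntegral.integral_of_le (hle k), integral_congr_ae (hcell k), setIntegral_const,
      Real.volume_real_Ioc_of_le (hle k), hstep, smul_eq_mul, chebNode]
    simp only [hh]
    have : (2 * ((k + 1 : ℕ) : ℝ) - 1) / (2 * u) * Real.pi = (k + 1 / 2) * Real.pi / u := by
      push_cast; field_simp; ring
    rw [this]

lemma cos_mem_Ioo {θ : ℝ} (hθ : θ ∈ Ioo 0 Real.pi) : Real.cos θ ∈ Ioo (-1 : ℝ) 1 := by
  have h1 := Real.cos_lt_cos_of_nonneg_of_le_pi le_rfl hθ.2.le hθ.1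
  have h2 := Real.cos_lt_cos_of_nonneg_of_le_pi hθ.1.le le_rfl hθ.2
  rw [Real.cos_zero] at h1
  rw [Real.cos_pi] at h2
  exact ⟨h2, h1⟩

lemma injOn_cos_Ioo : InjOn Real.cos (Ioo 0 Real.pi) :=
  Real.injOn_cos.mono Ioo_subset_Icc_self

lemma sqrt_one_sub_cos_sq {θ : ℝ} (hθ : θ ∈ Ioo 0 Real.pi) :
    Real.sqrt (1 - Real.cos θ ^ 2) = Real.sin θ := by
  rw [← Real.sin_sq, Real.sqrt_sq (Real.sin_pos_of_mem_Ioo hθ).le]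

/-- Substitution x = cos θ: on (0, π) the Chebyshev weight √(1 - cos² θ) is sin θ, which is the
Jacobian. -/
lemma integral_cos_mul_sqrt (G : ℝ → ℝ) :
    ∫ θ in Ioo 0 Real.pi, G (Real.cos θ) * Real.sqrt (1 - Real.cos θ ^ 2) =
      ∫ x in Ioo (-1 : ℝ) 1, G x := by
  have himg : Real.cos '' Ioo 0 Real.pi = Ioo (-1 : ℝ) 1 := by
    ext x
    constructor
    · rintro ⟨θ, hθ, rfl⟩; exact cos_mem_Ioo hθ
    · intro hx
      refine ⟨Real.arccos x, ⟨Real.arccos_pos.2 hx.2, ?_⟩, Real.cos_arccos hx.1.le hx.2.le⟩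
      refine lt_of_le_of_ne (Real.arccos_le_pi x) fun h => ?_
      rw [Real.arccos_eq_pi] at h
      linarith [hx.1]
  rw [← himg, integral_image_eq_integral_abs_deriv_smul measurableSet_Ioo
    (fun θ _ => (Real.hasDerivAt_cos θ).hasDerivWithinAt) injOn_cos_Ioo]
  refine setIntegral_congr_fun measurableSet_Ioo fun θ hθ => ?_
  rw [sqrt_one_sub_cos_sq hθ, abs_neg, abs_of_pos (Real.sin_pos_of_mem_Ioo hθ), smul_eq_mul, mul_comm]

/-- Gauss-Chebyshev quadratures of a bounded convergent family of functions converge. -/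
theorem tendsto_chebQuad {ι : Type*} {l : Filter ι} [l.IsCountablyGenerated] {u : ι → ℕ}
    (hu : Tendsto u l atTop) {g : ι → ℝ → ℝ} {G : ℝ → ℝ} {C : ℝ}
    (hb : ∀ᶠ i in l, ∀ x ∈ Ioo (-1 : ℝ) 1, |g i x| ≤ C) {E : Set ℝ} (hE : E.Countable)
    (hg : ∀ x ∈ Ioo (-1 : ℝ) 1, x ∉ E → Tendsto (fun q : ι × ℝ => g q.1 q.2) (l ×ˢ 𝓝 x) (𝓝 (G x))) :
    Tendsto (fun i => chebQuad (u i) (g i)) l (𝓝 (∫ x in Ioo (-1 : ℝ) 1, G x)) := by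
  have hpos : ∀ᶠ i in l, 0 < u i := hu.eventually_gt_atTop 0
  have hpi := Real.pi_pos
  rw [← integral_cos_mul_sqrt]
  have h1 : ∀ᶠ i in l, ∫ θ in Ioo 0 Real.pi, g i (Real.cos (cellMid (u i) θ)) *
      Real.sqrt (1 - Real.cos (cellMid (u i) θ) ^ 2) = chebQuad (u i) (g i) := by
    filter_upwards [hpos] with i hi
    rw [chebQuad_eq_integral hi, intervalIntegral.integral_of_le hpi.le, integral_Ioc_eq_integral_Ioo]
  refine Tendsto.congr' h1 ?_
  refine tendsto_integral_filter_of_dominated_convergence (fun _ => |C|) ?_ ?_ (by simp) ?_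
  -- No measurability of the functions g is needed: the integrand depends on θ only through a
  -- natural number, the index of its cell.
  · refine Eventually.of_forall fun i => Measurable.aestronglyMeasurable ?_
    have hm : Measurable fun θ : ℝ => ⌊(u i : ℝ) * θ / Real.pi⌋₊ :=
      Nat.measurable_floor.comp (by fun_prop)
    exact (measurable_from_top (f := fun k : ℕ => g i (Real.cos (((k : ℝ) + 1 / 2) * Real.pi / u i)) *
      Real.sqrt (1 - Real.cos (((k : ℝ) + 1 / 2) * Real.pi / u i) ^ 2))).comp hm
  · filter_upwards [hpos, hb] with i hi hbi
    filter_upwards [ae_restrict_mem measurableSet_Ioo] with θ hθ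
    have h2 := cellMid_mem hi hθ
    have h3 := (hbi _ (cos_mem_Ioo h2)).trans (le_abs_self C)
    rw [sqrt_one_sub_cos_sq h2, Real.norm_eq_abs, abs_mul]
    exact (mul_le_of_le_one_right (abs_nonneg _) (Real.abs_sin_le_one _)).trans h3
  -- The cosine is injective on (0, π), so the countable exceptional set pulls back to a countable,
  -- hence null, set of angles.
  · have hE' : ({θ ∈ Ioo 0 Real.pi | Real.cos θ ∈ E}).Countable :=
      MapsTo.countable_of_injOn (t := E) (fun θ hθ => hθ.2)
        (injOn_cos_Ioo.mono fun θ hθ => hθ.1) hE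
    have hae : ∀ᵐ θ : ℝ ∂(volume.restrict (Ioo 0 Real.pi)),
        θ ∉ {θ ∈ Ioo 0 Real.pi | Real.cos θ ∈ E} :=
      ae_restrict_of_ae (compl_mem_ae_iff.2 (hE'.measure_zero _))
    filter_upwards [ae_restrict_mem measurableSet_Ioo, hae] with θ hθ hθE
    have hxE : Real.cos θ ∉ E := fun h => hθE ⟨hθ, h⟩
    have hmid : Tendsto (fun i => cellMid (u i) θ) l (𝓝 θ) := by
      rw [tendsto_iff_dist_tendsto_zero]
      have h2 : Tendsto (fun i => Real.pi / (u i : ℝ)) l (𝓝 0) :=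
        tendsto_const_nhds.div_atTop (tendsto_natCast_atTop_atTop.comp hu)
      refine squeeze_zero' (Eventually.of_forall fun i => dist_nonneg) ?_ h2
      filter_upwards [hpos] with i hi
      rw [Real.dist_eq]
      exact abs_cellMid_sub_le hi hθ.1.le
    have hcos := (Real.continuous_cos.tendsto θ).comp hmid
    -- The function and its evaluation point vary together, which is why convergence was assumed
    -- jointly in the index and the point.
    have h3 := (hg _ (cos_mem_Ioo hθ) hxE).comp (tendsto_id.prodMk hcos)
    have hc : Continuous fun x : ℝ => Real.sqrt (1 - x ^ 2) := by fun_prop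
    have h4 := (hc.tendsto (Real.cos θ)).comp hcos
    exact h3.mul h4

lemma abs_chebQuad_le {u : ℕ} {g : ℝ → ℝ} {C : ℝ} (hC : 0 ≤ C)
    (hb : ∀ x ∈ Ioo (-1 : ℝ) 1, |g x| ≤ C) : |chebQuad u g| ≤ Real.pi * C := by
  have hpi := Real.pi_pos
  rcases Nat.eq_zero_or_pos u with rfl | hu
  · simp only [chebQuad, Nat.cast_zero, div_zero, zero_mul, abs_zero]; positivity
  rw [chebQuad_eq_integral hu, intervalIntegral.integral_of_le hpi.le, integral_Ioc_eq_integral_Ioo,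
    ← Real.norm_eq_abs]
  refine (norm_setIntegral_le_of_norm_le_const (C := C) measure_Ioo_lt_top fun θ hθ => ?_).trans ?_
  · have h2 := cellMid_mem hu hθ
    rw [sqrt_one_sub_cos_sq h2, Real.norm_eq_abs, abs_mul]
    exact (mul_le_of_le_one_right (abs_nonneg _) (Real.abs_sin_le_one _)).trans
      (hb _ (cos_mem_Ioo h2))
  · rw [Real.volume_real_Ioo_of_le hpi.le, sub_zero, mul_comm]

end HetNetASE

namespace HetNetASE

open Set
open scoped ENNReal

lemma gammaDelta_mul_rpow {α : ℝ} (hα : 0 < α) (n : ℕ) {z r : ℝ} (hz : 0 ≤ z) (hr : 0 < r) :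
    gammaDelta α n (z * r ^ α) = gammaDelta α n z * r ^ 2 := by
  unfold gammaDelta
  rw [Real.mul_rpow hz (by positivity), ← Real.rpow_mul hr.le, mul_div_cancel₀ _ hα.ne',
    Real.rpow_two]
  ring

lemma countable_sin_mul_eq_zero {c : ℝ} (hc : c ≠ 0) : {x : ℝ | Real.sin (c * x) = 0}.Countable := by
  refine (countable_range fun n : ℤ => (n : ℝ) * Real.pi / c).mono fun x hx => ?_
  obtain ⟨n, hn⟩ := Real.sin_eq_zero_iff.1 hx
  exact ⟨n, by simp only [hn]; field_simp⟩

namespace HetNet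

variable {N : HetNet}

lemma eta_pos : 0 < N.eta := by
  have hn : (0 : ℝ) < N.nak := by exact_mod_cast N.nak_pos
  have := Nat.factorial_pos N.nak
  unfold eta
  positivity

/-! ### The quadrature approximations of the pico tier -/

/-- For α > 2, homogeneity of Δ gives Δ(X) = Δ(Z) r², and the same quantity is also Δ(Z r^α/R_L^α)
R_L². The single Δ-term thus splits into the two needed to turn each S into a disc average. For α =
2 disc averages are given by `elemF`, and X = 0 makes them equal to 1. -/
lemma lapW_eq {p r w c τ : ℝ} (hr : 0 < r) (hc : 0 ≤ c) (hτ : 0 ≤ τ) :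
    N.lapW p r w (c * r ^ N.expo 1) τ = N.picoW p (c * τ) r w := by
  have hG := N.gain_nonneg (i := 1) w
  have hR := N.losR_pos
  have hn := N.nak_pos
  have hn' : (0 : ℝ) < N.nak := by exact_mod_cast hn
  have hra := Real.rpow_pos_of_pos hr (N.expo 1)
  have hRa := Real.rpow_pos_of_pos hR (N.expo 1)
  set Z := c * τ * N.gain 1 w / N.nak with hZ
  have hZ0 : 0 ≤ Z := by positivity
  have hX : c * r ^ N.expo 1 * N.gain 1 w * τ / N.nak = Z * r ^ N.expo 1 := by rw [hZ]; ring
  simp only [lapW, picoW, hX, ← hZ]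
  have hXR : Z * r ^ N.expo 1 / N.losR ^ N.expo 1 = Z * (r ^ N.expo 1 / N.losR ^ N.expo 1) :=
    mul_div_assoc _ _ _
  have hY0 : 0 ≤ Z * (r ^ N.expo 1 / N.losR ^ N.expo 1) := by positivity
  split_ifs with h2 h0
  · have hZz : Z = 0 := (mul_eq_zero.1 h0).resolve_right hra.ne'
    rw [hZz, zero_mul, discAvg_zero]
    ring
  · have hZp : 0 < Z := lt_of_le_of_ne hZ0 fun h => h0 (by rw [← h, zero_mul])
    rw [h2] at hra hRa hXR hY0 ⊢
    rw [discAvg_two hn hZp, discAvg_two hn (by positivity)]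
    simp only [Real.rpow_two] at *
    rw [mul_div_cancel_right₀ _ hra.ne', hXR]
    field_simp
    ring
  · have hα : 2 < N.expo 1 := lt_of_le_of_ne N.expo_pico (Ne.symm h2)
    rw [discAvg_eq_hypS_sub hα hn hZ0, discAvg_eq_hypS_sub hα hn hY0,
      mul_div_cancel_right₀ _ hra.ne', hXR]
    have e1 := gammaDelta_mul_rpow (by linarith : 0 < N.expo 1) N.nak hZ0 hr
    have e2 := gammaDelta_mul_rpow (by linarith : 0 < N.expo 1) N.nak hY0 hR
    have e3 : Z * (r ^ N.expo 1 / N.losR ^ N.expo 1) * N.losR ^ N.expo 1 = Z * r ^ N.expo 1 := by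
      field_simp
    rw [e3] at e2
    linear_combination (-p) * e1 + e2

lemma continuousAt_gain {w : ℝ} (hw : Real.sin (Real.pi * w) ≠ 0) : ContinuousAt (N.gain 1) w := by
  have hc : Continuous fun w : ℝ => Real.sin (Real.pi * w) := by fun_prop
  have hne : ∀ᶠ v in 𝓝 w, Real.sin (Real.pi * v) ≠ 0 := hc.continuousAt.eventually_ne hw
  have hA : (N.ant 1 : ℝ) ≠ 0 := by exact_mod_cast (N.ant_pos 1).ne'
  have h1 : ContinuousAt (fun v => Real.sin (Real.pi * N.ant 1 * v) ^ 2 /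
      ((N.ant 1 : ℝ) ^ 2 * Real.sin (Real.pi * v) ^ 2)) w :=
    ContinuousAt.div (by fun_prop) (by fun_prop) (by positivity)
  refine h1.congr ?_
  filter_upwards [hne] with v hv
  simp [gain, hv]

lemma continuousAt_picoW {p t r w : ℝ} (ht : 0 ≤ t) (hr : 0 < r) (hw : Real.sin (Real.pi * w) ≠ 0) :
    ContinuousAt (fun q : ℝ × ℝ => N.picoW p t q.1 q.2) (r, w) := by
  have hn : (0 : ℝ) < N.nak := by exact_mod_cast N.nak_pos
  have hR := N.losR_pos
  have hG : ContinuousAt (fun q : ℝ × ℝ => N.gain 1 q.2) (r, w) :=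
    ContinuousAt.comp (f := Prod.snd) (g := N.gain 1) (continuousAt_gain hw) continuousAt_snd
  have hZ : ContinuousAt (fun q : ℝ × ℝ => t * N.gain 1 q.2 / N.nak) (r, w) :=
    (continuousAt_const.mul hG).div_const _
  have hZ0 : ∀ v, 0 ≤ t * N.gain 1 v / N.nak := fun v => by
    have := N.gain_nonneg (i := 1) v; positivity
  have hrp : ∀ᶠ q : ℝ × ℝ in 𝓝 (r, w), 0 < q.1 :=
    continuousAt_fst.eventually (lt_mem_nhds (show r > 0 from hr))
  have hra : ContinuousAt (fun q : ℝ × ℝ => q.1 ^ N.expo 1 / N.losR ^ N.expo 1) (r, w) :=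
    (continuousAt_fst.rpow_const (Or.inl hr.ne')).div_const _
  have hD : ∀ z : ℝ × ℝ → ℝ, ContinuousAt z (r, w) → (∀ᶠ q in 𝓝 (r, w), 0 ≤ z q) →
      ContinuousAt (fun q => discAvg (N.expo 1) N.nak (z q)) (r, w) := by
    intro z hz hz0
    have h1 := continuousOn_discAvg (α := N.expo 1) (n := N.nak) (z (r, w)) hz0.self_of_nhds
    have h2 : Tendsto z (𝓝 (r, w)) (𝓝[Ici 0] (z (r, w))) := tendsto_nhdsWithin_iff.2 ⟨hz, hz0⟩
    exact h1.tendsto.comp h2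
  have h1 := hD _ hZ (Eventually.of_forall fun q => hZ0 q.2)
  have h2 := hD _ (hZ.mul hra) (by
    filter_upwards [hrp] with q hq
    have := hZ0 q.2
    simp only [Pi.mul_apply]
    positivity)
  exact ((continuousAt_const.mul (continuousAt_fst.pow 2)).mul h1).sub (continuousAt_const.mul h2)

/-- Rescales the uniform angle to [-1,1]; the density 1/2 is the factor in front of the quadrature
in `lapL`. -/
lemma integral_angleLaw (f : ℝ → ℝ) : ∫ w, f w ∂N.angleLaw =
    2⁻¹ * ∫ x in Ioo (-1 : ℝ) 1, f (x * N.spacing / N.wavelen) := by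
  have hs := N.spacing_pos
  have hw := N.wavelen_pos
  set a := N.spacing / N.wavelen with ha
  have ha0 : 0 < a := div_pos hs hw
  have h1 : ∀ x : ℝ, x * N.spacing / N.wavelen = x * a := fun x => by rw [ha]; ring
  have h2 := intervalIntegral.integral_comp_mul_right f ha0.ne' (a := -1) (b := 1)
  rw [intervalIntegral.integral_of_le (by norm_num), integral_Ioc_eq_integral_Ioo, neg_one_mul,
    one_mul, intervalIntegral.integral_of_le (by linarith), ← integral_Icc_eq_integral_Ioc] at h2
  simp_rw [h1]
  rw [h2, angleLaw, ProbabilityTheory.cond, integral_smul_measure, ← ha, Real.volume_Icc,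
    ENNReal.toReal_inv, ENNReal.toReal_ofReal (by linarith), smul_eq_mul, smul_eq_mul, ← mul_assoc]
  congr 1
  field_simp
  ring

lemma countable_sin_zero :
    {x : ℝ | Real.sin (Real.pi * (x * N.spacing / N.wavelen)) = 0}.Countable := by
  have hs := N.spacing_pos
  have hw := N.wavelen_pos
  have hpi := Real.pi_pos
  convert countable_sin_mul_eq_zero (c := Real.pi * (N.spacing / N.wavelen)) (by positivity) using 5
  ring

lemma lapL_eq {u : ℕ} {p r c τ : ℝ} (hr : 0 < r) (hc : 0 ≤ c) (hτ : 0 ≤ τ) :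
    N.lapL u p r (c * r ^ N.expo 1) τ =
      Real.exp (-(Real.pi * N.dens 1 * (N.losR ^ 2 - p * r ^ 2)) - Real.pi * N.dens 1 / 2 *
        chebQuad u fun x => N.picoW p (c * τ) r (x * N.spacing / N.wavelen)) := by
  unfold lapL
  simp only [lapW_eq hr hc hτ]

/-- The quadrature over the angle converges, locally uniformly in the distance. -/
lemma tendsto_lapL {p r c τ : ℝ} (hp : p ∈ Icc (0 : ℝ) 1) (hc : 0 ≤ c) (hτ : 0 ≤ τ)
    (hr : r ∈ Ioo 0 N.losR) :
    Tendsto (fun q : ℕ × ℝ => N.lapL q.1 p q.2 (c * q.2 ^ N.expo 1) τ) (atTop ×ˢ 𝓝 r)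
      (𝓝 (N.picoLap p (c * τ) r)) := by
  have hev : ∀ᶠ q : ℕ × ℝ in atTop ×ˢ 𝓝 r, q.2 ∈ Ioo 0 N.losR :=
    tendsto_snd.eventually (isOpen_Ioo.mem_nhds hr)
  have ht : 0 ≤ c * τ := mul_nonneg hc hτ
  have h1 := tendsto_chebQuad (l := (atTop : Filter ℕ) ×ˢ 𝓝 r) (u := Prod.fst) tendsto_fst
    (g := fun q x => N.picoW p (c * τ) q.2 (x * N.spacing / N.wavelen))
    (G := fun x => N.picoW p (c * τ) r (x * N.spacing / N.wavelen)) (C := N.losR ^ 2)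
    (by filter_upwards [hev] with q hq x _
        exact abs_picoW_le hp ht hq.1.le hq.2.le)
    N.countable_sin_zero
    (by
      intro x _ hxE
      have h2 : Tendsto (fun q : (ℕ × ℝ) × ℝ => ((q.1.2, q.2 * N.spacing / N.wavelen) : ℝ × ℝ))
          ((atTop ×ˢ 𝓝 r) ×ˢ 𝓝 x) (𝓝 (r, x * N.spacing / N.wavelen)) :=
        (tendsto_snd.comp tendsto_fst).prodMk_nhds
          ((tendsto_snd.mul_const N.spacing).div_const N.wavelen)
      have h3 := (continuousAt_picoW (N := N) (p := p) (w := x * N.spacing / N.wavelen) ht hr.1 hxE).tendsto.comp h2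
      exact h3)
  have h2 : Tendsto (fun q : ℕ × ℝ => Real.exp (-(Real.pi * N.dens 1 * (N.losR ^ 2 - p * q.2 ^ 2)) -
      Real.pi * N.dens 1 / 2 * chebQuad q.1 fun x => N.picoW p (c * τ) q.2
        (x * N.spacing / N.wavelen))) (atTop ×ˢ 𝓝 r) (𝓝 (N.picoLap p (c * τ) r)) := by
    refine (Real.continuous_exp.tendsto _).comp ?_
    rw [integral_angleLaw, ← mul_assoc, ← div_eq_mul_inv]
    have h4 : Continuous fun ρ : ℝ => -(Real.pi * N.dens 1 * (N.losR ^ 2 - p * ρ ^ 2)) := by fun_prop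
    have h5 := (h4.tendsto r).comp (tendsto_snd (f := (atTop : Filter ℕ)))
    exact h5.sub (h1.const_mul _)
  refine h2.congr' ?_
  filter_upwards [hev] with q hq
  exact (lapL_eq hq.1 hc hτ).symm

variable (N) in
/-- The noise factor of the coverage probability of the pico tier. -/
def noiseExp (c r : ℝ) : ℝ :=
  Real.exp (-(c * r ^ N.expo 1 * N.noise 1 / (N.power 1 * N.icpt 1 * N.ant 1)))

lemma noiseExp_le_one {c r : ℝ} (hc : 0 ≤ c) (hr : 0 ≤ r) : N.noiseExp c r ≤ 1 := by
  have h0 := N.noise_nonneg 1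
  have h1 := N.power_pos 1
  have h2 := N.icpt_pos 1
  have h3 : (0 : ℝ) < N.ant 1 := by exact_mod_cast N.ant_pos 1
  unfold noiseExp
  rw [Real.exp_le_one_iff, neg_nonpos]
  positivity

lemma continuousAt_noiseExp {c r : ℝ} (hr : 0 < r) : ContinuousAt (N.noiseExp c) r := by
  unfold noiseExp
  have : ContinuousAt (fun r : ℝ => r ^ N.expo 1) r :=
    Real.continuousAt_rpow_const _ _ (Or.inl hr.ne')
  fun_prop

/-- A bound uniform in the number of nodes and in the distance, which dominates the outer
quadrature. -/
lemma lapL_le {u : ℕ} {p r c τ : ℝ} (hp : p ∈ Icc (0 : ℝ) 1) (hr : r ∈ Ioo 0 N.losR)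
    (hc : 0 ≤ c) (hτ : 0 ≤ τ) : N.lapL u p r (c * r ^ N.expo 1) τ ≤
      Real.exp (Real.pi * N.dens 1 / 2 * (Real.pi * N.losR ^ 2)) := by
  have hd := N.dens_pos 1
  have hpi := Real.pi_pos
  rw [lapL_eq hr.1 hc hτ, Real.exp_le_exp]
  have h1 := abs_chebQuad_le (u := u) (C := N.losR ^ 2) (sq_nonneg _)
    (g := fun x => N.picoW p (c * τ) r (x * N.spacing / N.wavelen))
    fun x _ => abs_picoW_le hp (mul_nonneg hc hτ) hr.1.le hr.2.le
  have h2 : r ^ 2 ≤ N.losR ^ 2 := pow_le_pow_left₀ hr.1.le hr.2.le 2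
  have h3 : 0 ≤ N.losR ^ 2 - p * r ^ 2 := by nlinarith [hp.1, hp.2, sq_nonneg r]
  have h4 : 0 ≤ Real.pi * N.dens 1 * (N.losR ^ 2 - p * r ^ 2) := by positivity
  have h5 := mul_le_mul_of_nonneg_left (neg_le_of_abs_le h1)
    (by positivity : 0 ≤ Real.pi * N.dens 1 / 2)
  linarith

/-- The outer quadrature is applied to a family that itself depends on u₁, along the product filter.
The joint limit needed there is the convergence of the inner quadrature, locally uniform in the
distance (`tendsto_lapL`). -/
theorem tendsto_picoQuad {p τ : ℝ} (hp : p ∈ Icc (0 : ℝ) 1) (hτ : 0 ≤ τ) {g : ℝ → ℝ} {C : ℝ}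
    (hg : ContinuousOn g (Ioo 0 N.losR)) (hgC : ∀ r ∈ Ioo 0 N.losR, |g r| ≤ C) :
    Tendsto (fun u : ℕ × ℕ => N.picoQuad u.1 u.2 p g τ) atTop
      (𝓝 (∑ n ∈ Finset.Icc 1 N.nak, (-1) ^ (n + 1) * (N.nak.choose n : ℝ) *
        ∫ r in Ioc 0 N.losR, N.picoLap p (n * N.eta * τ) r * N.noiseExp (n * N.eta * τ) r * g r)) := by
  have hR := N.losR_pos
  have heta := N.eta_pos
  have hnode : ∀ x ∈ Ioo (-1 : ℝ) 1, (x + 1) * N.losR / 2 ∈ Ioo 0 N.losR := by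
    rintro x ⟨h1, h2⟩
    constructor
    · have : 0 < x + 1 := by linarith
      positivity
    · nlinarith
  have hint : ∀ F : ℝ → ℝ, ∫ r in Ioc 0 N.losR, F r =
      N.losR / 2 * ∫ x in Ioo (-1 : ℝ) 1, F ((x + 1) * N.losR / 2) := by
    intro F
    have h1 := intervalIntegral.integral_comp_mul_add F (div_pos hR two_pos).ne' (N.losR / 2)
      (a := -1) (b := 1)
    rw [intervalIntegral.integral_of_le (by norm_num), integral_Ioc_eq_integral_Ioo,
      show N.losR / 2 * -1 + N.losR / 2 = 0 by ring,
      show N.losR / 2 * 1 + N.losR / 2 = N.losR by ring,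
      intervalIntegral.integral_of_le hR.le] at h1
    have h2 : ∀ x : ℝ, (x + 1) * N.losR / 2 = N.losR / 2 * x + N.losR / 2 := fun x => by ring
    simp_rw [h2]
    rw [h1, smul_eq_mul, mul_inv_cancel_left₀ (div_pos hR two_pos).ne']
  simp_rw [picoQuad, hint, mul_left_comm _ (N.losR / 2)]
  rw [← Finset.mul_sum]
  refine Tendsto.const_mul _ (tendsto_finsetSum _ fun n _ => Tendsto.const_mul _ ?_)
  have hc : 0 ≤ n * N.eta := by positivity
  have hnoise : ∀ r : ℝ, Real.exp (-(n * N.eta * r ^ N.expo 1 * τ * N.noise 1 /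
      (N.power 1 * N.icpt 1 * N.ant 1))) = N.noiseExp (n * N.eta * τ) r := by
    intro r
    rw [noiseExp, mul_right_comm (n * N.eta)]
  simp only [hnoise]
  rw [← prod_atTop_atTop_eq]
  refine tendsto_chebQuad (l := (atTop : Filter ℕ) ×ˢ (atTop : Filter ℕ)) (u := Prod.snd) tendsto_snd
    (C := Real.exp (Real.pi * N.dens 1 / 2 * (Real.pi * N.losR ^ 2)) * C)
    (E := ∅) ?_ countable_empty ?_
  · refine Eventually.of_forall fun u x hx => ?_
    have hr := hnode x hx
    rw [abs_mul, abs_mul, abs_of_nonneg (by unfold lapL; positivity : 0 ≤ N.lapL _ _ _ _ _),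
      abs_of_nonneg (by unfold noiseExp; positivity : 0 ≤ N.noiseExp _ _)]
    refine mul_le_mul ?_ (hgC _ hr) (abs_nonneg _) (Real.exp_pos _).le
    exact (mul_le_of_le_one_right (by unfold lapL; positivity) (noiseExp_le_one (by positivity) hr.1.le)).trans
      (lapL_le hp hr hc hτ)
  · intro x hx _
    have hr := hnode x hx
    have hcont : Continuous fun y : ℝ => (y + 1) * N.losR / 2 := by fun_prop
    have h0 : Tendsto (fun q : (ℕ × ℕ) × ℝ => (q.2 + 1) * N.losR / 2)
        ((atTop ×ˢ atTop) ×ˢ 𝓝 x) (𝓝 ((x + 1) * N.losR / 2)) := (hcont.tendsto x).comp tendsto_snd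
    have h1 := (tendsto_lapL hp hc hτ hr).comp ((tendsto_fst.comp tendsto_fst).prodMk h0)
    have h2 := (continuousAt_noiseExp (N := N) (c := n * N.eta * τ) hr.1).tendsto.comp h0
    have h3 := (hg.continuousAt (isOpen_Ioo.mem_nhds hr)).tendsto.comp h0
    exact (h1.mul h2).mul h3

end HetNet

end HetNetASE

namespace HetNetASE

open Set
open scoped ENNReal

lemma sum_Icc_one_eq_sum_range {M : Type*} [AddCommMonoid M] (f : ℕ → M) (n : ℕ) :
    ∑ k ∈ Finset.Icc 1 n, f k = ∑ k ∈ Finset.range n, f (k + 1) := by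
  induction n with
  | zero => simp
  | succ n ih => rw [Finset.sum_Icc_succ_top (by omega), ih, Finset.sum_range_succ]

lemma one_sub_one_sub_pow (e : ℝ) (n : ℕ) :
    1 - (1 - e) ^ n = ∑ k ∈ Finset.Icc 1 n, (-1) ^ (k + 1) * (n.choose k : ℝ) * e ^ k := by
  have h := add_pow (-e) 1 n
  rw [Finset.sum_range_succ'] at h
  simp only [one_pow, mul_one, pow_zero, Nat.choose_zero_right, Nat.cast_one] at h
  rw [sum_Icc_one_eq_sum_range, show 1 - e = -e + 1 by ring, h, sub_add_cancel_right,
    ← Finset.sum_neg_distrib]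
  refine Finset.sum_congr rfl fun k _ => ?_
  rw [neg_pow]
  ring

namespace HetNet

variable {N : HetNet} {Ω : Type*} {mΩ : MeasurableSpace Ω} {P : Measure Ω}

/-! ### The survival function of the fading power -/

instance nullSingletonClass_fadeLaw (i : Fin 2) : NullSingletonClass (N.fadeLaw i) := by
  unfold fadeLaw gammaMeasure; infer_instance

lemma fadeTail_ofReal (i : Fin 2) {v : ℝ} (hv : 0 ≤ v) :
    N.fadeTail i (ENNReal.ofReal v) = N.fadeLaw i (Ioi v) := by
  unfold fadeTail
  simp only [ENNReal.ofReal_lt_ofReal_iff_of_nonneg hv]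
  rfl

lemma fadeTail_le_one (i : Fin 2) (y : ℝ≥0∞) : N.fadeTail i y ≤ 1 := prob_le_one

/-- `FadeApprox` speaks of the open half-line below v, the tail of the open half-line above it; the
Gamma law has no atoms, so they are complementary up to a null set. -/
lemma abs_fadeTail_sub_le {ε : ℝ} (hε : N.FadeApprox ε) {v : ℝ} (hv : 0 ≤ v) :
    |(N.fadeTail 1 (ENNReal.ofReal v)).toReal -
      (1 - (1 - Real.exp (-(N.eta * v))) ^ N.nak)| ≤ ε := by
  have h1 : (N.fadeTail 1 (ENNReal.ofReal v)).toReal = 1 - (N.fadeLaw 1).real (Iio v) := by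
    rw [fadeTail_ofReal 1 hv, ← measureReal_def, ← compl_Iic,
      probReal_compl_eq_one_sub measurableSet_Iic, measureReal_congr Iio_ae_eq_Iic]
  rw [h1, show ∀ a b : ℝ, 1 - a - (1 - b) = -(a - b) by intros; ring, abs_neg]
  exact hε v hv

lemma measurable_picoLap {p t : ℝ} : Measurable (N.picoLap p t) := by
  have h := (measurable_picoW (N := N) (p := p) (t := t)).stronglyMeasurable.integral_prod_right'
    (ν := N.angleLaw)
  have h1 : Measurable fun r => ∫ w, N.picoW p t r w ∂N.angleLaw := h.measurable
  unfold picoLap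
  exact ((by fun_prop : Measurable fun r : ℝ => -(Real.pi * N.dens 1 * (N.losR ^ 2 - p * r ^ 2))).sub
    (h1.const_mul _)).exp

lemma measurable_noiseExp {c : ℝ} : Measurable (N.noiseExp c) := by
  unfold noiseExp; fun_prop

namespace ServingRule

variable {Φ : Ω → Set BS} {i : Fin 2} {K : Set ℕ → Prop} {s : ℝ → ℝ≥0∞} {M : Ω → ℝ≥0∞}

lemma ae_ne_top : ∀ᵐ y ∂(N.interfLaw P Φ i K s M), y ≠ ⊤ :=
  ae_restrict_mem (measurableSet_singleton _).compl

variable [IsProbabilityMeasure P]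

lemma isFiniteMeasure (S : N.ServingRule P Φ i K s M) :
    IsFiniteMeasure (N.interfLaw P Φ i K s M) :=
  ⟨S.interfLaw_le.trans_lt ENNReal.one_lt_top⟩

/-- The pico transform in real-valued form; h(r) is the probability that the level is beaten at
distance r, and it merges with the nearest-distance density into g. -/
lemma integral_exp_interfLaw (S : N.ServingRule P Φ 1 K s M) {t : ℝ} (ht : 0 < t) {h g : ℝ → ℝ}
    (hP : ∀ r ∈ Ioc 0 N.losR, P {ω | M ω < s r} = ENNReal.ofReal (h r))
    (hg : ∀ r ∈ Ioc 0 N.losR,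
      g r = N.nearestDens 1 ((N.place 1).real {c | K c}) r * h r)
    (hgm : Measurable g) (hg0 : ∀ r ∈ Ioc 0 N.losR, 0 ≤ g r) :
    ∫ y, Real.exp (-(t * y.toReal)) ∂(N.interfLaw P Φ 1 K s M) =
      ∫ r in Ioc 0 N.losR,
        N.picoLap ((N.place 1).real {c | K c}) t r * N.noiseExp t r * g r := by
  set p := (N.place 1).real {c | K c} with hp
  have hm : Measurable fun y : ℝ≥0∞ => Real.exp (-(t * y.toReal)) := by fun_prop
  rw [integral_eq_lintegral_of_nonneg_ae (Eventually.of_forall fun y => (Real.exp_pos _).le)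
    hm.aestronglyMeasurable,
    integral_eq_lintegral_of_nonneg_ae]
  · congr 1
    have h1 := lintegral_expNeg_interfLaw_pico S.poisson S.finite S.decay S.measurable_place
      S.measurable_score S.measurable_level S.indep S.mono ht
    refine Eq.trans (lintegral_congr_ae ?_) (h1.trans (setLIntegral_congr_fun measurableSet_Ioc ?_))
    · filter_upwards [ae_ne_top] with y hy
      rw [← expNeg_ofReal (by positivity), ENNReal.ofReal_mul ht.le, ENNReal.ofReal_toReal hy]
    · intro r hr
      have h2 : 0 ≤ N.picoLap p t r * N.noiseExp t r * N.nearestDens 1 p r :=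
        mul_nonneg (mul_nonneg (Real.exp_pos _).le (Real.exp_pos _).le)
          (nearestDens_nonneg 1 measureReal_nonneg hr.1.le)
      have h3 := ENNReal.ofReal_mul (q := h r) h2
      simp only [hP r hr, hg r hr]
      rw [← mul_assoc, h3]
      rfl
  · filter_upwards [ae_restrict_mem measurableSet_Ioc] with r hr
    exact mul_nonneg (mul_nonneg (Real.exp_pos _).le (Real.exp_pos _).le) (hg0 r hr)
  · exact ((measurable_picoLap.mul measurable_noiseExp).mul hgm).aestronglyMeasurable

/-- The fading tail is replaced by 1 - (1 - exp(-ηv))^N under the integral. Against a law of mass at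
most 1 this costs at most ε, and the binomial expansion of the replacement yields the Laplace
transforms at nητ. -/
lemma abs_coverage_sub_le (S : N.ServingRule P Φ 1 K s M) {τ ε : ℝ} (hτ : 0 < τ)
    (hε : N.FadeApprox ε) {h g : ℝ → ℝ}
    (hP : ∀ r ∈ Ioc 0 N.losR, P {ω | M ω < s r} = ENNReal.ofReal (h r))
    (hg : ∀ r ∈ Ioc 0 N.losR,
      g r = N.nearestDens 1 ((N.place 1).real {c | K c}) r * h r)
    (hgm : Measurable g) (hg0 : ∀ r ∈ Ioc 0 N.losR, 0 ≤ g r) :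
    |(∫⁻ y, N.fadeTail 1 (ENNReal.ofReal τ * y) ∂(N.interfLaw P Φ 1 K s M)).toReal -
      ∑ n ∈ Finset.Icc 1 N.nak, (-1) ^ (n + 1) * (N.nak.choose n : ℝ) *
        ∫ r in Ioc 0 N.losR, N.picoLap ((N.place 1).real {c | K c}) (n * N.eta * τ) r *
          N.noiseExp (n * N.eta * τ) r * g r| ≤ ε := by
  have := S.isFiniteMeasure
  have heta := N.eta_pos
  set m := N.interfLaw P Φ 1 K s M with hmdef
  -- Nonnegativity of ε comes from the defining bound at the point 0.
  have hε0 : 0 ≤ ε := (abs_nonneg _).trans (hε 0 le_rfl)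
  have hint : ∀ n : ℕ, Integrable (fun y : ℝ≥0∞ => Real.exp (-(n * N.eta * τ * y.toReal))) m := by
    intro n
    refine Integrable.of_bound (C := 1) (by fun_prop : Measurable _).aestronglyMeasurable
      (Eventually.of_forall fun y => ?_)
    rw [Real.norm_eq_abs, Real.abs_exp, Real.exp_le_one_iff, neg_nonpos]
    positivity
  have hfm : Measurable fun y => N.fadeTail 1 (ENNReal.ofReal τ * y) :=
    measurable_fadeTail.comp (measurable_const_mul _)
  have hfi : Integrable (fun y => (N.fadeTail 1 (ENNReal.ofReal τ * y)).toReal) m := by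
    refine Integrable.of_bound (C := 1) hfm.ennreal_toReal.aestronglyMeasurable
      (Eventually.of_forall fun y => ?_)
    rw [Real.norm_eq_abs, abs_of_nonneg ENNReal.toReal_nonneg]
    exact ENNReal.toReal_le_of_le_ofReal zero_le_one (by simpa using fadeTail_le_one 1 _)
  rw [← integral_toReal hfm.aemeasurable
    (Eventually.of_forall fun y => (fadeTail_le_one 1 _).trans_lt ENNReal.one_lt_top)]
  have hsum : ∑ n ∈ Finset.Icc 1 N.nak, (-1) ^ (n + 1) * (N.nak.choose n : ℝ) *
        ∫ r in Ioc 0 N.losR, N.picoLap ((N.place 1).real {c | K c}) (n * N.eta * τ) r *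
          N.noiseExp (n * N.eta * τ) r * g r =
      ∫ y, (1 - (1 - Real.exp (-(N.eta * (τ * y.toReal)))) ^ N.nak) ∂m := by
    simp_rw [one_sub_one_sub_pow]
    have he : ∀ (n : ℕ) (y : ℝ≥0∞), Real.exp (-(N.eta * (τ * y.toReal))) ^ n =
        Real.exp (-(n * N.eta * τ * y.toReal)) := by
      intro n y; rw [← Real.exp_nat_mul]; congr 1; ring
    simp_rw [he]
    rw [integral_finsetSum _ fun n _ => (hint n).const_mul _]
    refine Finset.sum_congr rfl fun n hn => ?_
    have hn1 : (0 : ℝ) < n := by exact_mod_cast (Finset.mem_Icc.1 hn).1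
    rw [integral_const_mul, ← S.integral_exp_interfLaw (by positivity) hP hg hgm hg0]
  have hint2 : Integrable
      (fun y : ℝ≥0∞ => 1 - (1 - Real.exp (-(N.eta * (τ * y.toReal)))) ^ N.nak) m := by
    refine Integrable.of_bound (C := 1) (by fun_prop : Measurable _).aestronglyMeasurable
      (Eventually.of_forall fun y => ?_)
    have h1 : Real.exp (-(N.eta * (τ * y.toReal))) ≤ 1 := by
      rw [Real.exp_le_one_iff, neg_nonpos]; positivity
    have h2 := Real.exp_pos (-(N.eta * (τ * y.toReal)))
    have h3 : 0 ≤ (1 - Real.exp (-(N.eta * (τ * y.toReal)))) ^ N.nak := pow_nonneg (by linarith) _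
    have h4 := pow_le_one₀ (n := N.nak) (by linarith : 0 ≤ 1 - Real.exp (-(N.eta * (τ * y.toReal))))
      (by linarith)
    rw [Real.norm_eq_abs, abs_le]
    constructor <;> linarith
  rw [hsum, ← integral_sub hfi hint2]
  have hbd : ∀ᵐ y ∂m, ‖(N.fadeTail 1 (ENNReal.ofReal τ * y)).toReal -
      (1 - (1 - Real.exp (-(N.eta * (τ * y.toReal)))) ^ N.nak)‖ ≤ ε := by
    filter_upwards [ae_ne_top] with y hy
    have h1 := abs_fadeTail_sub_le hε (v := τ * y.toReal) (by positivity)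
    rwa [ENNReal.ofReal_mul hτ.le, ENNReal.ofReal_toReal hy] at h1
  refine (norm_integral_le_of_norm_le_const hbd).trans ?_
  refine mul_le_of_le_one_right hε0 ?_
  rw [measureReal_def]
  exact ENNReal.toReal_le_of_le_ofReal zero_le_one (by simpa using S.interfLaw_le)

end ServingRule

/-! ### The approximations of the coverage probabilities of the pico tier -/

variable [IsProbabilityMeasure P] {Φ : Fin 2 → Ω → Set BS}

lemma cacheProb_mem (i : Fin 2) (f : ℕ) : N.cacheProb i f ∈ Icc (0 : ℝ) 1 := by
  have := N.place_prob i
  exact ⟨measureReal_nonneg, measureReal_le_one⟩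

lemma nearestDens_one_le {p r : ℝ} (hp : p ∈ Icc (0 : ℝ) 1) (hr : r ∈ Ioo 0 N.losR) :
    N.nearestDens 1 p r ≤ 2 * Real.pi * N.dens 1 * N.losR := by
  have hd := N.dens_pos 1
  have hpi := Real.pi_pos
  have hp0 := hp.1
  have hr0 := hr.1
  have h1 : Real.exp (-(Real.pi * p * N.dens 1 * r ^ 2)) ≤ 1 := by
    rw [Real.exp_le_one_iff, neg_nonpos]; positivity
  unfold nearestDens
  refine (mul_le_of_le_one_right (by positivity) h1).trans ?_
  have h2 : p * r ≤ 1 * N.losR := mul_le_mul hp.2 hr.2.le hr0.le zero_le_one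
  have h3 := mul_le_mul_of_nonneg_left h2 (by positivity : 0 ≤ 2 * Real.pi * N.dens 1)
  linarith

lemma continuous_nearestDens (p : ℝ) : Continuous (N.nearestDens 1 p) := by
  unfold nearestDens; fun_prop

lemma approximates_tierCov (hΦ : N.IsModel P Φ) (f : ℕ) {τ : ℝ} (hτ : 0 < τ) :
    N.Approximates (N.tierCov P Φ 1 f τ) fun u₁ u₂ =>
      N.picoQuad u₁ u₂ (N.cacheProb 1 f) (N.nearestDens 1 (N.cacheProb 1 f)) τ := by
  have hp := cacheProb_mem (N := N) 1 f
  refine ⟨_, tendsto_picoQuad hp hτ.le (continuous_nearestDens _).continuousOn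
    (C := 2 * Real.pi * N.dens 1 * N.losR) fun r hr => ?_, fun ε hε => ?_⟩
  · rw [abs_of_nonneg (nearestDens_nonneg 1 hp.1 hr.1.le)]
    exact nearestDens_one_le hp hr
  · have h := (nearestRule hΦ 1 (measurableSet_mem_place f)).abs_coverage_sub_le hτ hε
      (h := fun _ => 1) (g := N.nearestDens 1 (N.cacheProb 1 f))
      (fun r _ => by simp [nearScore_pos]) (fun r _ => by simp [cacheProb])
      (measurable_nearestDens 1 _) (fun r hr => nearestDens_nonneg 1 hp.1 hr.1.le)
    rw [← measure_lt_tierSinr hΦ 1 (measurableSet_mem_place f) hτ] at h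
    exact h

lemma approximates_maxRPCov (hΦ : N.IsModel P Φ) (f : ℕ) {τ : ℝ} (hτ : 0 < τ) :
    N.Approximates (N.maxRPCov P Φ 1 f τ) fun u₁ u₂ =>
      N.picoQuad u₁ u₂ (N.cacheProb 1 f) (N.distDensRP 1 f) τ := by
  have hp := cacheProb_mem (N := N) 1 f
  have hp' := cacheProb_mem (N := N) 0 f
  have hd := N.dens_pos 0
  have hexp : ∀ r, Real.exp (-(Real.pi * (N.cacheProb 0 f * N.dens 0) * N.exclMacro r ^ 2)) ≤ 1 := by
    intro r
    have := hp'.1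
    rw [Real.exp_le_one_iff, neg_nonpos]; positivity
  refine ⟨_, tendsto_picoQuad hp hτ.le (C := 2 * Real.pi * N.dens 1 * N.losR) ?_ fun r hr => ?_,
    fun ε hε => ?_⟩
  · refine ContinuousOn.congr (f := fun r => N.nearestDens 1 (N.cacheProb 1 f) r *
      Real.exp (-(Real.pi * (N.cacheProb 0 f * N.dens 0) * N.exclMacro r ^ 2))) ?_
      fun r hr => distDensRP_one_eq f hr.1 hr.2.le
    have h1 : ContinuousOn N.exclMacro (Ioo 0 N.losR) := fun r hr => by
      unfold exclMacro
      exact (continuousAt_const.mul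
        (Real.continuousAt_rpow_const _ _ (Or.inl hr.1.ne'))).continuousWithinAt
    exact (continuous_nearestDens _).continuousOn.mul (by fun_prop)
  · rw [abs_of_nonneg (distDensRP_nonneg 1 f hr.1.le), distDensRP_one_eq f hr.1 hr.2.le]
    exact (mul_le_of_le_one_right (nearestDens_nonneg 1 hp.1 hr.1.le) (hexp r)).trans
      (nearestDens_one_le hp hr)
  · have h := (powerRule hΦ one_ne_zero (measurableSet_mem_place f)).abs_coverage_sub_le hτ hε
      (h := fun r => Real.exp (-(Real.pi * (N.cacheProb 0 f * N.dens 0) * N.exclMacro r ^ 2)))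
      (g := N.distDensRP 1 f)
      (fun r hr => measure_other_lt hΦ 0 f (powScore_mono 1 hr.1
        ((N.linkGain_one_pos_iff hr.1).2 hr.2)).1 (exclMacro_nonneg hr.1.le)
        fun ρ hρ => powScore_le_exclMacro hr.1 hr.2 hρ)
      (fun r hr => distDensRP_one_eq f hr.1 hr.2)
      (measurable_distDensRP 1 f) (fun r hr => distDensRP_nonneg 1 f hr.1.le)
    rw [← measure_maxRP hΦ one_ne_zero f hτ] at h
    exact h

end HetNet

end HetNetASE

namespace HetNetASE

open Set
open scoped ENNReal

/-! ### Comparison of two independent random variables -/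

section Survival

variable {Ω : Type*} {mΩ : MeasurableSpace Ω} (P : Measure Ω) [IsProbabilityMeasure P]
  (V W : Ω → ℝ≥0∞)

/-- The survival function of a random variable with values in `[0, ∞]`. -/
def survival (t : ℝ) : ℝ := P.real {ω | ENNReal.ofReal t < V ω}

variable {P V W}

lemma survival_antitone : Antitone (survival P V) := fun _ _ h =>
  measureReal_mono fun _ hω => (ENNReal.ofReal_le_ofReal h).trans_lt hω

lemma survival_le_one (t : ℝ) : survival P V t ≤ 1 := measureReal_le_one

/-- The events V > t decrease to V = ∞, so the mass at infinity can be read off from the coverage at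
large thresholds. -/
lemma tendsto_survival (hV : Measurable V) :
    Tendsto (survival P V) atTop (𝓝 (P.real {ω | V ω = ⊤})) := by
  have h1 := tendsto_measure_iInter_atTop (μ := P) (s := fun t : ℝ => {ω | ENNReal.ofReal t < V ω})
    (fun t => (measurableSet_lt measurable_const hV).nullMeasurableSet)
    (fun _ _ h _ hω => (ENNReal.ofReal_le_ofReal h).trans_lt hω) ⟨0, measure_ne_top _ _⟩
  have h2 : ⋂ t : ℝ, {ω | ENNReal.ofReal t < V ω} = {ω | V ω = ⊤} := by
    ext ω
    simp only [mem_iInter, mem_ofPred_eq]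
    constructor
    · intro h
      by_contra hne
      have := h (V ω).toReal
      rw [ENNReal.ofReal_toReal hne] at this
      exact lt_irrefl _ this
    · intro h t
      rw [h]; exact ENNReal.ofReal_lt_top
  rw [h2] at h1
  exact (ENNReal.tendsto_toReal (measure_ne_top _ _)).comp h1

/-- Continuity of the survival function rules out an atom at a: P(W ≥ a) is bounded by P(W > b) for
b < a, and b tends to a. -/
lemma measureReal_lt_ofReal (hW : Measurable W) {a : ℝ} (ha : 0 < a)
    (hH : ContinuousAt (survival P W) a) :
    P.real {ω | W ω < ENNReal.ofReal a} = 1 - survival P W a := by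
  have h1 : {ω | W ω < ENNReal.ofReal a} = {ω | ENNReal.ofReal a ≤ W ω}ᶜ := by ext ω; simp
  rw [h1, probReal_compl_eq_one_sub (measurableSet_le measurable_const hW)]
  congr 1
  apply le_antisymm
  · have h2 : Tendsto (survival P W) (𝓝[<] a) (𝓝 (survival P W a)) := hH.tendsto.mono_left inf_le_left
    refine ge_of_tendsto h2 ?_
    filter_upwards [self_mem_nhdsWithin] with b hb
    refine measureReal_mono fun ω hω => ?_
    exact ((ENNReal.ofReal_lt_ofReal_iff ha).2 hb).trans_le hω
  · refine measureReal_mono fun ω hω => ?_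
    rw [mem_ofPred_eq] at hω ⊢
    exact hω.le

lemma one_add_lt_rpow_iff {t ρ : ℝ} (ht : 0 < t) (hρ : 0 < ρ) (w : ℝ≥0∞) :
    1 + w < (1 + ENNReal.ofReal t) ^ ρ ↔ w < ENNReal.ofReal ((1 + t) ^ ρ - 1) := by
  have h1 : 1 ≤ (1 + t) ^ ρ := Real.one_le_rpow (by linarith) hρ.le
  rw [← ENNReal.ofReal_one, ← ENNReal.ofReal_add zero_le_one ht.le,
    ENNReal.ofReal_rpow_of_pos (by linarith),
    show (1 + t) ^ ρ = 1 + ((1 + t) ^ ρ - 1) by ring, ENNReal.ofReal_add zero_le_one (by linarith),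
    ENNReal.add_lt_add_iff_left ENNReal.ofReal_ne_top, add_sub_cancel_left]

/-- A monotone differentiable function with a finite limit at infinity has an integrable derivative;
continuity of the derivative is not needed. -/
lemma integrableOn_deriv_survival (hV : Measurable V)
    (hG : ∀ t, 0 < t → DifferentiableAt ℝ (survival P V) t) {τ : ℝ} (hτ : 0 < τ) :
    IntegrableOn (deriv (survival P V)) (Ioi τ) :=
  integrableOn_Ioi_deriv_of_nonpos' (fun x hx => (hG x (hτ.trans_le hx)).hasDerivAt)
    (fun _ _ => survival_antitone.deriv_nonpos) (tendsto_survival hV)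

/-- The finite part of the law of `V` above `τ` has density `-G'`, `G` the survival function. -/
lemma map_restrict_eq_withDensity (hV : Measurable V)
    (hG : ∀ t, 0 < t → DifferentiableAt ℝ (survival P V) t) {τ : ℝ} (hτ : 0 < τ) :
    (P.restrict {ω | ENNReal.ofReal τ < V ω ∧ V ω ≠ ⊤}).map (fun ω => (V ω).toReal) =
      (volume.restrict (Ioi τ)).withDensity fun t => ENNReal.ofReal (-deriv (survival P V) t) := by
  have hI := integrableOn_deriv_survival hV hG hτ
  have hVr : Measurable fun ω => (V ω).toReal := hV.ennreal_toReal
  refine Measure.ext_of_Iic _ _ fun a => ?_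
  rw [Measure.map_apply hVr measurableSet_Iic, withDensity_apply _ measurableSet_Iic,
    Measure.restrict_restrict measurableSet_Iic, Measure.restrict_apply (hVr measurableSet_Iic)]
  rcases le_or_gt a τ with h | h
  · have h1 : Iic a ∩ Ioi τ = ∅ := by
      ext x; simp only [mem_inter_iff, mem_Iic, mem_Ioi, mem_empty_iff_false, iff_false]
      intro hx; linarith [hx.1, hx.2]
    have h2 : (fun ω => (V ω).toReal) ⁻¹' Iic a ∩ {ω | ENNReal.ofReal τ < V ω ∧ V ω ≠ ⊤} = ∅ := by
      ext ω
      simp only [mem_inter_iff, mem_preimage, mem_Iic, mem_ofPred_eq, mem_empty_iff_false, iff_false]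
      rintro ⟨h3, h4, h5⟩
      rw [ENNReal.ofReal_lt_iff_lt_toReal hτ.le h5] at h4
      linarith
    rw [h1, h2]; simp
  · have h1 : Iic a ∩ Ioi τ = Ioc τ a := by rw [inter_comm]; rfl
    have h2 : (fun ω => (V ω).toReal) ⁻¹' Iic a ∩ {ω | ENNReal.ofReal τ < V ω ∧ V ω ≠ ⊤} =
        {ω | ENNReal.ofReal τ < V ω} \ {ω | ENNReal.ofReal a < V ω} := by
      ext ω
      simp only [mem_inter_iff, mem_preimage, mem_Iic, mem_ofPred_eq, Set.mem_sdiff, not_lt]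
      constructor
      · rintro ⟨h3, h4, h5⟩
        refine ⟨h4, ?_⟩
        rw [← ENNReal.ofReal_toReal h5]
        exact ENNReal.ofReal_le_ofReal h3
      · rintro ⟨h3, h4⟩
        have h5 : V ω ≠ ⊤ := (h4.trans_lt ENNReal.ofReal_lt_top).ne
        exact ⟨ENNReal.toReal_le_of_le_ofReal (hτ.trans h).le h4, h3, h5⟩
    -- Differentiability together with integrability of the derivative suffices for the fundamental
    -- theorem of calculus here.
    have h3 : ∫ t in τ..a, deriv (survival P V) t = survival P V a - survival P V τ := by
      refine intervalIntegral.integral_deriv_eq_sub (fun x hx => ?_) ?_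
      · rw [uIcc_of_le h.le] at hx
        exact hG x (hτ.trans_le hx.1)
      · rw [intervalIntegrable_iff_integrableOn_Ioc_of_le h.le]
        exact hI.mono_set Ioc_subset_Ioi_self
    rw [intervalIntegral.integral_of_le h.le] at h3
    rw [h1, h2, ← ofReal_integral_eq_lintegral_ofReal (f := fun t => -deriv (survival P V) t)
      (hI.mono_set Ioc_subset_Ioi_self).neg
      (Eventually.of_forall fun t => neg_nonneg.2 survival_antitone.deriv_nonpos)]
    have hsub : {ω | ENNReal.ofReal a < V ω} ⊆ {ω | ENNReal.ofReal τ < V ω} :=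
      fun ω hω => (ENNReal.ofReal_le_ofReal h.le).trans_lt hω
    rw [integral_neg, h3, neg_sub, measure_sdiff hsub
      (measurableSet_lt measurable_const hV).nullMeasurableSet (measure_ne_top _ _), survival, survival,
      ENNReal.ofReal_sub _ measureReal_nonneg, ofReal_measureReal, ofReal_measureReal]

lemma integrableOn_deriv_mul_survival (hV : Measurable V)
    (hG : ∀ t, 0 < t → DifferentiableAt ℝ (survival P V) t) {τ ρ : ℝ} (hτ : 0 < τ) :
    IntegrableOn (fun t => -deriv (survival P V) t * (1 - survival P W ((1 + t) ^ ρ - 1))) (Ioi τ) := by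
  have hI := (integrableOn_deriv_survival hV hG hτ).neg
  refine hI.mul_bdd (c := 1) ?_ (Eventually.of_forall fun t => ?_)
  · have h1 : Measurable fun t : ℝ => (1 + t) ^ ρ - 1 := by fun_prop
    exact (measurable_const.sub (survival_antitone.measurable.comp h1)).aestronglyMeasurable
  · have h1 : 0 ≤ survival P W ((1 + t) ^ ρ - 1) := measureReal_nonneg
    have h2 := survival_le_one (P := P) (V := W) ((1 + t) ^ ρ - 1)
    rw [Real.norm_eq_abs, abs_le]
    constructor <;> linarith

/-- The probability that `V` exceeds both `τ` and a transform of an independent variable `W`. -/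
theorem measureReal_one_add_lt_rpow (hV : Measurable V) (hW : Measurable W) (hind : IndepFun V W P)
    (hG : ∀ t, 0 < t → DifferentiableAt ℝ (survival P V) t)
    (hH : ∀ t, 0 < t → ContinuousAt (survival P W) t) {τ ρ : ℝ} (hτ : 0 < τ) (hρ : 0 < ρ) :
    P.real {ω | 1 + W ω < (1 + V ω) ^ ρ ∧ ENNReal.ofReal τ < V ω} =
      (∫ t in Ioi τ, -deriv (survival P V) t * (1 - survival P W ((1 + t) ^ ρ - 1))) +
        P.real {ω | V ω = ⊤} * P.real {ω | W ω ≠ ⊤} := by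
  have hH1 : ∀ t, 0 ≤ 1 - survival P W ((1 + t) ^ ρ - 1) := fun t => by
    linarith [survival_le_one (P := P) (V := W) ((1 + t) ^ ρ - 1)]
  set k : ℝ → ℝ≥0∞ := fun t => ENNReal.ofReal (1 - survival P W ((1 + t) ^ ρ - 1)) with hk
  have hkm : Measurable k := by
    have h1 : Measurable fun t : ℝ => (1 + t) ^ ρ - 1 := by fun_prop
    exact (measurable_const.sub (survival_antitone.measurable.comp h1)).ennreal_ofReal
  set B : Set Ω := {ω | ENNReal.ofReal τ < V ω ∧ V ω ≠ ⊤} with hB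
  have hBm : MeasurableSet B := (measurableSet_lt measurable_const hV).inter
    (hV (measurableSet_singleton _).compl)
  have hVt : MeasurableSet {ω | V ω = ⊤} := hV (measurableSet_singleton _)
  have hfin : P {ω | 1 + W ω < (1 + V ω) ^ ρ ∧ ω ∈ B} = ENNReal.ofReal
      (∫ t in Ioi τ, -deriv (survival P V) t * (1 - survival P W ((1 + t) ^ ρ - 1))) := by
    set A : Set (ℝ≥0∞ × ℝ≥0∞) :=
      {q | 1 + q.2 < (1 + q.1) ^ ρ ∧ ENNReal.ofReal τ < q.1 ∧ q.1 ≠ ⊤} with hA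
    have hAm : MeasurableSet A :=
      (measurableSet_lt (f := fun q : ℝ≥0∞ × ℝ≥0∞ => 1 + q.2) (g := fun q => (1 + q.1) ^ ρ)
        (by fun_prop) (by fun_prop)).inter
        ((measurableSet_lt measurable_const measurable_fst).inter
          (measurable_fst (measurableSet_singleton _).compl))
    have h1 : P {ω | 1 + W ω < (1 + V ω) ^ ρ ∧ ω ∈ B} = P.map (fun ω => (V ω, W ω)) A := by
      rw [Measure.map_apply (hV.prodMk hW) hAm]; rfl
    rw [h1, hind.map_prod_eq_prod_map_map hV.aemeasurable hW.aemeasurable, Measure.prod_apply hAm,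
      lintegral_map (measurable_measure_prodMk_left hAm) hV]
    -- For a fixed finite value t of V above τ, the section is the event W < (1+t)^ρ - 1, whose
    -- probability is one minus the survival function of W.
    have h2 : ∀ ω, P.map W (Prod.mk (V ω) ⁻¹' A) = B.indicator (fun ω => k (V ω).toReal) ω := by
      intro ω
      rw [Measure.map_apply hW (measurable_prodMk_left hAm)]
      by_cases hω : ω ∈ B
      · rw [indicator_of_mem hω]
        obtain ⟨h3, h4⟩ := hω
        have h5 : τ < (V ω).toReal := (ENNReal.ofReal_lt_iff_lt_toReal hτ.le h4).1 h3
        have h6 : W ⁻¹' (Prod.mk (V ω) ⁻¹' A) =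
            {ω' | W ω' < ENNReal.ofReal ((1 + (V ω).toReal) ^ ρ - 1)} := by
          ext ω'
          simp only [hA, mem_preimage, mem_ofPred_eq, h3, ne_eq, h4, not_false_eq_true, and_true]
          rw [← one_add_lt_rpow_iff (hτ.trans h5) hρ, ENNReal.ofReal_toReal h4]
        have h7 : 0 < (1 + (V ω).toReal) ^ ρ - 1 := by
          have := Real.one_lt_rpow (x := 1 + (V ω).toReal) (by linarith) hρ
          linarith
        rw [h6, ← ofReal_measureReal (measure_ne_top _ _), measureReal_lt_ofReal hW h7 (hH _ h7)]
      · rw [indicator_of_notMem hω]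
        have h6 : W ⁻¹' (Prod.mk (V ω) ⁻¹' A) = ∅ := by
          ext ω'
          simp only [hA, mem_preimage, mem_ofPred_eq, mem_empty_iff_false, iff_false]
          exact fun h => hω h.2
        rw [h6, measure_empty]
    simp_rw [h2]
    rw [lintegral_indicator hBm]
    have h3 : ∫⁻ ω in B, k (V ω).toReal ∂P =
        ∫⁻ t, k t ∂((P.restrict B).map fun ω => (V ω).toReal) :=
      (lintegral_map hkm hV.ennreal_toReal).symm
    have hdm : Measurable fun t => ENNReal.ofReal (-deriv (survival P V) t) :=
      (measurable_deriv _).neg.ennreal_ofReal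
    rw [h3, map_restrict_eq_withDensity hV hG hτ, lintegral_withDensity_eq_lintegral_mul _ hdm hkm]
    have hd0 : ∀ t, 0 ≤ -deriv (survival P V) t := fun t => neg_nonneg.2 survival_antitone.deriv_nonpos
    rw [ofReal_integral_eq_lintegral_ofReal (integrableOn_deriv_mul_survival hV hG hτ)
      (Eventually.of_forall fun t => mul_nonneg (hd0 t) (hH1 t))]
    refine lintegral_congr fun t => ?_
    rw [ENNReal.ofReal_mul (hd0 t)]
    rfl
  -- On V = ∞ the comparison holds exactly when W is finite, which produces the additional product
  -- term.
  have htop : {ω | 1 + W ω < (1 + V ω) ^ ρ ∧ ENNReal.ofReal τ < V ω} =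
      {ω | 1 + W ω < (1 + V ω) ^ ρ ∧ ω ∈ B} ∪ ({ω | V ω = ⊤} ∩ {ω | W ω ≠ ⊤}) := by
    ext ω
    simp only [hB, mem_union, mem_inter_iff, mem_ofPred_eq]
    by_cases hω : V ω = ⊤
    · simp [hω, ENNReal.top_rpow_of_pos hρ, lt_top_iff_ne_top]
    · simp [hω]
  have hdisj : Disjoint {ω | 1 + W ω < (1 + V ω) ^ ρ ∧ ω ∈ B} ({ω | V ω = ⊤} ∩ {ω | W ω ≠ ⊤}) :=
    disjoint_left.2 fun ω h1 h2 => h1.2.2 h2.1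
  have hind2 : P ({ω | V ω = ⊤} ∩ {ω | W ω ≠ ⊤}) = P {ω | V ω = ⊤} * P {ω | W ω ≠ ⊤} :=
    hind.measure_inter_preimage_eq_mul {⊤} {⊤}ᶜ (measurableSet_singleton _)
      (measurableSet_singleton _).compl
  rw [htop, measureReal_union hdisj (hVt.inter (hW (measurableSet_singleton _).compl)),
    measureReal_def, hfin, ENNReal.toReal_ofReal, measureReal_def, hind2, ENNReal.toReal_mul]
  · rfl
  · exact integral_nonneg fun t =>
      mul_nonneg (neg_nonneg.2 survival_antitone.deriv_nonpos) (hH1 t)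

end Survival

end HetNetASE

namespace HetNetASE

open Set
open scoped ENNReal

namespace HetNet

variable {N : HetNet} {Ω : Type*} {mΩ : MeasurableSpace Ω} {P : Measure Ω}

/-! ### The density of the fading power -/

variable (N) in
/-- The survival function of the fading power. -/
def fadeSurv (i : Fin 2) (v : ℝ) : ℝ := (N.fadeLaw i).real (Ioi v)

variable (N) in
/-- The probability density of the fading power. -/
def fadeDens (i : Fin 2) (v : ℝ) : ℝ := gammaPDFReal (N.fadeParam i) (N.fadeParam i) v

lemma fadeParam_cast_pos (i : Fin 2) : (0 : ℝ) < N.fadeParam i := by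
  exact_mod_cast N.fadeParam_pos i

lemma fadeDens_nonneg (i : Fin 2) (v : ℝ) : 0 ≤ N.fadeDens i v :=
  gammaPDFReal_nonneg (N.fadeParam_cast_pos i) (N.fadeParam_cast_pos i) v

lemma measurable_fadeDens (i : Fin 2) : Measurable (N.fadeDens i) := measurable_gammaPDFReal _ _

lemma integrable_fadeDens (i : Fin 2) : Integrable (N.fadeDens i) := by
  refine ⟨(measurable_fadeDens i).aestronglyMeasurable, ?_⟩
  rw [hasFiniteIntegral_iff_ofReal (Eventually.of_forall (fadeDens_nonneg i))]
  have h := lintegral_gammaPDF_eq_one (N.fadeParam_cast_pos i) (N.fadeParam_cast_pos i)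
  exact h.trans_lt ENNReal.one_lt_top

lemma fadeSurv_eq (i : Fin 2) (v : ℝ) : N.fadeSurv i v = 1 - ∫ x in Iic v, N.fadeDens i x := by
  have h := cdf_gammaMeasure_eq_integral (N.fadeParam_cast_pos i) (N.fadeParam_cast_pos i) v
  have : IsProbabilityMeasure (gammaMeasure (N.fadeParam i) (N.fadeParam i)) :=
    isProbabilityMeasure_gammaMeasure (N.fadeParam_cast_pos i) (N.fadeParam_cast_pos i)
  rw [cdf_eq_real] at h
  rw [fadeSurv, fadeLaw, ← compl_Iic, probReal_compl_eq_one_sub measurableSet_Iic, h]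
  rfl

lemma continuousAt_fadeDens (i : Fin 2) {v : ℝ} (hv : 0 < v) : ContinuousAt (N.fadeDens i) v := by
  have h1 : ContinuousAt (fun x : ℝ => (N.fadeParam i : ℝ) ^ (N.fadeParam i : ℝ) /
      Real.Gamma (N.fadeParam i) * x ^ ((N.fadeParam i : ℝ) - 1) *
        Real.exp (-(N.fadeParam i * x))) v := by
    have := Real.continuousAt_rpow_const v ((N.fadeParam i : ℝ) - 1) (Or.inl hv.ne')
    fun_prop
  refine h1.congr ?_
  filter_upwards [lt_mem_nhds hv] with x hx
  simp [fadeDens, gammaPDFReal, hx.le]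

lemma hasDerivAt_fadeSurv (i : Fin 2) {v : ℝ} (hv : 0 < v) :
    HasDerivAt (N.fadeSurv i) (-N.fadeDens i v) v := by
  have hI := N.integrable_fadeDens i
  have h1 : ∀ x, N.fadeSurv i x = N.fadeSurv i 0 - ∫ y in (0 : ℝ)..x, N.fadeDens i y := by
    intro x
    rw [fadeSurv_eq, fadeSurv_eq, ← intervalIntegral.integral_Iic_sub_Iic hI.integrableOn hI.integrableOn]
    ring
  have h2 := intervalIntegral.integral_hasDerivAt_right (a := 0) (b := v) hI.intervalIntegrable
    ((measurable_fadeDens i).stronglyMeasurable.stronglyMeasurableAtFilter)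
    (continuousAt_fadeDens i hv)
  exact (h2.const_sub (N.fadeSurv i 0)).congr_of_eventuallyEq (Eventually.of_forall h1)

lemma fadeSurv_antitone (i : Fin 2) : Antitone (N.fadeSurv i) := fun _ _ h =>
  measureReal_mono (Ioi_subset_Ioi h)

lemma abs_fadeSurv_le (i : Fin 2) (v : ℝ) : |N.fadeSurv i v| ≤ 1 := by
  rw [fadeSurv, abs_of_nonneg measureReal_nonneg]; exact measureReal_le_one

lemma fadeSurv_zero (i : Fin 2) : N.fadeSurv i 0 = 1 := by
  rw [fadeSurv_eq, integral_Iic_eq_integral_Iio, setIntegral_congr_fun (g := fun _ => (0 : ℝ))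
    measurableSet_Iio]
  · simp
  · intro x hx
    have : ¬ (0 : ℝ) ≤ x := not_le.2 hx
    simp [fadeDens, gammaPDFReal, this]

lemma tendsto_fadeSurv (i : Fin 2) : Tendsto (N.fadeSurv i) atTop (𝓝 0) := by
  have h := (tendsto_cdf_atTop (N.fadeLaw i)).const_sub 1
  rw [sub_self] at h
  refine h.congr fun v => ?_
  rw [cdf_eq_real, fadeSurv, ← compl_Iic, probReal_compl_eq_one_sub measurableSet_Iic]

/-- The product is a constant times v^n exp(-nv), and v ≤ exp v. Bounding v times the density,
rather than the density alone, dominates the derivative in τ uniformly over all interference levels.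
-/
lemma mul_fadeDens_le (i : Fin 2) {v : ℝ} (hv : 0 ≤ v) : v * N.fadeDens i v ≤
    (N.fadeParam i : ℝ) ^ (N.fadeParam i : ℝ) / Real.Gamma (N.fadeParam i) := by
  have hn := N.fadeParam_cast_pos i
  have hn1 : (1 : ℝ) ≤ N.fadeParam i := by exact_mod_cast N.fadeParam_pos i
  have hG := Real.Gamma_pos_of_pos hn
  rcases hv.eq_or_lt with rfl | hv
  · rw [zero_mul]; positivity
  have h1 : v ≤ Real.exp v := by linarith [Real.add_one_le_exp v]
  have h2 : v ^ (N.fadeParam i : ℝ) * Real.exp (-(N.fadeParam i * v)) ≤ 1 := by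
    rw [Real.rpow_natCast, Real.exp_neg, Real.exp_nat_mul, ← div_eq_mul_inv]
    exact div_le_one_of_le₀ (pow_le_pow_left₀ hv.le h1 _) (by positivity)
  have h3 : v * v ^ ((N.fadeParam i : ℝ) - 1) = v ^ (N.fadeParam i : ℝ) := by
    rw [Real.rpow_sub_one hv.ne', mul_div_cancel₀ _ hv.ne']
  have h4 : v * N.fadeDens i v = (N.fadeParam i : ℝ) ^ (N.fadeParam i : ℝ) /
      Real.Gamma (N.fadeParam i) * (v ^ (N.fadeParam i : ℝ) * Real.exp (-(N.fadeParam i * v))) := by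
    simp only [fadeDens, gammaPDFReal, hv.le, if_true, ← h3]
    ring
  rw [h4]
  exact mul_le_of_le_one_right (by positivity) h2

/-! ### Measurability and independence of the signal-to-interference ratios -/

variable {Φ : Fin 2 → Ω → Set BS}

/-- Measurability holds for the counts of the tier itself, which makes the SINRs of the two tiers
independent. Positive finite thresholds are serving events, the threshold 0 is a countable union
over 1/n, and ∞ is trivial. -/
lemma measurable_tierSinr (hΦ : N.IsModel P Φ) (i : Fin 2) {K : Set ℕ → Prop}
    (hK : MeasurableSet {c | K c}) :
    Measurable[countAlgebra (Φ i)] fun ω => N.tierSinr i K (Φ i ω) := by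
  have hpos : ∀ τ : ℝ, 0 < τ →
      MeasurableSet[countAlgebra (Φ i)] {ω | ENNReal.ofReal τ < N.tierSinr i K (Φ i ω)} := by
    intro τ hτ
    have hG : MeasurableSet {q : BS × ℝ≥0∞ | ENNReal.ofReal τ * (ENNReal.ofReal (N.noise i) + q.2) <
        ENNReal.ofReal (N.signal i q.1)} := by
      have h1 : Measurable fun q : BS × ℝ≥0∞ => N.signal i q.1 :=
        (N.measurable_signal i).comp measurable_fst
      exact measurableSet_lt (by fun_prop) (by fun_prop)
    have h2 := measurableSet_servedBy (N := N) (i := i) (Φ := Φ i) (M := fun _ => 0) (hΦ.locFinite i)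
      nearScore_decay hK measurable_nearScore hG
    rw [MeasurableSpace.comap_const, sup_bot_eq] at h2
    convert h2 using 1
    ext ω
    simp only [mem_ofPred_eq, lt_tierSinr_iff]
    refine exists_congr fun x => ?_
    simp only [ServedBy, mem_univ, and_true, mem_ofPred_eq, ofReal_lt_sinr_iff hτ, and_assoc]
  have hne : ∀ v : ℝ≥0∞, v ≠ 0 →
      MeasurableSet[countAlgebra (Φ i)] {ω | v < N.tierSinr i K (Φ i ω)} := by
    intro v hv
    by_cases hv' : v = ⊤
    · simp [hv']
    · rw [← ENNReal.ofReal_toReal hv']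
      exact hpos _ (ENNReal.toReal_pos hv hv')
  refine @measurable_of_Ioi ℝ≥0∞ Ω _ _ _ (countAlgebra (Φ i)) _ _ _ _ fun v => ?_
  by_cases hv : v = 0
  · have h1 : (fun ω => N.tierSinr i K (Φ i ω)) ⁻¹' Ioi v =
        ⋃ n : ℕ, {ω | (n : ℝ≥0∞)⁻¹ < N.tierSinr i K (Φ i ω)} := by
      ext ω
      simp only [hv, mem_preimage, mem_Ioi, mem_iUnion, mem_ofPred_eq]
      exact ⟨fun h => ENNReal.exists_inv_nat_lt h.ne', fun ⟨n, h⟩ => pos_of_gt h⟩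
    rw [h1]
    exact MeasurableSet.iUnion fun n => hne _ (by simp)
  · exact hne v hv

lemma measurable_fileSinr (hΦ : N.IsModel P Φ) (i : Fin 2) (f : ℕ) :
    Measurable (N.fileSinr Φ i f) :=
  (measurable_tierSinr hΦ i (measurableSet_mem_place f)).mono (hΦ.poisson i).countAlgebra_le le_rfl

lemma indepFun_fileSinr (hΦ : N.IsModel P Φ) {i j : Fin 2} (hij : i ≠ j) (f : ℕ) :
    IndepFun (N.fileSinr Φ i f) (N.fileSinr Φ j f) P := by
  have h1 : Indep (countAlgebra (Φ i)) (countAlgebra (Φ j)) P := by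
    fin_cases i <;> fin_cases j
    · exact absurd rfl hij
    · exact hΦ.indep
    · exact hΦ.indep.symm
    · exact absurd rfl hij
  have h2 := indep_of_indep_of_le_left h1 (measurable_tierSinr hΦ i (measurableSet_mem_place f)).comap_le
  exact indep_of_indep_of_le_right h2 (measurable_tierSinr hΦ j (measurableSet_mem_place f)).comap_le

/-! ### The coverage probability as a function of the threshold -/

variable [IsProbabilityMeasure P]

variable (N P Φ) in
/-- The law of the normalized noise and interference of the link from the nearest base station
caching a file. -/
def fileInterf (i : Fin 2) (f : ℕ) : Measure ℝ≥0∞ :=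
  N.interfLaw P (Φ i) i (fun c => f ∈ c) nearScore fun _ => 0

lemma tierCov_eq_integral (hΦ : N.IsModel P Φ) (i : Fin 2) (f : ℕ) {τ : ℝ} (hτ : 0 < τ) :
    N.tierCov P Φ i f τ = ∫ y, N.fadeSurv i (τ * y.toReal) ∂(N.fileInterf P Φ i f) := by
  have hfm : Measurable fun y => N.fadeTail i (ENNReal.ofReal τ * y) :=
    measurable_fadeTail.comp (measurable_const_mul _)
  have h1 : N.tierCov P Φ i f τ =
      (∫⁻ y, N.fadeTail i (ENNReal.ofReal τ * y) ∂(N.fileInterf P Φ i f)).toReal := by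
    rw [fileInterf, ← measure_lt_tierSinr hΦ i (measurableSet_mem_place f) hτ]
    rfl
  rw [h1, ← integral_toReal hfm.aemeasurable
    (Eventually.of_forall fun y => (fadeTail_le_one i _).trans_lt ENNReal.one_lt_top)]
  refine integral_congr_ae ?_
  filter_upwards [ServingRule.ae_ne_top] with y hy
  rw [fadeSurv, measureReal_def, ← fadeTail_ofReal i (by positivity), ENNReal.ofReal_mul hτ.le,
    ENNReal.ofReal_toReal hy]

lemma isFiniteMeasure_fileInterf (hΦ : N.IsModel P Φ) (i : Fin 2) (f : ℕ) :
    IsFiniteMeasure (N.fileInterf P Φ i f) :=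
  (nearestRule hΦ i (measurableSet_mem_place f)).isFiniteMeasure

/-- Differentiation under the integral sign: near τ the integrand has derivative -f(ty) y with f the
fading density, bounded by a constant divided by τ/2 through `mul_fadeDens_le`. -/
lemma differentiableAt_tierCov (hΦ : N.IsModel P Φ) (i : Fin 2) (f : ℕ) {τ : ℝ} (hτ : 0 < τ) :
    DifferentiableAt ℝ (N.tierCov P Φ i f) τ := by
  have := isFiniteMeasure_fileInterf hΦ i f
  set C := (N.fadeParam i : ℝ) ^ (N.fadeParam i : ℝ) / Real.Gamma (N.fadeParam i)
  have hm : ∀ t : ℝ, Measurable fun y : ℝ≥0∞ => N.fadeSurv i (t * y.toReal) := fun t =>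
    (fadeSurv_antitone i).measurable.comp (by fun_prop)
  have hmd : ∀ t : ℝ, Measurable fun y : ℝ≥0∞ => -N.fadeDens i (t * y.toReal) * y.toReal := fun t =>
    ((measurable_fadeDens i).comp (by fun_prop : Measurable fun y : ℝ≥0∞ => t * y.toReal)).neg.mul
      (by fun_prop)
  have h := hasDerivAt_integral_of_dominated_loc_of_deriv_le (μ := N.fileInterf P Φ i f)
    (F := fun t y => N.fadeSurv i (t * y.toReal))
    (F' := fun t y => -N.fadeDens i (t * y.toReal) * y.toReal) (x₀ := τ)
    (bound := fun _ => C / (τ / 2)) (Ioi_mem_nhds (half_lt_self hτ))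
    (Eventually.of_forall fun t => (hm t).aestronglyMeasurable)
    (Integrable.of_bound (C := 1) (hm τ).aestronglyMeasurable
      (Eventually.of_forall fun y => abs_fadeSurv_le i _))
    (hmd τ).aestronglyMeasurable
    (Eventually.of_forall fun y t ht => by
      have ht' : τ / 2 < t := ht
      have ht0 : 0 < t := by linarith
      have h1 := mul_fadeDens_le (N := N) i (v := t * y.toReal) (by positivity)
      have h2 := fadeDens_nonneg (N := N) i (t * y.toReal)
      rw [Real.norm_eq_abs, abs_mul, abs_neg, abs_of_nonneg h2, abs_of_nonneg ENNReal.toReal_nonneg,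
        le_div_iff₀ (by positivity)]
      refine le_trans ?_ h1
      have h3 : 0 ≤ N.fadeDens i (t * y.toReal) * y.toReal := by positivity
      nlinarith)
    (integrable_const _)
    (Eventually.of_forall fun y t ht => by
      have ht' : τ / 2 < t := ht
      have ht0 : 0 < t := by linarith
      -- At y = 0 the integrand is constant in t; this case is separate because the fading survival
      -- function is differentiated only on (0, ∞).
      rcases (ENNReal.toReal_nonneg (a := y)).eq_or_lt with h0 | h0
      · simp only [← h0, mul_zero]
        exact hasDerivAt_const _ _
      · have h1 := hasDerivAt_fadeSurv (N := N) i (mul_pos ht0 h0)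
        have h2 : HasDerivAt (fun t : ℝ => t * y.toReal) y.toReal t := hasDerivAt_mul_const _
        exact h1.comp t h2)
  refine (h.2.congr_of_eventuallyEq ?_).differentiableAt
  filter_upwards [lt_mem_nhds hτ] with t ht
  exact tierCov_eq_integral hΦ i f ht

end HetNet

end HetNetASE

/-! ### Limits for large thresholds and the mass at infinite SINR -/

namespace HetNetASE

open Set
open scoped ENNReal

/-- The mass at zero as a limit of rescaled integrals. -/
lemma tendsto_integral_mul_toReal {m : Measure ℝ≥0∞} [IsFiniteMeasure m] (hm : ∀ᵐ y ∂m, y ≠ ⊤)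
    {H : ℝ → ℝ} (hH : Measurable H) (hH0 : H 0 = 1) {C : ℝ} (hHb : ∀ v, 0 ≤ v → |H v| ≤ C)
    (hlim : Tendsto H atTop (𝓝 0)) :
    Tendsto (fun t : ℝ => ∫ y, H (t * y.toReal) ∂m) atTop (𝓝 (m.real {0})) := by
  have h1 : ∫ y, ({0} : Set ℝ≥0∞).indicator (fun _ => (1 : ℝ)) y ∂m = m.real {0} := by
    rw [integral_indicator_const _ (measurableSet_singleton _), smul_eq_mul, mul_one]
  rw [← h1]
  refine tendsto_integral_filter_of_dominated_convergence (fun _ => C) ?_ ?_ (integrable_const _) ?_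
  · refine Eventually.of_forall fun t => Measurable.aestronglyMeasurable ?_
    exact hH.comp (by fun_prop : Measurable fun y : ℝ≥0∞ => t * y.toReal)
  · filter_upwards [eventually_ge_atTop 0] with t ht
    exact Eventually.of_forall fun y => hHb _ (by positivity)
  · filter_upwards [hm] with y hy
    by_cases h0 : y = 0
    · simp [h0, hH0]
    · rw [indicator_of_notMem (by simpa using h0)]
      exact hlim.comp (tendsto_id.atTop_mul_const (ENNReal.toReal_pos h0 hy))

lemma discAvg_le {α z : ℝ} {n : ℕ} (hα : 0 ≤ α) (hn : 0 < n) (hz : 0 ≤ z) :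
    discAvg α n z ≤ (1 + z)⁻¹ := by
  have h1 : ∫ v in Ioc (0 : ℝ) 1, 2 * v * (1 + z)⁻¹ = (1 + z)⁻¹ := by
    rw [integral_mul_const, integral_Ioc_two_mul zero_le_one]; ring
  rw [← h1, discAvg]
  refine integral_mono_of_nonneg ?_ ?_ ?_
  · filter_upwards [ae_restrict_mem measurableSet_Ioc] with v hv
    have := hv.1
    simp only [Pi.zero_apply]
    positivity
  · exact (Continuous.integrableOn_Icc (by fun_prop)).mono_set Ioc_subset_Icc_self
  · filter_upwards [ae_restrict_mem measurableSet_Ioc] with v hv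
    have hv0 := hv.1
    have h2 : v ^ α ≤ 1 := Real.rpow_le_one hv0.le hv.2 hα
    have h3 : z ≤ z / v ^ α := by
      rw [le_div_iff₀ (by positivity)]; exact mul_le_of_le_one_right hz h2
    have h4 : 1 + z ≤ (1 + z / v ^ α) ^ n :=
      (by linarith : 1 + z ≤ 1 + z / v ^ α).trans (le_self_pow₀ (by linarith) hn.ne')
    exact mul_le_mul_of_nonneg_left (inv_anti₀ (by linarith) h4) (by linarith)

lemma tendsto_discAvg {α : ℝ} {n : ℕ} (hα : 0 ≤ α) (hn : 0 < n) :
    Tendsto (discAvg α n) atTop (𝓝 0) := by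
  refine tendsto_of_tendsto_of_tendsto_of_le_of_le' tendsto_const_nhds
    (tendsto_inv_atTop_zero.comp (tendsto_atTop_add_const_left _ 1 tendsto_id)) ?_ ?_
  · filter_upwards [eventually_ge_atTop 0] with z hz
    exact (discAvg_mem hz).1
  · filter_upwards [eventually_ge_atTop 0] with z hz
    exact discAvg_le hα hn hz

namespace HetNet

variable {N : HetNet} {Ω : Type*} {mΩ : MeasurableSpace Ω} {P : Measure Ω} [IsProbabilityMeasure P]
  {Φ : Fin 2 → Ω → Set BS}

/-! ### Infinite signal-to-interference ratios -/

lemma tierSinr_ne_top {i : Fin 2} (hN : 0 < N.noise i) (K : Set ℕ → Prop) (S : Set BS) :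
    N.tierSinr i K S ≠ ⊤ := by
  unfold tierSinr
  split_ifs
  · refine ENNReal.div_ne_top ENNReal.ofReal_ne_top ?_
    have : ENNReal.ofReal (N.noise i) ≠ 0 := by simpa using hN
    simp [this]
  · exact ENNReal.zero_ne_top

lemma tendsto_tierCov (hΦ : N.IsModel P Φ) (i : Fin 2) (f : ℕ) :
    Tendsto (N.tierCov P Φ i f) atTop (𝓝 (P.real {ω | N.fileSinr Φ i f ω = ⊤})) :=
  tendsto_survival (measurable_fileSinr hΦ i f)

/-- With noise the denominator is positive. Without it the closed form bounds the coverage by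
1/Δ(τ), since S - Δ ≥ 0 is a disc average, and Δ(τ) grows like τ^(2/α). -/
lemma measureReal_fileSinr_zero_eq_top (hΦ : N.IsModel P Φ) (f : ℕ) :
    P.real {ω | N.fileSinr Φ 0 f ω = ⊤} = 0 := by
  rcases (N.noise_nonneg 0).eq_or_lt with h | h
  · have hα := N.two_lt_expo
    have hlim : Tendsto (N.tierCov P Φ 0 f) atTop (𝓝 0) := by
      have hG : Tendsto (fun τ => (gammaDelta (N.expo 0) 1 τ)⁻¹) atTop (𝓝 0) := by
        refine tendsto_inv_atTop_zero.comp ?_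
        have h1 := gammaDelta_pos (α := N.expo 0) (n := 1) hα one_pos one_pos
        have h2 : ∀ τ, gammaDelta (N.expo 0) 1 τ = gammaDelta (N.expo 0) 1 1 * τ ^ (2 / N.expo 0) := by
          intro τ; unfold gammaDelta; rw [Real.one_rpow, mul_one]
        rw [funext h2]
        exact (tendsto_rpow_atTop (by positivity)).const_mul_atTop h1
      refine tendsto_of_tendsto_of_tendsto_of_le_of_le' tendsto_const_nhds hG
        (Eventually.of_forall fun _ => measureReal_nonneg) ?_
      filter_upwards [eventually_gt_atTop 0] with τ hτ
      obtain ⟨hp, hp1⟩ := cacheProb_mem (N := N) 0 f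
      rw [tierCov_zero hΦ f hτ, macroCov_eq h.symm hp hp1 hτ]
      have hD := gammaDelta_pos (n := 1) hα one_pos hτ
      have hS := discAvg_eq_hypS_sub (n := 1) hα one_pos hτ.le
      have hS' := (discAvg_mem (α := N.expo 0) (n := 1) hτ.le).1
      set p := N.cacheProb 0 f
      have h3 : gammaDelta (N.expo 0) 1 τ ≤
          p * hypS (N.expo 0) 1 τ + (1 - p) * gammaDelta (N.expo 0) 1 τ := by nlinarith
      rw [inv_eq_one_div]
      exact div_le_div₀ zero_le_one hp1 hD h3
    exact tendsto_nhds_unique (tendsto_tierCov hΦ 0 f) hlim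
  · have : {ω | N.fileSinr Φ 0 f ω = ⊤} = ∅ := by
      ext ω; simpa [fileSinr] using tierSinr_ne_top h _ _
    rw [this, measureReal_empty]

lemma angleLaw_absolutelyContinuous : N.angleLaw ≪ volume :=
  ProbabilityTheory.cond_absolutelyContinuous

lemma ae_gain_pos : ∀ᵐ w ∂N.angleLaw, 0 < N.gain 1 w := by
  have hA : (0 : ℝ) < N.ant 1 := by exact_mod_cast N.ant_pos 1
  have hc : Real.pi * N.ant 1 ≠ 0 := by have := Real.pi_pos; positivity
  have h1 : ∀ᵐ w ∂N.angleLaw, w ∉ {w : ℝ | Real.sin (Real.pi * N.ant 1 * w) = 0} :=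
    angleLaw_absolutelyContinuous.ae_le
      (compl_mem_ae_iff.2 ((countable_sin_mul_eq_zero hc).measure_zero volume))
  filter_upwards [h1] with w hw
  have hw' : Real.sin (Real.pi * N.ant 1 * w) ≠ 0 := hw
  unfold gain
  split_ifs with h2 h3
  · exact one_pos
  · exact one_pos
  · positivity

/-- As t grows, any interferer with positive gain kills the transform, and almost every angle has
positive gain. What survives, combined with the nearest-distance density, is the absence of all
other stations in the ball. -/
lemma tendsto_picoLap {p r : ℝ} (hp : p ∈ Icc (0 : ℝ) 1) (hr : 0 < r) (hrR : r ≤ N.losR) :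
    Tendsto (fun t => N.picoLap p t r) atTop
      (𝓝 (Real.exp (-(Real.pi * N.dens 1 * (N.losR ^ 2 - p * r ^ 2))))) := by
  have hα : 0 ≤ N.expo 1 := by linarith [N.expo_pico]
  have hn : (0 : ℝ) < N.nak := by exact_mod_cast N.nak_pos
  have hR := N.losR_pos
  have h1 : Tendsto (fun t => ∫ w, N.picoW p t r w ∂N.angleLaw) atTop (𝓝 (∫ _, (0 : ℝ) ∂N.angleLaw)) := by
    refine tendsto_integral_filter_of_dominated_convergence (fun _ => N.losR ^ 2) ?_ ?_
      (integrable_const _) ?_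
    · filter_upwards [eventually_ge_atTop 0] with t ht
      exact (integrable_picoW hp ht hr.le hrR).aestronglyMeasurable
    · filter_upwards [eventually_ge_atTop 0] with t ht
      exact Eventually.of_forall fun w => abs_picoW_le hp ht hr.le hrR
    · filter_upwards [ae_gain_pos] with w hw
      have h2 : Tendsto (fun t : ℝ => t * N.gain 1 w / N.nak) atTop atTop :=
        (tendsto_id.atTop_mul_const hw).atTop_div_const hn
      have h3 : Tendsto (fun t : ℝ => t * N.gain 1 w / N.nak * (r ^ N.expo 1 / N.losR ^ N.expo 1))
          atTop atTop := h2.atTop_mul_const (by positivity)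
      have h4 := (((tendsto_discAvg hα N.nak_pos).comp h2).const_mul (p * r ^ 2)).sub
        (((tendsto_discAvg hα N.nak_pos).comp h3).const_mul (N.losR ^ 2))
      simp only [mul_zero, sub_zero] at h4
      exact h4
  rw [integral_zero] at h1
  have h2 := (Real.continuous_exp.tendsto _).comp
    ((h1.const_mul (Real.pi * N.dens 1)).const_sub (-(Real.pi * N.dens 1 * (N.losR ^ 2 - p * r ^ 2))))
  rw [mul_zero, sub_zero] at h2
  exact h2

lemma picoLap_le {p t r : ℝ} (hp : p ∈ Icc (0 : ℝ) 1) (ht : 0 ≤ t) (hr : 0 ≤ r)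
    (hrR : r ≤ N.losR) : N.picoLap p t r ≤ Real.exp (Real.pi * N.dens 1 * N.losR ^ 2) := by
  have hd := N.dens_pos 1
  have hpi := Real.pi_pos
  have h1 : |∫ w, N.picoW p t r w ∂N.angleLaw| ≤ N.losR ^ 2 := by
    have := norm_integral_le_of_norm_le_const (μ := N.angleLaw) (f := N.picoW p t r)
      (C := N.losR ^ 2) (Eventually.of_forall fun w => (abs_picoW_le (w := w) hp ht hr hrR))
    simpa using this
  have h2 : r ^ 2 ≤ N.losR ^ 2 := pow_le_pow_left₀ hr hrR 2
  have h3 : 0 ≤ N.losR ^ 2 - p * r ^ 2 := by nlinarith [hp.1, hp.2, sq_nonneg r]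
  have h4 : 0 ≤ Real.pi * N.dens 1 * (N.losR ^ 2 - p * r ^ 2) := by positivity
  have h5 := mul_le_mul_of_nonneg_left (neg_le_of_abs_le h1)
    (by positivity : 0 ≤ Real.pi * N.dens 1)
  unfold picoLap
  rw [Real.exp_le_exp]
  linarith

/-- The mass at SINR = ∞ is the mass of the interference law at 0. The result is the Poisson
probability of exactly one pico station in the ball, times the probability that it caches the file.
-/
lemma measureReal_fileSinr_one_eq_top (hΦ : N.IsModel P Φ) (hN : N.noise 1 = 0) (f : ℕ) :
    P.real {ω | N.fileSinr Φ 1 f ω = ⊤} =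
      N.cacheProb 1 f * (Real.pi * N.dens 1 * N.losR ^ 2) *
        Real.exp (-(Real.pi * N.dens 1 * N.losR ^ 2)) := by
  have := isFiniteMeasure_fileInterf hΦ 1 f
  have hp := cacheProb_mem (N := N) 1 f
  have hR := N.losR_pos
  set p := N.cacheProb 1 f with hpdef
  have hne : ∀ᵐ y ∂(N.fileInterf P Φ 1 f), y ≠ ⊤ := ServingRule.ae_ne_top
  have h1 := tendsto_integral_mul_toReal hne (fadeSurv_antitone (N := N) 1).measurable (fadeSurv_zero 1)
    (fun v _ => abs_fadeSurv_le 1 v) (tendsto_fadeSurv 1)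
  have h2 : Tendsto (N.tierCov P Φ 1 f) atTop (𝓝 ((N.fileInterf P Φ 1 f).real {0})) := by
    refine h1.congr' ?_
    filter_upwards [eventually_gt_atTop 0] with τ hτ
    exact (tierCov_eq_integral hΦ 1 f hτ).symm
  rw [tendsto_nhds_unique (tendsto_tierCov hΦ 1 f) h2]
  -- The same mass at 0 is the limit for the fading tail and for exp(-v), so it can be computed from
  -- the explicit Laplace transform.
  have h3 := tendsto_integral_mul_toReal hne (H := fun v => Real.exp (-v)) (by fun_prop) (by simp)
    (C := 1) (fun v hv => by rw [Real.abs_exp, Real.exp_le_one_iff]; linarith)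
    Real.tendsto_exp_neg_atTop_nhds_zero
  have h4 : Tendsto (fun t => ∫ r in Ioc 0 N.losR, N.picoLap p t r * N.nearestDens 1 p r) atTop
      (𝓝 (∫ r in Ioc 0 N.losR, Real.exp (-(Real.pi * N.dens 1 * (N.losR ^ 2 - p * r ^ 2))) *
        N.nearestDens 1 p r)) := by
    refine tendsto_integral_filter_of_dominated_convergence
      (fun r => Real.exp (Real.pi * N.dens 1 * N.losR ^ 2) * N.nearestDens 1 p r) ?_ ?_ ?_ ?_
    · exact Eventually.of_forall fun t =>
        (measurable_picoLap.mul (measurable_nearestDens 1 p)).aestronglyMeasurable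
    · filter_upwards [eventually_ge_atTop 0] with t ht
      filter_upwards [ae_restrict_mem measurableSet_Ioc] with r hr
      have h5 := nearestDens_nonneg (N := N) 1 hp.1 hr.1.le
      have h6 : 0 ≤ N.picoLap p t r := (Real.exp_pos _).le
      rw [Real.norm_eq_abs, abs_of_nonneg (mul_nonneg h6 h5)]
      exact mul_le_mul_of_nonneg_right (picoLap_le hp ht hr.1.le hr.2) h5
    · have h5 := (continuous_nearestDens (N := N) p).const_smul
        (Real.exp (Real.pi * N.dens 1 * N.losR ^ 2))
      exact (h5.integrableOn_Icc).mono_set Ioc_subset_Icc_self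
    · filter_upwards [ae_restrict_mem measurableSet_Ioc] with r hr
      exact (tendsto_picoLap hp hr.1 hr.2).mul_const _
  have h5 : ∫ r in Ioc 0 N.losR, Real.exp (-(Real.pi * N.dens 1 * (N.losR ^ 2 - p * r ^ 2))) *
      N.nearestDens 1 p r = p * (Real.pi * N.dens 1 * N.losR ^ 2) *
        Real.exp (-(Real.pi * N.dens 1 * N.losR ^ 2)) := by
    have h6 : ∀ r : ℝ, Real.exp (-(Real.pi * N.dens 1 * (N.losR ^ 2 - p * r ^ 2))) *
        N.nearestDens 1 p r = p * (Real.pi * N.dens 1) *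
          Real.exp (-(Real.pi * N.dens 1 * N.losR ^ 2)) * (2 * r) := by
      intro r
      have h7 : Real.exp (-(Real.pi * N.dens 1 * (N.losR ^ 2 - p * r ^ 2))) *
          Real.exp (-(Real.pi * p * N.dens 1 * r ^ 2)) =
          Real.exp (-(Real.pi * N.dens 1 * N.losR ^ 2)) := by
        rw [← Real.exp_add]; congr 1; ring
      rw [nearestDens, ← h7]
      ring
    simp_rw [h6]
    rw [integral_const_mul, integral_Ioc_two_mul hR.le]
    ring
  rw [h5] at h4
  refine tendsto_nhds_unique h3 (h4.congr' ?_)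
  filter_upwards [eventually_gt_atTop 0] with t ht
  have h8 := (nearestRule hΦ 1 (measurableSet_mem_place f)).integral_exp_interfLaw ht
    (h := fun _ => 1) (g := N.nearestDens 1 p)
    (fun r _ => by simp [nearScore_pos]) (fun r _ => by simp [hpdef, cacheProb])
    (measurable_nearestDens 1 _) (fun r hr => nearestDens_nonneg 1 hp.1 hr.1.le)
  have h9 : ∀ r, N.noiseExp t r = 1 := fun r => by simp [noiseExp, hN]
  simp only [h9, mul_one] at h8
  exact h8.symm

/-! ### Association by rate -/

lemma biasB_mul_band_pos (i : Fin 2) : 0 < N.biasB i * N.band i := mul_pos (N.biasB_pos i) (N.band_pos i)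

lemma integrableOn_maxRateDens (hΦ : N.IsModel P Φ) (i : Fin 2) (f : ℕ) {τ : ℝ} (hτ : 0 < τ) :
    IntegrableOn (N.maxRateDens P Φ i f) (Ioi τ) :=
  integrableOn_deriv_mul_survival (measurable_fileSinr hΦ i f)
    (fun _ ht => differentiableAt_tierCov hΦ i f ht) hτ

lemma maxRateCov_eq (hΦ : N.IsModel P Φ) (i : Fin 2) (f : ℕ) {τ : ℝ} (hτ : 0 < τ) :
    N.maxRateCov P Φ i f τ = (∫ t in Ioi τ, N.maxRateDens P Φ i f t) +
      P.real {ω | N.fileSinr Φ i f ω = ⊤} * P.real {ω | N.fileSinr Φ (1 - i) f ω ≠ ⊤} := by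
  have hij : i ≠ 1 - i := by fin_cases i <;> decide
  have h := measureReal_one_add_lt_rpow (measurable_fileSinr hΦ i f) (measurable_fileSinr hΦ (1 - i) f)
    (indepFun_fileSinr hΦ hij f) (fun _ ht => differentiableAt_tierCov hΦ i f ht)
    (fun _ ht => (differentiableAt_tierCov hΦ (1 - i) f ht).continuousAt) hτ
    (ρ := N.biasB i * N.band i / (N.biasB (1 - i) * N.band (1 - i)))
    (div_pos (biasB_mul_band_pos i) (biasB_mul_band_pos (1 - i)))
  refine Eq.trans ?_ h
  unfold maxRateCov
  congr 1
  ext ω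
  simp only [mem_ofPred_eq]
  refine and_congr_left fun _ => ?_
  -- The comparison of biased rates is a comparison of powers, with the quotient of the biased
  -- bandwidths as exponent.
  rw [← rate_lt_rate_iff (biasB_mul_band_pos (1 - i))]
  constructor
  · exact fun h => h _ hij.symm
  · intro h j hj
    have : j = 1 - i := by
      omega
    rw [this]; exact h

lemma maxRateCov_eq_integral (hΦ : N.IsModel P Φ) {i : Fin 2} (hi : i = 0 ∨ 0 < N.noise 1) (f : ℕ)
    {τ : ℝ} (hτ : 0 < τ) :
    N.maxRateCov P Φ i f τ = ∫ t in Ioi τ, N.maxRateDens P Φ i f t := by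
  have h0 : P.real {ω | N.fileSinr Φ i f ω = ⊤} = 0 := by
    by_cases h : i = 0
    · rw [h]; exact measureReal_fileSinr_zero_eq_top hΦ f
    · have h1 : i = 1 := by omega
      subst h1
      have : {ω | N.fileSinr Φ 1 f ω = ⊤} = ∅ := by
        ext ω; simpa [fileSinr] using tierSinr_ne_top (hi.resolve_left h) _ _
      rw [this, measureReal_empty]
  rw [maxRateCov_eq hΦ i f hτ, h0, zero_mul, add_zero]

lemma maxRateCov_one_of_noise_eq_zero (hΦ : N.IsModel P Φ) (hN : N.noise 1 = 0) (f : ℕ) {τ : ℝ}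
    (hτ : 0 < τ) :
    N.maxRateCov P Φ 1 f τ = (∫ t in Ioi τ, N.maxRateDens P Φ 1 f t) +
      N.cacheProb 1 f * (Real.pi * N.dens 1 * N.losR ^ 2) *
        Real.exp (-(Real.pi * N.dens 1 * N.losR ^ 2)) := by
  have h0 : P.real {ω | N.fileSinr Φ (1 - 1) f ω ≠ ⊤} = 1 := by
    have h1 := measureReal_fileSinr_zero_eq_top hΦ f
    have h2 : {ω | N.fileSinr Φ 0 f ω ≠ ⊤} = {ω | N.fileSinr Φ 0 f ω = ⊤}ᶜ := rfl
    have h3 : MeasurableSet {ω | N.fileSinr Φ 0 f ω = ⊤} :=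
      measurable_fileSinr hΦ 0 f (measurableSet_singleton _)
    rw [sub_self, h2, probReal_compl_eq_one_sub h3, h1, sub_zero]
  rw [maxRateCov_eq hΦ 1 f hτ, h0, mul_one, measureReal_fileSinr_one_eq_top hΦ hN]

end HetNet

end HetNetASE

namespace HetNetASE

open Set
open scoped ENNReal

namespace HetNet

variable {N : HetNet} {Ω : Type*} {mΩ : MeasurableSpace Ω} {P : Measure Ω} [IsProbabilityMeasure P]
  {Φ : Fin 2 → Ω → Set BS}

/-! ### The area spectral efficiency -/

lemma ASE_eq (hΦ : N.IsModel P Φ) (s : Scheme) {R : ℝ} (hR : 0 < R) :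
    N.ASE P Φ s R = N.aseFormula (N.coverage P Φ s) R := by
  have hsub : Finset.Icc 1 N.Hc ⊆ Finset.Icc 1 N.Nc := Finset.Icc_subset_Icc_right N.Hc_le
  have hsd : Finset.Icc 1 N.Nc \ Finset.Icc 1 N.Hc = Finset.Icc (N.Hc + 1) N.Nc := by
    ext f; simp only [Finset.mem_sdiff, Finset.mem_Icc]; omega
  rw [ASE, aseFormula, ← Finset.sum_sdiff hsub, hsd, add_comm]
  congr 1
  · refine Finset.sum_congr rfl fun f hf => ?_
    rw [if_pos (Finset.mem_Icc.1 hf).2, Finset.mul_sum]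
    refine Finset.sum_congr rfl fun i _ => ?_
    rw [aseTerm, logb_one_add_thr]
    ring
  · have h1 : ∀ f ∈ Finset.Icc (N.Hc + 1) N.Nc, N.req f * (if f ≤ N.Hc then
        ∑ i : Fin 2, aseTerm (N.cacheProb i f * N.dens i) (N.thr i R)
          (N.coverage P Φ s i f (N.thr i R))
        else aseTerm (N.dens 0) (N.thr 0 R) (N.serverProb P Φ R)) =
        N.dens 0 * R / N.band 0 * unitStep (N.Cbh - R) * (N.req f * N.macroCov 1 (N.thr 0 R)) := by
      intro f hf
      have hf' := (Finset.mem_Icc.1 hf).1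
      rw [if_neg (by omega), aseTerm, logb_one_add_thr, serverProb_eq hΦ hR]
      ring
    rw [Finset.sum_congr rfl h1, ← Finset.mul_sum, PS]
    -- If every file is cached in the network, the sum is empty and the value of the unit step is
    -- irrelevant.
    by_cases h : N.Hc + 1 ≤ N.Nc
    · have h2 : ((N.Hc + 1 : ℕ) : ℝ) ≤ N.Nc := by exact_mod_cast h
      have h3 : unitStep ((N.Nc : ℝ) - N.Hc - 1) = 1 := by
        push_cast at h2
        exact if_pos (by linarith)
      rw [h3]; ring
    · rw [Finset.Icc_eq_empty h]; simp

lemma ASE_maxRate_eq (hΦ : N.IsModel P Φ) (hN : 0 < N.noise 1) {R : ℝ} (hR : 0 < R) :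
    N.ASE P Φ .maxRate R =
      N.aseFormula (fun i f τ => ∫ t in Ioi τ, N.maxRateDens P Φ i f t) R := by
  rw [ASE_eq hΦ _ hR, aseFormula, aseFormula]
  congr 1
  refine Finset.sum_congr rfl fun f _ => Finset.sum_congr rfl fun i _ => ?_
  rw [coverage, maxRateCov_eq_integral hΦ (Or.inr hN) f (thr_pos i hR)]

end HetNet

end HetNetASE

end

/-! ### The main statement -/

theorem proposition1 (N : HetNetASE.HetNet) {Ω : Type*} [MeasurableSpace Ω]
    (P : MeasureTheory.Measure Ω) [MeasureTheory.IsProbabilityMeasure P]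
    (Φ : Fin 2 → Ω → Set HetNetASE.BS) (hΦ : N.IsModel P Φ) :
    -- the area spectral efficiency under both schemes
    (∀ (s : HetNetASE.HetNet.Scheme) (R : ℝ), 0 < R →
      N.ASE P Φ s R = N.aseFormula (N.coverage P Φ s) R) ∧
    -- under Max-Rate, in terms of the densities of the coverage probabilities
    (0 < N.noise 1 → ∀ R : ℝ, 0 < R →
      N.ASE P Φ .maxRate R =
        N.aseFormula (fun i f τ => ∫ t in Set.Ioi τ, N.maxRateDens P Φ i f t) R) ∧
    (∀ (f : ℕ) (τ : ℝ), f ∈ Finset.Icc 1 N.Hc → 0 < τ →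
      -- Max-RP coverage probabilities
      N.maxRPCov P Φ 0 f τ = N.macroInt (N.cacheProb 0 f) (N.distDensRP 0 f) τ ∧
      N.Approximates (N.maxRPCov P Φ 1 f τ)
        (fun u₁ u₂ => N.picoQuad u₁ u₂ (N.cacheProb 1 f) (N.distDensRP 1 f) τ) ∧
      -- Max-Rate coverage probabilities
      (∀ i, DifferentiableAt ℝ (N.tierCov P Φ i f) τ ∧
        MeasureTheory.IntegrableOn (N.maxRateDens P Φ i f) (Set.Ioi τ)) ∧
      (∀ i, i = 0 ∨ 0 < N.noise 1 →
        N.maxRateCov P Φ i f τ = ∫ t in Set.Ioi τ, N.maxRateDens P Φ i f t) ∧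
      (N.noise 1 = 0 →
        N.maxRateCov P Φ 1 f τ = (∫ t in Set.Ioi τ, N.maxRateDens P Φ 1 f t) +
          N.cacheProb 1 f * (Real.pi * N.dens 1 * N.losR ^ 2) *
            Real.exp (-(Real.pi * N.dens 1 * N.losR ^ 2))) ∧
      -- cache-related coverage probabilities of the two tiers
      N.tierCov P Φ 0 f τ = N.macroCov (N.cacheProb 0 f) τ ∧
      N.Approximates (N.tierCov P Φ 1 f τ)
        (fun u₁ u₂ => N.picoQuad u₁ u₂ (N.cacheProb 1 f)
          (N.nearestDens 1 (N.cacheProb 1 f)) τ)) ∧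
    -- closed form for the interference-limited macro tier
    (N.noise 0 = 0 → ∀ p τ : ℝ, 0 ≤ p → p ≤ 1 → 0 < τ →
      N.macroCov p τ = p / (p * HetNetASE.hypS (N.expo 0) 1 τ +
        (1 - p) * HetNetASE.gammaDelta (N.expo 0) 1 τ)) := by
  refine ⟨fun s R hR => HetNetASE.HetNet.ASE_eq hΦ s hR,
    fun hN R hR => HetNetASE.HetNet.ASE_maxRate_eq hΦ hN hR, fun f τ _ hτ => ?_,
    fun hN p τ hp hp1 hτ => HetNetASE.HetNet.macroCov_eq hN hp hp1 hτ⟩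
  exact ⟨HetNetASE.HetNet.maxRPCov_zero hΦ f hτ, HetNetASE.HetNet.approximates_maxRPCov hΦ f hτ,
    fun i => ⟨HetNetASE.HetNet.differentiableAt_tierCov hΦ i f hτ,
      HetNetASE.HetNet.integrableOn_maxRateDens hΦ i f hτ⟩,
    fun i hi => HetNetASE.HetNet.maxRateCov_eq_integral hΦ hi f hτ,
    fun hN => HetNetASE.HetNet.maxRateCov_one_of_noise_eq_zero hΦ hN f hτ,
    HetNetASE.HetNet.tierCov_zero hΦ f hτ, HetNetASE.HetNet.approximates_tierCov hΦ f hτ⟩
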